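/- Let $(M,g)$ be a smooth Riemannian manifold (Hausdorff, second countable, without boundary) with volume measure $\mathrm{dvol}_g$, and let $\Omega\subset\subset M$ be a domain (open, connected, with compact closure) whose boundary is smooth, with $\Omega$ lying locally on one side of it. Let $k\colon M\to(0,\infty)$ be a smooth function, $W$ a smooth vector field on $M$, and $h\in C^\infty(\Omega)$ with $\int_\Omega\|\operatorname{grad}h\|\,\mathrm{dvol}_g<\infty$ (for example $h\in C^\infty(\overline\Omega)$). For $x\in\Omega$ and $X\in T_xM$ put $$f(X)=\sqrt{1+k^2\,\|W+\operatorname{grad}h+X\|_g^2}+\sqrt{1+k^2\,\|W-\operatorname{grad}h+X\|_g^2},$$ and, with weak gradients, put $$A(u)=\int_\Omega f(\operatorname{grad}u)\,\mathrm{dvol}_g\quad(u\in W^{1,1}(\Omega)),\qquad A_\varepsilon(u)=\int_\Omega \bigl(f(\operatorname{grad}u)+\varepsilon\|\operatorname{grad}u\|_g^2\bigr)\,\mathrm{dvol}_g\quad(u\in W^{1,2}(\Omega),\ \varepsilon>0).$$ Suppose that for every open $U\subset\subset\Omega$ there is a constant $C_U<\infty$ such that, for all $0<\varepsilon\le1$,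 every minimizer $u_\varepsilon$ of $A_\varepsilon$ among the functions $u\in W^{1,2}(\Omega)$ with $\int_\Omega u\,\mathrm{dvol}_g=0$ satisfies $$\sup_U|u_\varepsilon|\le C_U\quad\text{and}\quad \sup_U\|\operatorname{grad}u_\varepsilon\|_g\le C_U$$ (essential suprema). Then the minimizing problem $$A(u)\to\min,\qquad u\in W^{1,1}(\Omega),\quad \int_\Omega u\,\mathrm{dvol}_g=0,$$ has a locally Lipschitz continuous solution $u_0\in W^{1,1}(\Omega)\cap C^{0,1}_{\mathrm{loc}}(\Omega)$, and this solution is unique (up to equality almost everywhere). -/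

import Mathlib

open MeasureTheory Set Topology
open scoped Manifold ContDiff ENNReal

noncomputable section

namespace SymArea

/-- The model space `ℝᵐ`. -/
abbrev Model (m : ℕ) : Type := EuclideanSpace ℝ (Fin m)

variable {m : ℕ} {M : Type*} [TopologicalSpace M] [ChartedSpace (Model m) M]

/-- A (not necessarily continuous) vector field on `M`. -/
abbrev VField (m : ℕ) (M : Type*) [TopologicalSpace M] [ChartedSpace (Model m) M] : Type _ :=
  (x : M) → TangentSpace (𝓡 m) x

/-- The coefficients, in a chart `c` around `x`, of a tangent vector at `x`. -/
def chartCoeff (c : OpenPartialHomeomorph M (Model m)) (x : M) (v : TangentSpace (𝓡 m) x) :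
    Model m :=
  mfderiv (𝓡 m) (𝓡 m) c x v

/-- The `i`-th coordinate vector of a chart `c`, at the point with coordinates `y`. -/
def coordVec (c : OpenPartialHomeomorph M (Model m)) (y : Model m) (i : Fin m) :
    TangentSpace (𝓡 m) (c.symm y) :=
  mfderiv (𝓡 m) (𝓡 m) c.symm y (EuclideanSpace.single i (1 : ℝ) : Model m)

variable [IsManifold (𝓡 m) ∞ M]

/-- A vector field on the whole manifold is of class `C^r`. -/
def IsCField (r : WithTop ℕ∞) (X : VField m M) : Prop :=
  ContMDiff (𝓡 m) (𝓡 m).tangent r (fun x => (⟨x, X x⟩ : TangentBundle (𝓡 m) M))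

variable (m M) in
/-- Smooth Riemannian metrics on the smooth manifold `M`. -/
abbrev RMetric : Type _ :=
  Bundle.ContMDiffRiemannianMetric (𝓡 m) ∞ (Model m) (fun x : M => TangentSpace (𝓡 m) x)

variable (g : RMetric m M)

/-- The norm of a tangent vector. -/
def tnorm (x : M) (v : TangentSpace (𝓡 m) x) : ℝ := √(g.inner x v v)

/-- The density `√(det (g_ij))` of the Riemannian volume in the chart `c`. -/
def volDensity (c : OpenPartialHomeomorph M (Model m)) (y : Model m) : ℝ :=
  √(Matrix.det (Matrix.of fun i j : Fin m =>
    g.inner (c.symm y) (coordVec c y i) (coordVec c y j)))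

/-- The Riemannian volume measure: the least measure which dominates, for each chart `c`, the
measure `√(det (g_ij)) dy` on the domain of `c`.  As these local measures agree on the overlaps of
charts, the volume measure is equal to the local one on the domain of each chart. -/
def vol [MeasurableSpace M] : Measure M :=
  ⨆ c ∈ atlas (Model m) M,
    Measure.map c.symm
      ((volume.withDensity fun y => ENNReal.ofReal (volDensity g c y)).restrict c.target)

/-- The divergence of a vector field, `(√det g)⁻¹ ∑ i, ∂_i (√det g X^i)` in the preferred chart
at the point. -/
def divergence (X : VField m M) (x : M) : ℝ :=
  let c := chartAt (Model m) x
  (volDensity g c (c x))⁻¹ *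
    ∑ i : Fin m,
      fderiv ℝ (fun y => volDensity g c y * chartCoeff c (c.symm y) (X (c.symm y)) i) (c x)
        (EuclideanSpace.single i (1 : ℝ))

/-- The gradient of a differentiable function: the vector dual to `dh` for the metric. -/
def gradient (h : M → ℝ) : VField m M := fun x =>
  (g.inner x).inverse (mfderiv (𝓡 m) 𝓘(ℝ, ℝ) h x : TangentSpace (𝓡 m) x →L[ℝ] ℝ)

section Sobolev

variable [MeasurableSpace M]

/-- A vector field is (almost everywhere) measurable on `Ω`: its coefficients in charts are. -/
def IsMeasField (Ω : Set M) (Y : VField m M) : Prop :=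
  ∀ c ∈ atlas (Model m) M,
    AEMeasurable (fun x => chartCoeff c x (Y x)) ((vol g).restrict (Ω ∩ c.source))

/-- `Y` is the weak gradient of `u` on `Ω`. -/
structure IsWeakGradient (Ω : Set M) (u : M → ℝ) (Y : VField m M) : Prop where
  locInt : LocallyIntegrableOn u Ω (vol g)
  meas : IsMeasField g Ω Y
  locInt_norm : LocallyIntegrableOn (fun x => tnorm g x (Y x)) Ω (vol g)
  integral_eq : ∀ X : VField m M, IsCField 1 X →
    (∃ K : Set M, IsCompact K ∧ K ⊆ Ω ∧ ∀ x ∉ K, X x = 0) →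
    ∫ x in Ω, g.inner x (X x) (Y x) ∂(vol g) = - ∫ x in Ω, u x * divergence g X x ∂(vol g)

open Classical in
/-- The weak gradient of `u` on `Ω` (unique almost everywhere), if there is one. -/
def weakGrad (Ω : Set M) (u : M → ℝ) : VField m M :=
  if H : ∃ Y, IsWeakGradient g Ω u Y then H.choose else fun _ => 0

/-- The Sobolev space `W^{1,p}(Ω)` (as a set of functions, not of classes). -/
def MemSobolev (Ω : Set M) (p : ℝ≥0∞) (u : M → ℝ) : Prop :=
  MemLp u p ((vol g).restrict Ω) ∧
    ∃ Y, IsWeakGradient g Ω u Y ∧ MemLp (fun x => tnorm g x (Y x)) p ((vol g).restrict Ω)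

/-- The functions in `W^{1,p}(Ω)` with mean zero. -/
def MeanZeroSobolev (Ω : Set M) (p : ℝ≥0∞) : Set (M → ℝ) :=
  {u | MemSobolev g Ω p u ∧ ∫ x in Ω, u x ∂(vol g) = 0}

/-- The integrand
`f(X) = √(1 + k²‖W + grad h + X‖²) + √(1 + k²‖W - grad h + X‖²)`. -/
def integrand (k : M → ℝ) (W : VField m M) (h : M → ℝ) (x : M) (X : TangentSpace (𝓡 m) x) : ℝ :=
  √(1 + k x ^ 2 * tnorm g x (W x + gradient g h x + X) ^ 2) +
    √(1 + k x ^ 2 * tnorm g x (W x - gradient g h x + X) ^ 2)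

/-- The area functional `A`. -/
def area (Ω : Set M) (k : M → ℝ) (W : VField m M) (h : M → ℝ) (u : M → ℝ) : ℝ :=
  ∫ x in Ω, integrand g k W h x (weakGrad g Ω u x) ∂(vol g)

/-- The approximating functionals `A_ε`. -/
def areaEps (Ω : Set M) (k : M → ℝ) (W : VField m M) (h : M → ℝ) (ε : ℝ) (u : M → ℝ) : ℝ :=
  ∫ x in Ω, (integrand g k W h x (weakGrad g Ω u x) + ε * tnorm g x (weakGrad g Ω u x) ^ 2)
    ∂(vol g)

end Sobolev

/-- `u` minimizes the functional `F` in the class `C`. -/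
def IsMinimizer (F : (M → ℝ) → ℝ) (C : Set (M → ℝ)) (u : M → ℝ) : Prop :=
  u ∈ C ∧ ∀ v ∈ C, F u ≤ F v

/-- The boundary of the open set `Ω` is smooth: near each boundary point, `Ω` is the set where a
smooth function without critical point there is negative. -/
def HasSmoothBoundary (m : ℕ) {M : Type*} [TopologicalSpace M] [ChartedSpace (Model m) M]
    (Ω : Set M) : Prop :=
  ∀ p ∈ frontier Ω, ∃ (V : Set M) (ρ : M → ℝ), IsOpen V ∧ p ∈ V ∧
    ContMDiffOn (𝓡 m) 𝓘(ℝ, ℝ) ∞ ρ V ∧ mfderiv (𝓡 m) 𝓘(ℝ, ℝ) ρ p ≠ 0 ∧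
    Ω ∩ V = {x ∈ V | ρ x < 0}

/-- `u` is locally Lipschitz on the open set `Ω` (in all charts, equivalently for the Riemannian
distance of any metric). -/
def IsLocLipschitz (m : ℕ) {M : Type*} [TopologicalSpace M] [ChartedSpace (Model m) M]
    (Ω : Set M) (u : M → ℝ) : Prop :=
  ∀ c ∈ atlas (Model m) M, LocallyLipschitzOn (c.target ∩ c.symm ⁻¹' Ω) (fun y => u (c.symm y))

/-- `U ⊂⊂ Ω`. -/
def CompactlyIn {M : Type*} [TopologicalSpace M] (U Ω : Set M) : Prop :=
  IsCompact (closure U) ∧ closure U ⊆ Ω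

end SymArea

end

set_option linter.unusedSectionVars false

noncomputable section

/-! The integrand `f` is strictly convex, but it grows only linearly and its convexity degenerates
at infinity, so `W^{1,1}` offers neither weak compactness nor a uniform convexity estimate. One
pointwise inequality takes their place (`sqrt_midpoint_defect`, `areaInt_midpoint`): the defect
`f(X) + f(Y) - 2 f((X+Y)/2)` is at least `k²‖X-Y‖² / (2 f(X) f(Y) (f(X)+f(Y)))`. Where gradients are
bounded, this makes minimizing sequences Cauchy in `L²`; with no bound at all, it forces the
gradients to agree where the defect vanishes.

For fixed `ε`, the parallelogram law for the Dirichlet term makes minimizing sequences of `A_ε`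
Cauchy, and Fatou's lemma yields a minimizer (`exists_isMinimizer_areaEps`). The minimizers for `ε =
1/(n+1)` form a minimizing sequence of `A` over `W^{1,2}`. Midpoints of its members are again
competitors, so the defects tend to zero, and the assumed local gradient bounds turn this into `L²`
convergence on compact sets. A local Poincaré inequality (`exists_local_poincare`) fixes the
additive constants, so a subsequence of the gradients converges almost everywhere to a weak
gradient. By Fatou its area is at most the infimum over `W^{1,2}`, and linear coercivity puts it
into `L¹` (`exists_minimal_field`). The gradient bounds survive in the limit and give the Lipschitz
representative (`exists_isLocLipschitz`).

The smooth boundary enters through a one-sided cone condition in charts (`hasConeAt_chartDom`).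
Translating into the domain before mollifying shows that gradients of functions `C¹` on `M` are
dense in `L¹` among the `W^{1,1}` gradients (`exists_contMDiff_approx`), so the infima over
`W^{1,2}` and `W^{1,1}` agree. The same translation shows that a function with gradient in `L^p` is
itself in `L^p` (`IsWeakGradient.lintegral_lt_top`). Hence the problem can be posed for gradient
fields alone, the mean value being adjusted at the end (`isMinimizer_iff`).

The Euclidean estimates behind this rest largely on one identity, `u(x+z) - u(x) = ∫₀¹ Z(x+tz) z dt`
for almost every `x` (`IsWeakDeriv.shift`): it yields the Poincaré inequality on balls,
`p`-integrability and Lipschitz representatives.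

Uniqueness: two minimizers have zero defect, hence equal gradients almost everywhere; they differ by
a constant because `Ω` is connected, and the constant is zero because both means are. -/

namespace SymArea

/-! ### The metric tensor and the volume density in a chart. -/

section Charts

variable {m : ℕ} {M : Type*} [TopologicalSpace M] [ChartedSpace (Model m) M]

/-- The derivative of the inverse of a chart. -/
def symmDeriv (c : OpenPartialHomeomorph M (Model m)) (y : Model m) : Model m →L[ℝ] Model m :=
  mfderiv (𝓡 m) (𝓡 m) c.symm y

/-- The coefficients of a vector field in a chart, as a function on the model space. -/
def coeff (c : OpenPartialHomeomorph M (Model m)) (Y : VField m M) (y : Model m) : Model m :=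
  chartCoeff c (c.symm y) (Y (c.symm y))

variable [IsManifold (𝓡 m) ∞ M] (g : RMetric m M)

/-- The metric at a point, with the tangent space identified with the model space. -/
def metricAt (x : M) : Model m →L[ℝ] Model m →L[ℝ] ℝ := g.inner x

/-- The metric tensor in a chart. -/
def metricChart (c : OpenPartialHomeomorph M (Model m)) (y : Model m) :
    Model m →L[ℝ] Model m →L[ℝ] ℝ :=
  (metricAt g (c.symm y)).bilinearComp (symmDeriv c y) (symmDeriv c y)

theorem mdiff_chart {c : OpenPartialHomeomorph M (Model m)} (hc : c ∈ atlas (Model m) M) :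
    c.MDifferentiable (𝓡 m) (𝓡 m) := by
  have : IsManifold (𝓡 m) 1 M := IsManifold.of_le (n := ∞) (by simp)
  exact mdifferentiable_of_mem_atlas hc

theorem symmDeriv_coeff {c : OpenPartialHomeomorph M (Model m)} (hc : c ∈ atlas (Model m) M)
    (Y : VField m M) {y : Model m} (hy : y ∈ c.target) :
    symmDeriv c y (coeff c Y y) = Y (c.symm y) := by
  have h := (mdiff_chart hc).symm_comp_deriv (c.map_target hy)
  rw [c.right_inv hy] at h
  exact congrArg (fun L : Model m →L[ℝ] Model m => L (Y (c.symm y))) h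

theorem chartCoeff_symmDeriv {c : OpenPartialHomeomorph M (Model m)} (hc : c ∈ atlas (Model m) M)
    {y : Model m} (hy : y ∈ c.target) (v : Model m) :
    chartCoeff c (c.symm y) (symmDeriv c y v) = v := by
  have h := (mdiff_chart hc).comp_symm_deriv hy
  exact congrArg (fun L : Model m →L[ℝ] Model m => L v) h

theorem inner_symm_eq {c : OpenPartialHomeomorph M (Model m)} (hc : c ∈ atlas (Model m) M)
    (X Y : VField m M) {y : Model m} (hy : y ∈ c.target) :
    g.inner (c.symm y) (X (c.symm y)) (Y (c.symm y)) =
      metricChart g c y (coeff c X y) (coeff c Y y) := by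
  have h1 := symmDeriv_coeff hc X hy
  have h2 := symmDeriv_coeff hc Y hy
  simp only [metricChart, ContinuousLinearMap.bilinearComp_apply, h1, h2]
  rfl

theorem tnorm_symm_eq {c : OpenPartialHomeomorph M (Model m)} (hc : c ∈ atlas (Model m) M)
    (X : VField m M) {y : Model m} (hy : y ∈ c.target) :
    tnorm g (c.symm y) (X (c.symm y)) = √(metricChart g c y (coeff c X y) (coeff c X y)) := by
  rw [tnorm, inner_symm_eq g hc X X hy]

theorem symmDeriv_injective {c : OpenPartialHomeomorph M (Model m)} (hc : c ∈ atlas (Model m) M)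
    {y : Model m} (hy : y ∈ c.target) : Function.Injective (symmDeriv c y) := fun v w h => by
  rw [← chartCoeff_symmDeriv hc hy v, ← chartCoeff_symmDeriv hc hy w, h]

theorem metricChart_symm (c : OpenPartialHomeomorph M (Model m)) (y v w : Model m) :
    metricChart g c y v w = metricChart g c y w v :=
  g.symm (c.symm y) _ _

theorem metricChart_pos {c : OpenPartialHomeomorph M (Model m)} (hc : c ∈ atlas (Model m) M)
    {y : Model m} (hy : y ∈ c.target) {v : Model m} (hv : v ≠ 0) : 0 < metricChart g c y v v := by
  have : symmDeriv c y v ≠ 0 := fun h => hv (symmDeriv_injective hc hy (by simpa using h))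
  exact g.pos (c.symm y) _ this

/-- The tangent map of `c.symm` carries the constant field `v` on the model space to this field, so
its smoothness is that of a tangent map. -/
theorem contMDiffOn_coordVec {c : OpenPartialHomeomorph M (Model m)} (hc : c ∈ atlas (Model m) M)
    (v : Model m) : ContMDiffOn (𝓡 m) (𝓡 m).tangent ∞
      (fun y => (⟨c.symm y, symmDeriv c y v⟩ : TangentBundle (𝓡 m) M)) c.target := by
  have h1 : ContMDiffOn (𝓡 m) (𝓡 m) ∞ c.symm c.target :=
    contMDiffOn_symm_of_mem_maximalAtlas (IsManifold.subset_maximalAtlas hc)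
  have h2 := h1.contMDiffOn_tangentMapWithin (m := ∞) (by simp) c.open_target.uniqueMDiffOn
  have h3 : ContMDiffOn (𝓡 m) (𝓡 m).tangent ∞
      (fun y => (⟨y, v⟩ : TangentBundle (𝓡 m) (Model m))) c.target := by
    exact (contMDiffOn_vectorSpace_iff_contDiffOn (𝕜 := ℝ) (E := Model m)
      (V := fun y => (v : TangentSpace 𝓘(ℝ, Model m) y))).2 contDiffOn_const
  have h4 := h2.comp h3 (fun y hy => hy)
  refine h4.congr fun y hy => ?_
  simp only [Function.comp, tangentMapWithin, symmDeriv]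
  rw [mfderivWithin_of_isOpen c.open_target hy]
  rfl

theorem contDiffOn_metricChart_apply {c : OpenPartialHomeomorph M (Model m)}
    (hc : c ∈ atlas (Model m) M) (v w : Model m) :
    ContDiffOn ℝ ∞ (fun y => metricChart g c y v w) c.target := by
  have h1 : ContMDiffOn (𝓡 m) (𝓡 m) ∞ c.symm c.target :=
    contMDiffOn_symm_of_mem_maximalAtlas (IsManifold.subset_maximalAtlas hc)
  have hg := g.contMDiff.comp_contMDiffOn h1
  have := ContMDiffOn.clm_bundle_apply₂ (F₁ := Model m) (F₂ := Model m) (F₃ := ℝ)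
    (E₁ := fun x : M => TangentSpace (𝓡 m) x) (E₂ := fun x : M => TangentSpace (𝓡 m) x)
    (E₃ := fun x : M => Bundle.Trivial M ℝ x) hg
    (contMDiffOn_coordVec hc v) (contMDiffOn_coordVec hc w)
  have h2 : ContMDiffOn (𝓡 m) 𝓘(ℝ, ℝ) ∞ (fun y => metricChart g c y v w) c.target := by
    intro y hy
    have := this y hy
    rw [Bundle.contMDiffWithinAt_totalSpace] at this
    exact this.2
  exact h2.contDiffOn

theorem contDiffOn_metricChart {c : OpenPartialHomeomorph M (Model m)}
    (hc : c ∈ atlas (Model m) M) : ContDiffOn ℝ ∞ (metricChart g c) c.target := by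
  rw [contDiffOn_clm_apply]
  intro v
  rw [contDiffOn_clm_apply]
  intro w
  exact contDiffOn_metricChart_apply g hc v w

theorem continuousOn_metricChart {c : OpenPartialHomeomorph M (Model m)}
    (hc : c ∈ atlas (Model m) M) : ContinuousOn (metricChart g c) c.target :=
  (contDiffOn_metricChart g hc).continuousOn

theorem volDensity_eq (c : OpenPartialHomeomorph M (Model m)) (y : Model m) :
    volDensity g c y = √(Matrix.det (Matrix.of fun i j : Fin m =>
      metricChart g c y (EuclideanSpace.single i (1 : ℝ)) (EuclideanSpace.single j (1 : ℝ)))) := rfl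

/-- The quadratic form of the Gram matrix at `v` is the metric at the vector with components `v`,
which is positive because the derivative of `c.symm` is injective. -/
theorem gram_posDef {c : OpenPartialHomeomorph M (Model m)} (hc : c ∈ atlas (Model m) M)
    {y : Model m} (hy : y ∈ c.target) : (Matrix.of fun i j : Fin m =>
      metricChart g c y (EuclideanSpace.single i (1 : ℝ))
        (EuclideanSpace.single j (1 : ℝ))).PosDef := by
  refine Matrix.PosDef.of_dotProduct_mulVec_pos ?_ ?_
  · ext i j
    simp [metricChart_symm g c y (EuclideanSpace.single j (1 : ℝ))]
  · intro v hv
    have hv' : (WithLp.toLp 2 v : Model m) ≠ 0 := by simpa using hv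
    have := metricChart_pos g hc hy hv'
    have e : (WithLp.toLp 2 v : Model m) = ∑ i, v i • EuclideanSpace.single i (1 : ℝ) := by
      ext j; simp [Finset.sum_apply, Pi.single_apply]
    rw [e] at this
    simp only [map_sum, map_smul, sum_apply, smul_apply,
      smul_eq_mul] at this
    simp only [Finset.mul_sum] at this
    rw [Finset.sum_comm] at this
    simpa [dotProduct, Matrix.mulVec, Finset.mul_sum, mul_comm, mul_left_comm] using this

theorem volDensity_pos {c : OpenPartialHomeomorph M (Model m)} (hc : c ∈ atlas (Model m) M)
    {y : Model m} (hy : y ∈ c.target) : 0 < volDensity g c y :=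
  Real.sqrt_pos.2 (gram_posDef g hc hy).det_pos

theorem contDiffOn_volDensity {c : OpenPartialHomeomorph M (Model m)}
    (hc : c ∈ atlas (Model m) M) : ContDiffOn ℝ ∞ (volDensity g c) c.target := by
  refine ContDiffOn.sqrt ?_ fun y hy => (gram_posDef g hc hy).det_pos.ne'
  simp only [Matrix.det_apply]
  refine ContDiffOn.sum fun σ _ => ContDiffOn.const_smul _ (contDiffOn_prod fun i _ => ?_)
  exact contDiffOn_metricChart_apply g hc _ _

end Charts

theorem isOpen_inter_preimage_symm {m : ℕ} {M : Type*} [TopologicalSpace M]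
    (c : OpenPartialHomeomorph M (Model m)) {Ω : Set M} (hΩ : IsOpen Ω) :
    IsOpen (c.target ∩ c.symm ⁻¹' Ω) :=
  c.symm.isOpen_inter_preimage hΩ

/-- The overlap of two charts, in the coordinates of the first one. -/
def overlap {m : ℕ} {M : Type*} [TopologicalSpace M]
    (c c' : OpenPartialHomeomorph M (Model m)) : Set (Model m) :=
  c.target ∩ c.symm ⁻¹' c'.source

theorem isOpen_overlap {m : ℕ} {M : Type*} [TopologicalSpace M]
    (c c' : OpenPartialHomeomorph M (Model m)) : IsOpen (overlap c c') :=
  isOpen_inter_preimage_symm c c'.open_source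

/-! ### Change of charts, and uniform bounds on compact parts of a chart. -/

section Transition

variable {m : ℕ} {M : Type*} [TopologicalSpace M] [ChartedSpace (Model m) M]
  [IsManifold (𝓡 m) ∞ M] (g : RMetric m M)

theorem contDiffOn_transition {c c' : OpenPartialHomeomorph M (Model m)}
    (hc : c ∈ atlas (Model m) M) (hc' : c' ∈ atlas (Model m) M) :
    ContDiffOn ℝ ∞ (fun y => c' (c.symm y)) (overlap c c') := by
  have h1 : ContMDiffOn (𝓡 m) (𝓡 m) ∞ c.symm c.target :=
    contMDiffOn_symm_of_mem_maximalAtlas (IsManifold.subset_maximalAtlas hc)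
  have h2 : ContMDiffOn (𝓡 m) (𝓡 m) ∞ c' c'.source :=
    contMDiffOn_of_mem_maximalAtlas (IsManifold.subset_maximalAtlas hc')
  have h3 : ContMDiffOn (𝓡 m) (𝓡 m) ∞ (fun y => c' (c.symm y)) (overlap c c') :=
    h2.comp (h1.mono inter_subset_left) fun y hy => hy.2
  exact h3.contDiffOn

theorem differentiableAt_transition {c c' : OpenPartialHomeomorph M (Model m)}
    (hc : c ∈ atlas (Model m) M) (hc' : c' ∈ atlas (Model m) M) {y : Model m}
    (hy : y ∈ overlap c c') : DifferentiableAt ℝ (fun y => c' (c.symm y)) y :=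
  ((contDiffOn_transition hc hc').contDiffAt ((isOpen_overlap c c').mem_nhds hy)).differentiableAt
    (by simp)

theorem symmDeriv_chartCoeff {c : OpenPartialHomeomorph M (Model m)} (hc : c ∈ atlas (Model m) M)
    {x : M} (hx : x ∈ c.source) (v : Model m) : symmDeriv c (c x) (chartCoeff c x v) = v := by
  have h := (mdiff_chart hc).symm_comp_deriv hx
  exact congrArg (fun L : Model m →L[ℝ] Model m => L v) h

theorem chartCoeff_symmDeriv_transition {c c' : OpenPartialHomeomorph M (Model m)}
    (hc : c ∈ atlas (Model m) M) (hc' : c' ∈ atlas (Model m) M) {y : Model m}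
    (hy : y ∈ overlap c c') (v : Model m) :
    chartCoeff c' (c.symm y) (symmDeriv c y v) = fderiv ℝ (fun y => c' (c.symm y)) y v := by
  have h := mfderiv_comp y ((mdiff_chart hc').mdifferentiableAt hy.2)
    ((mdiff_chart hc).mdifferentiableAt_symm hy.1)
  rw [mfderiv_eq_fderiv] at h
  exact (congrArg (fun L : Model m →L[ℝ] Model m => L v) h).symm

theorem symmDeriv_transition {c c' : OpenPartialHomeomorph M (Model m)}
    (hc : c ∈ atlas (Model m) M) (hc' : c' ∈ atlas (Model m) M) {y : Model m}
    (hy : y ∈ overlap c c') (v : Model m) :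
    symmDeriv c' (c' (c.symm y)) (fderiv ℝ (fun y => c' (c.symm y)) y v) = symmDeriv c y v := by
  rw [← chartCoeff_symmDeriv_transition hc hc' hy, symmDeriv_chartCoeff hc' hy.2]

theorem coeff_transition {c c' : OpenPartialHomeomorph M (Model m)}
    (hc : c ∈ atlas (Model m) M) (hc' : c' ∈ atlas (Model m) M) {y : Model m}
    (hy : y ∈ overlap c c') (X : VField m M) :
    coeff c' X (c' (c.symm y)) = fderiv ℝ (fun y => c' (c.symm y)) y (coeff c X y) := by
  rw [← chartCoeff_symmDeriv_transition hc hc' hy, symmDeriv_coeff hc X hy.1, coeff,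
    c'.left_inv hy.2]

theorem metricChart_transition {c c' : OpenPartialHomeomorph M (Model m)}
    (hc : c ∈ atlas (Model m) M) (hc' : c' ∈ atlas (Model m) M) {y : Model m}
    (hy : y ∈ overlap c c') (v w : Model m) :
    metricChart g c y v w = metricChart g c' (c' (c.symm y))
      (fderiv ℝ (fun y => c' (c.symm y)) y v) (fderiv ℝ (fun y => c' (c.symm y)) y w) := by
  simp only [metricChart, ContinuousLinearMap.bilinearComp_apply,
    symmDeriv_transition hc hc' hy, c'.left_inv hy.2]

/-- Gram matrices transform by congruence `JᵀB'J`, with `J` the matrix of `A`. The square root of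
the factor `det² ` is the Jacobian of the change of variables formula, which is why local volumes
agree. -/
theorem det_gram_comp {m : ℕ} (B B' : Model m →L[ℝ] Model m →L[ℝ] ℝ) (A : Model m →L[ℝ] Model m)
    (h : ∀ v w, B v w = B' (A v) (A w)) :
    (Matrix.of fun i j : Fin m => B (EuclideanSpace.single i (1 : ℝ))
      (EuclideanSpace.single j (1 : ℝ))).det = A.det ^ 2 *
    (Matrix.of fun i j : Fin m => B' (EuclideanSpace.single i (1 : ℝ))
      (EuclideanSpace.single j (1 : ℝ))).det := by
  set b := (EuclideanSpace.basisFun (Fin m) ℝ).toBasis with hb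
  have hbi : ∀ i, b i = EuclideanSpace.single i (1 : ℝ) := fun i => by simp [hb]
  set J := LinearMap.toMatrix b b (A : Model m →ₗ[ℝ] Model m) with hJ
  have hA : ∀ j, A (EuclideanSpace.single j (1 : ℝ)) =
      ∑ i, J i j • EuclideanSpace.single i (1 : ℝ) := fun j => by
    have := b.sum_repr (A (b j))
    rw [← hbi j, ← this]
    refine Finset.sum_congr rfl fun i _ => ?_
    rw [hJ, LinearMap.toMatrix_apply, hbi i]
    rfl
  have key : (Matrix.of fun i j : Fin m => B (EuclideanSpace.single i (1 : ℝ))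
      (EuclideanSpace.single j (1 : ℝ))) = J.transpose *
    (Matrix.of fun i j : Fin m => B' (EuclideanSpace.single i (1 : ℝ))
      (EuclideanSpace.single j (1 : ℝ))) * J := by
    ext i j
    simp only [Matrix.of_apply, h, hA, map_sum, map_smul, sum_apply, smul_apply, smul_eq_mul,
      Matrix.mul_apply, Matrix.transpose_apply, Finset.sum_mul, Finset.mul_sum]
    refine Finset.sum_congr rfl fun k _ => Finset.sum_congr rfl fun l _ => ?_
    ring
  rw [key, Matrix.det_mul, Matrix.det_mul, Matrix.det_transpose, hJ, LinearMap.det_toMatrix]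
  simp only [ContinuousLinearMap.det]
  ring

theorem volDensity_transition {c c' : OpenPartialHomeomorph M (Model m)}
    (hc : c ∈ atlas (Model m) M) (hc' : c' ∈ atlas (Model m) M) {y : Model m}
    (hy : y ∈ overlap c c') :
    volDensity g c y = |(fderiv ℝ (fun y => c' (c.symm y)) y).det| *
      volDensity g c' (c' (c.symm y)) := by
  rw [volDensity_eq, volDensity_eq, det_gram_comp _ _ _ (metricChart_transition g hc hc' hy),
    Real.sqrt_mul (sq_nonneg _), Real.sqrt_sq_eq_abs]

theorem contDiffOn_coeff {c : OpenPartialHomeomorph M (Model m)}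
    (hc : c ∈ atlas (Model m) M) {X : VField m M} (hX : IsCField 1 X) :
    ContDiffOn ℝ 1 (coeff c X) c.target := by
  have h0 : ContMDiffOn (𝓡 m) (𝓡 m) ∞ c.symm c.target :=
    contMDiffOn_symm_of_mem_maximalAtlas (IsManifold.subset_maximalAtlas hc)
  have h1 : ContMDiffOn (𝓡 m) (𝓡 m) ∞ c c.source :=
    contMDiffOn_of_mem_maximalAtlas (IsManifold.subset_maximalAtlas hc)
  have h2 := h1.contMDiffOn_tangentMapWithin (m := 1) (by
    rw [one_add_one_eq_two]; exact ENat.LEInfty.out)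
    c.open_source.uniqueMDiffOn
  have h3 := h2.comp (ContMDiff.comp_contMDiffOn hX (h0.of_le (by exact_mod_cast le_top)))
    (fun y hy => c.map_target hy)
  have h4 : ContMDiffOn (𝓡 m) (𝓡 m).tangent 1
      (fun y => (⟨y, coeff c X y⟩ : TangentBundle (𝓡 m) (Model m))) c.target := by
    refine h3.congr fun y hy => ?_
    simp only [Function.comp, tangentMapWithin, coeff, chartCoeff]
    rw [mfderivWithin_of_isOpen c.open_source (c.map_target hy), c.right_inv hy]
    rfl
  exact (contMDiffOn_vectorSpace_iff_contDiffOn (𝕜 := ℝ) (E := Model m)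
      (V := fun y => (coeff c X y : TangentSpace 𝓘(ℝ, Model m) y))).1 h4

/-- The metric is continuous and positive on the compact set `K ×` unit sphere; homogeneity extends
the bound to all vectors. -/
theorem exists_le_metricChart {c : OpenPartialHomeomorph M (Model m)}
    (hc : c ∈ atlas (Model m) M) {K : Set (Model m)} (hK : IsCompact K) (hKc : K ⊆ c.target) :
    ∃ a : ℝ, 0 < a ∧ ∀ y ∈ K, ∀ v, a * ‖v‖ ≤ √(metricChart g c y v v) := by
  have hcont : ContinuousOn (fun p : Model m × Model m => metricChart g c p.1 p.2 p.2)
      (K ×ˢ Metric.sphere 0 1) := by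
    have h1 : ContinuousOn (fun p : Model m × Model m => metricChart g c p.1)
        (K ×ˢ Metric.sphere 0 1) :=
      ((continuousOn_metricChart g hc).mono hKc).comp continuousOn_fst fun p hp => hp.1
    exact (h1.clm_apply continuousOn_snd).clm_apply continuousOn_snd
  obtain ⟨a, ha, h⟩ := (hK.prod (isCompact_sphere (0 : Model m) 1)).exists_forall_le' hcont
    (a := 0) (fun p hp => metricChart_pos g hc (hKc hp.1) (ne_zero_of_mem_unit_sphere ⟨p.2, hp.2⟩))
  refine ⟨√a, Real.sqrt_pos.2 ha, fun y hy v => ?_⟩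
  rcases eq_or_ne v 0 with rfl | hv
  · simp
  rw [← Real.sqrt_sq (norm_nonneg v), ← Real.sqrt_mul ha.le]
  refine Real.sqrt_le_sqrt ?_
  have hv' : 0 < ‖v‖ := norm_pos_iff.2 hv
  have := h (y, ‖v‖⁻¹ • v) ⟨hy, by simp [norm_smul, hv'.ne']⟩
  simp only [map_smul, smul_apply, smul_eq_mul] at this
  rw [← mul_assoc, ← sq, inv_pow, ← div_eq_inv_mul, le_div_iff₀ (by positivity)] at this
  exact this

theorem exists_volDensity_le {c : OpenPartialHomeomorph M (Model m)}
    (hc : c ∈ atlas (Model m) M) {K : Set (Model m)} (hK : IsCompact K) (hKc : K ⊆ c.target) :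
    ∃ b : ℝ, 0 < b ∧ ∀ y ∈ K, volDensity g c y ≤ b := by
  obtain ⟨B, hB⟩ := hK.exists_bound_of_continuousOn
    ((contDiffOn_volDensity g hc).continuousOn.mono hKc)
  exact ⟨max B 1, by positivity, fun y hy =>
    ((Real.le_norm_self _).trans (hB y hy)).trans (le_max_left _ _)⟩

theorem exists_le_volDensity {c : OpenPartialHomeomorph M (Model m)}
    (hc : c ∈ atlas (Model m) M) {K : Set (Model m)} (hK : IsCompact K) (hKc : K ⊆ c.target) :
    ∃ a : ℝ, 0 < a ∧ ∀ y ∈ K, a ≤ volDensity g c y :=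
  hK.exists_forall_le' ((contDiffOn_volDensity g hc).continuousOn.mono hKc)
    fun _ hy => volDensity_pos g hc (hKc hy)

end Transition

/-! ### The Riemannian volume and its local description. -/

section Volume

variable {m : ℕ} {M : Type*} [TopologicalSpace M] [ChartedSpace (Model m) M]
  [IsManifold (𝓡 m) ∞ M] (g : RMetric m M) [MeasurableSpace M] [BorelSpace M]

/-- The Riemannian volume on the domain of a chart. -/
def chartMeasure (c : OpenPartialHomeomorph M (Model m)) : Measure M :=
  Measure.map c.symm
    ((volume.withDensity fun y => ENNReal.ofReal (volDensity g c y)).restrict c.target)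

theorem measurableEmbedding_restrict_symm (c : OpenPartialHomeomorph M (Model m)) :
    MeasurableEmbedding (c.target.domRestrict c.symm) :=
  c.symm.isOpenEmbedding_restrict.measurableEmbedding

theorem measurableSet_inter_preimage_symm (c : OpenPartialHomeomorph M (Model m)) {A : Set M}
    (hA : MeasurableSet A) : MeasurableSet (c.target ∩ c.symm ⁻¹' A) := by
  have := ((measurableEmbedding_restrict_symm c).measurable hA)
  have h2 := c.open_target.measurableSet.subtype_image this
  convert h2 using 1
  ext y
  exact ⟨fun h => ⟨⟨y, h.1⟩, h.2, rfl⟩, by rintro ⟨z, hz, rfl⟩; exact ⟨z.2, hz⟩⟩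

theorem aemeasurable_ofReal_volDensity {c : OpenPartialHomeomorph M (Model m)}
    (hc : c ∈ atlas (Model m) M) {O : Set (Model m)} (hO : O ⊆ c.target) :
    AEMeasurable (fun y => ENNReal.ofReal (volDensity g c y)) (volume.restrict O) :=
  ((contDiffOn_volDensity g hc).continuousOn.aemeasurable
    c.open_target.measurableSet).ennreal_ofReal.mono_measure (Measure.restrict_mono hO le_rfl)

/-- The measure on the target of a chart which corresponds to the volume measure on `A`. -/
def coordMeasure (c : OpenPartialHomeomorph M (Model m)) (A : Set M) : Measure (Model m) :=
  (volume.restrict (c.target ∩ c.symm ⁻¹' A)).withDensity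
    fun y => ENNReal.ofReal (volDensity g c y)

/-- As `c.symm` is continuous only on `c.target`, it is not used as a map on the whole model space.
Instead both measures are images of one measure on the subtype `c.target` under measurable
embeddings. Integrals, almost-everywhere statements, measurability and integrability then pass from
`M` to the chart and back for arbitrary integrands. -/
theorem exists_common_measure (c : OpenPartialHomeomorph M (Model m)) {A : Set M}
    (hA : MeasurableSet A) : ∃ N : Measure c.target,
      N.map Subtype.val = coordMeasure g c A ∧
      N.map (c.target.domRestrict c.symm) = (chartMeasure g c).restrict A := by
  set μ := volume.withDensity fun y => ENNReal.ofReal (volDensity g c y) with hμ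
  have he := measurableEmbedding_restrict_symm c
  have hv : MeasurableEmbedding (Subtype.val : c.target → Model m) :=
    MeasurableEmbedding.subtype_coe c.open_target.measurableSet
  set N0 : Measure c.target := μ.comap Subtype.val with hN0
  have h0 : N0.map Subtype.val = μ.restrict c.target :=
    map_comap_subtype_coe c.open_target.measurableSet μ
  have h1 : N0.map (c.target.domRestrict c.symm) = chartMeasure g c := by
    rw [chartMeasure, ← hμ, ← h0]
    rw [AEMeasurable.map_map_of_aemeasurable _ hv.measurable.aemeasurable]
    · rfl
    · rw [h0]
      exact c.continuousOn_symm.aemeasurable c.open_target.measurableSet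
  refine ⟨N0.restrict (Subtype.val ⁻¹' (c.symm ⁻¹' A)), ?_, ?_⟩
  · have hm := measurableSet_inter_preimage_symm c hA
    rw [← hv.restrict_map, h0, coordMeasure, ← restrict_withDensity hm, ← hμ,
      Measure.restrict_restrict' c.open_target.measurableSet, inter_comm]
  · rw [← h1, he.restrict_map]
    rfl

theorem chartMeasure_apply (c : OpenPartialHomeomorph M (Model m)) {A : Set M}
    (hA : MeasurableSet A) : chartMeasure g c A =
      ∫⁻ y in c.target ∩ c.symm ⁻¹' A, ENNReal.ofReal (volDensity g c y) := by
  obtain ⟨N, h1, h2⟩ := exists_common_measure g c hA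
  have e := congrArg (fun μ => μ univ) h2
  have e' := congrArg (fun μ => μ univ) h1
  simp only [Measure.restrict_apply_univ, coordMeasure] at e e'
  rw [Measure.map_apply (measurableEmbedding_restrict_symm c).measurable .univ] at e
  rw [Measure.map_apply measurable_subtype_coe .univ, withDensity_apply _ .univ,
    Measure.restrict_univ] at e'
  rw [← e, ← e', preimage_univ, preimage_univ]

theorem chartMeasure_inter_source (c : OpenPartialHomeomorph M (Model m)) {A : Set M}
    (hA : MeasurableSet A) : chartMeasure g c (A ∩ c.source) = chartMeasure g c A := by
  rw [chartMeasure_apply g c hA, chartMeasure_apply g c (hA.inter c.open_source.measurableSet)]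
  congr 2
  ext y
  simp only [mem_inter_iff, mem_preimage]
  exact ⟨fun h => ⟨h.1, h.2.1⟩, fun h => ⟨h.1, h.2, c.map_target h.1⟩⟩

/-- This is the change of variables formula for the transition map; its Jacobian is absorbed by
`volDensity_transition`. -/
theorem chartMeasure_eq_of_subset {c c' : OpenPartialHomeomorph M (Model m)}
    (hc : c ∈ atlas (Model m) M) (hc' : c' ∈ atlas (Model m) M) {A : Set M}
    (hA : MeasurableSet A) (h : A ⊆ c.source) (h' : A ⊆ c'.source) :
    chartMeasure g c A = chartMeasure g c' A := by
  rw [chartMeasure_apply g c hA, chartMeasure_apply g c' hA]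
  set S := c.target ∩ c.symm ⁻¹' A with hS
  have hSo : S ⊆ overlap c c' := fun y hy => ⟨hy.1, h' hy.2⟩
  have himg : (fun y => c' (c.symm y)) '' S = c'.target ∩ c'.symm ⁻¹' A := by
    ext z
    constructor
    · rintro ⟨y, hy, rfl⟩
      refine ⟨c'.map_source (h' hy.2), ?_⟩
      simp only [mem_preimage, c'.left_inv (h' hy.2)]
      exact hy.2
    · rintro ⟨hz, hz'⟩
      refine ⟨c (c'.symm z), ⟨c.map_source (h hz'), ?_⟩, ?_⟩
      · simp only [mem_preimage, c.left_inv (h hz')]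
        exact hz'
      · simp only [c.left_inv (h hz'), c'.right_inv hz]
  have hinj : InjOn (fun y => c' (c.symm y)) S := fun y hy z hz e =>
    c.symm.injOn hy.1 hz.1 (c'.injOn (h' hy.2) (h' hz.2) e)
  rw [← himg, lintegral_image_eq_lintegral_abs_det_fderiv_mul volume
    (measurableSet_inter_preimage_symm c hA)
    (fun y hy => (differentiableAt_transition hc hc' (hSo hy)).hasFDerivAt.hasFDerivWithinAt) hinj]
  refine setLIntegral_congr_fun (measurableSet_inter_preimage_symm c hA) fun y hy => ?_
  rw [volDensity_transition g hc hc' (hSo hy), ENNReal.ofReal_mul (abs_nonneg _)]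

theorem vol_restrict_source {c : OpenPartialHomeomorph M (Model m)}
    (hc : c ∈ atlas (Model m) M) : (vol g).restrict c.source = chartMeasure g c := by
  have hsm := c.open_source.measurableSet
  have hself : (chartMeasure g c).restrict c.source = chartMeasure g c := by
    ext A hA
    rw [Measure.restrict_apply hA, chartMeasure_inter_source g c hA]
  refine le_antisymm ?_ ?_
  -- Off `c.source` the other charts are not controlled, so the bound there is the top measure; it
  -- disappears on restriction to `c.source`.
  · have hle : vol g ≤ chartMeasure g c + (⊤ : Measure M).restrict c.sourceᶜ := by
      refine iSup₂_le fun c' hc' => ?_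
      change chartMeasure g c' ≤ _
      rw [← Measure.restrict_add_restrict_compl (μ := chartMeasure g c') hsm]
      refine add_le_add ?_ (Measure.restrict_mono le_rfl le_top)
      refine Measure.le_iff.2 fun A hA => ?_
      have hm := (hA.inter hsm).inter c'.open_source.measurableSet
      rw [Measure.restrict_apply hA, ← chartMeasure_inter_source g c' (hA.inter hsm),
        chartMeasure_eq_of_subset g hc' hc hm inter_subset_right
          (fun x hx => hx.1.2)]
      exact measure_mono fun x hx => hx.1.1
    refine (Measure.restrict_mono le_rfl hle).trans ?_
    rw [Measure.restrict_add, hself, Measure.restrict_restrict hsm]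
    simp
  · rw [← hself]
    exact Measure.restrict_mono le_rfl (le_iSup₂_of_le c hc le_rfl)

theorem exists_common_measure_vol {c : OpenPartialHomeomorph M (Model m)}
    (hc : c ∈ atlas (Model m) M) {A : Set M}
    (hA : MeasurableSet A) (hAc : A ⊆ c.source) : ∃ N : Measure c.target,
      N.map Subtype.val = coordMeasure g c A ∧
      N.map (c.target.domRestrict c.symm) = (vol g).restrict A := by
  obtain ⟨N, h1, h2⟩ := exists_common_measure g c hA
  refine ⟨N, h1, ?_⟩
  rw [h2, ← vol_restrict_source g hc, Measure.restrict_restrict hA, inter_eq_left.2 hAc]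

theorem setLIntegral_vol {c : OpenPartialHomeomorph M (Model m)}
    (hc : c ∈ atlas (Model m) M) {A : Set M} (hA : MeasurableSet A) (hAc : A ⊆ c.source)
    (F : M → ℝ≥0∞) : ∫⁻ x in A, F x ∂(vol g) =
      ∫⁻ y in c.target ∩ c.symm ⁻¹' A, ENNReal.ofReal (volDensity g c y) * F (c.symm y) := by
  obtain ⟨N, h1, h2⟩ := exists_common_measure_vol g hc hA hAc
  rw [← h2, (measurableEmbedding_restrict_symm c).lintegral_map]
  have := (MeasurableEmbedding.subtype_coe c.open_target.measurableSet).lintegral_map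
    (μ := N) (fun y => F (c.symm y))
  rw [h1, coordMeasure, lintegral_withDensity_eq_lintegral_mul_non_measurable₀ _
    (aemeasurable_ofReal_volDensity g hc inter_subset_left) (.of_forall fun _ => by simp)] at this
  exact this.symm

theorem setIntegral_vol {c : OpenPartialHomeomorph M (Model m)}
    (hc : c ∈ atlas (Model m) M) {A : Set M} (hA : MeasurableSet A) (hAc : A ⊆ c.source)
    (F : M → ℝ) : ∫ x in A, F x ∂(vol g) =
      ∫ y in c.target ∩ c.symm ⁻¹' A, volDensity g c y * F (c.symm y) := by
  obtain ⟨N, h1, h2⟩ := exists_common_measure_vol g hc hA hAc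
  rw [← h2, (measurableEmbedding_restrict_symm c).integral_map]
  have := (MeasurableEmbedding.subtype_coe c.open_target.measurableSet).integral_map
    (μ := N) (fun y => F (c.symm y))
  rw [h1, coordMeasure, integral_withDensity_eq_integral_toReal_smul₀
    (aemeasurable_ofReal_volDensity g hc inter_subset_left) (.of_forall fun _ => by simp)] at this
  refine this.symm.trans (integral_congr_ae (.of_forall fun y => ?_))
  simp [ENNReal.toReal_ofReal (Real.sqrt_nonneg _), volDensity]

/-- The density is positive on the target, so no null sets are gained or lost. -/
theorem ae_coordMeasure {c : OpenPartialHomeomorph M (Model m)}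
    (hc : c ∈ atlas (Model m) M) {A : Set M} (hA : MeasurableSet A) :
    ae (coordMeasure g c A) = ae (volume.restrict (c.target ∩ c.symm ⁻¹' A)) := by
  have hm := measurableSet_inter_preimage_symm c hA
  refine le_antisymm (withDensity_absolutelyContinuous _ _).ae_le ?_
  refine (withDensity_absolutelyContinuous'
    (aemeasurable_ofReal_volDensity g hc inter_subset_left) ?_).ae_le
  filter_upwards [ae_restrict_mem hm] with y hy
  simpa using volDensity_pos g hc hy.1

theorem ae_vol_iff {c : OpenPartialHomeomorph M (Model m)}
    (hc : c ∈ atlas (Model m) M) {A : Set M} (hA : MeasurableSet A) (hAc : A ⊆ c.source)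
    (P : M → Prop) : (∀ᵐ x ∂((vol g).restrict A), P x) ↔
      ∀ᵐ y ∂(volume.restrict (c.target ∩ c.symm ⁻¹' A)), P (c.symm y) := by
  obtain ⟨N, h1, h2⟩ := exists_common_measure_vol g hc hA hAc
  rw [← h2, (measurableEmbedding_restrict_symm c).ae_map_iff]
  have := (MeasurableEmbedding.subtype_coe c.open_target.measurableSet).ae_map_iff
    (μ := N) (p := fun y => P (c.symm y))
  rw [h1, Filter.Eventually, ae_coordMeasure g hc hA] at this
  exact this.symm

theorem aemeasurable_vol_iff {c : OpenPartialHomeomorph M (Model m)}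
    (hc : c ∈ atlas (Model m) M) {A : Set M} (hA : MeasurableSet A) (hAc : A ⊆ c.source)
    {β : Type*} [MeasurableSpace β] (F : M → β) : AEMeasurable F ((vol g).restrict A) ↔
      AEMeasurable (fun y => F (c.symm y)) (volume.restrict (c.target ∩ c.symm ⁻¹' A)) := by
  obtain ⟨N, h1, h2⟩ := exists_common_measure_vol g hc hA hAc
  rw [← h2, (measurableEmbedding_restrict_symm c).aemeasurable_map_iff]
  have := (MeasurableEmbedding.subtype_coe c.open_target.measurableSet).aemeasurable_map_iff
    (μ := N) (g := fun y => F (c.symm y))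
  have h3 := ae_coordMeasure g hc hA
  rw [h1] at this
  refine this.symm.trans ⟨fun h => ?_, fun h => ?_⟩
  · exact h.mono_ac (Measure.ae_le_iff_absolutelyContinuous.1 h3.ge)
  · exact h.mono_ac (Measure.ae_le_iff_absolutelyContinuous.1 h3.le)

theorem integrableOn_vol_iff {c : OpenPartialHomeomorph M (Model m)}
    (hc : c ∈ atlas (Model m) M) {A : Set M} (hA : MeasurableSet A) (hAc : A ⊆ c.source)
    (F : M → ℝ) : IntegrableOn F A (vol g) ↔
      IntegrableOn (fun y => volDensity g c y * F (c.symm y)) (c.target ∩ c.symm ⁻¹' A) := by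
  obtain ⟨N, h1, h2⟩ := exists_common_measure_vol g hc hA hAc
  rw [IntegrableOn, ← h2, (measurableEmbedding_restrict_symm c).integrable_map_iff]
  have := (MeasurableEmbedding.subtype_coe c.open_target.measurableSet).integrable_map_iff
    (μ := N) (g := fun y => F (c.symm y))
  rw [h1, coordMeasure, integrable_withDensity_iff_integrable_smul₀'
    (aemeasurable_ofReal_volDensity g hc inter_subset_left) (.of_forall fun _ => by simp)] at this
  refine this.symm.trans (integrable_congr (.of_forall fun y => ?_))
  simp [ENNReal.toReal_ofReal (Real.sqrt_nonneg _), volDensity]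

instance isLocallyFiniteMeasure_vol : IsLocallyFiniteMeasure (vol g) := by
  refine ⟨fun x => ?_⟩
  set c := chartAt (Model m) x with hcd
  have hc : c ∈ atlas (Model m) M := chart_mem_atlas _ x
  have hx : x ∈ c.source := mem_chart_source _ x
  obtain ⟨r, hr, hrc⟩ := Metric.nhds_basis_closedBall.mem_iff.1
    (c.open_target.mem_nhds (c.map_source hx))
  refine ⟨c.source ∩ c ⁻¹' Metric.ball (c x) r,
    (c.isOpen_inter_preimage Metric.isOpen_ball).mem_nhds ⟨hx, Metric.mem_ball_self hr⟩, ?_⟩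
  have hA : MeasurableSet (c.source ∩ c ⁻¹' Metric.ball (c x) r) :=
    (c.isOpen_inter_preimage Metric.isOpen_ball).measurableSet
  obtain ⟨b, hb, hbK⟩ := exists_volDensity_le g hc (isCompact_closedBall (c x) r) hrc
  have h1 := setLIntegral_vol g hc hA inter_subset_left (fun _ => 1)
  simp only [lintegral_const, Measure.restrict_apply_univ, one_mul, mul_one] at h1
  rw [h1]
  have hsub : c.target ∩ c.symm ⁻¹' (c.source ∩ c ⁻¹' Metric.ball (c x) r) ⊆
      Metric.ball (c x) r := fun y hy => by
    have := hy.2.2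
    rwa [mem_preimage, c.right_inv hy.1] at this
  calc _ ≤ ∫⁻ y in Metric.ball (c x) r, ENNReal.ofReal (volDensity g c y) :=
        lintegral_mono_set hsub
    _ ≤ ∫⁻ y in Metric.ball (c x) r, ENNReal.ofReal b :=
        setLIntegral_mono' measurableSet_ball fun y hy =>
          ENNReal.ofReal_le_ofReal (hbK y (Metric.ball_subset_closedBall hy))
    _ < ⊤ := by
        simp only [lintegral_const, Measure.restrict_apply_univ]
        exact ENNReal.mul_lt_top (by simp) measure_ball_lt_top

end Volume

/-! ### Integration by parts in the model space. -/

section IntegrationByParts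

variable {m : ℕ}

theorem integrableOn_of_eq_zero_off_compact {E F : Type*} [TopologicalSpace E] [T2Space E]
    [MeasurableSpace E]
    [OpensMeasurableSpace E] [NormedAddCommGroup F] [SecondCountableTopologyEither E F]
    {μ : Measure E} [IsFiniteMeasureOnCompacts μ]
    {O K : Set E} {f : E → F} (hO : MeasurableSet O) (hf : ContinuousOn f O) (hK : IsCompact K)
    (hKO : K ⊆ O) (h0 : ∀ y ∈ O, y ∉ K → f y = 0) : IntegrableOn f O μ :=
  ((hf.mono hKO).integrableOn_compact hK).of_forall_sdiff_eq_zero hO fun y hy => h0 y hy.1 hy.2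

theorem contDiff_indicator_of_eq_zero_off_compact {E F : Type*} [NormedAddCommGroup E]
    [NormedSpace ℝ E] [NormedAddCommGroup F] [NormedSpace ℝ F] {n : WithTop ℕ∞}
    {O K : Set E} {f : E → F} (hO : IsOpen O) (hf : ContDiffOn ℝ n f O) (hK : IsCompact K)
    (hKO : K ⊆ O) (h0 : ∀ y ∈ O, y ∉ K → f y = 0) : ContDiff ℝ n (O.indicator f) := by
  rw [contDiff_iff_contDiffAt]
  intro y
  by_cases hy : y ∈ K
  · refine (hf.contDiffAt (hO.mem_nhds (hKO hy))).congr_of_eventuallyEq ?_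
    filter_upwards [hO.mem_nhds (hKO hy)] with z hz using indicator_of_mem hz f
  · refine (contDiffAt_const (c := (0 : F))).congr_of_eventuallyEq ?_
    filter_upwards [hK.isClosed.isOpen_compl.mem_nhds hy] with z hz
    by_cases hzO : z ∈ O
    · rw [indicator_of_mem hzO, h0 z hzO hz]
    · exact indicator_of_notMem hzO f

theorem integral_fderiv_eq_zero {f : Model m → ℝ} (hf : ContDiff ℝ 1 f) (hc : HasCompactSupport f)
    (v : Model m) : ∫ y, fderiv ℝ f y v = 0 := by
  have hd : Continuous fun y => fderiv ℝ f y v :=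
    (hf.continuous_fderiv one_ne_zero).clm_apply continuous_const
  have hdc : HasCompactSupport fun y => fderiv ℝ f y v := by
    exact hc.fderiv_apply ℝ v
  -- Integration by parts against the constant function `1`.
  have := integral_mul_fderiv_eq_neg_fderiv_mul_of_integrable (μ := volume) (f := fun _ => (1 : ℝ))
    (g := f) (v := v) (by simp) (by simpa using hd.integrable_of_hasCompactSupport hdc)
    (by simpa using hf.continuous.integrable_of_hasCompactSupport hc)
    (fun _ _ => differentiableAt_const _) (fun y _ => (hf.differentiable one_ne_zero) y)
  simpa using this

/-- The divergence of a vector field on the model space. -/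
def flatDiv (V : Model m → Model m) (y : Model m) : ℝ :=
  ∑ i : Fin m, fderiv ℝ (fun z => V z i) y (EuclideanSpace.single i (1 : ℝ))

theorem contDiffOn_coord {n : WithTop ℕ∞} {O : Set (Model m)} {V : Model m → Model m}
    (hV : ContDiffOn ℝ n V O) (i : Fin m) : ContDiffOn ℝ n (fun z => V z i) O :=
  (contDiffOn_euclidean.1 hV) i

theorem continuousOn_flatDiv {O : Set (Model m)} (hO : IsOpen O) {V : Model m → Model m}
    (hV : ContDiffOn ℝ 1 V O) : ContinuousOn (flatDiv V) O := by
  refine continuousOn_finsetSum _ fun i _ => ContinuousOn.clm_apply ?_ continuousOn_const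
  exact (contDiffOn_coord hV i).continuousOn_fderiv_of_isOpen hO le_rfl

theorem fderiv_apply_eq_sum (L : Model m →L[ℝ] ℝ) (v : Model m) :
    L v = ∑ i, v i * L (EuclideanSpace.single i (1 : ℝ)) := by
  have e : v = ∑ i, v i • EuclideanSpace.single i (1 : ℝ) := by
    ext j; simp [Finset.sum_apply, Pi.single_apply]
  conv_lhs => rw [e]
  simp

theorem flatDiv_eq_zero {V : Model m → Model m} {y : Model m} (h : ∀ᶠ z in 𝓝 y, V z = 0) :
    flatDiv V y = 0 := by
  refine Finset.sum_eq_zero fun i _ => ?_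
  have : (fun z => V z i) =ᶠ[𝓝 y] fun _ => (0 : ℝ) := by
    filter_upwards [h] with z hz; simp [hz]
  rw [this.fderiv_eq]
  simp

/-- Each product `φ V_i` extends by zero to a compactly supported `C¹` function, whose `i`-th
partial derivative has integral zero; the product rule does the rest. Both alternatives of `h0` are
needed: `φ` is cut off in the proof that the divergence does not depend on the chart, `V` when a
`C¹` function is shown to have its gradient as weak gradient. -/
theorem integral_mul_flatDiv {O K : Set (Model m)} (hO : IsOpen O) {φ : Model m → ℝ}
    (hφ : ContDiffOn ℝ 1 φ O) {V : Model m → Model m} (hV : ContDiffOn ℝ 1 V O)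
    (hK : IsCompact K) (hKO : K ⊆ O)
    (h0 : (∀ y ∈ O, y ∉ K → φ y = 0) ∨ (∀ y ∈ O, y ∉ K → V y = 0)) :
    ∫ y in O, φ y * flatDiv V y = -∫ y in O, fderiv ℝ φ y (V y) := by
  have hnhds : ∀ y ∈ O, y ∉ K → ∀ᶠ z in 𝓝 y, z ∈ O ∧ z ∉ K := fun y hy hyK =>
    Filter.inter_mem (hO.mem_nhds hy) (hK.isClosed.isOpen_compl.mem_nhds hyK)
  have hP : ∀ i, ContDiffOn ℝ 1 (fun y => φ y * V y i) O := fun i =>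
    hφ.mul (contDiffOn_coord hV i)
  have hP0 : ∀ i, ∀ y ∈ O, y ∉ K → φ y * V y i = 0 := fun i y hy hyK => by
    rcases h0 with h | h <;> simp [h y hy hyK]
  have hi1 : IntegrableOn (fun y => φ y * flatDiv V y) O := by
    refine integrableOn_of_eq_zero_off_compact hO.measurableSet
      (hφ.continuousOn.mul (continuousOn_flatDiv hO hV)) hK hKO fun y hy hyK => ?_
    rcases h0 with h | h
    · simp [h y hy hyK]
    · rw [flatDiv_eq_zero, mul_zero]
      filter_upwards [hnhds y hy hyK] with z hz using h z hz.1 hz.2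
  have hi2 : IntegrableOn (fun y => fderiv ℝ φ y (V y)) O := by
    refine integrableOn_of_eq_zero_off_compact hO.measurableSet
      ((hφ.continuousOn_fderiv_of_isOpen hO le_rfl).clm_apply hV.continuousOn) hK hKO
      fun y hy hyK => ?_
    rcases h0 with h | h
    · have : φ =ᶠ[𝓝 y] fun _ => (0 : ℝ) := by
        filter_upwards [hnhds y hy hyK] with z hz using h z hz.1 hz.2
      rw [this.fderiv_eq]
      simp
    · simp [h y hy hyK]
  rw [eq_neg_iff_add_eq_zero, ← integral_add hi1 hi2]
  have hG : ∀ i, ContDiff ℝ 1 (O.indicator fun y => φ y * V y i) := fun i =>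
    contDiff_indicator_of_eq_zero_off_compact hO (hP i) hK hKO (hP0 i)
  have hGc : ∀ i, HasCompactSupport (O.indicator fun y => φ y * V y i) := fun i =>
    HasCompactSupport.intro hK fun y hy => by
      by_cases hyO : y ∈ O
      · rw [indicator_of_mem hyO, hP0 i y hyO hy]
      · exact indicator_of_notMem hyO _
  have hsum : ∑ i, ∫ y, fderiv ℝ (O.indicator fun y => φ y * V y i) y
      (EuclideanSpace.single i (1 : ℝ)) = 0 :=
    Finset.sum_eq_zero fun i _ => integral_fderiv_eq_zero (hG i) (hGc i) _
  rw [← integral_finsetSum] at hsum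
  swap
  · exact fun i _ => (((hG i).continuous_fderiv one_ne_zero).clm_apply
      continuous_const).integrable_of_hasCompactSupport ((hGc i).fderiv_apply ℝ _)
  rw [← hsum]
  refine Eq.trans ?_ (setIntegral_eq_integral_of_forall_compl_eq_zero (s := O) ?_)
  · refine setIntegral_congr_fun hO.measurableSet fun y hy => ?_
    have hφd : DifferentiableAt ℝ φ y :=
      (hφ.contDiffAt (hO.mem_nhds hy)).differentiableAt one_ne_zero
    have hVd : ∀ i, DifferentiableAt ℝ (fun z => V z i) y := fun i =>
      ((contDiffOn_coord hV i).contDiffAt (hO.mem_nhds hy)).differentiableAt one_ne_zero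
    simp only
    rw [fderiv_apply_eq_sum, flatDiv, Finset.mul_sum, ← Finset.sum_add_distrib]
    refine Finset.sum_congr rfl fun i _ => ?_
    have e : (O.indicator fun y => φ y * V y i) =ᶠ[𝓝 y] fun y => φ y * V y i := by
      filter_upwards [hO.mem_nhds hy] with z hz using indicator_of_mem hz _
    rw [e.fderiv_eq, fderiv_fun_mul hφd (hVd i)]
    simp
  · intro y hy
    refine Finset.sum_eq_zero fun i _ => ?_
    have e : (O.indicator fun y => φ y * V y i) =ᶠ[𝓝 y] fun _ => (0 : ℝ) := by
      filter_upwards [hK.isClosed.isOpen_compl.mem_nhds fun h => hy (hKO h)] with z hz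
      by_cases hzO : z ∈ O
      · rw [indicator_of_mem hzO, hP0 i z hzO hz]
      · exact indicator_of_notMem hzO _
    rw [e.fderiv_eq]
    simp

end IntegrationByParts

/-! ### The divergence does not depend on the chart. -/

section Divergence

variable {m : ℕ} {M : Type*} [TopologicalSpace M] [ChartedSpace (Model m) M]
  [IsManifold (𝓡 m) ∞ M] (g : RMetric m M)

/-- The coordinate expression of a vector field, multiplied by the density of the volume. -/
def densCoeff (c : OpenPartialHomeomorph M (Model m)) (X : VField m M) (y : Model m) : Model m :=
  volDensity g c y • coeff c X y

/-- The divergence of a vector field, computed in a given chart. -/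
def divChart (c : OpenPartialHomeomorph M (Model m)) (X : VField m M) (y : Model m) : ℝ :=
  (volDensity g c y)⁻¹ * flatDiv (densCoeff g c X) y

theorem divergence_eq_divChart_chartAt (X : VField m M) (x : M) :
    divergence g X x = divChart g (chartAt (Model m) x) X (chartAt (Model m) x x) := rfl

theorem contDiffOn_densCoeff {c : OpenPartialHomeomorph M (Model m)}
    (hc : c ∈ atlas (Model m) M) {X : VField m M} (hX : IsCField 1 X) :
    ContDiffOn ℝ 1 (densCoeff g c X) c.target :=
  ((contDiffOn_volDensity g hc).of_le (by exact_mod_cast le_top)).smul (contDiffOn_coeff hc hX)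

theorem continuousOn_divChart {c : OpenPartialHomeomorph M (Model m)}
    (hc : c ∈ atlas (Model m) M) {X : VField m M} (hX : IsCField 1 X) :
    ContinuousOn (divChart g c X) c.target :=
  ((contDiffOn_volDensity g hc).continuousOn.inv₀ fun _ hy => (volDensity_pos g hc hy).ne').mul
    (continuousOn_flatDiv c.open_target (contDiffOn_densCoeff g hc hX))

theorem volDensity_mul_divChart {c : OpenPartialHomeomorph M (Model m)}
    (hc : c ∈ atlas (Model m) M) (X : VField m M) {y : Model m} (hy : y ∈ c.target) :
    volDensity g c y * divChart g c X y = flatDiv (densCoeff g c X) y := by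
  rw [divChart, mul_inv_cancel_left₀ (volDensity_pos g hc hy).ne']

theorem target_inter_preimage_sources (c c' : OpenPartialHomeomorph M (Model m)) :
    c.target ∩ c.symm ⁻¹' (c.source ∩ c'.source) = overlap c c' := by
  ext y
  exact ⟨fun h => ⟨h.1, h.2.2⟩, fun h => ⟨h.1, c.map_target h.1, h.2⟩⟩

/-- Duality avoids differentiating the Jacobian of the transition map. Tested against a bump `φ`,
both expressions give `-∫ dφ(X)` with respect to the volume, which knows no chart. So the two
continuous functions agree almost everywhere, hence everywhere. -/
theorem divChart_transition [MeasurableSpace M] [BorelSpace M]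
    {c c' : OpenPartialHomeomorph M (Model m)}
    (hc : c ∈ atlas (Model m) M) (hc' : c' ∈ atlas (Model m) M) {X : VField m M}
    (hX : IsCField 1 X) {y : Model m} (hy : y ∈ overlap c c') :
    divChart g c X y = divChart g c' X (c' (c.symm y)) := by
  have hO := isOpen_overlap c c'
  have hO' := isOpen_overlap c' c
  have hmaps : ∀ {c c' : OpenPartialHomeomorph M (Model m)} {y}, y ∈ overlap c c' →
      c' (c.symm y) ∈ overlap c' c := fun {c c' y} hy =>
    ⟨c'.map_source hy.2, by rw [mem_preimage, c'.left_inv hy.2]; exact c.map_target hy.1⟩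
  have hc1 : ContinuousOn (divChart g c X) (overlap c c') :=
    (continuousOn_divChart g hc hX).mono inter_subset_left
  have hc2 : ContinuousOn (fun y => divChart g c' X (c' (c.symm y))) (overlap c c') :=
    (continuousOn_divChart g hc' hX).comp (contDiffOn_transition hc hc').continuousOn
      fun y hy => c'.map_source hy.2
  have hd : ContinuousOn (volDensity g c) (overlap c c') :=
    (contDiffOn_volDensity g hc).continuousOn.mono inter_subset_left
  -- The density turns Lebesgue integrals into volume integrals, which both charts compute; being
  -- positive, it is divided out at the end.
  set D : Model m → ℝ := fun y => volDensity g c y *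
    (divChart g c X y - divChart g c' X (c' (c.symm y))) with hD
  have hDc : ContinuousOn D (overlap c c') := hd.mul (hc1.sub hc2)
  have hDi : LocallyIntegrableOn D (overlap c c') :=
    hDc.locallyIntegrableOn hO.measurableSet
  have key : ∀ᵐ y, y ∈ overlap c c' → D y = 0 := by
    refine hO.ae_eq_zero_of_integral_contDiff_smul_eq_zero hDi fun φ hφ hφc hφO => ?_
    have hφ1 : ContDiffOn ℝ 1 φ (overlap c c') := (hφ.of_le (by exact_mod_cast le_top)).contDiffOn
    have hφ0 : ∀ y, y ∉ tsupport φ → φ y = 0 := fun y hy => image_eq_zero_of_notMem_tsupport hy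
    have hm := (c.open_source.inter c'.open_source).measurableSet
    have e1 : ∫ x in c.source ∩ c'.source, φ (c x) * divChart g c X (c x) ∂(vol g) =
        -∫ y in overlap c c', fderiv ℝ φ y (densCoeff g c X y) := by
      rw [setIntegral_vol g hc hm inter_subset_left, target_inter_preimage_sources,
        ← integral_mul_flatDiv hO hφ1 ((contDiffOn_densCoeff g hc hX).mono inter_subset_left)
          hφc hφO (Or.inl fun y _ => hφ0 y)]
      refine setIntegral_congr_fun hO.measurableSet fun y hy => ?_
      simp only [c.right_inv hy.1]
      rw [← volDensity_mul_divChart g hc X hy.1]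
      ring
    have hT : ContDiffOn ℝ 1 (fun z => c (c'.symm z)) (overlap c' c) :=
      (contDiffOn_transition hc' hc).of_le (by exact_mod_cast le_top)
    have hK' : IsCompact ((fun y => c' (c.symm y)) '' tsupport φ) :=
      hφc.isCompact.image_of_continuousOn
        ((contDiffOn_transition hc hc').continuousOn.mono hφO)
    have e2 : ∫ x in c.source ∩ c'.source, φ (c x) * divChart g c' X (c' x) ∂(vol g) =
        -∫ y in overlap c c', fderiv ℝ φ y (densCoeff g c X y) := by
      have hm' := (c'.open_source.inter c.open_source).measurableSet
      have hT0 : ∀ z ∈ overlap c' c, z ∉ (fun y => c' (c.symm y)) '' tsupport φ →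
          φ (c (c'.symm z)) = 0 := fun z hz hzK => hφ0 _ fun h => hzK
        ⟨_, h, by simp only [c.left_inv hz.2, c'.right_inv hz.1]⟩
      -- In the chart `c'` the test function is `φ` composed with the transition map; the chain rule
      -- and `coeff_transition` bring its derivative along `X` back to the chart `c`.
      have e5 : ∫ x in c'.source ∩ c.source, φ (c x) * divChart g c' X (c' x) ∂(vol g) =
          -∫ x in c'.source ∩ c.source, fderiv ℝ φ (c x) (coeff c X (c x)) ∂(vol g) := by
        rw [setIntegral_vol g hc' hm' inter_subset_left,
          setIntegral_vol g hc' hm' inter_subset_left, target_inter_preimage_sources]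
        have := integral_mul_flatDiv hO' (hφ1.comp hT fun z hz => hmaps hz)
          ((contDiffOn_densCoeff g hc' hX).mono inter_subset_left) hK'
          (image_subset_iff.2 fun y hy => hmaps (hφO hy)) (Or.inl hT0)
        refine Eq.trans ?_ (this.trans (congrArg Neg.neg ?_))
        · refine setIntegral_congr_fun hO'.measurableSet fun z hz => ?_
          simp only [c'.right_inv hz.1, Function.comp]
          rw [← volDensity_mul_divChart g hc' X hz.1]
          ring
        · refine setIntegral_congr_fun hO'.measurableSet fun z hz => ?_
          have hd1 : DifferentiableAt ℝ φ (c (c'.symm z)) :=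
            hφ.contDiffAt.differentiableAt (by simp)
          have := coeff_transition hc' hc hz X
          rw [fderiv_comp z hd1 (differentiableAt_transition hc' hc hz), this, densCoeff]
          simp
      rw [inter_comm, e5, inter_comm, setIntegral_vol g hc hm inter_subset_left,
        target_inter_preimage_sources]
      refine congrArg Neg.neg (setIntegral_congr_fun hO.measurableSet fun y hy => ?_)
      simp only [c.right_inv hy.1, densCoeff, map_smul, smul_eq_mul]
    rw [← setIntegral_eq_integral_of_forall_compl_eq_zero (s := overlap c c')
      fun y hy => by rw [hφ0 y fun h => hy (hφO h), zero_smul]]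
    have i1 : IntegrableOn (fun y => φ y * (volDensity g c y * divChart g c X y))
        (overlap c c') := integrableOn_of_eq_zero_off_compact hO.measurableSet
      (hφ.continuous.continuousOn.mul (hd.mul hc1)) hφc hφO
        fun y _ hy => by rw [hφ0 y hy, zero_mul]
    have i2 : IntegrableOn (fun y => φ y * (volDensity g c y *
        divChart g c' X (c' (c.symm y)))) (overlap c c') :=
      integrableOn_of_eq_zero_off_compact hO.measurableSet
      (hφ.continuous.continuousOn.mul (hd.mul hc2)) hφc hφO
        fun y _ hy => by rw [hφ0 y hy, zero_mul]
    have e3 := e1.trans e2.symm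
    rw [setIntegral_vol g hc hm inter_subset_left, setIntegral_vol g hc hm inter_subset_left,
      target_inter_preimage_sources] at e3
    rw [← sub_eq_zero] at e3
    rw [← e3]
    refine Eq.trans ?_ ((integral_sub i1 i2).trans ?_)
    · exact setIntegral_congr_fun hO.measurableSet fun y hy => by simp only [hD, smul_eq_mul]; ring
    · refine congrArg₂ (· - ·) ?_ ?_ <;>
      · refine setIntegral_congr_fun hO.measurableSet fun y hy => ?_
        simp only [c.right_inv hy.1]
        ring
  have hae : divChart g c X =ᵐ[volume.restrict (overlap c c')]
      fun y => divChart g c' X (c' (c.symm y)) := by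
    rw [Filter.EventuallyEq, ae_restrict_iff' hO.measurableSet]
    filter_upwards [key] with y h hy
    have := h hy
    rw [hD, mul_eq_zero, or_iff_right (volDensity_pos g hc hy.1).ne', sub_eq_zero] at this
    exact this
  exact Measure.eqOn_open_of_ae_eq hae hO hc1 hc2 hy

end Divergence

/-! ### Vector fields, their divergence, and fields supported in one chart. -/

section Fields

variable {m : ℕ} {M : Type*} [TopologicalSpace M] [ChartedSpace (Model m) M]
  [IsManifold (𝓡 m) ∞ M] (g : RMetric m M)

theorem divergence_eq_divChart [MeasurableSpace M] [BorelSpace M]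
    {c : OpenPartialHomeomorph M (Model m)} (hc : c ∈ atlas (Model m) M)
    {X : VField m M} (hX : IsCField 1 X) {x : M} (hx : x ∈ c.source) :
    divergence g X x = divChart g c X (c x) := by
  have h := divChart_transition g hc (chart_mem_atlas (Model m) x) hX (y := c x)
    ⟨c.map_source hx, by rw [mem_preimage, c.left_inv hx]; exact mem_chart_source _ x⟩
  rw [h, c.left_inv hx]
  rfl

/-- The definition of `divergence` switches charts from point to point; near `x` it is the
expression in one fixed chart, which is continuous. -/
theorem continuous_divergence [MeasurableSpace M] [BorelSpace M] {X : VField m M}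
    (hX : IsCField 1 X) : Continuous (divergence g X) := by
  rw [continuous_iff_continuousAt]
  intro x
  set c := chartAt (Model m) x
  have hc : c ∈ atlas (Model m) M := chart_mem_atlas _ x
  have hx : x ∈ c.source := mem_chart_source _ x
  have h1 : ContinuousAt (fun x => divChart g c X (c x)) x :=
    ((continuousOn_divChart g hc hX).continuousAt
      (c.open_target.mem_nhds (c.map_source hx))).comp (c.continuousAt hx)
  refine h1.congr ?_
  filter_upwards [c.open_source.mem_nhds hx] with z hz using
    (divergence_eq_divChart g hc hX hz).symm

theorem coeff_eq_zero {c : OpenPartialHomeomorph M (Model m)} {X : VField m M} {y : Model m}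
    (h : X (c.symm y) = 0) : coeff c X y = 0 :=
  (congrArg (chartCoeff c (c.symm y)) h).trans (map_zero (mfderiv (𝓡 m) (𝓡 m) c (c.symm y)))

/-- The derivative of a function along a vector field. -/
def fieldDeriv (v : M → ℝ) (X : VField m M) (x : M) : ℝ := mfderiv (𝓡 m) 𝓘(ℝ, ℝ) v x (X x)

theorem fieldDeriv_eq_zero {v : M → ℝ} {X : VField m M} {x : M} (h : X x = 0) :
    fieldDeriv v X x = 0 :=
  (congrArg (mfderiv (𝓡 m) 𝓘(ℝ, ℝ) v x) h).trans (map_zero _)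

theorem divergence_eq_zero {X : VField m M} {x : M} (h : ∀ᶠ z in 𝓝 x, X z = 0) :
    divergence g X x = 0 := by
  set c := chartAt (Model m) x with hcd
  have hx : x ∈ c.source := mem_chart_source _ x
  rw [divergence_eq_divChart_chartAt, divChart, flatDiv_eq_zero, mul_zero]
  have h1 : Filter.Tendsto c.symm (𝓝 (c x)) (𝓝 x) := by
    simpa [ContinuousAt, c.left_inv hx] using c.continuousAt_symm (c.map_source hx)
  filter_upwards [h1.eventually h] with y hy
  rw [densCoeff, coeff_eq_zero hy, smul_zero]

theorem coeff_sum {ι : Type*} (c : OpenPartialHomeomorph M (Model m)) (S : Finset ι)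
    (X : ι → VField m M) (y : Model m) :
    coeff c (fun x => ∑ i ∈ S, X i x) y = ∑ i ∈ S, coeff c (X i) y := by
  simp only [coeff, chartCoeff]
  exact map_sum (mfderiv (𝓡 m) (𝓡 m) c (c.symm y)) _ _

theorem divergence_sum {ι : Type*} (S : Finset ι) {X : ι → VField m M}
    (hX : ∀ i, IsCField 1 (X i)) (x : M) :
    divergence g (fun x => ∑ i ∈ S, X i x) x = ∑ i ∈ S, divergence g (X i) x := by
  simp only [divergence_eq_divChart_chartAt]
  set c := chartAt (Model m) x
  have hc : c ∈ atlas (Model m) M := chart_mem_atlas _ x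
  have hx : c x ∈ c.target := c.map_source (mem_chart_source _ x)
  have hd : ∀ i j, DifferentiableAt ℝ (fun z => densCoeff g c (X i) z j) (c x) := fun i j =>
    ((contDiffOn_coord (contDiffOn_densCoeff g hc (hX i)) j).contDiffAt
      (c.open_target.mem_nhds hx)).differentiableAt one_ne_zero
  simp only [divChart, flatDiv, ← Finset.mul_sum]
  rw [Finset.sum_comm]
  congr 1
  refine Finset.sum_congr rfl fun j _ => ?_
  have : (fun z => densCoeff g c (fun x => ∑ i ∈ S, X i x) z j) =
      fun z => ∑ i ∈ S, densCoeff g c (X i) z j := by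
    funext z
    simp [densCoeff, coeff_sum, Finset.smul_sum]
  rw [this, fderiv_fun_sum fun i _ => hd i j, sum_apply]

/-- The part of the chart domain, in coordinates, which lies in `Ω`. -/
def chartDom {m : ℕ} {M : Type*} [TopologicalSpace M] (c : OpenPartialHomeomorph M (Model m))
    (Ω : Set M) : Set (Model m) := c.target ∩ c.symm ⁻¹' Ω

theorem isOpen_chartDom {m : ℕ} {M : Type*} [TopologicalSpace M]
    (c : OpenPartialHomeomorph M (Model m)) {Ω : Set M} (hΩ : IsOpen Ω) : IsOpen (chartDom c Ω) :=
  isOpen_inter_preimage_symm c hΩ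

theorem chartDom_inter_source {m : ℕ} {M : Type*} [TopologicalSpace M]
    (c : OpenPartialHomeomorph M (Model m)) (Ω : Set M) :
    c.target ∩ c.symm ⁻¹' (Ω ∩ c.source) = chartDom c Ω := by
  ext y
  exact ⟨fun h => ⟨h.1, h.2.1⟩, fun h => ⟨h.1, h.2, c.map_target h.1⟩⟩

theorem mfderiv_coeff {c : OpenPartialHomeomorph M (Model m)} (hc : c ∈ atlas (Model m) M)
    {v : M → ℝ} {y : Model m} (hy : y ∈ c.target)
    (hv : MDifferentiableAt (𝓡 m) 𝓘(ℝ, ℝ) v (c.symm y)) (w : Model m) :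
    fderiv ℝ (fun y => v (c.symm y)) y w =
      mfderiv (𝓡 m) 𝓘(ℝ, ℝ) v (c.symm y) (symmDeriv c y w) := by
  have h := mfderiv_comp y hv ((mdiff_chart hc).mdifferentiableAt_symm hy)
  rw [mfderiv_eq_fderiv] at h
  exact congrArg (fun L : Model m →L[ℝ] ℝ => L w) h

/-- The vector field with constant coefficients `v` in a chart, multiplied by a function of the
coordinates. -/
def chartField (c : OpenPartialHomeomorph M (Model m)) (f : Model m → ℝ) (v : Model m) :
    VField m M :=
  open Classical in fun x => if x ∈ c.source then f (c x) • symmDeriv c (c x) v else (0 : Model m)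

theorem chartField_apply {c : OpenPartialHomeomorph M (Model m)} {f : Model m → ℝ} {v : Model m}
    {x : M} (hx : x ∈ c.source) :
    chartField c f v x = f (c x) • symmDeriv c (c x) v := if_pos hx

theorem chartField_eq_zero {c : OpenPartialHomeomorph M (Model m)} {f : Model m → ℝ} {v : Model m}
    {K : Set (Model m)} (h0 : ∀ y ∈ c.target, y ∉ K → f y = 0) {x : M} (hx : x ∉ c.symm '' K) :
    chartField c f v x = 0 := by
  by_cases hxs : x ∈ c.source
  · rw [chartField_apply hxs, h0 _ (c.map_source hxs), zero_smul]
    · rfl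
    · exact fun h => hx ⟨_, h, c.left_inv hxs⟩
  · exact if_neg hxs

theorem coeff_chartField {c : OpenPartialHomeomorph M (Model m)} (hc : c ∈ atlas (Model m) M)
    {f : Model m → ℝ} {v y : Model m} (hy : y ∈ c.target) :
    coeff c (chartField c f v) y = f y • v := by
  rw [coeff, chartField_apply (c.map_target hy), c.right_inv hy, ← map_smul]
  exact chartCoeff_symmDeriv hc hy _

/-- Outside the chart domain the field vanishes near every point, because the compact set `c.symm ''
K` is closed in the Hausdorff space `M`. -/
theorem isCField_chartField [T2Space M] {c : OpenPartialHomeomorph M (Model m)}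
    (hc : c ∈ atlas (Model m) M) {f : Model m → ℝ} (hf : ContDiffOn ℝ 1 f c.target)
    {K : Set (Model m)} (hK : IsCompact K) (hKc : K ⊆ c.target)
    (h0 : ∀ y ∈ c.target, y ∉ K → f y = 0) (v : Model m) : IsCField 1 (chartField c f v) := by
  intro x
  by_cases hx : x ∈ c.source
  · have hcs : ContMDiffOn (𝓡 m) (𝓡 m) 1 c c.source :=
      (contMDiffOn_of_mem_maximalAtlas (n := ∞) (IsManifold.subset_maximalAtlas hc)).of_le
        (by exact_mod_cast le_top)
    have h1 : ContMDiffOn (𝓡 m) 𝓘(ℝ, ℝ) 1 (fun x => f (c x)) c.source :=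
      (hf.contMDiffOn).comp hcs fun x hx => c.map_source hx
    have h2 : ContMDiffOn (𝓡 m) (𝓡 m).tangent 1
        (fun x => (⟨c.symm (c x), symmDeriv c (c x) v⟩ : TangentBundle (𝓡 m) M)) c.source :=
      ((contMDiffOn_coordVec hc v).of_le (by exact_mod_cast le_top)).comp hcs
        fun x hx => c.map_source hx
    have aux : ∀ (x x' : M) (w : Model m), x = x' →
        (⟨x, w⟩ : TangentBundle (𝓡 m) M) = ⟨x', w⟩ := by rintro x _ w rfl; rfl
    have h3 : ContMDiffOn (𝓡 m) (𝓡 m).tangent 1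
        (fun x => (⟨x, symmDeriv c (c x) v⟩ : TangentBundle (𝓡 m) M)) c.source :=
      h2.congr fun x hx => aux _ _ _ (c.left_inv hx).symm
    have h4 := ContMDiffOn.smul_section h1 h3
    refine (h4.contMDiffAt (c.open_source.mem_nhds hx)).congr_of_eventuallyEq ?_
    filter_upwards [c.open_source.mem_nhds hx] with z hz
    rw [chartField_apply hz]
    rfl
  · have hKi : IsClosed (c.symm '' K) :=
      (hK.image_of_continuousOn (c.continuousOn_symm.mono hKc)).isClosed
    have hxK : x ∉ c.symm '' K := by
      rintro ⟨y, hy, rfl⟩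
      exact hx (c.map_target (hKc hy))
    have := Bundle.contMDiff_zeroSection (n := 1) ℝ (F := Model m)
      (fun x : M => TangentSpace (𝓡 m) x) (IB := 𝓡 m) x
    refine this.congr_of_eventuallyEq ?_
    filter_upwards [hKi.isOpen_compl.mem_nhds hxK] with z hz
    rw [chartField_eq_zero h0 hz]
    rfl

variable [MeasurableSpace M] [BorelSpace M]

/-- Read in the chart, this is `integral_mul_flatDiv` for the field multiplied by the density. The
restriction to fields supported in one chart is removed in `isWeakGradient_gradient` by a partition
of unity. -/
theorem integral_mfderiv_eq_neg_of_chart [T2Space M] {Ω : Set M} (hΩ : IsOpen Ω) {v : M → ℝ}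
    (hv : ContMDiffOn (𝓡 m) 𝓘(ℝ, ℝ) 1 v Ω) {X : VField m M} (hX : IsCField 1 X)
    {c : OpenPartialHomeomorph M (Model m)} (hc : c ∈ atlas (Model m) M) {K : Set M}
    (hK : IsCompact K) (hKΩ : K ⊆ Ω) (hKc : K ⊆ c.source) (h0 : ∀ x ∉ K, X x = 0) :
    ∫ x in Ω, fieldDeriv v X x ∂(vol g) =
      -∫ x in Ω, v x * divergence g X x ∂(vol g) := by
  have hm := (hΩ.inter c.open_source).measurableSet
  have hdiv0 : ∀ x ∉ K, divergence g X x = 0 := fun x hx =>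
    divergence_eq_zero g (Filter.mem_of_superset (hK.isClosed.isOpen_compl.mem_nhds hx) h0)
  have e1 : ∫ x in Ω, fieldDeriv v X x ∂(vol g) =
      ∫ x in Ω ∩ c.source, fieldDeriv v X x ∂(vol g) := by
    refine setIntegral_eq_of_subset_of_forall_sdiff_eq_zero hΩ.measurableSet inter_subset_left
      fun x hx => ?_
    exact fieldDeriv_eq_zero (h0 x fun h => hx.2 ⟨hx.1, hKc h⟩)
  have e2 : ∫ x in Ω, v x * divergence g X x ∂(vol g) =
      ∫ x in Ω ∩ c.source, v x * divergence g X x ∂(vol g) := by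
    refine setIntegral_eq_of_subset_of_forall_sdiff_eq_zero hΩ.measurableSet inter_subset_left
      fun x hx => ?_
    rw [hdiv0 x fun h => hx.2 ⟨hx.1, hKc h⟩, mul_zero]
  have hO := isOpen_chartDom c hΩ
  have hvc : ContDiffOn ℝ 1 (fun y => v (c.symm y)) (chartDom c Ω) := by
    have h1 : ContMDiffOn (𝓡 m) (𝓡 m) 1 c.symm c.target :=
      (contMDiffOn_symm_of_mem_maximalAtlas (n := ∞) (IsManifold.subset_maximalAtlas hc)).of_le
        (by exact_mod_cast le_top)
    have h2 : ContMDiffOn (𝓡 m) 𝓘(ℝ, ℝ) 1 (fun y => v (c.symm y)) (chartDom c Ω) :=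
      hv.comp (h1.mono inter_subset_left) fun y hy => hy.2
    exact h2.contDiffOn
  have hK' : IsCompact (c '' K) := hK.image_of_continuousOn (c.continuousOn.mono hKc)
  have hK'O : c '' K ⊆ chartDom c Ω := by
    rintro _ ⟨x, hx, rfl⟩
    exact ⟨c.map_source (hKc hx), by rw [mem_preimage, c.left_inv (hKc hx)]; exact hKΩ hx⟩
  have hV0 : ∀ y ∈ chartDom c Ω, y ∉ c '' K → densCoeff g c X y = 0 := fun y hy hyK => by
    have : X (c.symm y) = 0 := h0 _ fun h => hyK ⟨_, h, c.right_inv hy.1⟩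
    rw [densCoeff, coeff_eq_zero this, smul_zero]
  have key := integral_mul_flatDiv hO hvc ((contDiffOn_densCoeff g hc hX).mono inter_subset_left)
    hK' hK'O (Or.inr hV0)
  rw [e1, e2, setIntegral_vol g hc hm inter_subset_right, setIntegral_vol g hc hm
    inter_subset_right, chartDom_inter_source, eq_neg_iff_add_eq_zero, add_comm,
    ← eq_neg_iff_add_eq_zero]
  refine Eq.trans ?_ (key.trans (congrArg Neg.neg ?_))
  · refine setIntegral_congr_fun hO.measurableSet fun y hy => ?_
    rw [divergence_eq_divChart g hc hX (c.map_target hy.1), c.right_inv hy.1,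
      ← volDensity_mul_divChart g hc X hy.1]
    ring
  · refine setIntegral_congr_fun hO.measurableSet fun y hy => ?_
    have hd : MDifferentiableAt (𝓡 m) 𝓘(ℝ, ℝ) v (c.symm y) :=
      (hv.contMDiffAt (hΩ.mem_nhds hy.2)).mdifferentiableAt one_ne_zero
    simp only [densCoeff, map_smul, smul_eq_mul]
    rw [mfderiv_coeff hc hy.1 hd, symmDeriv_coeff hc X hy.1]
    rfl

theorem integrableOn_mul_divergence [T2Space M] [SecondCountableTopology M] {Ω K : Set M}
    (hK : IsCompact K) (hKΩ : K ⊆ Ω) (hΩ : IsOpen Ω) {u : M → ℝ}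
    (hu : LocallyIntegrableOn u Ω (vol g)) {X : VField m M} (hX : IsCField 1 X)
    (h0 : ∀ x ∉ K, X x = 0) : IntegrableOn (fun x => u x * divergence g X x) Ω (vol g) := by
  have h1 : IntegrableOn (fun x => u x * divergence g X x) K (vol g) :=
    (hu.integrableOn_compact_subset hKΩ hK).mul_continuousOn
      (continuous_divergence g hX).continuousOn hK
  refine h1.of_forall_sdiff_eq_zero hΩ.measurableSet fun x hx => ?_
  rw [divergence_eq_zero g (Filter.mem_of_superset
    (hK.isClosed.isOpen_compl.mem_nhds hx.2) h0), mul_zero]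

end Fields

/-! ### Linear algebra of the metric at a point; gradients as covectors. -/

section Pointwise

variable {m : ℕ} {M : Type*} [TopologicalSpace M] [ChartedSpace (Model m) M]
  [IsManifold (𝓡 m) ∞ M] (g : RMetric m M)

theorem metricAt_self_nonneg (x : M) (v : Model m) : 0 ≤ metricAt g x v v := by
  rcases eq_or_ne v 0 with rfl | hv
  · simp
  · exact (g.pos x v hv).le

theorem metricAt_symm (x : M) (v w : Model m) : metricAt g x v w = metricAt g x w v :=
  g.symm x v w

/-- The norm of a tangent vector, seen as an element of the model space. -/
def nrm (x : M) (v : Model m) : ℝ := √(metricAt g x v v)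

theorem nrm_nonneg (x : M) (v : Model m) : 0 ≤ nrm g x v := Real.sqrt_nonneg _

theorem nrm_sq (x : M) (v : Model m) : nrm g x v ^ 2 = metricAt g x v v :=
  Real.sq_sqrt (metricAt_self_nonneg g x v)

theorem nrm_zero (x : M) : nrm g x 0 = 0 := by simp [nrm]

theorem nrm_eq_zero {x : M} {v : Model m} : nrm g x v = 0 ↔ v = 0 := by
  refine ⟨fun h => ?_, fun h => by rw [h, nrm_zero]⟩
  by_contra hv
  exact (Real.sqrt_pos.2 (g.pos x v hv)).ne' h

theorem nrm_smul (x : M) (a : ℝ) (v : Model m) : nrm g x (a • v) = |a| * nrm g x v := by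
  rw [nrm, nrm, ← Real.sqrt_sq_eq_abs, ← Real.sqrt_mul (sq_nonneg a)]
  simp [sq, mul_assoc]

theorem metricAt_sq_le (x : M) (v w : Model m) :
    metricAt g x v w ^ 2 ≤ metricAt g x v v * metricAt g x w w := by
  rcases eq_or_ne w 0 with rfl | hw
  · simp
  have hpos : 0 < metricAt g x w w := g.pos x w hw
  -- This vector is `⟨w,w⟩` times the component of `v` orthogonal to `w`, the usual choice for
  -- Cauchy–Schwarz.
  have h := metricAt_self_nonneg g x (metricAt g x w w • v - metricAt g x v w • w)
  simp only [map_sub, map_smul, sub_apply, smul_apply, smul_eq_mul, metricAt_symm g x w v] at h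
  have h2 : 0 ≤ metricAt g x w w * (metricAt g x v v * metricAt g x w w
      - metricAt g x v w ^ 2) := by nlinarith
  nlinarith [nonneg_of_mul_nonneg_right h2 hpos]

theorem abs_metricAt_le (x : M) (v w : Model m) :
    |metricAt g x v w| ≤ nrm g x v * nrm g x w := by
  rw [nrm, nrm, ← Real.sqrt_mul (metricAt_self_nonneg g x v)]
  exact Real.abs_le_sqrt (metricAt_sq_le g x v w)

theorem nrm_add_sq (x : M) (v w : Model m) :
    nrm g x (v + w) ^ 2 = nrm g x v ^ 2 + 2 * metricAt g x v w + nrm g x w ^ 2 := by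
  simp only [nrm_sq, map_add, add_apply, metricAt_symm g x w v]
  ring

theorem nrm_sub_sq (x : M) (v w : Model m) :
    nrm g x (v - w) ^ 2 = nrm g x v ^ 2 - 2 * metricAt g x v w + nrm g x w ^ 2 := by
  simp only [nrm_sq, map_sub, sub_apply, metricAt_symm g x w v]
  ring

theorem nrm_add_le (x : M) (v w : Model m) : nrm g x (v + w) ≤ nrm g x v + nrm g x w := by
  refine abs_le_of_sq_le_sq' ?_ (add_nonneg (nrm_nonneg g x v) (nrm_nonneg g x w)) |>.2
  rw [nrm_add_sq]
  nlinarith [le_abs_self (metricAt g x v w), abs_metricAt_le g x v w]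

theorem nrm_neg (x : M) (v : Model m) : nrm g x (-v) = nrm g x v := by
  simpa using nrm_smul g x (-1) v

theorem nrm_sub_le (x : M) (v w : Model m) : nrm g x (v - w) ≤ nrm g x v + nrm g x w := by
  rw [sub_eq_add_neg, ← nrm_neg g x w]
  exact nrm_add_le g x v (-w)

theorem nrm_sum_le {ι : Type*} (x : M) (S : Finset ι) (v : ι → Model m) :
    nrm g x (∑ i ∈ S, v i) ≤ ∑ i ∈ S, nrm g x (v i) :=
  Finset.le_sum_of_subadditive (nrm g x) (nrm_zero g x).le (nrm_add_le g x) S v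

/-- A positive form is injective into the dual, hence bijective by dimension. So the `inverse` in
the definition of `gradient` is a genuine inverse and not the default value `0`. -/
theorem exists_equiv_of_pos {m : ℕ} {B : Model m →L[ℝ] Model m →L[ℝ] ℝ}
    (hB : ∀ v, v ≠ 0 → 0 < B v v) :
    ∃ e : Model m ≃L[ℝ] (Model m →L[ℝ] ℝ), (e : Model m →L[ℝ] Model m →L[ℝ] ℝ) = B := by
  have hinj : Function.Injective (B : Model m →ₗ[ℝ] Model m →L[ℝ] ℝ) := by
    refine (injective_iff_map_eq_zero _).2 fun v hv => ?_
    by_contra hv0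
    exact (hB v hv0).ne' (by simpa using congrArg (fun L : Model m →L[ℝ] ℝ => L v) hv)
  have hdim : Module.finrank ℝ (Model m) = Module.finrank ℝ (Model m →L[ℝ] ℝ) := by
    rw [← (LinearMap.toContinuousLinearMap (𝕜 := ℝ) (E := Model m) (F' := ℝ)).finrank_eq,
      Module.finrank_linearMap]
    simp
  refine ⟨(LinearMap.linearEquivOfInjective _ hinj hdim).toContinuousLinearEquiv, ?_⟩
  ext v w
  rfl

theorem metricAt_gradient (v : M → ℝ) (x : M) (w : Model m) :
    metricAt g x (gradient g v x) w = (mfderiv (𝓡 m) 𝓘(ℝ, ℝ) v x : Model m →L[ℝ] ℝ) w := by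
  obtain ⟨e, he⟩ := exists_equiv_of_pos (B := metricAt g x) fun v hv => g.pos x v hv
  have h1 : (gradient g v x : Model m) =
      (metricAt g x).inverse (mfderiv (𝓡 m) 𝓘(ℝ, ℝ) v x : Model m →L[ℝ] ℝ) := rfl
  rw [h1, ← he, ContinuousLinearMap.inverse_equiv]
  exact congrArg (fun L : Model m →L[ℝ] ℝ => L w) (e.apply_symm_apply _)

/-- The coefficients of the covector dual to a vector field, in a chart. -/
def covec (c : OpenPartialHomeomorph M (Model m)) (Y : VField m M) (y : Model m) :
    Model m →L[ℝ] ℝ := metricChart g c y (coeff c Y y)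

theorem covec_gradient {c : OpenPartialHomeomorph M (Model m)} (hc : c ∈ atlas (Model m) M)
    {v : M → ℝ} {y : Model m} (hy : y ∈ c.target)
    (hv : MDifferentiableAt (𝓡 m) 𝓘(ℝ, ℝ) v (c.symm y)) :
    covec g c (gradient g v) y = fderiv ℝ (fun y => v (c.symm y)) y := by
  ext w
  rw [mfderiv_coeff hc hy hv, covec, metricChart, ContinuousLinearMap.bilinearComp_apply,
    symmDeriv_coeff hc _ hy, metricAt_gradient]

theorem coeff_add (c : OpenPartialHomeomorph M (Model m)) (X Y : VField m M) (y : Model m) :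
    coeff c (X + Y) y = coeff c X y + coeff c Y y :=
  map_add (mfderiv (𝓡 m) (𝓡 m) c (c.symm y)) _ _

theorem coeff_smul (c : OpenPartialHomeomorph M (Model m)) (f : M → ℝ) (Y : VField m M)
    (y : Model m) : coeff c (fun x => f x • Y x) y = f (c.symm y) • coeff c Y y :=
  map_smul (mfderiv (𝓡 m) (𝓡 m) c (c.symm y)) _ _

theorem covec_add (c : OpenPartialHomeomorph M (Model m)) (X Y : VField m M) (y : Model m) :
    covec g c (X + Y) y = covec g c X y + covec g c Y y := by
  rw [covec, coeff_add, map_add]; rfl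

theorem covec_smul (c : OpenPartialHomeomorph M (Model m)) (f : M → ℝ) (Y : VField m M)
    (y : Model m) : covec g c (fun x => f x • Y x) y = f (c.symm y) • covec g c Y y := by
  rw [covec, coeff_smul, map_smul]; rfl

theorem nrm_symm_eq {c : OpenPartialHomeomorph M (Model m)} (hc : c ∈ atlas (Model m) M)
    (Y : VField m M) {y : Model m} (hy : y ∈ c.target) :
    nrm g (c.symm y) (Y (c.symm y)) = √(metricChart g c y (coeff c Y y) (coeff c Y y)) :=
  tnorm_symm_eq g hc Y hy

theorem exists_covec_le {c : OpenPartialHomeomorph M (Model m)}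
    (hc : c ∈ atlas (Model m) M) {K : Set (Model m)} (hK : IsCompact K) (hKc : K ⊆ c.target) :
    ∃ b : ℝ, 0 < b ∧ ∀ y ∈ K, ∀ Y : VField m M,
      ‖covec g c Y y‖ ≤ b * nrm g (c.symm y) (Y (c.symm y)) := by
  obtain ⟨B, hB⟩ := hK.exists_bound_of_continuousOn (f := metricChart g c)
    ((continuousOn_metricChart g hc).mono hKc)
  obtain ⟨a, ha, hal⟩ := exists_le_metricChart g hc hK hKc
  refine ⟨max B 1 / a, by positivity, fun y hy Y => ?_⟩
  rw [nrm_symm_eq g hc Y (hKc hy)]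
  calc ‖covec g c Y y‖ ≤ ‖metricChart g c y‖ * ‖coeff c Y y‖ :=
        ContinuousLinearMap.le_opNorm _ _
    _ ≤ max B 1 * ‖coeff c Y y‖ := by gcongr; exact (hB y hy).trans (le_max_left _ _)
    _ = max B 1 / a * (a * ‖coeff c Y y‖) := by field_simp
    _ ≤ _ := by gcongr; exact hal y hy _

/-- The squared norm is the covector applied to the coefficients `w`, hence at most `‖covec‖‖w‖`,
while `a‖w‖` is at most the norm itself; one factor cancels. Together with `exists_covec_le` this
passes between weak derivatives in charts, which are covectors, and the Riemannian norms in the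
functionals. -/
theorem exists_le_covec {c : OpenPartialHomeomorph M (Model m)}
    (hc : c ∈ atlas (Model m) M) {K : Set (Model m)} (hK : IsCompact K) (hKc : K ⊆ c.target) :
    ∃ b : ℝ, 0 < b ∧ ∀ y ∈ K, ∀ Y : VField m M,
      nrm g (c.symm y) (Y (c.symm y)) ≤ b * ‖covec g c Y y‖ := by
  obtain ⟨a, ha, hal⟩ := exists_le_metricChart g hc hK hKc
  refine ⟨1 / a, by positivity, fun y hy Y => ?_⟩
  rw [nrm_symm_eq g hc Y (hKc hy)]
  set w := coeff c Y y
  set t := √(metricChart g c y w w) with ht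
  have h1 : a * ‖w‖ ≤ t := hal y hy w
  have h2 : t * t ≤ ‖covec g c Y y‖ * ‖w‖ := by
    have h0 : 0 ≤ metricChart g c y w w := by
      rcases eq_or_ne w 0 with h | h
      · simp [h]
      · exact (metricChart_pos g hc (hKc hy) h).le
    rw [ht, Real.mul_self_sqrt h0]
    exact (Real.le_norm_self _).trans ((covec g c Y y).le_opNorm w)
  rcases (Real.sqrt_nonneg _ : 0 ≤ t).eq_or_lt with h | h
  · rw [ht, ← h]; positivity
  · have h3 : a * (t * t) ≤ ‖covec g c Y y‖ * t := by
      calc a * (t * t) ≤ a * (‖covec g c Y y‖ * ‖w‖) := by gcongr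
        _ = ‖covec g c Y y‖ * (a * ‖w‖) := by ring
        _ ≤ _ := by gcongr
    rw [one_div, ← div_eq_inv_mul, le_div_iff₀ ha]
    nlinarith

theorem continuousOn_inverse_metricChart {c : OpenPartialHomeomorph M (Model m)}
    (hc : c ∈ atlas (Model m) M) :
    ContinuousOn (fun y => (metricChart g c y).inverse) c.target := by
  intro y hy
  obtain ⟨e, he⟩ := exists_equiv_of_pos fun v hv => metricChart_pos g hc hy (v := v) hv
  have h1 : ContinuousAt ContinuousLinearMap.inverse (metricChart g c y) := by
    rw [← he]
    exact (contDiffAt_map_inverse (𝕜 := ℝ) (n := 0) e).continuousAt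
  exact h1.comp_continuousWithinAt (f := metricChart g c) (continuousOn_metricChart g hc y hy)

theorem inverse_covec {c : OpenPartialHomeomorph M (Model m)}
    (hc : c ∈ atlas (Model m) M) (Y : VField m M) {y : Model m} (hy : y ∈ c.target) :
    (metricChart g c y).inverse (covec g c Y y) = coeff c Y y := by
  obtain ⟨e, he⟩ := exists_equiv_of_pos fun v hv => metricChart_pos g hc hy (v := v) hv
  rw [covec, ← he, ContinuousLinearMap.inverse_equiv]
  simp

end Pointwise

/-- `Z` is the weak derivative of `u` on the open set `O` of the model space. -/
structure IsWeakDeriv {m : ℕ} (O : Set (Model m)) (u : Model m → ℝ) (Z : Model m → Model m →L[ℝ] ℝ) :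
    Prop where
  locInt : LocallyIntegrableOn u O
  locInt_deriv : LocallyIntegrableOn Z O
  integral_eq : ∀ φ : Model m → ℝ, ContDiff ℝ 1 φ → HasCompactSupport φ → tsupport φ ⊆ O →
    ∀ v, ∫ y in O, u y * fderiv ℝ φ y v = -∫ y in O, Z y v * φ y

theorem aestronglyMeasurable_clm_apply {α E F : Type*} [MeasurableSpace α] {μ : Measure α}
    [NormedAddCommGroup E] [NormedSpace ℝ E] [NormedAddCommGroup F] [NormedSpace ℝ F]
    {L : α → E →L[ℝ] F} {v : α → E} (hL : AEStronglyMeasurable L μ)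
    (hv : AEStronglyMeasurable v μ) : AEStronglyMeasurable (fun a => L a (v a)) μ :=
  (isBoundedBilinearMap_apply (𝕜 := ℝ) (E := E) (F := F)).continuous.comp_aestronglyMeasurable
    (hL.prodMk hv)

/-! ### Measurability and local integrability of fields, checked in charts. -/

section Measurability

variable {m : ℕ} {M : Type*} [TopologicalSpace M] [ChartedSpace (Model m) M]
  [IsManifold (𝓡 m) ∞ M] (g : RMetric m M) [MeasurableSpace M] [BorelSpace M]

variable (m M) in
theorem exists_countable_charts [SecondCountableTopology M] :
    ∃ t : Set (OpenPartialHomeomorph M (Model m)), t.Countable ∧ t ⊆ atlas (Model m) M ∧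
      ∀ x, ∃ c ∈ t, x ∈ c.source := by
  obtain ⟨s, hs, hu⟩ := TopologicalSpace.countable_cover_nhds
    (fun x : M => (chartAt (Model m) x).open_source.mem_nhds (mem_chart_source (Model m) x))
  refine ⟨(chartAt (Model m)) '' s, hs.image _, ?_, fun x => ?_⟩
  · rintro _ ⟨x, _, rfl⟩
    exact chart_mem_atlas _ x
  · obtain ⟨i, hi, hx⟩ := mem_iUnion₂.1 (hu ▸ mem_univ x)
    exact ⟨_, mem_image_of_mem _ hi, hx⟩

theorem ae_of_charts [SecondCountableTopology M] {μ : Measure M} {Ω : Set M} {P : M → Prop}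
    (h : ∀ c ∈ atlas (Model m) M, ∀ᵐ x ∂(μ.restrict (Ω ∩ c.source)), P x) :
    ∀ᵐ x ∂(μ.restrict Ω), P x := by
  obtain ⟨t, ht, hta, hcov⟩ := exists_countable_charts m M
  have hΩ : Ω = ⋃ c ∈ t, Ω ∩ c.source := by
    ext x
    obtain ⟨c, hc, hx⟩ := hcov x
    simp only [mem_iUnion, mem_inter_iff]
    exact ⟨fun hxΩ => ⟨c, hc, hxΩ, hx⟩, fun ⟨_, _, h, _⟩ => h⟩
  rw [hΩ, ae_restrict_biUnion_iff _ ht]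
  exact fun c hc => h c (hta hc)

theorem aemeasurable_of_charts [SecondCountableTopology M] {μ : Measure M} {Ω : Set M}
    {β : Type*} [MeasurableSpace β] {f : M → β}
    (h : ∀ c ∈ atlas (Model m) M, AEMeasurable f (μ.restrict (Ω ∩ c.source))) :
    AEMeasurable f (μ.restrict Ω) := by
  obtain ⟨t, ht, hta, hcov⟩ := exists_countable_charts m M
  have hΩ : Ω = ⋃ c : t, Ω ∩ c.1.source := by
    ext x
    obtain ⟨c, hc, hx⟩ := hcov x
    simp only [mem_iUnion, mem_inter_iff]
    exact ⟨fun hxΩ => ⟨⟨c, hc⟩, hxΩ, hx⟩, fun ⟨_, h, _⟩ => h⟩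
  have := ht.to_subtype
  rw [hΩ, aemeasurable_iUnion_iff]
  exact fun c => h c (hta c.2)

variable {g} {Ω : Set M}

theorem isMeasField_iff (hΩ : IsOpen Ω) {Y : VField m M} : IsMeasField g Ω Y ↔
    ∀ c ∈ atlas (Model m) M, AEMeasurable (coeff c Y) (volume.restrict (chartDom c Ω)) := by
  refine forall₂_congr fun c hc => ?_
  rw [aemeasurable_vol_iff g hc (hΩ.inter c.open_source).measurableSet inter_subset_right,
    chartDom_inter_source]
  rfl

theorem isMeasField_of_continuousOn (hΩ : IsOpen Ω) {Y : VField m M}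
    (h : ∀ c ∈ atlas (Model m) M, ContinuousOn (coeff c Y) (chartDom c Ω)) :
    IsMeasField g Ω Y :=
  (isMeasField_iff hΩ).2 fun c hc => (h c hc).aemeasurable (isOpen_chartDom c hΩ).measurableSet

theorem IsMeasField.add {X Y : VField m M} (hX : IsMeasField g Ω X) (hY : IsMeasField g Ω Y) :
    IsMeasField g Ω (X + Y) := fun c hc => by
  refine ((hX c hc).add (hY c hc)).congr (.of_forall fun x => ?_)
  exact (map_add (mfderiv (𝓡 m) (𝓡 m) c x) _ _).symm

theorem IsMeasField.smul {f : M → ℝ} (hf : AEMeasurable f ((vol g).restrict Ω)) {Y : VField m M}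
    (hY : IsMeasField g Ω Y) : IsMeasField g Ω (fun x => f x • Y x) := fun c hc => by
  refine ((hf.mono_measure (Measure.restrict_mono inter_subset_left le_rfl)).smul
    (hY c hc)).congr (.of_forall fun x => ?_)
  exact (map_smul (mfderiv (𝓡 m) (𝓡 m) c x) _ _).symm

theorem IsMeasField.const_smul (a : ℝ) {Y : VField m M} (hY : IsMeasField g Ω Y) :
    IsMeasField g Ω (a • Y) := hY.smul (f := fun _ => a) aemeasurable_const

theorem IsMeasField.sub {X Y : VField m M} (hX : IsMeasField g Ω X) (hY : IsMeasField g Ω Y) :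
    IsMeasField g Ω (X - Y) := by
  have := hX.add (hY.const_smul (-1))
  rwa [neg_one_smul, ← sub_eq_add_neg] at this

theorem IsMeasField.aemeasurable_covec (hΩ : IsOpen Ω) {Y : VField m M} (hY : IsMeasField g Ω Y)
    {c : OpenPartialHomeomorph M (Model m)} (hc : c ∈ atlas (Model m) M) :
    AEStronglyMeasurable (covec g c Y) (volume.restrict (chartDom c Ω)) := by
  have h1 : AEStronglyMeasurable (metricChart g c) (volume.restrict (chartDom c Ω)) :=
    ((continuousOn_metricChart g hc).mono inter_subset_left).aestronglyMeasurable
      (isOpen_chartDom c hΩ).measurableSet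
  have h2 := ((isMeasField_iff hΩ).1 hY c hc).aestronglyMeasurable
  exact aestronglyMeasurable_clm_apply h1 h2

theorem IsMeasField.aemeasurable_inner [SecondCountableTopology M] (hΩ : IsOpen Ω)
    {X Y : VField m M} (hX : IsMeasField g Ω X)
    (hY : IsMeasField g Ω Y) :
    AEMeasurable (fun x => metricAt g x (X x) (Y x)) ((vol g).restrict Ω) := by
  refine aemeasurable_of_charts (m := m) fun c hc => ?_
  rw [aemeasurable_vol_iff g hc (hΩ.inter c.open_source).measurableSet inter_subset_right,
    chartDom_inter_source]
  have h1 := hX.aemeasurable_covec hΩ hc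
  have h2 := ((isMeasField_iff hΩ).1 hY c hc).aestronglyMeasurable
  have h3 := aestronglyMeasurable_clm_apply h1 h2
  refine h3.aemeasurable.congr ?_
  filter_upwards [ae_restrict_mem (isOpen_chartDom c hΩ).measurableSet] with y hy using
    (inner_symm_eq g hc X Y hy.1).symm

theorem IsMeasField.aemeasurable_nrm [SecondCountableTopology M] (hΩ : IsOpen Ω)
    {Y : VField m M} (hY : IsMeasField g Ω Y) :
    AEMeasurable (fun x => nrm g x (Y x)) ((vol g).restrict Ω) :=
  (hY.aemeasurable_inner hΩ hY).sqrt

theorem isMeasField_of_isCField (hΩ : IsOpen Ω) {Y : VField m M} (hY : IsCField 1 Y) :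
    IsMeasField g Ω Y :=
  isMeasField_of_continuousOn hΩ fun _ hc =>
    (contDiffOn_coeff hc hY).continuousOn.mono inter_subset_left

theorem continuousOn_nrm {Y : VField m M} (hΩ : IsOpen Ω)
    (h : ∀ c ∈ atlas (Model m) M, ContinuousOn (coeff c Y) (chartDom c Ω)) :
    ContinuousOn (fun x => nrm g x (Y x)) Ω := by
  intro x hx
  set c := chartAt (Model m) x
  have hc : c ∈ atlas (Model m) M := chart_mem_atlas _ x
  have hxs : x ∈ c.source := mem_chart_source _ x
  have h1 : ContinuousOn (fun y => √(metricChart g c y (coeff c Y y) (coeff c Y y)))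
      (chartDom c Ω) :=
    ((((continuousOn_metricChart g hc).mono inter_subset_left).clm_apply (h c hc)).clm_apply
      (h c hc)).sqrt
  have hcx : c x ∈ chartDom c Ω :=
    ⟨c.map_source hxs, by rw [mem_preimage, c.left_inv hxs]; exact hx⟩
  have h2 := (h1.continuousAt ((isOpen_chartDom c hΩ).mem_nhds hcx)).comp (c.continuousAt hxs)
  refine (h2.congr ?_).continuousWithinAt
  filter_upwards [c.open_source.mem_nhds hxs] with z hz
  have := nrm_symm_eq g hc Y (c.map_source hz)
  rw [c.left_inv hz] at this
  exact this.symm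

theorem continuous_nrm_of_isCField {Y : VField m M} (hY : IsCField 1 Y) :
    Continuous (fun x => nrm g x (Y x)) :=
  continuousOn_univ.1 (continuousOn_nrm isOpen_univ fun _ hc =>
    (contDiffOn_coeff hc hY).continuousOn.mono inter_subset_left)

theorem contDiffOn_comp_symm {c : OpenPartialHomeomorph M (Model m)}
    (hc : c ∈ atlas (Model m) M) {v : M → ℝ} (hv : ContMDiffOn (𝓡 m) 𝓘(ℝ, ℝ) 1 v Ω) :
    ContDiffOn ℝ 1 (fun y => v (c.symm y)) (chartDom c Ω) := by
  have h1 : ContMDiffOn (𝓡 m) (𝓡 m) 1 c.symm c.target :=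
    (contMDiffOn_symm_of_mem_maximalAtlas (n := ∞) (IsManifold.subset_maximalAtlas hc)).of_le
      (by exact_mod_cast le_top)
  have h2 : ContMDiffOn (𝓡 m) 𝓘(ℝ, ℝ) 1 (fun y => v (c.symm y)) (chartDom c Ω) :=
    hv.comp (h1.mono inter_subset_left) fun y hy => hy.2
  exact h2.contDiffOn

theorem continuousOn_coeff_gradient (hΩ : IsOpen Ω) {v : M → ℝ}
    (hv : ContMDiffOn (𝓡 m) 𝓘(ℝ, ℝ) 1 v Ω) {c : OpenPartialHomeomorph M (Model m)}
    (hc : c ∈ atlas (Model m) M) : ContinuousOn (coeff c (gradient g v)) (chartDom c Ω) := by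
  have h1 : ContinuousOn (fun y => (metricChart g c y).inverse
      (fderiv ℝ (fun y => v (c.symm y)) y)) (chartDom c Ω) :=
    ((continuousOn_inverse_metricChart g hc).mono inter_subset_left).clm_apply
      ((contDiffOn_comp_symm hc hv).continuousOn_fderiv_of_isOpen (isOpen_chartDom c hΩ) le_rfl)
  refine h1.congr fun y hy => ?_
  simp only
  rw [← covec_gradient g hc hy.1 ((hv.contMDiffAt (hΩ.mem_nhds hy.2)).mdifferentiableAt
    one_ne_zero), inverse_covec g hc _ hy.1]

theorem locallyIntegrableOn_iff_compact {E F : Type*} [TopologicalSpace E] [T2Space E]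
    [LocallyCompactSpace E] [MeasurableSpace E] [NormedAddCommGroup F] {μ : Measure E} {O : Set E}
    (hO : IsOpen O) {f : E → F} :
    LocallyIntegrableOn f O μ ↔ ∀ K, K ⊆ O → IsCompact K → IntegrableOn f K μ :=
  locallyIntegrableOn_iff hO.isLocallyClosed

theorem target_inter_preimage_image {M : Type*} [TopologicalSpace M]
    (c : OpenPartialHomeomorph M (Model m)) {K : Set (Model m)} (hK : K ⊆ c.target) :
    c.target ∩ c.symm ⁻¹' (c.symm '' K) = K := by
  ext y
  refine ⟨?_, fun hy => ⟨hK hy, mem_image_of_mem _ hy⟩⟩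
  rintro ⟨hy, z, hz, hzy⟩
  rwa [← c.symm.injOn (hK hz) hy hzy]

theorem isCompact_symm_image {M : Type*} [TopologicalSpace M]
    {c : OpenPartialHomeomorph M (Model m)} {K : Set (Model m)} (hK : IsCompact K)
    (hKc : K ⊆ c.target) : IsCompact (c.symm '' K) :=
  hK.image_of_continuousOn (c.continuousOn_symm.mono hKc)

theorem symm_image_subset_source {M : Type*} [TopologicalSpace M]
    {c : OpenPartialHomeomorph M (Model m)} {K : Set (Model m)} (hKc : K ⊆ c.target) :
    c.symm '' K ⊆ c.source := by
  rintro _ ⟨y, hy, rfl⟩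
  exact c.map_target (hKc hy)

theorem integrableOn_comp_symm [T2Space M] {c : OpenPartialHomeomorph M (Model m)}
    (hc : c ∈ atlas (Model m) M) {K : Set (Model m)} (hK : IsCompact K) (hKc : K ⊆ c.target)
    {f : M → ℝ} (hf : IntegrableOn f (c.symm '' K) (vol g)) :
    IntegrableOn (fun y => f (c.symm y)) K := by
  rw [integrableOn_vol_iff g hc (isCompact_symm_image hK hKc).measurableSet
    (symm_image_subset_source hKc), target_inter_preimage_image c hKc] at hf
  have h1 : ContinuousOn (fun y => (volDensity g c y)⁻¹) K :=
    ((contDiffOn_volDensity g hc).continuousOn.mono hKc).inv₀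
      fun y hy => (volDensity_pos g hc (hKc hy)).ne'
  refine (hf.continuousOn_mul h1 hK).congr_fun (fun y hy => ?_) hK.measurableSet
  exact inv_mul_cancel_left₀ (volDensity_pos g hc (hKc hy)).ne' _

theorem locallyIntegrableOn_comp_symm [T2Space M] (hΩ : IsOpen Ω)
    {c : OpenPartialHomeomorph M (Model m)}
    (hc : c ∈ atlas (Model m) M) {f : M → ℝ} (hf : LocallyIntegrableOn f Ω (vol g)) :
    LocallyIntegrableOn (fun y => f (c.symm y)) (chartDom c Ω) := by
  rw [locallyIntegrableOn_iff_compact (isOpen_chartDom c hΩ)]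
  intro K hKO hK
  refine integrableOn_comp_symm (g := g) hc hK (hKO.trans inter_subset_left) ?_
  refine hf.integrableOn_compact_subset ?_ (isCompact_symm_image hK (hKO.trans inter_subset_left))
  rintro _ ⟨y, hy, rfl⟩
  exact (hKO hy).2

theorem locallyIntegrableOn_covec [T2Space M] (hΩ : IsOpen Ω)
    {c : OpenPartialHomeomorph M (Model m)}
    (hc : c ∈ atlas (Model m) M) {Y : VField m M} (hY : IsMeasField g Ω Y)
    (hYi : LocallyIntegrableOn (fun x => nrm g x (Y x)) Ω (vol g)) :
    LocallyIntegrableOn (covec g c Y) (chartDom c Ω) := by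
  have h1 := (locallyIntegrableOn_iff_compact (isOpen_chartDom c hΩ)).1
    (locallyIntegrableOn_comp_symm hΩ hc hYi)
  rw [locallyIntegrableOn_iff_compact (isOpen_chartDom c hΩ)]
  intro K hKO hK
  obtain ⟨b, hb, hbK⟩ := exists_covec_le g hc hK (hKO.trans inter_subset_left)
  refine Integrable.mono' ((h1 K hKO hK).const_mul b)
    ((hY.aemeasurable_covec hΩ hc).mono_measure (Measure.restrict_mono hKO le_rfl)) ?_
  filter_upwards [ae_restrict_mem hK.measurableSet] with y hy using hbK y hy Y

end Measurability

/-! ### Weak gradients on the manifold. -/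

section WeakGradient

variable {m : ℕ} {M : Type*} [TopologicalSpace M] [ChartedSpace (Model m) M]
  [IsManifold (𝓡 m) ∞ M] {g : RMetric m M} [MeasurableSpace M] [BorelSpace M]
  [T2Space M] {Ω : Set M} {u v : M → ℝ} {X Y : VField m M}

/-- Test with the coordinate field `(√det g)⁻¹ φ w`: the density cancels in both integrals and the
Euclidean identity for `φ` remains. The weak derivative in the chart is the covector of `Y`, so the
metric enters only through `covec`. -/
theorem IsWeakGradient.isWeakDeriv (hΩ : IsOpen Ω) (h : IsWeakGradient g Ω u Y)
    {c : OpenPartialHomeomorph M (Model m)} (hc : c ∈ atlas (Model m) M) :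
    IsWeakDeriv (chartDom c Ω) (fun y => u (c.symm y)) (covec g c Y) where
  locInt := locallyIntegrableOn_comp_symm hΩ hc h.locInt
  locInt_deriv := locallyIntegrableOn_covec hΩ hc h.meas h.locInt_norm
  integral_eq φ hφ hφc hφO w := by
    have hO := isOpen_chartDom c hΩ
    have hKc : tsupport φ ⊆ c.target := hφO.trans inter_subset_left
    set f : Model m → ℝ := fun y => (volDensity g c y)⁻¹ * φ y with hf
    have hfC : ContDiffOn ℝ 1 f c.target :=
      (((contDiffOn_volDensity g hc).of_le (by exact_mod_cast le_top)).inv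
        fun y hy => (volDensity_pos g hc hy).ne').mul hφ.contDiffOn
    have hf0 : ∀ y ∈ c.target, y ∉ tsupport φ → f y = 0 := fun y _ hy => by
      simp [hf, image_eq_zero_of_notMem_tsupport hy]
    have hX := isCField_chartField hc hfC hφc hKc hf0 w
    have hK := isCompact_symm_image hφc.isCompact hKc
    have hX0 : ∀ x ∉ c.symm '' tsupport φ, chartField c f w x = 0 :=
      fun x hx => chartField_eq_zero hf0 hx
    have key := h.integral_eq _ hX ⟨_, hK, by
      rintro _ ⟨y, hy, rfl⟩
      exact (hφO hy).2, hX0⟩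
    have hm := (hΩ.inter c.open_source).measurableSet
    have hsrc : ∀ x ∈ Ω \ (Ω ∩ c.source), x ∉ c.symm '' tsupport φ := fun x hx h =>
      hx.2 ⟨hx.1, symm_image_subset_source hKc h⟩
    have e1 : ∫ x in Ω, g.inner x (chartField c f w x) (Y x) ∂(vol g) =
        ∫ y in chartDom c Ω, covec g c Y y w * φ y := by
      rw [setIntegral_eq_of_subset_of_forall_sdiff_eq_zero hΩ.measurableSet
        (inter_subset_left (t := c.source)) (fun x hx => by
          have : metricAt g x (chartField c f w x) (Y x) = 0 := by
            rw [hX0 x (hsrc x hx)]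
            exact congrArg (fun L : Model m →L[ℝ] ℝ => L (Y x)) (map_zero (metricAt g x))
          exact this),
        setIntegral_vol g hc hm inter_subset_right, chartDom_inter_source]
      refine setIntegral_congr_fun hO.measurableSet fun y hy => ?_
      rw [inner_symm_eq g hc _ _ hy.1, coeff_chartField hc hy.1, covec, metricChart_symm]
      simp only [map_smul, smul_eq_mul, hf]
      rw [← mul_assoc, mul_inv_cancel_left₀ (volDensity_pos g hc hy.1).ne', mul_comm]
    have e2 : ∫ x in Ω, u x * divergence g (chartField c f w) x ∂(vol g) =
        ∫ y in chartDom c Ω, u (c.symm y) * fderiv ℝ φ y w := by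
      rw [setIntegral_eq_of_subset_of_forall_sdiff_eq_zero hΩ.measurableSet
        (inter_subset_left (t := c.source)) (fun x hx => by
          rw [divergence_eq_zero g (Filter.mem_of_superset
            (hK.isClosed.isOpen_compl.mem_nhds (hsrc x hx)) hX0), mul_zero]),
        setIntegral_vol g hc hm inter_subset_right, chartDom_inter_source]
      refine setIntegral_congr_fun hO.measurableSet fun y hy => ?_
      rw [divergence_eq_divChart g hc hX (c.map_target hy.1), c.right_inv hy.1,
        mul_left_comm, volDensity_mul_divChart g hc _ hy.1]
      congr 1
      have : ∀ i, (fun z => densCoeff g c (chartField c f w) z i) =ᶠ[𝓝 y] fun z => φ z * w i := by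
        intro i
        filter_upwards [c.open_target.mem_nhds hy.1] with z hz
        rw [densCoeff, coeff_chartField hc hz, smul_smul, hf,
          mul_inv_cancel_left₀ (volDensity_pos g hc hz).ne']
        simp
      rw [flatDiv, fderiv_apply_eq_sum]
      refine Finset.sum_congr rfl fun i _ => ?_
      rw [(this i).fderiv_eq, fderiv_mul_const ((hφ.differentiable one_ne_zero) y)]
      simp
    rw [e1, e2] at key
    linarith

theorem IsWeakDeriv.ae_eq {O : Set (Model m)} (hO : IsOpen O) {u : Model m → ℝ}
    {Z Z' : Model m → Model m →L[ℝ] ℝ} (h : IsWeakDeriv O u Z) (h' : IsWeakDeriv O u Z') :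
    ∀ᵐ y ∂(volume.restrict O), Z y = Z' y := by
  have key : ∀ w, ∀ᵐ y, y ∈ O → Z y w - Z' y w = 0 := fun w => by
    have hi : LocallyIntegrableOn (fun y => Z y w) O := fun y hy =>
      (h.locInt_deriv y hy).imp fun s hs => ⟨hs.1,
        (ContinuousLinearMap.apply ℝ ℝ w).integrable_comp hs.2⟩
    have hi' : LocallyIntegrableOn (fun y => Z' y w) O := fun y hy =>
      (h'.locInt_deriv y hy).imp fun s hs => ⟨hs.1,
        (ContinuousLinearMap.apply ℝ ℝ w).integrable_comp hs.2⟩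
    refine hO.ae_eq_zero_of_integral_contDiff_smul_eq_zero (hi.sub hi') fun φ hφ hφc hφO => ?_
    have hφ0 : ∀ y, y ∉ tsupport φ → φ y = 0 := fun y hy => image_eq_zero_of_notMem_tsupport hy
    have hint : ∀ {f : Model m → ℝ}, LocallyIntegrableOn f O →
        IntegrableOn (fun y => f y * φ y) O := fun {f} hf =>
      ((hf.integrableOn_compact_subset hφO hφc.isCompact).mul_continuousOn
        hφ.continuous.continuousOn hφc.isCompact).of_forall_sdiff_eq_zero hO.measurableSet
        fun y hy => by rw [hφ0 y hy.2, mul_zero]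
    have e := (h.integral_eq φ (hφ.of_le (by exact_mod_cast le_top)) hφc hφO w).symm.trans
      (h'.integral_eq φ (hφ.of_le (by exact_mod_cast le_top)) hφc hφO w)
    rw [neg_inj, ← sub_eq_zero, ← integral_sub (hint hi) (hint hi')] at e
    rw [← setIntegral_eq_integral_of_forall_compl_eq_zero (s := O)
      fun y hy => by rw [hφ0 y fun h => hy (hφO h), zero_smul], ← e]
    exact setIntegral_congr_fun hO.measurableSet fun y _ => by simp only [smul_eq_mul]; ring
  rw [ae_restrict_iff' hO.measurableSet]
  -- The coordinate directions suffice, so finitely many null sets are discarded.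
  have := ae_all_iff.2 fun i : Fin m => key (EuclideanSpace.single i 1)
  filter_upwards [this] with y hy hyO
  ext w
  rw [fderiv_apply_eq_sum, fderiv_apply_eq_sum (Z' y)]
  exact Finset.sum_congr rfl fun i _ => by rw [sub_eq_zero.1 (hy i hyO)]

/-- This makes the choice in `weakGrad` harmless: the functionals can be evaluated with any weak
gradient of `u`. -/
theorem IsWeakGradient.ae_eq [SecondCountableTopology M] (hΩ : IsOpen Ω)
    (h : IsWeakGradient g Ω u X) (h' : IsWeakGradient g Ω u Y) :
    ∀ᵐ x ∂((vol g).restrict Ω), X x = Y x := by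
  refine ae_of_charts (m := m) fun c hc => ?_
  rw [ae_vol_iff g hc (hΩ.inter c.open_source).measurableSet inter_subset_right,
    chartDom_inter_source]
  filter_upwards [(h.isWeakDeriv hΩ hc).ae_eq (isOpen_chartDom c hΩ) (h'.isWeakDeriv hΩ hc),
    ae_restrict_mem (isOpen_chartDom c hΩ).measurableSet] with y hy hyO
  have := congrArg (metricChart g c y).inverse hy
  rw [inverse_covec g hc X hyO.1, inverse_covec g hc Y hyO.1] at this
  rw [← symmDeriv_coeff hc X hyO.1, this, symmDeriv_coeff hc Y hyO.1]

theorem integrableOn_inner [SecondCountableTopology M] (hΩ : IsOpen Ω) {K : Set M}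
    (hK : IsCompact K) (hKΩ : K ⊆ Ω) (hX : IsCField 1 X) (h0 : ∀ x ∉ K, X x = 0)
    (hY : IsMeasField g Ω Y) (hYi : LocallyIntegrableOn (fun x => nrm g x (Y x)) Ω (vol g)) :
    IntegrableOn (fun x => metricAt g x (X x) (Y x)) Ω (vol g) := by
  obtain ⟨C, hC⟩ := hK.exists_bound_of_continuousOn
    (continuous_nrm_of_isCField (g := g) hX).continuousOn
  have h1 : IntegrableOn (fun x => metricAt g x (X x) (Y x)) K (vol g) := by
    refine Integrable.mono' ((hYi.integrableOn_compact_subset hKΩ hK).const_mul C)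
      ((((isMeasField_of_isCField hΩ hX).aemeasurable_inner hΩ hY).mono_measure
        (Measure.restrict_mono hKΩ le_rfl)).aestronglyMeasurable) ?_
    filter_upwards [ae_restrict_mem hK.measurableSet] with x hx
    refine (abs_metricAt_le g x (X x) (Y x)).trans ?_
    exact mul_le_mul_of_nonneg_right ((Real.le_norm_self _).trans (hC x hx)) (nrm_nonneg g x _)
  refine h1.of_forall_sdiff_eq_zero hΩ.measurableSet fun x hx => ?_
  rw [h0 x hx.2]
  exact congrArg (fun L : Model m →L[ℝ] ℝ => L (Y x)) (map_zero (metricAt g x))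

theorem IsWeakGradient.integral_metricAt_eq (h : IsWeakGradient g Ω u Y) {K : Set M}
    (hK : IsCompact K) (hKΩ : K ⊆ Ω) (hX : IsCField 1 X) (h0 : ∀ x ∉ K, X x = 0) :
    ∫ x in Ω, metricAt g x (X x) (Y x) ∂(vol g) = - ∫ x in Ω, u x * divergence g X x ∂(vol g) :=
  h.integral_eq X hX ⟨K, hK, hKΩ, h0⟩

theorem IsWeakGradient.add [SecondCountableTopology M] (hΩ : IsOpen Ω)
    (hu : IsWeakGradient g Ω u X) (hv : IsWeakGradient g Ω v Y) :
    IsWeakGradient g Ω (u + v) (X + Y) where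
  locInt := hu.locInt.add hv.locInt
  meas := hu.meas.add hv.meas
  locInt_norm := by
    have := ChartedSpace.locallyCompactSpace (Model m) M
    rw [locallyIntegrableOn_iff_compact hΩ]
    intro K hKΩ hK
    refine Integrable.mono' ((hu.locInt_norm.integrableOn_compact_subset hKΩ hK).add
      (hv.locInt_norm.integrableOn_compact_subset hKΩ hK))
      (((hu.meas.add hv.meas).aemeasurable_nrm hΩ).mono_measure
        (Measure.restrict_mono hKΩ le_rfl)).aestronglyMeasurable (.of_forall fun x => ?_)
    exact (Real.norm_of_nonneg (nrm_nonneg g x _)).le.trans (nrm_add_le g x (X x) (Y x))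
  integral_eq V hV := by
    rintro ⟨K, hK, hKΩ, h0⟩
    have e1 := integral_add (integrableOn_inner hΩ hK hKΩ hV h0 hu.meas hu.locInt_norm)
      (integrableOn_inner hΩ hK hKΩ hV h0 hv.meas hv.locInt_norm)
    have e2 := integral_add (integrableOn_mul_divergence g hK hKΩ hΩ hu.locInt hV h0)
      (integrableOn_mul_divergence g hK hKΩ hΩ hv.locInt hV h0)
    rw [hu.integral_metricAt_eq hK hKΩ hV h0, hv.integral_metricAt_eq hK hKΩ hV h0, ← neg_add,
      ← e2] at e1
    refine Eq.trans ?_ (e1.trans (congrArg Neg.neg ?_))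
    · exact integral_congr_ae (.of_forall fun x => map_add (metricAt g x (V x)) (X x) (Y x))
    · exact integral_congr_ae (.of_forall fun x => by simp only [Pi.add_apply]; ring)

theorem metricAt_sum_left {M : Type*} [TopologicalSpace M] [ChartedSpace (Model m) M]
    [IsManifold (𝓡 m) ∞ M] (g : RMetric m M) {ι : Type*} (x : M) (S : Finset ι)
    (v : ι → Model m) (w : Model m) :
    metricAt g x (∑ i ∈ S, v i) w = ∑ i ∈ S, metricAt g x (v i) w := by
  rw [map_sum, sum_apply]

theorem IsWeakGradient.const_smul (hu : IsWeakGradient g Ω u X) (a : ℝ) :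
    IsWeakGradient g Ω (a • u) (a • X) where
  locInt := hu.locInt.smul a
  meas := hu.meas.const_smul a
  locInt_norm := by
    have e : (fun x => tnorm g x ((a • X) x)) = |a| • fun x => tnorm g x (X x) :=
      funext fun x => nrm_smul g x a (X x)
    rw [e]
    exact hu.locInt_norm.smul |a|
  integral_eq V hV hK := by
    have e := congrArg (a * ·) (hu.integral_eq V hV hK)
    simp only [mul_neg, ← integral_const_mul] at e
    refine Eq.trans ?_ (e.trans (congrArg Neg.neg ?_))
    · exact integral_congr_ae (.of_forall fun x => map_smul (metricAt g x (V x)) a (X x))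
    · exact integral_congr_ae (.of_forall fun x => by
        simp only [Pi.smul_apply, smul_eq_mul]; ring)

theorem IsWeakGradient.sub [SecondCountableTopology M] (hΩ : IsOpen Ω)
    (hu : IsWeakGradient g Ω u X) (hv : IsWeakGradient g Ω v Y) :
    IsWeakGradient g Ω (u - v) (X - Y) := by
  have := hu.add hΩ (hv.const_smul (-1))
  simpa only [neg_one_smul, ← sub_eq_add_neg] using this

theorem IsWeakGradient.congr (hu : IsWeakGradient g Ω u X)
    (huv : ∀ᵐ x ∂((vol g).restrict Ω), u x = v x) : IsWeakGradient g Ω v X where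
  locInt := fun x hx => by
    obtain ⟨s, hs, hi⟩ := hu.locInt x hx
    refine ⟨s ∩ Ω, Filter.inter_mem hs self_mem_nhdsWithin, ?_⟩
    refine (hi.mono_set inter_subset_left).congr ?_
    exact ae_mono (Measure.restrict_mono inter_subset_right le_rfl) huv
  meas := hu.meas
  locInt_norm := hu.locInt_norm
  integral_eq V hV hK := by
    rw [hu.integral_eq V hV hK]
    refine congrArg Neg.neg (integral_congr_ae ?_)
    filter_upwards [huv] with x hx
    rw [hx]

theorem IsCField.smul {f : M → ℝ} (hf : ContMDiff (𝓡 m) 𝓘(ℝ, ℝ) 1 f) (hX : IsCField 1 X) :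
    IsCField 1 (fun x => f x • X x) := ContMDiff.smul_section hf hX

/-- A partition of unity subordinate to chart domains splits the test field into pieces supported in
single charts, finitely many of which meet the compact set `K`. -/
theorem isWeakGradient_gradient [SecondCountableTopology M] (hΩ : IsOpen Ω)
    (hv : ContMDiffOn (𝓡 m) 𝓘(ℝ, ℝ) 1 v Ω) : IsWeakGradient g Ω v (gradient g v) where
  locInt := hv.continuousOn.locallyIntegrableOn hΩ.measurableSet
  meas := isMeasField_of_continuousOn hΩ fun _ hc => continuousOn_coeff_gradient hΩ hv hc
  locInt_norm := (continuousOn_nrm hΩ fun _ hc =>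
    continuousOn_coeff_gradient hΩ hv hc).locallyIntegrableOn hΩ.measurableSet
  integral_eq V hV := by
    rintro ⟨K, hK, hKΩ, h0⟩
    have hlc := ChartedSpace.locallyCompactSpace (Model m) M
    obtain ⟨f, hf⟩ := SmoothPartitionOfUnity.exists_isSubordinate_chartAt_source (𝓡 m) M
    have hfin := f.locallyFinite.finite_nonempty_inter_compact hK
    set S := hfin.toFinset
    set X : M → VField m M := fun i x => f i x • V x
    have hX : ∀ i, IsCField 1 (X i) := fun i =>
      hV.smul ((f i).contMDiff.of_le (by exact_mod_cast le_top))
    have hsum : ∀ x, V x = ∑ i ∈ S, X i x := fun x => by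
      by_cases hx : x ∈ K
      · have h1 : ∑ i ∈ S, f i x = 1 := by
          rw [← f.sum_eq_one (mem_univ x)]
          refine (finsum_eq_sum_of_support_subset _ fun i hi => ?_).symm
          exact hfin.mem_toFinset.2 ⟨x, hi, hx⟩
        simp only [X]
        rw [← Finset.sum_smul, h1, one_smul]
      · simp only [X, h0 x hx, smul_zero, Finset.sum_const_zero]
    have hVe : V = fun x => ∑ i ∈ S, X i x := funext hsum
    have hKi : ∀ i, IsCompact (K ∩ tsupport (f i)) := fun i => hK.inter_right (isClosed_tsupport _)
    have hX0 : ∀ i, ∀ x ∉ K ∩ tsupport (f i), X i x = 0 := fun i x hx => by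
      by_cases hxK : x ∈ K
      · simp only [X, image_eq_zero_of_notMem_tsupport fun h => hx ⟨hxK, h⟩, zero_smul]
      · simp only [X, h0 x hxK, smul_zero]
    have hloc : LocallyIntegrableOn v Ω (vol g) :=
      hv.continuousOn.locallyIntegrableOn hΩ.measurableSet
    have hloc' : LocallyIntegrableOn (fun x => nrm g x (gradient g v x)) Ω (vol g) :=
      (continuousOn_nrm hΩ fun _ hc =>
        continuousOn_coeff_gradient hΩ hv hc).locallyIntegrableOn hΩ.measurableSet
    have hmeas : IsMeasField g Ω (gradient g v) :=
      isMeasField_of_continuousOn hΩ fun _ hc => continuousOn_coeff_gradient hΩ hv hc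
    have e1 : ∫ x in Ω, metricAt g x (V x) (gradient g v x) ∂(vol g) =
        ∑ i ∈ S, ∫ x in Ω, metricAt g x (X i x) (gradient g v x) ∂(vol g) := by
      rw [← integral_finsetSum _ fun i _ => integrableOn_inner hΩ (hKi i)
        (inter_subset_left.trans hKΩ) (hX i) (hX0 i) hmeas hloc']
      refine integral_congr_ae (.of_forall fun x => ?_)
      simp only [hsum x]
      exact metricAt_sum_left g x S (fun i => X i x) _
    have e2 : ∫ x in Ω, v x * divergence g V x ∂(vol g) =
        ∑ i ∈ S, ∫ x in Ω, v x * divergence g (X i) x ∂(vol g) := by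
      rw [← integral_finsetSum _ fun i _ => integrableOn_mul_divergence g (hKi i)
        (inter_subset_left.trans hKΩ) hΩ hloc (hX i) (hX0 i)]
      refine integral_congr_ae (.of_forall fun x => ?_)
      simp only
      rw [hVe, divergence_sum g S hX, Finset.mul_sum]
    refine e1.trans ?_
    rw [e2, ← Finset.sum_neg_distrib]
    refine Finset.sum_congr rfl fun i _ => ?_
    rw [← integral_mfderiv_eq_neg_of_chart g hΩ hv (hX i) (chart_mem_atlas _ i) (hKi i)
      (inter_subset_left.trans hKΩ) (inter_subset_right.trans (hf i)) (hX0 i)]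
    refine integral_congr_ae (.of_forall fun x => ?_)
    exact (metricAt_symm g x _ _).trans (metricAt_gradient g v x (X i x))

theorem isWeakGradient_const [SecondCountableTopology M] (hΩ : IsOpen Ω) (a : ℝ) :
    IsWeakGradient g Ω (fun _ => a) (0 : VField m M) := by
  have h := isWeakGradient_gradient (g := g) hΩ (v := fun _ => a) contMDiffOn_const
  convert h using 1
  funext x
  have h1 : (mfderiv (𝓡 m) 𝓘(ℝ, ℝ) (fun _ : M => a) x : Model m →L[ℝ] ℝ) = 0 := mfderiv_const
  have h2 : nrm g x (gradient g (fun _ => a) x) ^ 2 = 0 :=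
    (nrm_sq g x _).trans ((metricAt_gradient g _ x _).trans (by rw [h1]; rfl))
  exact ((nrm_eq_zero g).1 (pow_eq_zero_iff two_ne_zero |>.1 h2)).symm

end WeakGradient

/-! ### Recovering a Sobolev function along segments. -/

section Shift

variable {m : ℕ}

/-- The average of a function along the segments `[x - z, x]`. -/
def segAvg (φ : Model m → ℝ) (z : Model m) (x : Model m) : ℝ := ∫ t in (0 : ℝ)..1, φ (x - t • z)

theorem hasFDerivAt_segAvg {φ : Model m → ℝ} (hφ : ContDiff ℝ 1 φ) (hc : HasCompactSupport φ)
    (z x : Model m) :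
    HasFDerivAt (segAvg φ z) (∫ t in (0 : ℝ)..1, fderiv ℝ φ (x - t • z)) x := by
  have hd : Continuous (fderiv ℝ φ) := hφ.continuous_fderiv one_ne_zero
  obtain ⟨C, hC⟩ := hd.bounded_above_of_compact_support (hc.fderiv ℝ)
  refine intervalIntegral.hasFDerivAt_integral_of_dominated_of_fderiv_le (bound := fun _ => C)
    (F' := fun x t => fderiv ℝ φ (x - t • z)) Filter.univ_mem ?_ ?_ ?_ ?_ ?_ ?_
  · exact .of_forall fun y => (hφ.continuous.comp (by fun_prop)).aestronglyMeasurable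
  · exact (hφ.continuous.comp (by fun_prop)).intervalIntegrable _ _
  · exact (hd.comp (by fun_prop)).aestronglyMeasurable
  · exact .of_forall fun t _ y _ => hC _
  · exact intervalIntegrable_const
  · refine .of_forall fun t _ y _ => ?_
    have := ((hφ.differentiable one_ne_zero) (y - t • z)).hasFDerivAt.comp y
      ((hasFDerivAt_id y).sub_const (t • z))
    simpa [Function.comp_def] using this

theorem contDiff_segAvg {φ : Model m → ℝ} (hφ : ContDiff ℝ 1 φ) (hc : HasCompactSupport φ)
    (z : Model m) : ContDiff ℝ 1 (segAvg φ z) := by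
  rw [contDiff_one_iff_fderiv]
  refine ⟨fun x => (hasFDerivAt_segAvg hφ hc z x).differentiableAt, ?_⟩
  have : fderiv ℝ (segAvg φ z) = fun x => ∫ t in (0 : ℝ)..1, fderiv ℝ φ (x - t • z) :=
    funext fun x => (hasFDerivAt_segAvg hφ hc z x).fderiv
  rw [this]
  have hd : Continuous (fderiv ℝ φ) := hφ.continuous_fderiv one_ne_zero
  exact intervalIntegral.continuous_parametric_intervalIntegral_of_continuous'
    (f := fun x t => fderiv ℝ φ (x - t • z)) (hd.comp (by fun_prop)) 0 1

/-- The fundamental theorem of calculus for `t ↦ φ(x - tz)` leaves only the end points. This is why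
`segAvg φ z` is the test function which converts a weak derivative into a difference. -/
theorem fderiv_segAvg {φ : Model m → ℝ} (hφ : ContDiff ℝ 1 φ) (hc : HasCompactSupport φ)
    (z x : Model m) : fderiv ℝ (segAvg φ z) x z = φ x - φ (x - z) := by
  have hd : Continuous (fderiv ℝ φ) := hφ.continuous_fderiv one_ne_zero
  have hi : IntervalIntegrable (fun t : ℝ => fderiv ℝ φ (x - t • z)) volume 0 1 :=
    Continuous.intervalIntegrable (hd.comp (by fun_prop)) _ _
  rw [(hasFDerivAt_segAvg hφ hc z x).fderiv, ContinuousLinearMap.intervalIntegral_apply hi]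
  have h : ∀ t ∈ uIcc (0 : ℝ) 1, HasDerivAt (fun t : ℝ => -φ (x - t • z))
      (fderiv ℝ φ (x - t • z) z) t := fun t _ => by
    have h1 : HasDerivAt (fun t : ℝ => x - t • z) (-z) t := by
      simpa using ((hasDerivAt_id t).smul_const z).const_sub x
    have := (((hφ.differentiable one_ne_zero) (x - t • z)).hasFDerivAt.comp_hasDerivAt t h1).neg
    exact this.congr_deriv (by simp)
  rw [intervalIntegral.integral_eq_sub_of_hasDerivAt h]
  · simp only [one_smul, zero_smul, sub_zero]
    ring
  · exact Continuous.intervalIntegrable ((hd.comp (by fun_prop)).clm_apply continuous_const) _ _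

/-- The union of the segments `[x, x + z]`, for `x ∈ K`. -/
def sweep (K : Set (Model m)) (z : Model m) : Set (Model m) :=
  (fun p : Model m × ℝ => p.1 + p.2 • z) '' (K ×ˢ Icc (0 : ℝ) 1)

theorem isCompact_sweep {K : Set (Model m)} (hK : IsCompact K) (z : Model m) :
    IsCompact (sweep K z) :=
  (hK.prod isCompact_Icc).image (by fun_prop)

theorem mem_sweep {K : Set (Model m)} {z x : Model m} (hx : x ∈ K) {t : ℝ}
    (ht : t ∈ Icc (0 : ℝ) 1) : x + t • z ∈ sweep K z := ⟨(x, t), ⟨hx, ht⟩, rfl⟩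

theorem segAvg_eq_zero {φ : Model m → ℝ} {K : Set (Model m)} (hK : ∀ x, x ∉ K → φ x = 0)
    {z x : Model m} (hx : x ∉ sweep K z) : segAvg φ z x = 0 := by
  refine (intervalIntegral.integral_congr (g := fun _ => (0 : ℝ)) fun t ht =>
    hK _ fun h => hx ?_).trans intervalIntegral.integral_zero
  rw [uIcc_of_le zero_le_one] at ht
  simpa using mem_sweep (z := z) h ht

/-- On each fibre the map is a translation. It carries integrability of `Y` to `(t, x) ↦ Y(x + tz)`,
as Fubini requires. -/
theorem measurePreserving_shear (z : Model m) : MeasurePreserving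
    (fun p : ℝ × Model m => (p.1, p.2 + p.1 • z))
    ((volume.restrict (uIoc (0 : ℝ) 1)).prod volume)
    ((volume.restrict (uIoc (0 : ℝ) 1)).prod volume) := by
  refine (MeasurePreserving.id _).skew_product (g := fun t x => x + t • z) ?_
    (.of_forall fun t => ?_)
  · exact (by fun_prop : Continuous fun p : ℝ × Model m => p.2 + p.1 • z).measurable
  · exact (measurePreserving_add_right volume (t • z)).map_eq

/-- The set of all points `x` for which the segment `[x, x + z]` lies in `O`. -/
def segDom (O : Set (Model m)) (z : Model m) : Set (Model m) :=
  {x | ∀ t ∈ Icc (0 : ℝ) 1, x + t • z ∈ O}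

theorem isOpen_segDom {O : Set (Model m)} (hO : IsOpen O) (z : Model m) :
    IsOpen (segDom O z) := by
  rw [isOpen_iff_mem_nhds]
  intro x hx
  have h : ∀ t ∈ Icc (0 : ℝ) 1, ∀ᶠ p : Model m × ℝ in 𝓝 x ×ˢ 𝓝 t, p.1 + p.2 • z ∈ O := by
    intro t ht
    rw [← nhds_prod_eq]
    exact (by fun_prop : Continuous fun p : Model m × ℝ => p.1 + p.2 • z).continuousAt
      (hO.mem_nhds (hx t ht))
  have := isCompact_Icc.mem_prod_nhdsSet_of_forall (l := 𝓝 x)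
    (s := {p : Model m × ℝ | p.1 + p.2 • z ∈ O}) h
  obtain ⟨U, hU, V, hV, hUV⟩ := Filter.mem_prod_iff.1 this
  filter_upwards [hU] with y hy t ht
  exact hUV (mk_mem_prod hy (subset_of_mem_nhdsSet hV ht))

/-- Testing the weak derivative with `segAvg φ z` gives `∫ u(x) (φ(x) - φ(x-z)) dx` on one side. On
the other side, Fubini and a translation give the integral of `Z` along segments, paired with `φ`.
As `φ` is arbitrary with support in the interior of `K`, the identity holds almost everywhere there.
-/
theorem IsWeakDeriv.shift_aux {O : Set (Model m)} {u : Model m → ℝ}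
    {Z : Model m → Model m →L[ℝ] ℝ} (h : IsWeakDeriv O u Z) (hO : IsOpen O) (z : Model m)
    {K : Set (Model m)} (hK : IsCompact K) (hKO : K ⊆ segDom O z) :
    ∀ᵐ x, x ∈ interior K → u (x + z) - u x = ∫ t in (0 : ℝ)..1, Z (x + t • z) z := by
  have : IsFiniteMeasure (volume.restrict (uIoc (0 : ℝ) 1)) := by
    rw [uIoc_of_le zero_le_one]; infer_instance
  set K' := sweep K z with hK'
  have hKc' : IsCompact K' := isCompact_sweep hK z
  have hKO' : K' ⊆ O := by
    rintro _ ⟨p, hp, rfl⟩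
    exact hKO hp.1 _ hp.2
  have hKK' : ∀ x ∈ K, x ∈ K' := fun x hx => by
    simpa using mem_sweep (z := z) hx (left_mem_Icc.2 zero_le_one)
  have hKK1 : ∀ x ∈ K, x + z ∈ K' := fun x hx => by
    simpa using mem_sweep (z := z) hx (right_mem_Icc.2 zero_le_one)
  -- Cutting off at the compact swept set makes the functions integrable on the whole space, so that
  -- translations and Fubini apply; along segments starting in `K` nothing changes.
  set u' : Model m → ℝ := K'.indicator u with hu'
  set Y : Model m → ℝ := K'.indicator fun x => Z x z with hY
  have hu'i : Integrable u' :=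
    (integrable_indicator_iff hKc'.measurableSet).2 (h.locInt.integrableOn_compact_subset hKO' hKc')
  have hYi : Integrable Y := by
    refine (integrable_indicator_iff hKc'.measurableSet).2 ?_
    exact (ContinuousLinearMap.apply ℝ ℝ z).integrable_comp
      (h.locInt_deriv.integrableOn_compact_subset hKO' hKc')
  have hJ : Integrable (fun p : ℝ × Model m => Y (p.2 + p.1 • z))
      ((volume.restrict (uIoc (0 : ℝ) 1)).prod volume) := by
    have h1 : Integrable (fun p : ℝ × Model m => Y p.2)
        ((volume.restrict (uIoc (0 : ℝ) 1)).prod volume) := hYi.comp_snd _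
    exact (measurePreserving_shear z).integrable_comp_of_integrable h1
  set D : Model m → ℝ := fun x => u' (x + z) - u' x - ∫ t in (0 : ℝ)..1, Y (x + t • z) with hD
  have hIi : Integrable fun x => ∫ t in (0 : ℝ)..1, Y (x + t • z) := by
    have := hJ.integral_prod_right
    simp only [intervalIntegral.integral_of_le zero_le_one]
    rwa [uIoc_of_le zero_le_one] at this
  have hDi : Integrable D := ((hu'i.comp_add_right z).sub hu'i).sub hIi
  have key : ∀ᵐ x, x ∈ interior K → D x = 0 := by
    refine isOpen_interior.ae_eq_zero_of_integral_contDiff_smul_eq_zero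
      (hDi.locallyIntegrable.locallyIntegrableOn _) fun φ hφ hφc hφK => ?_
    have hφ1 : ContDiff ℝ 1 φ := hφ.of_le (by exact_mod_cast le_top)
    have hφ0 : ∀ x, x ∉ K → φ x = 0 := fun x hx =>
      image_eq_zero_of_notMem_tsupport fun h => hx (interior_subset (hφK h))
    obtain ⟨C, hC⟩ := hφ.continuous.bounded_above_of_compact_support hφc
    have hΦ0 : ∀ x, x ∉ K' → segAvg φ z x = 0 := fun x hx => segAvg_eq_zero hφ0 hx
    have hΦc : HasCompactSupport (segAvg φ z) := HasCompactSupport.intro hKc' hΦ0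
    have hΦs : Function.support (segAvg φ z) ⊆ K' := fun x hx =>
      by_contra fun h => Function.mem_support.1 hx (hΦ0 x h)
    have hΦt : tsupport (segAvg φ z) ⊆ O := (closure_minimal hΦs hKc'.isClosed).trans hKO'
    have i1 : Integrable fun x => u' (x + z) * φ x :=
      (hu'i.comp_add_right z).mul_bdd hφ.continuous.aestronglyMeasurable (.of_forall hC)
    have i2 : Integrable fun x => u' x * φ x :=
      hu'i.mul_bdd hφ.continuous.aestronglyMeasurable (.of_forall hC)
    have i3 : Integrable fun x => (∫ t in (0 : ℝ)..1, Y (x + t • z)) * φ x :=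
      hIi.mul_bdd hφ.continuous.aestronglyMeasurable (.of_forall hC)
    have i4 : Integrable fun x => u' x * φ (x - z) :=
      hu'i.mul_bdd (Continuous.aestronglyMeasurable (hφ.continuous.comp (by fun_prop)))
          (.of_forall fun x => hC _)
    have e := h.integral_eq _ (contDiff_segAvg hφ1 hφc z) hΦc hΦt z
    have e1 : ∫ y in O, u y * fderiv ℝ (segAvg φ z) y z =
        (∫ x, u' x * φ x) - ∫ x, u' (x + z) * φ x := by
      have : ∫ x, u' (x + z) * φ x = ∫ x, u' x * φ (x - z) := by
        rw [← integral_add_right_eq_self (fun x => u' x * φ (x - z)) z]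
        simp
      rw [this, ← integral_sub i2 i4]
      refine Eq.trans ?_ (setIntegral_eq_integral_of_forall_compl_eq_zero (s := O) ?_)
      · refine setIntegral_congr_fun hO.measurableSet fun y _ => ?_
        rw [fderiv_segAvg hφ1 hφc]
        by_cases hy : y ∈ K'
        · rw [hu', indicator_of_mem hy, mul_sub]
        · rw [hφ0 y fun h => hy (hKK' y h), hφ0 (y - z) fun h => hy (by simpa using hKK1 _ h)]
          simp
      · intro x hx
        rw [hu', indicator_of_notMem fun h => hx (hKO' h)]
        simp
    have e2 : ∫ y in O, Z y z * segAvg φ z y = ∫ x, (∫ t in (0 : ℝ)..1, Y (x + t • z)) * φ x := by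
      have s1 : ∫ y in O, Z y z * segAvg φ z y = ∫ y, ∫ t in (0 : ℝ)..1, Y y * φ (y - t • z) := by
        refine Eq.trans ?_ (setIntegral_eq_integral_of_forall_compl_eq_zero (s := O) ?_)
        · refine setIntegral_congr_fun hO.measurableSet fun y _ => ?_
          simp only [intervalIntegral.integral_const_mul]
          change _ = Y y * segAvg φ z y
          by_cases hy : y ∈ K'
          · rw [hY, indicator_of_mem hy]
          · rw [hΦ0 y hy, mul_zero, mul_zero]
        · intro x hx
          rw [hY, indicator_of_notMem fun h => hx (hKO' h)]
          simp
      have s2 : Integrable (fun p : ℝ × Model m => Y p.2 * φ (p.2 - p.1 • z))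
          ((volume.restrict (uIoc (0 : ℝ) 1)).prod volume) :=
        (hYi.comp_snd _).mul_bdd
          (Continuous.aestronglyMeasurable (hφ.continuous.comp (by fun_prop)))
          (.of_forall fun x => hC _)
      have s3 : Integrable (fun p : ℝ × Model m => Y (p.2 + p.1 • z) * φ p.2)
          ((volume.restrict (uIoc (0 : ℝ) 1)).prod volume) :=
        hJ.mul_bdd (Continuous.aestronglyMeasurable (hφ.continuous.comp (by fun_prop)))
          (.of_forall fun x => hC _)
      rw [s1, ← intervalIntegral_integral_swap (f := fun t y => Y y * φ (y - t • z)) s2]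
      simp only [← intervalIntegral.integral_mul_const]
      rw [← intervalIntegral_integral_swap (f := fun t x => Y (x + t • z) * φ x) s3]
      refine intervalIntegral.integral_congr fun t _ => ?_
      rw [← integral_add_right_eq_self (fun y => Y y * φ (y - t • z)) (t • z)]
      simp
    rw [e1, e2] at e
    have e3 : ∫ x, φ x • D x = (∫ x, u' (x + z) * φ x) - (∫ x, u' x * φ x) -
        ∫ x, (∫ t in (0 : ℝ)..1, Y (x + t • z)) * φ x := by
      have i5 : Integrable fun x => u' (x + z) * φ x - u' x * φ x := i1.sub i2
      rw [← integral_sub i1 i2, ← integral_sub i5 i3]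
      refine integral_congr_ae (.of_forall fun x => ?_)
      simp only [hD, smul_eq_mul]
      ring
    rw [e3]
    linarith
  filter_upwards [key] with x hx hxK
  have hxK' := interior_subset hxK
  have := hx hxK
  simp only [hD] at this
  rw [hu', indicator_of_mem (hKK1 x hxK'), indicator_of_mem (hKK' x hxK')] at this
  rw [sub_eq_zero.1 this]
  refine intervalIntegral.integral_congr fun t ht => ?_
  rw [uIcc_of_le zero_le_one] at ht
  simp only [hY]
  rw [indicator_of_mem (mem_sweep hxK' ht)]

/-- A Sobolev function is recovered along almost every segment by integrating its derivative. -/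
theorem IsWeakDeriv.shift {O : Set (Model m)} {u : Model m → ℝ}
    {Z : Model m → Model m →L[ℝ] ℝ} (h : IsWeakDeriv O u Z) (hO : IsOpen O) (z : Model m) :
    ∀ᵐ x ∂(volume.restrict (segDom O z)),
      u (x + z) - u x = ∫ t in (0 : ℝ)..1, Z (x + t • z) z := by
  have hS := isOpen_segDom hO z
  rw [ae_restrict_iff' hS.measurableSet]
  refine measure_null_of_locally_null _ fun x hx => ?_
  simp only [mem_compl_iff, mem_ofPred_eq, Classical.not_imp] at hx
  obtain ⟨K, hK, hxK, hKS⟩ := exists_compact_subset hS hx.1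
  refine ⟨interior K ∩ _, Filter.inter_mem
    (mem_nhdsWithin_of_mem_nhds (isOpen_interior.mem_nhds hxK)) self_mem_nhdsWithin, ?_⟩
  refine measure_mono_null ?_ (h.shift_aux hO z hK hKS)
  rintro y ⟨hyK, hy⟩ hy'
  exact hy fun _ => hy' hyK

end Shift

/-! ### Poincaré inequalities and Lipschitz representatives on balls. -/

section Poincare

variable {m : ℕ} {O : Set (Model m)} {u : Model m → ℝ} {Z : Model m → Model m →L[ℝ] ℝ}

theorem LocallyIntegrableOn.congr_ae_restrict {E F : Type*} [TopologicalSpace E]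
    [MeasurableSpace E] [NormedAddCommGroup F] {μ : Measure E} {O : Set E} {f f' : E → F}
    (h : LocallyIntegrableOn f O μ) (hff' : f =ᵐ[μ.restrict O] f') :
    LocallyIntegrableOn f' O μ := fun x hx => by
  obtain ⟨s, hs, hi⟩ := h x hx
  refine ⟨s ∩ O, Filter.inter_mem hs self_mem_nhdsWithin, ?_⟩
  exact (hi.mono_set inter_subset_left).congr
    (ae_mono (Measure.restrict_mono inter_subset_right le_rfl) hff')

theorem IsWeakDeriv.congr (h : IsWeakDeriv O u Z) {u' : Model m → ℝ}
    {Z' : Model m → Model m →L[ℝ] ℝ} (hu : u =ᵐ[volume.restrict O] u')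
    (hZ : Z =ᵐ[volume.restrict O] Z') : IsWeakDeriv O u' Z' where
  locInt := LocallyIntegrableOn.congr_ae_restrict h.locInt hu
  locInt_deriv := LocallyIntegrableOn.congr_ae_restrict h.locInt_deriv hZ
  integral_eq φ hφ hφc hφO v := by
    have e1 : ∫ y in O, u y * fderiv ℝ φ y v = ∫ y in O, u' y * fderiv ℝ φ y v :=
      integral_congr_ae (hu.mono fun y hy => by simp only [hy])
    have e2 : ∫ y in O, Z y v * φ y = ∫ y in O, Z' y v * φ y :=
      integral_congr_ae (hZ.mono fun y hy => by simp only [hy])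
    rw [← e1, ← e2, h.integral_eq φ hφ hφc hφO v]

theorem IsWeakDeriv.mono (h : IsWeakDeriv O u Z) {U : Set (Model m)} (hO : IsOpen O)
    (hUO : U ⊆ O) : IsWeakDeriv U u Z where
  locInt := h.locInt.mono_set hUO
  locInt_deriv := h.locInt_deriv.mono_set hUO
  integral_eq φ hφ hφc hφU v := by
    have hφ0 : ∀ y, y ∉ U → φ y = 0 := fun y hy =>
      image_eq_zero_of_notMem_tsupport fun h => hy (hφU h)
    have hφ1 : ∀ y, y ∉ U → fderiv ℝ φ y v = 0 := fun y hy => by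
      have : fderiv ℝ φ y = 0 := image_eq_zero_of_notMem_tsupport (f := fderiv ℝ φ)
        fun h => hy (hφU (tsupport_fderiv_subset ℝ h))
      rw [this]; rfl
    have e := h.integral_eq φ hφ hφc (hφU.trans hUO) v
    rw [setIntegral_eq_of_subset_of_forall_sdiff_eq_zero hO.measurableSet hUO
      fun y hy => by rw [hφ1 y hy.2, mul_zero],
      setIntegral_eq_of_subset_of_forall_sdiff_eq_zero hO.measurableSet hUO
      fun y hy => by rw [hφ0 y hy.2, mul_zero]] at e
    exact e

theorem IsWeakDeriv.exists_measurable (h : IsWeakDeriv O u Z) : ∃ (u' : Model m → ℝ)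
    (Z' : Model m → Model m →L[ℝ] ℝ), StronglyMeasurable u' ∧ StronglyMeasurable Z' ∧
      u =ᵐ[volume.restrict O] u' ∧ Z =ᵐ[volume.restrict O] Z' ∧ IsWeakDeriv O u' Z' :=
  have h1 := h.locInt.aestronglyMeasurable
  have h2 := h.locInt_deriv.aestronglyMeasurable
  ⟨h1.mk _, h2.mk _, h1.stronglyMeasurable_mk, h2.stronglyMeasurable_mk, h1.ae_eq_mk, h2.ae_eq_mk,
    h.congr h1.ae_eq_mk h2.ae_eq_mk⟩

/-- Jensen's inequality, read off from the monotonicity of `L^p` norms in `p` on a probability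
space. -/
theorem lintegral_rpow_le {α : Type*} [MeasurableSpace α] {μ : Measure α} [IsProbabilityMeasure μ]
    {f : α → ℝ≥0∞} (hf : AEMeasurable f μ) {p : ℝ} (hp : 1 ≤ p) :
    (∫⁻ a, f a ∂μ) ^ p ≤ ∫⁻ a, f a ^ p ∂μ := by
  have h := eLpNorm'_le_eLpNorm'_of_exponent_le one_pos hp μ hf.aestronglyMeasurable
  simp only [eLpNorm', enorm_eq_self, ENNReal.rpow_one, div_one] at h
  calc (∫⁻ a, f a ∂μ) ^ p ≤ ((∫⁻ a, f a ^ p ∂μ) ^ (1 / p)) ^ p := by gcongr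
    _ = _ := by rw [← ENNReal.rpow_mul, one_div_mul_cancel (by positivity), ENNReal.rpow_one]

/-- Jensen's inequality on each segment, followed by Fubini: for every `t` the inner integral over
`x` is a translate of the integral of `‖Z‖^p` over `O`. -/
theorem IsWeakDeriv.lintegral_shift_le (h : IsWeakDeriv O u Z) (hO : IsOpen O) (z : Model m)
    {A : Set (Model m)} (hA : A ⊆ segDom O z) {p : ℝ} (hp : 1 ≤ p) :
    ∫⁻ x in A, ‖u (x + z) - u x‖ₑ ^ p ≤ ‖z‖ₑ ^ p * ∫⁻ x in O, ‖Z x‖ₑ ^ p := by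
  -- An everywhere measurable representative makes `(x, t) ↦ Z'(x + tz)` jointly measurable.
  obtain ⟨-, Z', -, hZ'm, -, hZZ', -⟩ := h.exists_measurable
  have h' := h.congr (.refl _ _) hZZ'
  have hp0 : 0 < p := by linarith
  set ν : Measure ℝ := volume.restrict (Ioc (0 : ℝ) 1) with hν
  have hνp : IsProbabilityMeasure ν := ⟨by simp [hν]⟩
  set F : Model m → ℝ≥0∞ := O.indicator fun x => ‖Z' x‖ₑ ^ p with hF
  have hFm : Measurable F := ((hZ'm.enorm).pow_const p).indicator hO.measurableSet
  have hpt : ∀ᵐ x ∂(volume.restrict (segDom O z)),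
      ‖u (x + z) - u x‖ₑ ^ p ≤ ‖z‖ₑ ^ p * ∫⁻ t, F (x + t • z) ∂ν := by
    filter_upwards [h'.shift hO z, ae_restrict_mem (isOpen_segDom hO z).measurableSet] with x hx hxS
    rw [hx, intervalIntegral.integral_of_le zero_le_one]
    have hm : Measurable fun t : ℝ => ‖Z' (x + t • z)‖ₑ :=
      hZ'm.enorm.comp (by fun_prop : Continuous fun t : ℝ => x + t • z).measurable
    have e : ∫⁻ t, F (x + t • z) ∂ν = ∫⁻ t, ‖Z' (x + t • z)‖ₑ ^ p ∂ν := by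
      refine setLIntegral_congr_fun measurableSet_Ioc fun t ht => ?_
      exact indicator_of_mem (hxS t ⟨ht.1.le, ht.2⟩) _
    rw [e]
    calc ‖∫ t in Ioc (0 : ℝ) 1, Z' (x + t • z) z‖ₑ ^ p
        ≤ (∫⁻ t, ‖Z' (x + t • z)‖ₑ * ‖z‖ₑ ∂ν) ^ p := by
          gcongr
          refine (enorm_integral_le_lintegral_enorm _).trans (lintegral_mono fun t => ?_)
          exact ContinuousLinearMap.le_opENorm _ _
      _ = ‖z‖ₑ ^ p * (∫⁻ t, ‖Z' (x + t • z)‖ₑ ∂ν) ^ p := by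
          rw [lintegral_mul_const _ hm, ENNReal.mul_rpow_of_nonneg _ _ hp0.le, mul_comm]
      _ ≤ _ := by gcongr; exact lintegral_rpow_le hm.aemeasurable hp
  have hFt : Measurable (Function.uncurry fun (x : Model m) (t : ℝ) => F (x + t • z)) :=
    hFm.comp (by fun_prop : Continuous fun q : Model m × ℝ => q.1 + q.2 • z).measurable
  calc ∫⁻ x in A, ‖u (x + z) - u x‖ₑ ^ p
      ≤ ∫⁻ x in segDom O z, ‖u (x + z) - u x‖ₑ ^ p := lintegral_mono_set hA
    _ ≤ ∫⁻ x in segDom O z, ‖z‖ₑ ^ p * ∫⁻ t, F (x + t • z) ∂ν := lintegral_mono_ae hpt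
    _ ≤ ∫⁻ x : Model m, (‖z‖ₑ ^ p * ∫⁻ t, F (x + t • z) ∂ν) ∂volume :=
        setLIntegral_le_lintegral _ _
    _ = ‖z‖ₑ ^ p * ∫⁻ x : Model m, (∫⁻ t, F (x + t • z) ∂ν) ∂volume :=
        lintegral_const_mul' _ _ (by simp [ENNReal.rpow_eq_top_iff, hp0.not_gt])
    _ = ‖z‖ₑ ^ p * ∫⁻ t, (∫⁻ x : Model m, F (x + t • z) ∂volume) ∂ν := by
        rw [lintegral_lintegral_swap hFt.aemeasurable]
    _ = ‖z‖ₑ ^ p * ∫⁻ x in O, ‖Z x‖ₑ ^ p := by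
        simp only [lintegral_add_right_eq_self, lintegral_const, measure_univ, mul_one]
        rw [hF, lintegral_indicator hO.measurableSet]
        have e : ∫⁻ x in O, ‖Z x‖ₑ ^ p = ∫⁻ x in O, ‖Z' x‖ₑ ^ p :=
          lintegral_congr_ae (hZZ'.mono fun x hx => by simp only [hx])
        rw [e]

/-- Substitute `y = x + z` and integrate over `x` first. If `x` and `x + z` lie in the ball, so does
the segment between them, by convexity, and `lintegral_shift_le` applies; only `z` with `‖z‖ < 2r`
contribute, which gives the constant. -/
theorem IsWeakDeriv.poincare_ball (h : IsWeakDeriv O u Z) (hO : IsOpen O) {y₀ : Model m} {r : ℝ}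
    (hB : Metric.ball y₀ r ⊆ O) {p : ℝ} (hp : 1 ≤ p) :
    ∫⁻ x in Metric.ball y₀ r, ∫⁻ y in Metric.ball y₀ r, ‖u y - u x‖ₑ ^ p ≤
      ENNReal.ofReal (2 * r) ^ p * volume (Metric.ball (0 : Model m) (2 * r)) *
        ∫⁻ x in Metric.ball y₀ r, ‖Z x‖ₑ ^ p := by
  set B := Metric.ball y₀ r with hBdef
  have hBo : IsOpen B := Metric.isOpen_ball
  have hp0 : 0 < p := by linarith
  obtain ⟨u', Z', hu'm, -, huu', hZZ', hw⟩ := (h.mono hO hB).exists_measurable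
  have e1 : ∫⁻ x in B, ∫⁻ y in B, ‖u y - u x‖ₑ ^ p = ∫⁻ x in B, ∫⁻ y in B, ‖u' y - u' x‖ₑ ^ p := by
    refine lintegral_congr_ae (huu'.mono fun x hx => ?_)
    exact lintegral_congr_ae (huu'.mono fun y hy => by simp only [hx, hy])
  have e2 : ∫⁻ x in B, ‖Z x‖ₑ ^ p = ∫⁻ x in B, ‖Z' x‖ₑ ^ p :=
    lintegral_congr_ae (hZZ'.mono fun x hx => by simp only [hx])
  rw [e1, e2]
  set F : Model m → Model m → ℝ≥0∞ := fun x z =>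
    B.indicator 1 x * (B.indicator 1 (x + z) * ‖u' (x + z) - u' x‖ₑ ^ p) with hF
  have hind : Measurable (B.indicator (1 : Model m → ℝ≥0∞)) :=
    measurable_one.indicator hBo.measurableSet
  have hadd : Measurable fun q : Model m × Model m => q.1 + q.2 := measurable_add
  have hFm : Measurable (Function.uncurry F) := by
    refine (hind.comp measurable_fst).mul ((hind.comp hadd).mul ?_)
    exact (((hu'm.measurable.comp hadd).sub (hu'm.measurable.comp measurable_fst)).enorm).pow_const p
  have e3 : ∫⁻ x in B, ∫⁻ y in B, ‖u' y - u' x‖ₑ ^ p = ∫⁻ x, ∫⁻ z, F x z := by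
    rw [← lintegral_indicator hBo.measurableSet]
    refine lintegral_congr fun x => ?_
    by_cases hx : x ∈ B
    · rw [indicator_of_mem hx, ← lintegral_indicator hBo.measurableSet,
        ← lintegral_add_left_eq_self _ x]
      refine lintegral_congr fun z => ?_
      simp only [hF, indicator_of_mem hx, Pi.one_apply, one_mul]
      by_cases hxz : x + z ∈ B
      · rw [indicator_of_mem hxz, indicator_of_mem hxz]; simp
      · rw [indicator_of_notMem hxz, indicator_of_notMem hxz, zero_mul]
    · rw [indicator_of_notMem hx]
      simp [hF, indicator_of_notMem hx]
  rw [e3, lintegral_lintegral_swap hFm.aemeasurable]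
  set S := ∫⁻ x in B, ‖Z' x‖ₑ ^ p with hS
  have key : ∀ z, ∫⁻ x, F x z ≤
      (Metric.ball (0 : Model m) (2 * r)).indicator (fun _ => ENNReal.ofReal (2 * r) ^ p * S) z := by
    intro z
    by_cases hz : z ∈ Metric.ball (0 : Model m) (2 * r)
    · rw [indicator_of_mem hz]
      have hAm : MeasurableSet (B ∩ (fun x => x + z) ⁻¹' B) :=
        hBo.measurableSet.inter ((hBo.preimage (by fun_prop)).measurableSet)
      have hA : B ∩ (fun x => x + z) ⁻¹' B ⊆ segDom B z := by
        rintro x ⟨hx, hxz⟩ t ht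
        have := (convex_ball y₀ r) hx hxz (sub_nonneg.2 ht.2) ht.1 (by ring)
        convert this using 1
        simp only [smul_add, ← add_assoc, ← add_smul]
        simp
      calc ∫⁻ x, F x z = ∫⁻ x in B ∩ (fun x => x + z) ⁻¹' B, ‖u' (x + z) - u' x‖ₑ ^ p := by
            rw [← lintegral_indicator hAm]
            refine lintegral_congr fun x => ?_
            by_cases hx : x ∈ B <;> by_cases hxz : x + z ∈ B <;>
              simp [hF, hx, hxz, indicator]
        _ ≤ ‖z‖ₑ ^ p * S := hw.lintegral_shift_le hBo z hA hp
        _ ≤ _ := by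
            gcongr
            rw [← ofReal_norm]
            exact ENNReal.ofReal_le_ofReal (mem_ball_zero_iff.1 hz).le
    · rw [indicator_of_notMem hz, nonpos_iff_eq_zero]
      refine lintegral_eq_zero_of_ae_eq_zero (.of_forall fun x => ?_)
      by_cases hx : x ∈ B
      · by_cases hxz : x + z ∈ B
        · refine absurd ?_ hz
          rw [mem_ball_zero_iff]
          rw [hBdef, Metric.mem_ball, dist_eq_norm] at hx hxz
          calc ‖z‖ = ‖(x + z - y₀) - (x - y₀)‖ := by congr 1; abel
            _ ≤ ‖x + z - y₀‖ + ‖x - y₀‖ := norm_sub_le _ _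
            _ < 2 * r := by linarith
        · simp [hF, indicator_of_notMem hxz]
      · simp [hF, indicator_of_notMem hx]
  refine (lintegral_mono key).trans ?_
  rw [lintegral_indicator measurableSet_ball, setLIntegral_const]
  exact le_of_eq (by ring)

/-- The double integral is finite, so its inner integral is finite for almost every `x`. For one
such `x`, `u` differs from the constant `u x` by a `p`-integrable function. -/
theorem IsWeakDeriv.lintegral_ball_lt_top (h : IsWeakDeriv O u Z) (hO : IsOpen O) {y₀ : Model m}
    {r : ℝ} (hr : 0 < r) (hB : Metric.ball y₀ r ⊆ O) {p : ℝ} (hp : 1 ≤ p)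
    (hZ : ∫⁻ x in Metric.ball y₀ r, ‖Z x‖ₑ ^ p < ⊤) :
    ∫⁻ x in Metric.ball y₀ r, ‖u x‖ₑ ^ p < ⊤ := by
  set B := Metric.ball y₀ r with hBdef
  have hp0 : 0 < p := by linarith
  obtain ⟨u', Z', hu'm, -, huu', hZZ', hw⟩ := (h.mono hO hB).exists_measurable
  have hP := hw.poincare_ball Metric.isOpen_ball le_rfl hp
  have hfin : ∫⁻ x in B, ∫⁻ y in B, ‖u' y - u' x‖ₑ ^ p < ⊤ := by
    refine hP.trans_lt (ENNReal.mul_lt_top (ENNReal.mul_lt_top ?_ measure_ball_lt_top) ?_)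
    · exact ENNReal.rpow_lt_top_of_nonneg hp0.le ENNReal.ofReal_ne_top
    · have e : ∫⁻ x in B, ‖Z x‖ₑ ^ p = ∫⁻ x in B, ‖Z' x‖ₑ ^ p :=
        lintegral_congr_ae (hZZ'.mono fun x hx => by simp only [hx])
      rw [← e]
      exact hZ
  have hm : Measurable fun x => ∫⁻ y in B, ‖u' y - u' x‖ₑ ^ p := by
    refine Measurable.lintegral_prod_right' (ν := volume.restrict B)
      (f := fun q : Model m × Model m => ‖u' q.2 - u' q.1‖ₑ ^ p) ?_
    exact (((hu'm.measurable.comp measurable_snd).sub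
      (hu'm.measurable.comp measurable_fst)).enorm).pow_const p
  have hae := ae_lt_top hm hfin.ne
  have : (volume.restrict B) ≠ 0 := by
    rw [Ne, Measure.restrict_eq_zero]
    exact (Metric.measure_ball_pos volume y₀ hr).ne'
  have hne : (ae (volume.restrict B)).NeBot := ae_neBot.2 this
  obtain ⟨x, hx⟩ := hae.exists
  have e : ∫⁻ y in B, ‖u y‖ₑ ^ p = ∫⁻ y in B, ‖u' y‖ₑ ^ p :=
    lintegral_congr_ae (huu'.mono fun y hy => by simp only [hy])
  rw [e]
  calc ∫⁻ y in B, ‖u' y‖ₑ ^ p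
      ≤ ∫⁻ y in B, 2 ^ (p - 1) * (‖u' y - u' x‖ₑ ^ p + ‖u' x‖ₑ ^ p) := by
        refine lintegral_mono fun y => ?_
        refine le_trans ?_ (ENNReal.rpow_add_le_mul_rpow_add_rpow _ _ hp)
        gcongr
        simpa using enorm_add_le (u' y - u' x) (u' x)
    _ = 2 ^ (p - 1) * ((∫⁻ y in B, ‖u' y - u' x‖ₑ ^ p) + ‖u' x‖ₑ ^ p * volume B) := by
        rw [lintegral_const_mul' _ _ (by simp [ENNReal.rpow_eq_top_iff]),
          lintegral_add_right _ measurable_const]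
        simp
    _ < ⊤ := by
        refine ENNReal.mul_lt_top (lt_top_iff_ne_top.2 (by simp [ENNReal.rpow_eq_top_iff]))
          (ENNReal.add_lt_top.2 ⟨hx, ?_⟩)
        refine ENNReal.mul_lt_top ?_ measure_ball_lt_top
        exact ENNReal.rpow_lt_top_of_nonneg hp0.le (by simp)

/-- Integrate `‖u y‖ ≤ ‖u x‖ + ‖u y - u x‖` over `x ∈ N` and `y` in the ball. With `N` of positive
measure, control of `u` on `N` spreads to the whole ball; this is how it travels along chains of
balls. -/
theorem IsWeakDeriv.poincare_subset (h : IsWeakDeriv O u Z) (hO : IsOpen O) {y₀ : Model m} {r : ℝ}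
    (hB : Metric.ball y₀ r ⊆ O) {N : Set (Model m)}
    (hNB : N ⊆ Metric.ball y₀ r) :
    volume N * ∫⁻ x in Metric.ball y₀ r, ‖u x‖ₑ ≤
      volume (Metric.ball y₀ r) * (∫⁻ x in N, ‖u x‖ₑ) +
      ENNReal.ofReal (2 * r) * volume (Metric.ball (0 : Model m) (2 * r)) *
        ∫⁻ x in Metric.ball y₀ r, ‖Z x‖ₑ := by
  set B := Metric.ball y₀ r with hBdef
  have hP := h.poincare_ball hO hB le_rfl
  simp only [ENNReal.rpow_one] at hP
  have hum : AEMeasurable (fun x => ‖u x‖ₑ) (volume.restrict N) :=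
    (h.locInt.aestronglyMeasurable.enorm).mono_measure
      (Measure.restrict_mono (hNB.trans hB) le_rfl)
  calc volume N * ∫⁻ x in B, ‖u x‖ₑ = ∫⁻ x in N, ∫⁻ y in B, ‖u y‖ₑ := by
        rw [setLIntegral_const, mul_comm]
    _ ≤ ∫⁻ x in N, ((∫⁻ y in B, ‖u x‖ₑ) + ∫⁻ y in B, ‖u y - u x‖ₑ) := by
        refine lintegral_mono fun x => ?_
        rw [← lintegral_add_left measurable_const]
        refine lintegral_mono fun y => ?_
        simpa using enorm_add_le (u x) (u y - u x)
    _ = ∫⁻ x in N, (‖u x‖ₑ * volume B + ∫⁻ y in B, ‖u y - u x‖ₑ) := by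
        simp only [setLIntegral_const]
    _ = volume B * (∫⁻ x in N, ‖u x‖ₑ) + ∫⁻ x in N, ∫⁻ y in B, ‖u y - u x‖ₑ := by
        rw [lintegral_add_left' (hum.mul_const _), lintegral_mul_const'' _ hum, mul_comm]
    _ ≤ _ := by
        exact add_le_add_right ((lintegral_mono_set hNB).trans hP) _

/-- A Sobolev function whose derivative is bounded by `C` on a ball is `C`-Lipschitz there, up to
modification on a null set. -/
theorem IsWeakDeriv.exists_lipschitz (h : IsWeakDeriv O u Z) (hO : IsOpen O) {y₀ : Model m}
    {r : ℝ} (hB : Metric.closedBall y₀ r ⊆ O) {C : NNReal}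
    (hZ : ∀ᵐ x ∂(volume.restrict (Metric.ball y₀ r)), ‖Z x‖ ≤ C) :
    ∃ v : Model m → ℝ, LipschitzWith C v ∧ ∀ᵐ x ∂(volume.restrict (Metric.ball y₀ r)), u x = v x := by
  set B := Metric.ball y₀ r with hBdef
  have hBo : IsOpen B := Metric.isOpen_ball
  classical
  -- After truncation the bound holds at every point, hence along every segment.
  set Z' : Model m → Model m →L[ℝ] ℝ := fun x => if ‖Z x‖ ≤ C then Z x else 0 with hZ'
  have hZ'C : ∀ x, ‖Z' x‖ ≤ C := fun x => by
    by_cases hx : ‖Z x‖ ≤ C <;> simp [hZ', hx]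
  have hw : IsWeakDeriv B u Z' := (h.mono hO (Metric.ball_subset_closedBall.trans hB)).congr
    (.refl _ _) (hZ.mono fun x hx => by simp [hZ', hx])
  have hshift : ∀ z, ∀ᵐ x, x ∈ B → x + z ∈ B → ‖u (x + z) - u x‖ ≤ C * ‖z‖ := fun z => by
    have := hw.shift hBo z
    rw [ae_restrict_iff' (isOpen_segDom hBo z).measurableSet] at this
    filter_upwards [this] with x hx hxB hxzB
    rw [hx ?_]
    · have := intervalIntegral.norm_integral_le_of_norm_le_const (a := (0 : ℝ)) (b := 1)
        (f := fun t => Z' (x + t • z) z) (C := C * ‖z‖) fun t _ =>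
          ((Z' (x + t • z)).le_opNorm z).trans (by gcongr; exact hZ'C _)
      simpa using this
    · intro t ht
      have := (convex_ball y₀ r) hxB hxzB (sub_nonneg.2 ht.2) ht.1 (by ring)
      convert this using 1
      simp only [smul_add, ← add_assoc, ← add_smul]
      simp
  set ũ : Model m → ℝ := (Metric.closedBall y₀ r).indicator u with hũ
  have hũi : Integrable ũ := (integrable_indicator_iff measurableSet_closedBall).2
    (h.locInt.integrableOn_compact_subset hB (isCompact_closedBall _ _))
  have hleb : ∀ᵐ x, Filter.Tendsto (fun ε : ℝ => ⨍ y in Metric.closedBall x ε, ũ y) (𝓝[>] 0)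
      (𝓝 (ũ x)) := by
    filter_upwards [IsUnifLocDoublingMeasure.ae_tendsto_average volume hũi.locallyIntegrable 1]
      with x hx
    refine hx (fun _ => x) (fun ε => ε) Filter.tendsto_id ?_
    filter_upwards [self_mem_nhdsWithin] with ε hε
    exact Metric.mem_closedBall_self (by simpa using (mem_Ioi.1 hε).le)
  -- At points of `L` the value of `u` is the limit of its averages over balls. For two such points
  -- these averages are compared by translating one ball onto the other, where the difference of
  -- values is bounded almost everywhere by `hshift`.
  set L : Set (Model m) := {x | x ∈ B ∧ Filter.Tendsto (fun ε : ℝ =>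
    ⨍ y in Metric.closedBall x ε, ũ y) (𝓝[>] 0) (𝓝 (ũ x))} with hL
  have hLip : LipschitzOnWith C u L := by
    refine LipschitzOnWith.of_dist_le_mul fun x hx x' hx' => ?_
    have hlim := (hx.2.sub hx'.2).norm
    have hBu : ∀ x ∈ B, ũ x = u x := fun x hx =>
      indicator_of_mem (Metric.ball_subset_closedBall hx) _
    rw [hBu x hx.1, hBu x' hx'.1] at hlim
    rw [dist_eq_norm, dist_eq_norm]
    refine le_of_tendsto hlim ?_
    obtain ⟨δ, hδ, hδB⟩ := Metric.nhds_basis_closedBall.mem_iff.1 (hBo.mem_nhds hx.1)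
    obtain ⟨δ', hδ', hδB'⟩ := Metric.nhds_basis_closedBall.mem_iff.1 (hBo.mem_nhds hx'.1)
    filter_upwards [Ioo_mem_nhdsGT (lt_min hδ hδ')] with ε hε
    have hε1 : ∀ w ∈ Metric.closedBall x' ε, w ∈ B := fun w hw =>
      hδB' (Metric.closedBall_subset_closedBall (hε.2.le.trans (min_le_right _ _)) hw)
    have hε2 : ∀ w ∈ Metric.closedBall x' ε, w + (x - x') ∈ B := fun w hw => by
      refine hδB (Metric.closedBall_subset_closedBall (hε.2.le.trans (min_le_left _ _)) ?_)
      rw [Metric.mem_closedBall, dist_eq_norm] at hw ⊢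
      convert hw using 2
      abel
    have hmap : ⨍ y in Metric.closedBall x ε, ũ y =
        ⨍ y in Metric.closedBall x' ε, ũ (y + (x - x')) := by
      rw [setAverage_eq, setAverage_eq, ← integral_indicator measurableSet_closedBall,
        ← integral_indicator measurableSet_closedBall]
      congr 1
      · congr 1
        simp only [measureReal_def]
        rw [Measure.addHaar_closedBall_center, Measure.addHaar_closedBall_center volume x']
      · rw [← integral_add_right_eq_self _ (x - x')]
        refine integral_congr_ae (.of_forall fun y => ?_)
        have : y + (x - x') ∈ Metric.closedBall x ε ↔ y ∈ Metric.closedBall x' ε := by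
          rw [Metric.mem_closedBall, Metric.mem_closedBall, dist_eq_norm, dist_eq_norm]
          have : y + (x - x') - x = y - x' := by abel
          rw [this]
        by_cases hy : y ∈ Metric.closedBall x' ε
        · simp only [indicator_of_mem hy, indicator_of_mem (this.2 hy)]
        · simp only [indicator_of_notMem hy, indicator_of_notMem (fun h => hy (this.1 h))]
    have hvol : volume (Metric.closedBall x' ε) ≠ 0 :=
      (Metric.measure_closedBall_pos volume x' hε.1).ne'
    have hvol' : volume (Metric.closedBall x' ε) ≠ ⊤ := measure_closedBall_lt_top.ne
    rw [hmap, setAverage_eq, setAverage_eq, ← smul_sub, ← integral_sub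
      (hũi.comp_add_right (x - x')).integrableOn hũi.integrableOn, norm_smul]
    have hn := norm_setIntegral_le_of_norm_le_const_ae' (μ := volume)
      (f := fun y => ũ (y + (x - x')) - ũ y) (s := Metric.closedBall x' ε)
      (C := C * ‖x - x'‖) measure_closedBall_lt_top (by
        filter_upwards [hshift (x - x')] with y hy hyb
        rw [hBu _ (hε1 y hyb), hBu _ (hε2 y hyb)]
        exact hy (hε1 y hyb) (hε2 y hyb))
    have hpos : 0 < volume.real (Metric.closedBall x' ε) := ENNReal.toReal_pos hvol hvol'
    rw [norm_inv, Real.norm_of_nonneg hpos.le, inv_mul_le_iff₀ hpos]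
    linarith
  obtain ⟨v, hv, hvu⟩ := hLip.extend_real
  refine ⟨v, hv, ?_⟩
  rw [ae_restrict_iff' hBo.measurableSet]
  filter_upwards [hleb] with x hx hxB using hvu ⟨hxB, hx⟩

end Poincare

/-! ### Translating and mollifying: approximation up to the boundary. -/

section Mollification

variable {m : ℕ} {O : Set (Model m)} {u : Model m → ℝ} {Z : Model m → Model m →L[ℝ] ℝ}

theorem integrableOn_of_eq_zero_off {E : Type*} [NormedAddCommGroup E] {f : Model m → E}
    {K : Set (Model m)} (hO : MeasurableSet O) (hK : IsCompact K) (hKO : K ⊆ O)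
    (hf : LocallyIntegrableOn f O) (h0 : ∀ y, y ∉ K → f y = 0) : IntegrableOn f O :=
  ((hf.integrableOn_compact_subset hKO hK).of_forall_sdiff_eq_zero hO fun y hy => h0 y hy.2)

theorem integrable_indicator_of_integrableOn {E : Type*} [NormedAddCommGroup E] {f : Model m → E}
    (hO : MeasurableSet O) (hf : IntegrableOn f O) : Integrable (O.indicator f) :=
  (integrable_indicator_iff hO).2 hf

theorem enorm_smul_sub_smul {E : Type*} [NormedAddCommGroup E] [NormedSpace ℝ E] (r : ℝ) (a b : E) :
    ‖r • a - r • b‖ₑ = ‖r‖ₑ * ‖a - b‖ₑ := by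
  rw [← smul_sub, enorm_smul]

theorem enorm_eq_zero_of_eq_zero {E : Type*} [NormedAddCommGroup E] {a : E} (h : a = 0) :
    ‖a‖ₑ = 0 := by
  rw [h, enorm_zero]

theorem IsWeakDeriv.contDiff_smul (h : IsWeakDeriv O u Z) (hO : IsOpen O) {χ : Model m → ℝ}
    (hχ : ContDiff ℝ 1 χ) :
    IsWeakDeriv O (fun y => χ y * u y) (fun y => χ y • Z y + u y • fderiv ℝ χ y) where
  locInt := h.locInt.continuousOn_mul hχ.continuous.continuousOn hO.isLocallyClosed
  locInt_deriv := (h.locInt_deriv.continuousOn_smul hO.isLocallyClosed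
    hχ.continuous.continuousOn).add
    (h.locInt.smul_continuousOn hO.isLocallyClosed (hχ.continuous_fderiv one_ne_zero).continuousOn)
  integral_eq φ hφ hφc hφO v := by
    have hχφ : ContDiff ℝ 1 (fun y => χ y * φ y) := hχ.mul hφ
    have hsub : tsupport (fun y => χ y * φ y) ⊆ tsupport φ := tsupport_mul_subset_right
    have e := h.integral_eq _ hχφ (hφc.mono' ((subset_tsupport _).trans hsub)) (hsub.trans hφO) v
    have hd : ∀ y, fderiv ℝ (fun y => χ y * φ y) y v = χ y * fderiv ℝ φ y v + φ y * fderiv ℝ χ y v :=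
      fun y => by
        rw [fderiv_fun_mul (hχ.differentiable one_ne_zero y) (hφ.differentiable one_ne_zero y)]
        rfl
    have hφ0 : ∀ y, y ∉ tsupport φ → φ y = 0 := fun y hy => image_eq_zero_of_notMem_tsupport hy
    have hdφ0 : ∀ y, y ∉ tsupport φ → fderiv ℝ φ y v = 0 := fun y hy => by
      have : fderiv ℝ φ y = 0 := image_eq_zero_of_notMem_tsupport (f := fderiv ℝ φ)
        fun h => hy (tsupport_fderiv_subset ℝ h)
      rw [this]; rfl
    have key : ∀ {f : Model m → ℝ} {G : Model m → ℝ}, LocallyIntegrableOn f O → Continuous G →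
        (∀ y, y ∉ tsupport φ → G y = 0) → IntegrableOn (fun y => f y * G y) O := by
      intro f G hf hG hG0
      exact integrableOn_of_eq_zero_off hO.measurableSet hφc hφO
        (hf.mul_continuousOn hG.continuousOn hO.isLocallyClosed) fun y hy => by
          rw [hG0 y hy, mul_zero]
    have hφ'c : Continuous fun y => fderiv ℝ φ y v :=
      (hφ.continuous_fderiv one_ne_zero).clm_apply continuous_const
    have hχ'c : Continuous fun y => fderiv ℝ χ y v :=
      (hχ.continuous_fderiv one_ne_zero).clm_apply continuous_const
    have hZv : LocallyIntegrableOn (fun y => Z y v) O := fun y hy => by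
      obtain ⟨s, hs, hi⟩ := h.locInt_deriv y hy
      exact ⟨s, hs, hi.apply_continuousLinearMap v⟩
    have i1 : IntegrableOn (fun y => u y * (χ y * fderiv ℝ φ y v)) O :=
      key h.locInt (hχ.continuous.mul hφ'c) fun y hy => by rw [hdφ0 y hy, mul_zero]
    have i2 : IntegrableOn (fun y => u y * (φ y * fderiv ℝ χ y v)) O :=
      key h.locInt (hφ.continuous.mul hχ'c) fun y hy => by rw [hφ0 y hy, zero_mul]
    have i3 : IntegrableOn (fun y => Z y v * (χ y * φ y)) O :=
      key hZv (hχ.continuous.mul hφ.continuous) fun y hy => by rw [hφ0 y hy, mul_zero]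
    have e1 : ∫ y in O, u y * fderiv ℝ (fun y => χ y * φ y) y v =
        (∫ y in O, u y * (χ y * fderiv ℝ φ y v)) + ∫ y in O, u y * (φ y * fderiv ℝ χ y v) := by
      rw [← integral_add i1 i2]
      exact integral_congr_ae (.of_forall fun y => by simp only [hd]; ring)
    have e2 : ∫ y in O, (χ y • Z y + u y • fderiv ℝ χ y) v * φ y =
        (∫ y in O, Z y v * (χ y * φ y)) + ∫ y in O, u y * (φ y * fderiv ℝ χ y v) := by
      rw [← integral_add i3 i2]
      refine integral_congr_ae (.of_forall fun y => ?_)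
      change (χ y * Z y v + u y * fderiv ℝ χ y v) * φ y = _
      ring
    have e3 : ∫ y in O, χ y * u y * fderiv ℝ φ y v = ∫ y in O, u y * (χ y * fderiv ℝ φ y v) :=
      integral_congr_ae (.of_forall fun y => by simp only; ring)
    rw [e2, e3]
    linarith

/-- Continuity of translations in `L¹`: it follows from uniform continuity for continuous functions
of compact support, and these are dense. -/
theorem exists_lintegral_translate_sub_le {E : Type*} [NormedAddCommGroup E] [NormedSpace ℝ E]
    {f : Model m → E} (hf : Integrable f) {η : ℝ≥0∞} (hη : η ≠ 0) :
    ∃ δ > 0, ∀ z : Model m, ‖z‖ ≤ δ → ∫⁻ y, ‖f (y - z) - f y‖ₑ ≤ η := by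
  have hη3 : η / 3 ≠ 0 := (ENNReal.div_pos hη (by norm_num)).ne'
  obtain ⟨φ, hφc, hφ, hφcont, -⟩ := hf.exists_hasCompactSupport_lintegral_sub_le hη3
  obtain ⟨R, hR⟩ := hφc.isCompact.isBounded.subset_closedBall (0 : Model m)
  -- The margin `1` keeps the translates of `φ` by `‖z‖ ≤ 1` supported in `B`.
  set B := Metric.closedBall (0 : Model m) (R + 1) with hB
  have hBt : volume B ≠ ⊤ := measure_closedBall_lt_top.ne
  obtain ⟨τ, hτ, hτB⟩ : ∃ τ : NNReal, 0 < τ ∧ (τ : ℝ≥0∞) * volume B ≤ η / 3 := by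
    obtain ⟨τ, hτ, hτ'⟩ := ENNReal.exists_nnreal_pos_mul_lt hBt hη3
    exact ⟨τ, hτ, hτ'.le⟩
  have hu := hφc.uniformContinuous_of_continuous hφcont
  obtain ⟨δ, hδ, hδ'⟩ := Metric.uniformContinuous_iff.1 hu τ hτ
  refine ⟨min (δ / 2) 1, by positivity, fun z hz => ?_⟩
  have h1 : ∀ y, ‖φ (y - z) - φ y‖ₑ ≤ B.indicator (fun _ => (τ : ℝ≥0∞)) y := fun y => by
    by_cases hy : y ∈ B
    · rw [indicator_of_mem hy]
      have := hδ' (a := y - z) (b := y) (by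
        rw [dist_eq_norm, sub_sub_cancel_left, norm_neg]
        exact (hz.trans (min_le_left _ _)).trans_lt (half_lt_self hδ))
      rw [dist_eq_norm] at this
      rw [← ofReal_norm, ← ENNReal.ofReal_coe_nnreal]
      exact ENNReal.ofReal_le_ofReal this.le
    · have hy' : R + 1 < ‖y‖ := by simpa [hB] using hy
      have hz1 : ‖z‖ ≤ 1 := hz.trans (min_le_right _ _)
      have h0 : ∀ x : Model m, R < ‖x‖ → φ x = 0 := fun x hx =>
        image_eq_zero_of_notMem_tsupport fun h => absurd (hR h) (by simpa using hx)
      rw [h0 y (by linarith), h0 (y - z) (by linarith [norm_sub_norm_le y z])]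
      simp
  have h2 : ∫⁻ y, ‖φ (y - z) - φ y‖ₑ ≤ η / 3 := by
    refine (lintegral_mono h1).trans ?_
    rw [lintegral_indicator measurableSet_closedBall, setLIntegral_const]
    exact hτB
  have h3 : ∫⁻ y, ‖f (y - z) - φ (y - z)‖ₑ ≤ η / 3 := by
    rw [lintegral_sub_right_eq_self (fun y => ‖f y - φ y‖ₑ) z]
    exact hφ
  have m1 : AEMeasurable fun y => ‖f (y - z) - φ (y - z)‖ₑ :=
    (((hf.comp_sub_right z).aestronglyMeasurable).sub
      (hφcont.comp (continuous_sub_right z)).aestronglyMeasurable).enorm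
  have m2 : AEMeasurable fun y => ‖φ (y - z) - φ y‖ₑ :=
    ((hφcont.comp (continuous_sub_right z)).sub hφcont).aestronglyMeasurable.enorm
  calc ∫⁻ y, ‖f (y - z) - f y‖ₑ
      ≤ ∫⁻ y, (‖f (y - z) - φ (y - z)‖ₑ + ‖φ (y - z) - φ y‖ₑ + ‖f y - φ y‖ₑ) := by
        refine lintegral_mono fun y => ?_
        have : f (y - z) - f y = (f (y - z) - φ (y - z)) + (φ (y - z) - φ y) + -(f y - φ y) := by
          abel
        calc ‖f (y - z) - f y‖ₑ = ‖(f (y - z) - φ (y - z)) + (φ (y - z) - φ y) + -(f y - φ y)‖ₑ := by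
              rw [← this]
          _ ≤ _ := (enorm_add_le _ _).trans (by rw [enorm_neg]; gcongr; exact enorm_add_le _ _)
    _ = (∫⁻ y, ‖f (y - z) - φ (y - z)‖ₑ) + (∫⁻ y, ‖φ (y - z) - φ y‖ₑ) + ∫⁻ y, ‖f y - φ y‖ₑ := by
        rw [lintegral_add_left' (f := fun y => ‖f (y - z) - φ (y - z)‖ₑ + ‖φ (y - z) - φ y‖ₑ)
          (m1.add m2), lintegral_add_left' m1]
    _ ≤ η / 3 + η / 3 + η / 3 := by gcongr
    _ = η := ENNReal.add_thirds η

/-- The derivative falls on the kernel, and `t ↦ ψ(x - t)` is an admissible test function because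
its support lies in the closed ball of radius `ρ.rOut` around `x`, inside `O`. -/
theorem IsWeakDeriv.fderiv_mollify (h : IsWeakDeriv O u Z) (hO : IsOpen O)
    (hu : IntegrableOn u O) (hZ : IntegrableOn Z O) (ρ : ContDiffBump (0 : Model m)) {x : Model m}
    (hx : Metric.closedBall x ρ.rOut ⊆ O) :
    HasFDerivAt (fun y => ∫ t, ρ.normed volume (y - t) * O.indicator u t)
      (∫ t, ρ.normed volume t • O.indicator Z (x - t)) x := by
  set ψ := ρ.normed (volume : Measure (Model m)) with hψ
  have hψs : ContDiff ℝ 1 ψ := ρ.contDiff_normed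
  have hψc : HasCompactSupport ψ := ρ.hasCompactSupport_normed
  have hU : Integrable (O.indicator u) := (integrable_indicator_iff hO.measurableSet).2 hu
  have hZi : Integrable (O.indicator Z) := integrable_indicator_of_integrableOn hO.measurableSet hZ
  have hd := hψc.hasFDerivAt_convolution_left (ContinuousLinearMap.lsmul ℝ ℝ) hψs
    hU.locallyIntegrable x
  have hfun : (fun y => ∫ t, ψ (y - t) * O.indicator u t) =
      convolution ψ (O.indicator u) (ContinuousLinearMap.lsmul ℝ ℝ) volume := by
    funext y
    rw [convolution_eq_swap]
    rfl
  rw [hfun]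
  refine hd.congr_fderiv (ContinuousLinearMap.ext fun v => Eq.symm ?_)
  have hψi : Integrable fun t => ψ t • O.indicator Z (x - t) :=
    (hψc.convolutionExists_left (ContinuousLinearMap.lsmul ℝ ℝ) hψs.continuous
      hZi.locallyIntegrable x).integrable
  have hfi : Integrable fun t => ((ContinuousLinearMap.lsmul ℝ ℝ).precompL (Model m))
      (fderiv ℝ ψ t) (O.indicator u (x - t)) :=
    ((hψc.fderiv ℝ).convolutionExists_left _ (hψs.continuous_fderiv one_ne_zero)
      hU.locallyIntegrable x).integrable
  rw [ContinuousLinearMap.integral_apply hψi, convolution_def,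
    ContinuousLinearMap.integral_apply hfi]
  have hφs : ContDiff ℝ 1 fun t => ψ (x - t) := hψs.comp (contDiff_const.sub contDiff_id)
  have hts : tsupport (fun t => ψ (x - t)) ⊆ Metric.closedBall x ρ.rOut := by
    refine closure_minimal (fun t ht => ?_) Metric.isClosed_closedBall
    have : x - t ∈ tsupport ψ := subset_tsupport _ ht
    rw [hψ, ρ.tsupport_normed_eq] at this
    rw [Metric.mem_closedBall, dist_comm, dist_eq_norm]
    simpa using this
  have hφc : HasCompactSupport fun t => ψ (x - t) :=
    HasCompactSupport.of_support_subset_isCompact (isCompact_closedBall x ρ.rOut)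
      ((subset_tsupport _).trans hts)
  have e := h.integral_eq _ hφs hφc (hts.trans hx) v
  have hder : ∀ t, fderiv ℝ (fun t => ψ (x - t)) t v = - fderiv ℝ ψ (x - t) v := fun t => by
    have h1 : HasFDerivAt (fun t : Model m => x - t) (-ContinuousLinearMap.id ℝ (Model m)) t :=
      (hasFDerivAt_id t).const_sub x
    have h2 := ((hψs.differentiable one_ne_zero (x - t)).hasFDerivAt).comp t h1
    rw [HasFDerivAt.fderiv (f := fun t => ψ (x - t)) h2]
    simp
  rw [← integral_indicator hO.measurableSet, ← integral_indicator hO.measurableSet] at e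
  calc ∫ t, (ψ t • O.indicator Z (x - t)) v
      = ∫ t, (ψ (x - t) • O.indicator Z (x - (x - t))) v :=
        (integral_sub_left_eq_self (fun t => (ψ t • O.indicator Z (x - t)) v) volume x).symm
    _ = ∫ t, O.indicator (fun y => Z y v * ψ (x - y)) t := by
        refine integral_congr_ae (.of_forall fun t => ?_)
        simp only [sub_sub_cancel]
        by_cases ht : t ∈ O
        · rw [indicator_of_mem ht, indicator_of_mem ht]
          exact mul_comm _ _
        · rw [indicator_of_notMem ht, indicator_of_notMem ht, smul_zero]
          rfl
    _ = -∫ t, O.indicator (fun y => u y * fderiv ℝ (fun t => ψ (x - t)) y v) t := by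
        rw [e, neg_neg]
    _ = ∫ t, (((ContinuousLinearMap.lsmul ℝ ℝ).precompL (Model m))
          (fderiv ℝ ψ (x - t)) (O.indicator u (x - (x - t)))) v := by
        rw [← integral_neg]
        refine integral_congr_ae (.of_forall fun t => ?_)
        simp only [sub_sub_cancel]
        change _ = fderiv ℝ ψ (x - t) v * O.indicator u t
        by_cases ht : t ∈ O
        · rw [indicator_of_mem ht, indicator_of_mem ht, hder]
          ring
        · rw [indicator_of_notMem ht, indicator_of_notMem ht, mul_zero, neg_zero]
    _ = _ := integral_sub_left_eq_self (fun t => (((ContinuousLinearMap.lsmul ℝ ℝ).precompL (Model m))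
          (fderiv ℝ ψ t) (O.indicator u (x - t))) v) volume x

/-- Approximation of a Sobolev function by functions which are smooth up to the boundary: near its
support, the domain satisfies a one-sided cone condition, so that the function can be translated
into the domain before it is mollified. -/
theorem IsWeakDeriv.exists_contDiff_approx (h : IsWeakDeriv O u Z) (hO : IsOpen O)
    (hu : IntegrableOn u O) (hZ : IntegrableOn Z O) {K V : Set (Model m)} (hK : IsCompact K)
    (hV : IsOpen V) (hKV : K ⊆ V) (hu0 : ∀ y ∈ O, y ∉ K → u y = 0) (hZ0 : ∀ y ∈ O, y ∉ K → Z y = 0)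
    {e : Model m} {κ s₀ : ℝ} (hκ : 0 < κ) (hs₀ : 0 < s₀)
    (hcone : ∀ y ∈ O ∩ V, ∀ s ∈ Ioc 0 s₀, Metric.closedBall (y - s • e) (κ * s) ⊆ O)
    {η : ℝ≥0∞} (hη : η ≠ 0) :
    ∃ w : Model m → ℝ, ContDiff ℝ 1 w ∧ HasCompactSupport w ∧ tsupport w ⊆ V ∧
      ∫⁻ y in O, ‖fderiv ℝ w y - Z y‖ₑ ≤ η := by
  have hU : Integrable (O.indicator u) := (integrable_indicator_iff hO.measurableSet).2 hu
  have hZi : Integrable (O.indicator Z) := integrable_indicator_of_integrableOn hO.measurableSet hZ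
  obtain ⟨δ, hδ, hδη⟩ := exists_lintegral_translate_sub_le hZi hη
  obtain ⟨τ, hτ, hτV⟩ := hK.exists_cthickening_subset_open hV hKV
  -- All displacements `s • e + t` with `‖t‖ ≤ κ s` must be at most `δ`, for the continuity of
  -- translations, and at most `τ`, to keep the support in `V`.
  obtain ⟨s, hs, hss₀, hsδ⟩ : ∃ s > 0, s ≤ s₀ ∧ s * (‖e‖ + κ) ≤ min δ τ := by
    refine ⟨min s₀ (min δ τ / (‖e‖ + κ)), by positivity, min_le_left _ _, ?_⟩
    rw [← le_div_iff₀ (by positivity)]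
    exact min_le_right _ _
  have hκs : 0 < κ * s := by positivity
  -- The outer radius `κ * s` is that of the ball which the cone condition places inside `O` around
  -- the translated point.
  let ρ : ContDiffBump (0 : Model m) := ⟨κ * s / 2, κ * s, by positivity, by linarith⟩
  have hρ : ρ.rOut = κ * s := rfl
  set ψ := ρ.normed (volume : Measure (Model m)) with hψ
  have hψs : ContDiff ℝ 1 ψ := ρ.contDiff_normed
  have hψc : HasCompactSupport ψ := ρ.hasCompactSupport_normed
  set q : Model m → ℝ := fun y => ∫ t, ψ (y - t) * O.indicator u t with hq
  have hfun : q = convolution ψ (O.indicator u) (ContinuousLinearMap.lsmul ℝ ℝ) volume := by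
    funext y
    rw [convolution_eq_swap]
    rfl
  have hqs : ContDiff ℝ 1 q := by
    rw [hfun]
    exact hψc.contDiff_convolution_left (n := 1) _ hψs hU.locallyIntegrable
  have hψ0 : ∀ t, κ * s < ‖t‖ → ψ t = 0 := fun t ht =>
    image_eq_zero_of_notMem_tsupport fun h => by
      rw [hψ, ρ.tsupport_normed_eq, hρ] at h
      exact absurd (mem_closedBall_zero_iff.1 h) (not_le.2 ht)
  have hw0 : ∀ y, y ∉ Metric.cthickening τ K → q (y - s • e) = 0 := fun y hy => by
    refine integral_eq_zero_of_ae (.of_forall fun t => ?_)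
    by_cases ht : t ∈ O
    · by_cases htK : t ∈ K
      · have hd : τ < dist y t := by
          by_contra hle
          exact hy (Metric.mem_cthickening_of_dist_le y t τ K htK (not_lt.1 hle))
        have : ψ (y - s • e - t) = 0 := hψ0 _ (by
          have h1 : ‖y - t‖ ≤ ‖y - s • e - t‖ + ‖s • e‖ := by
            have : y - t = (y - s • e - t) + s • e := by abel
            rw [this]
            exact norm_add_le _ _
          rw [norm_smul, Real.norm_of_nonneg hs.le] at h1
          rw [dist_eq_norm] at hd
          have h2 := hsδ.trans (min_le_right _ _)
          nlinarith)
        simp [this]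
      · simp [indicator_of_mem ht, hu0 t ht htK]
    · simp [indicator_of_notMem ht]
  have hts : tsupport (fun y => q (y - s • e)) ⊆ Metric.cthickening τ K :=
    closure_minimal (fun y hy => by_contra fun h => hy (hw0 y h)) Metric.isClosed_cthickening
  refine ⟨fun y => q (y - s • e), hqs.comp (contDiff_id.sub contDiff_const),
    HasCompactSupport.of_support_subset_isCompact hK.cthickening ((subset_tsupport _).trans hts),
    hts.trans hτV, ?_⟩
  set 𝒵 := O.indicator Z with h𝒵
  have hψi : ∫⁻ t, ‖ψ t‖ₑ = 1 := by
    have h1 : ∀ t, ‖ψ t‖ₑ = ENNReal.ofReal (ψ t) := fun t =>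
      Real.enorm_eq_ofReal (ρ.nonneg_normed t)
    simp only [h1]
    rw [← ofReal_integral_eq_lintegral_ofReal ρ.integrable_normed
      (.of_forall fun t => ρ.nonneg_normed t), ρ.integral_normed, ENNReal.ofReal_one]
  -- As `ψ` has integral one, the error is the average of `𝒵(y - (s • e + t)) - 𝒵 y`. Off `V` both
  -- the approximation and `Z` have zero derivative, so nothing is to be shown there.
  have hpt : ∀ y ∈ O, ‖fderiv ℝ (fun y => q (y - s • e)) y - Z y‖ₑ ≤
      ∫⁻ t, ‖ψ t‖ₑ * ‖𝒵 (y - (s • e + t)) - 𝒵 y‖ₑ := fun y hy => by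
    by_cases hyV : y ∈ V
    · have hd := h.fderiv_mollify hO hu hZ ρ (hcone y ⟨hy, hyV⟩ s ⟨hs, hss₀⟩)
      have h1 : HasFDerivAt (fun y : Model m => y - s • e) (ContinuousLinearMap.id ℝ (Model m)) y :=
        (hasFDerivAt_id y).sub_const _
      have h2 : HasFDerivAt (fun y => q (y - s • e)) (∫ t, ψ t • 𝒵 (y - s • e - t)) y := by
        exact (hd.comp y h1).congr_fderiv (ContinuousLinearMap.comp_id _)
      have i1 : Integrable fun t => ψ t • 𝒵 (y - s • e - t) :=
        (hψc.convolutionExists_left (ContinuousLinearMap.lsmul ℝ ℝ) hψs.continuous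
          hZi.locallyIntegrable (y - s • e)).integrable
      have i2 : Integrable fun t => ψ t • 𝒵 y := ρ.integrable_normed.smul_const _
      have h3 : ∫ t, ψ t • 𝒵 y = Z y := by
        rw [integral_smul_const, ρ.integral_normed, one_smul, h𝒵, indicator_of_mem hy]
      rw [h2.fderiv, ← h3, ← integral_sub i1 i2]
      refine (enorm_integral_le_lintegral_enorm _).trans (lintegral_mono fun t => ?_)
      rw [sub_sub]
      exact (enorm_smul_sub_smul _ _ _).le
    · have hyK : y ∉ tsupport (fun y => q (y - s • e)) := fun h => hyV (hτV (hts h))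
      have : fderiv ℝ (fun y => q (y - s • e)) y = 0 :=
        image_eq_zero_of_notMem_tsupport (f := fderiv ℝ _)
          fun h => hyK (tsupport_fderiv_subset ℝ h)
      rw [this, hZ0 y hy fun h => hyV (hKV h), sub_zero]
      exact (enorm_eq_zero_of_eq_zero rfl).trans_le zero_le
  have hm : AEMeasurable (Function.uncurry fun y t => ‖ψ t‖ₑ * ‖𝒵 (y - (s • e + t)) - 𝒵 y‖ₑ)
      (volume.prod volume) := by
    have h1 : AEStronglyMeasurable (fun q : Model m × Model m => 𝒵 (q.1 - q.2 - s • e))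
        (volume.prod volume) :=
      (hZi.comp_sub_right (s • e)).aestronglyMeasurable.comp_quasiMeasurePreserving
        (quasiMeasurePreserving_sub_of_right_invariant volume volume)
    have h2 : AEStronglyMeasurable (fun q : Model m × Model m => 𝒵 q.1) (volume.prod volume) :=
      hZi.aestronglyMeasurable.comp_fst
    have h3 : Measurable fun q : Model m × Model m => ‖ψ q.2‖ₑ :=
      (hψs.continuous.measurable.comp measurable_snd).enorm
    refine h3.aemeasurable.mul ((h1.sub h2).enorm.congr (.of_forall fun q => ?_))
    have : q.1 - q.2 - s • e = q.1 - (s • e + q.2) := by abel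
    simp only [Pi.sub_apply, this]
  calc ∫⁻ y in O, ‖fderiv ℝ (fun y => q (y - s • e)) y - Z y‖ₑ
      ≤ ∫⁻ y in O, ∫⁻ t, ‖ψ t‖ₑ * ‖𝒵 (y - (s • e + t)) - 𝒵 y‖ₑ :=
        lintegral_mono_ae ((ae_restrict_mem hO.measurableSet).mono hpt)
    _ ≤ ∫⁻ y : Model m, (∫⁻ t, ‖ψ t‖ₑ * ‖𝒵 (y - (s • e + t)) - 𝒵 y‖ₑ) ∂volume :=
        setLIntegral_le_lintegral _ _
    _ = ∫⁻ t : Model m, (∫⁻ y, ‖ψ t‖ₑ * ‖𝒵 (y - (s • e + t)) - 𝒵 y‖ₑ) ∂volume :=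
        lintegral_lintegral_swap hm
    _ ≤ ∫⁻ t : Model m, ‖ψ t‖ₑ * η ∂volume := by
        refine lintegral_mono fun t => ?_
        rw [lintegral_const_mul' _ _ enorm_ne_top]
        by_cases ht : ‖t‖ ≤ κ * s
        · gcongr
          refine hδη _ ((norm_add_le _ _).trans ?_)
          rw [norm_smul, Real.norm_of_nonneg hs.le]
          have := hsδ.trans (min_le_left _ _)
          nlinarith
        · rw [hψ0 t (not_le.1 ht)]
          simp
    _ = η := by
        rw [lintegral_mul_const _ (hψs.continuous.measurable.enorm), hψi, one_mul]

end Mollification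

/-! ### The cone condition at points of the closure. -/

section Cone

variable {m : ℕ} {M : Type*} [TopologicalSpace M] [ChartedSpace (Model m) M]
  [IsManifold (𝓡 m) ∞ M] [MeasurableSpace M] [BorelSpace M]

/-- The one-sided cone condition for a set `O ⊆ ℝᵐ` in the ball of radius `r` around `y₀`. -/
def HasConeAt (O : Set (Model m)) (y₀ : Model m) (e : Model m) (κ s₀ r : ℝ) : Prop :=
  0 < κ ∧ 0 < s₀ ∧ 0 < r ∧ ∀ y ∈ O ∩ Metric.ball y₀ r, ∀ s ∈ Ioc 0 s₀,
    Metric.closedBall (y - s • e) (κ * s) ⊆ O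

theorem HasConeAt.mono {O : Set (Model m)} {y₀ e : Model m} {κ s₀ r s₁ r₁ : ℝ}
    (h : HasConeAt O y₀ e κ s₀ r) (hs : 0 < s₁) (hs' : s₁ ≤ s₀) (hr : 0 < r₁) (hr' : r₁ ≤ r) :
    HasConeAt O y₀ e κ s₁ r₁ :=
  ⟨h.1, hs, hr, fun y hy s hs => h.2.2.2 y ⟨hy.1, Metric.ball_subset_ball hr' hy.2⟩ s
    ⟨hs.1, hs.2.trans hs'⟩⟩

theorem hasConeAt_of_mem {O : Set (Model m)} (hO : IsOpen O) {y₀ : Model m} (hy : y₀ ∈ O) :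
    ∃ e κ s₀ r, HasConeAt O y₀ e κ s₀ r := by
  obtain ⟨r, hr, hrO⟩ := Metric.isOpen_iff.1 hO y₀ hy
  -- At an interior point no translation is needed: with `e = 0` only small balls around nearby
  -- points have to lie in `O`.
  refine ⟨0, 1, r / 2, r / 2, one_pos, half_pos hr, half_pos hr, fun y hy s hs x hx => hrO ?_⟩
  rw [smul_zero, sub_zero, one_mul, Metric.mem_closedBall] at hx
  have := Metric.mem_ball.1 hy.2
  rw [Metric.mem_ball]
  linarith [dist_triangle x y y₀, hs.2]

/-- A vector `e` with `D e = 1` points outward, so a step `-s e` lowers `F` by about `s`. Strict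
differentiability makes this uniform for base points near `y₀`, which ordinary differentiability at
`y₀` would not. -/
theorem hasConeAt_of_hasStrictFDerivAt {O N : Set (Model m)} {F : Model m → ℝ} {y₀ : Model m}
    {D : Model m →L[ℝ] ℝ} (hN : N ∈ 𝓝 y₀) (hF : HasStrictFDerivAt F D y₀) (hD : D ≠ 0)
    (hO : ∀ y ∈ N, y ∈ O ↔ F y < 0) : ∃ e κ s₀ r, HasConeAt O y₀ e κ s₀ r := by
  obtain ⟨v, hv⟩ : ∃ v, D v ≠ 0 := by
    by_contra! hcon
    exact hD (ContinuousLinearMap.ext hcon)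
  set e := (D v)⁻¹ • v with he
  have hDe : D e = 1 := by rw [he, map_smul, smul_eq_mul, inv_mul_cancel₀ hv]
  -- With this `κ` a perturbation of norm at most `κ s` changes the linear part by at most `s/4`,
  -- and `ε` below keeps the linearization error within `s/4`; so `F` still drops by at least `s/2`.
  set κ := 1 / (4 * (‖D‖ + 1)) with hκ
  have hκ0 : 0 < κ := by positivity
  have hDκ : ‖D‖ * κ ≤ 1 / 4 := by
    rw [hκ, mul_one_div, div_le_div_iff₀ (by positivity) (by norm_num)]
    linarith [norm_nonneg D]
  let ε : NNReal := ⟨1 / (4 * (‖e‖ + κ)), by positivity⟩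
  have hε : (ε : ℝ) = 1 / (4 * (‖e‖ + κ)) := rfl
  have hε0 : 0 < ε := by
    rw [← NNReal.coe_pos, hε]
    positivity
  have hεe : ε * (‖e‖ + κ) = 1 / 4 := by
    rw [hε]
    field_simp
  obtain ⟨S, hS, hSF⟩ := hF.approximates_deriv_on_nhds (.inr hε0)
  obtain ⟨R, hR, hRS⟩ := Metric.mem_nhds_iff.1 (Filter.inter_mem hN hS)
  have hek : 0 < ‖e‖ + κ := by positivity
  refine ⟨e, κ, R / 2 / (‖e‖ + κ), R / 2, hκ0, by positivity, by positivity,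
    fun y hy s hs a ha => ?_⟩
  have hsR : s * (‖e‖ + κ) ≤ R / 2 := (le_div_iff₀ hek).1 hs.2
  have hyR : y ∈ N ∩ S := hRS (Metric.ball_subset_ball (by linarith) hy.2)
  set w := a - (y - s • e) with hw
  have hwn : ‖w‖ ≤ κ * s := by rw [hw, ← dist_eq_norm]; exact Metric.mem_closedBall.1 ha
  have hay : a - y = w - s • e := by rw [hw]; abel
  have hayn : ‖a - y‖ ≤ s * (‖e‖ + κ) := by
    rw [hay]
    refine (norm_sub_le _ _).trans ?_
    rw [norm_smul, Real.norm_of_nonneg hs.1.le]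
    linarith
  have haR : a ∈ N ∩ S := by
    refine hRS ?_
    rw [Metric.mem_ball]
    have h1 := Metric.mem_ball.1 hy.2
    have h2 := dist_triangle a y y₀
    rw [dist_eq_norm a y] at h2
    linarith
  rw [hO a haR.1]
  have hFy : F y < 0 := (hO y hyR.1).1 hy.1
  have h1 := hSF a haR.2 y hyR.2
  have h2 : D (a - y) = D w - s := by rw [hay, map_sub, map_smul, hDe, smul_eq_mul, mul_one]
  have h3 : D w ≤ ‖D‖ * (κ * s) :=
    (le_abs_self _).trans ((D.le_opNorm w).trans (by gcongr))
  rw [h2, Real.norm_eq_abs] at h1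
  have h4 : (ε : ℝ) * ‖a - y‖ ≤ ε * (s * (‖e‖ + κ)) := by gcongr
  have h5 := (le_abs_self _).trans (h1.trans h4)
  have h6 : (ε : ℝ) * (s * (‖e‖ + κ)) = s * (1 / 4) := by rw [← hεe]; ring
  have h7 : ‖D‖ * (κ * s) ≤ s * (1 / 4) := by nlinarith [hs.1]
  linarith [hs.1]

theorem hasConeAt_chartDom {Ω : Set M} (hΩ : IsOpen Ω) (hbd : HasSmoothBoundary m Ω)
    {c : OpenPartialHomeomorph M (Model m)} (hc : c ∈ atlas (Model m) M) {y₀ : Model m}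
    (hy₀ : y₀ ∈ c.target) (hcl : c.symm y₀ ∈ closure Ω) :
    ∃ e κ s₀ r, HasConeAt (chartDom c Ω) y₀ e κ s₀ r := by
  by_cases hp : c.symm y₀ ∈ Ω
  · exact hasConeAt_of_mem (isOpen_chartDom c hΩ) ⟨hy₀, hp⟩
  obtain ⟨V, ρ, hV, hpV, hρ, hρ', hΩV⟩ := hbd (c.symm y₀) (by
    rw [hΩ.frontier_eq]
    exact ⟨hcl, hp⟩)
  have hNo : IsOpen (chartDom c V) := isOpen_chartDom c hV
  have hN : chartDom c V ∈ 𝓝 y₀ := hNo.mem_nhds ⟨hy₀, hpV⟩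
  have hF : ContDiffAt ℝ 1 (fun y => ρ (c.symm y)) y₀ :=
    (contDiffOn_comp_symm hc (hρ.of_le (by exact_mod_cast le_top))).contDiffAt hN
  refine hasConeAt_of_hasStrictFDerivAt hN (hF.hasStrictFDerivAt one_ne_zero) ?_ fun y hy => ?_
  · intro h0
    apply hρ'
    refine ContinuousLinearMap.ext fun v => ?_
    have h1 := mfderiv_coeff hc hy₀ (v := ρ) ((hρ.contMDiffAt (hV.mem_nhds hpV)).mdifferentiableAt
      (by simp)) (coeff c (fun _ => v) y₀)
    rw [h0, symmDeriv_coeff hc (fun _ => v) hy₀] at h1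
    exact h1.symm
  · have h1 : c.symm y ∈ Ω ∩ V ↔ c.symm y ∈ V ∧ ρ (c.symm y) < 0 := by rw [hΩV]; rfl
    exact ⟨fun h => (h1.1 ⟨h.2, hy.2⟩).2, fun h => ⟨hy.1, (h1.2 ⟨hy.2, h⟩).1⟩⟩

end Cone

/-! ### A function with gradient in `L^p` is itself in `L^p` up to the boundary. -/

section LocalIntegrability

variable {m : ℕ} {M : Type*} [TopologicalSpace M] [ChartedSpace (Model m) M]
  [IsManifold (𝓡 m) ∞ M] {g : RMetric m M} [MeasurableSpace M] [BorelSpace M]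
  {Ω : Set M} {u : M → ℝ} {Y : VField m M}

theorem measurableSet_symm_image (c : OpenPartialHomeomorph M (Model m)) {A : Set (Model m)}
    (hA : A ⊆ c.target) (hAm : MeasurableSet A) : MeasurableSet (c.symm '' A) := by
  have : c.symm '' A = c.target.domRestrict c.symm '' (Subtype.val ⁻¹' A) := by
    ext x
    constructor
    · rintro ⟨y, hy, rfl⟩
      exact ⟨⟨y, hA hy⟩, hy, rfl⟩
    · rintro ⟨y, hy, rfl⟩
      exact ⟨y, hy, rfl⟩
  rw [this]
  exact (measurableEmbedding_restrict_symm c).measurableSet_image.2 (measurable_subtype_coe hAm)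

theorem setLIntegral_symm_image (g : RMetric m M) {c : OpenPartialHomeomorph M (Model m)}
    (hc : c ∈ atlas (Model m) M) {A : Set (Model m)} (hA : A ⊆ c.target) (hAm : MeasurableSet A)
    (F : M → ℝ≥0∞) : ∫⁻ x in c.symm '' A, F x ∂(vol g) =
      ∫⁻ y in A, ENNReal.ofReal (volDensity g c y) * F (c.symm y) := by
  rw [setLIntegral_vol g hc (measurableSet_symm_image c hA hAm) (symm_image_subset_source hA),
    target_inter_preimage_image c hA]

theorem exists_lintegral_comparison (g : RMetric m M) {c : OpenPartialHomeomorph M (Model m)}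
    (hc : c ∈ atlas (Model m) M) {K : Set (Model m)} (hK : IsCompact K) (hKc : K ⊆ c.target) :
    ∃ b : NNReal, ∀ A ⊆ K, MeasurableSet A → ∀ F : M → ℝ≥0∞,
      ∫⁻ y in A, F (c.symm y) ≤ b * ∫⁻ x in c.symm '' A, F x ∂(vol g) ∧
      ∫⁻ x in c.symm '' A, F x ∂(vol g) ≤ b * ∫⁻ y in A, F (c.symm y) := by
  obtain ⟨β, hβ, hβ'⟩ := exists_volDensity_le g hc hK hKc
  obtain ⟨α, hα, hα'⟩ := exists_le_volDensity g hc hK hKc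
  refine ⟨Real.toNNReal (max β α⁻¹), fun A hA hAm F => ?_⟩
  rw [setLIntegral_symm_image g hc (hA.trans hKc) hAm]
  have hcoe : ((Real.toNNReal (max β α⁻¹) : NNReal) : ℝ≥0∞) = ENNReal.ofReal (max β α⁻¹) := rfl
  rw [hcoe]
  constructor
  · rw [← lintegral_const_mul' _ _ ENNReal.ofReal_ne_top]
    refine setLIntegral_mono' hAm fun y hy => ?_
    rw [← mul_assoc, ← ENNReal.ofReal_mul (by positivity)]
    refine le_mul_of_one_le_left zero_le ?_
    rw [← ENNReal.ofReal_one]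
    refine ENNReal.ofReal_le_ofReal ?_
    calc (1 : ℝ) = α⁻¹ * α := (inv_mul_cancel₀ hα.ne').symm
      _ ≤ _ := mul_le_mul (le_max_right _ _) (hα' y (hA hy)) hα.le (by positivity)
  · rw [← lintegral_const_mul' _ _ ENNReal.ofReal_ne_top]
    refine setLIntegral_mono' hAm fun y hy => ?_
    gcongr
    exact (hβ' y (hA hy)).trans (le_max_left _ _)

theorem exists_lintegral_covec_le (g : RMetric m M) {c : OpenPartialHomeomorph M (Model m)}
    (hc : c ∈ atlas (Model m) M) {K : Set (Model m)} (hK : IsCompact K) (hKc : K ⊆ c.target) {p : ℝ}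
    (hp : 0 ≤ p) :
    ∃ b : NNReal, ∀ A ⊆ K, MeasurableSet A → ∀ Y : VField m M,
      ∫⁻ y in A, ‖covec g c Y y‖ₑ ^ p ≤
        b * ∫⁻ x in c.symm '' A, ENNReal.ofReal (nrm g x (Y x)) ^ p ∂(vol g) := by
  obtain ⟨b, hb⟩ := exists_lintegral_comparison g hc hK hKc
  obtain ⟨b', hb'0, hb'⟩ := exists_covec_le g hc hK hKc
  refine ⟨b'.toNNReal ^ p * b, fun A hA hAm Y => ?_⟩
  have h1 := (hb A hA hAm fun x => ENNReal.ofReal (nrm g x (Y x)) ^ p).1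
  calc ∫⁻ y in A, ‖covec g c Y y‖ₑ ^ p
      ≤ ∫⁻ y in A, (b'.toNNReal ^ p : NNReal) *
          ENNReal.ofReal (nrm g (c.symm y) (Y (c.symm y))) ^ p := by
        refine setLIntegral_mono' hAm fun y hy => ?_
        rw [ENNReal.coe_rpow_of_nonneg _ hp, ← ENNReal.mul_rpow_of_nonneg _ _ hp]
        gcongr
        rw [← ofReal_norm]
        refine (ENNReal.ofReal_le_ofReal (hb' y (hA hy) Y)).trans ?_
        rw [ENNReal.ofReal_mul hb'0.le]
        rfl
    _ = (b'.toNNReal ^ p : NNReal) * ∫⁻ y in A, ENNReal.ofReal (nrm g (c.symm y) (Y (c.symm y))) ^ p :=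
        lintegral_const_mul' _ _ ENNReal.coe_ne_top
    _ ≤ _ := by
        rw [ENNReal.coe_mul, mul_assoc]
        gcongr

theorem exists_lintegral_nrm_le (g : RMetric m M) {c : OpenPartialHomeomorph M (Model m)}
    (hc : c ∈ atlas (Model m) M) {K : Set (Model m)} (hK : IsCompact K) (hKc : K ⊆ c.target) :
    ∃ b : NNReal, ∀ A ⊆ K, MeasurableSet A → ∀ Y : VField m M,
      ∫⁻ x in c.symm '' A, ENNReal.ofReal (nrm g x (Y x)) ∂(vol g) ≤
        b * ∫⁻ y in A, ‖covec g c Y y‖ₑ := by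
  obtain ⟨b, hb⟩ := exists_lintegral_comparison g hc hK hKc
  obtain ⟨b', hb'0, hb'⟩ := exists_le_covec g hc hK hKc
  refine ⟨b * b'.toNNReal, fun A hA hAm Y => ?_⟩
  refine (hb A hA hAm fun x => ENNReal.ofReal (nrm g x (Y x))).2.trans ?_
  rw [ENNReal.coe_mul, mul_assoc]
  gcongr
  rw [← lintegral_const_mul' _ _ ENNReal.coe_ne_top]
  refine setLIntegral_mono' hAm fun y hy => ?_
  refine (ENNReal.ofReal_le_ofReal (hb' y (hA hy) Y)).trans ?_
  rw [ENNReal.ofReal_mul hb'0.le, ofReal_norm]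
  rfl

theorem exists_ball_subset_chartDom (c : OpenPartialHomeomorph M (Model m)) (hΩ : IsOpen Ω) {x : M}
    (hx : x ∈ Ω) (hxc : x ∈ c.source) : ∃ r > 0, Metric.closedBall (c x) r ⊆ chartDom c Ω :=
  Metric.nhds_basis_closedBall.mem_iff.1 ((isOpen_chartDom c hΩ).mem_nhds
    ⟨c.map_source hxc, by rwa [mem_preimage, c.left_inv hxc]⟩)

theorem symm_image_mem_nhds (c : OpenPartialHomeomorph M (Model m)) {x : M} (hxc : x ∈ c.source)
    {A : Set (Model m)} (hA : A ∈ 𝓝 (c x)) : c.symm '' A ∈ 𝓝 x := by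
  have := c.symm.image_mem_nhds (c.map_source hxc) hA
  rwa [c.left_inv hxc] at this

variable [T2Space M]

theorem IsWeakGradient.exists_nhds_lintegral_lt_top (hΩ : IsOpen Ω) (h : IsWeakGradient g Ω u Y)
    {p : ℝ} (hp : 1 ≤ p) (hY : ∫⁻ x in Ω, ENNReal.ofReal (nrm g x (Y x)) ^ p ∂(vol g) < ⊤) {x : M}
    (hx : x ∈ Ω) : ∃ U ∈ 𝓝 x, ∫⁻ x in U, ‖u x‖ₑ ^ p ∂(vol g) < ⊤ := by
  set c := chartAt (Model m) x with hcdef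
  have hc : c ∈ atlas (Model m) M := chart_mem_atlas _ _
  have hxc : x ∈ c.source := mem_chart_source _ _
  obtain ⟨r, hr, hrΩ⟩ := exists_ball_subset_chartDom c hΩ hx hxc
  have hKc : Metric.closedBall (c x) r ⊆ c.target := hrΩ.trans inter_subset_left
  have hBK : Metric.ball (c x) r ⊆ Metric.closedBall (c x) r := Metric.ball_subset_closedBall
  obtain ⟨b, hb⟩ := exists_lintegral_comparison g hc (isCompact_closedBall (c x) r) hKc
  obtain ⟨b', hb'⟩ := exists_lintegral_covec_le g hc (isCompact_closedBall (c x) r) hKc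
    (zero_le_one.trans hp)
  refine ⟨c.symm '' Metric.ball (c x) r, symm_image_mem_nhds c hxc (Metric.ball_mem_nhds _ hr), ?_⟩
  refine (hb _ hBK measurableSet_ball fun x => ‖u x‖ₑ ^ p).2.trans_lt
    (ENNReal.mul_lt_top ENNReal.coe_lt_top ?_)
  refine (h.isWeakDeriv hΩ hc).lintegral_ball_lt_top (isOpen_chartDom c hΩ) hr (hBK.trans hrΩ) hp ?_
  refine (hb' _ hBK measurableSet_ball Y).trans_lt (ENNReal.mul_lt_top ENNReal.coe_lt_top ?_)
  refine (lintegral_mono_set ?_).trans_lt hY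
  rintro _ ⟨y, hy, rfl⟩
  exact (hrΩ (hBK hy)).2

theorem lintegral_lt_top_of_nhds {μ : Measure M} {K : Set M} (hK : IsCompact K) {F : M → ℝ≥0∞}
    (h : ∀ x ∈ K, ∃ U ∈ 𝓝 x, ∫⁻ x in U ∩ Ω, F x ∂μ < ⊤) : ∫⁻ x in K ∩ Ω, F x ∂μ < ⊤ := by
  refine hK.induction_on (p := fun s => ∫⁻ x in s ∩ Ω, F x ∂μ < ⊤) (by simp)
    (fun s t hst ht => (lintegral_mono_set (inter_subset_inter_left _ hst)).trans_lt ht)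
    (fun s t hs ht => ?_) fun x hx => ?_
  · rw [union_inter_distrib_right]
    exact (lintegral_union_le _ _ _).trans_lt (ENNReal.add_lt_top.2 ⟨hs, ht⟩)
  · obtain ⟨U, hU, hU'⟩ := h x hx
    exact ⟨U, mem_nhdsWithin_of_mem_nhds hU, hU'⟩

theorem IsWeakGradient.lintegral_lt_top_of_isCompact (hΩ : IsOpen Ω) (h : IsWeakGradient g Ω u Y)
    {p : ℝ} (hp : 1 ≤ p) (hY : ∫⁻ x in Ω, ENNReal.ofReal (nrm g x (Y x)) ^ p ∂(vol g) < ⊤) {K : Set M}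
    (hK : IsCompact K) (hKΩ : K ⊆ Ω) : ∫⁻ x in K, ‖u x‖ₑ ^ p ∂(vol g) < ⊤ := by
  have := lintegral_lt_top_of_nhds (Ω := Ω) (μ := vol g) hK (F := fun x => ‖u x‖ₑ ^ p) fun x hx => by
    obtain ⟨U, hU, hU'⟩ := h.exists_nhds_lintegral_lt_top hΩ hp hY (hKΩ hx)
    exact ⟨U, hU, (lintegral_mono_set inter_subset_left).trans_lt hU'⟩
  rwa [inter_eq_left.2 hKΩ] at this

theorem isClosed_setOf_ball_subset (O : Set (Model m)) (δ : ℝ) :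
    IsClosed {a : Model m | Metric.ball a δ ⊆ O} := by
  have : {a : Model m | Metric.ball a δ ⊆ O} = ⋂ x ∈ Oᶜ, {a | δ ≤ dist x a} := by
    ext a
    simp only [mem_iInter, mem_compl_iff]
    refine ⟨fun h x hx => show δ ≤ dist x a from not_lt.1 fun hlt => hx (h hlt), fun h x hx => ?_⟩
    by_contra hxO
    exact absurd (Metric.mem_ball.1 hx) (not_lt.2 (h x hxO))
  rw [this]
  exact isClosed_biInter fun x _ => isClosed_le continuous_const (continuous_const.dist continuous_id)

/-- Near a boundary point the cone direction moves the domain into a compact subset of its interior,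
where `u` is `p`-integrable by the interior estimate. The difference between `u` and its translate
is controlled by `lintegral_shift_le`. -/
theorem IsWeakGradient.exists_nhds_lintegral_inter_lt_top (hΩ : IsOpen Ω)
    (hbd : HasSmoothBoundary m Ω) (h : IsWeakGradient g Ω u Y)
    {p : ℝ} (hp : 1 ≤ p) (hY : ∫⁻ x in Ω, ENNReal.ofReal (nrm g x (Y x)) ^ p ∂(vol g) < ⊤) {x : M}
    (hx : x ∈ closure Ω) : ∃ U ∈ 𝓝 x, ∫⁻ x in U ∩ Ω, ‖u x‖ₑ ^ p ∂(vol g) < ⊤ := by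
  set c := chartAt (Model m) x with hcdef
  have hc : c ∈ atlas (Model m) M := chart_mem_atlas _ _
  have hxc : x ∈ c.source := mem_chart_source _ _
  have hp0 : 0 < p := by linarith
  set O := chartDom c Ω with hO
  have hOo : IsOpen O := isOpen_chartDom c hΩ
  obtain ⟨e, κ, s₀, r₀, hκ, hs₀, hr₀, hcone⟩ := hasConeAt_chartDom hΩ hbd hc (c.map_source hxc)
    (by rwa [c.left_inv hxc])
  obtain ⟨R, hR, hRc⟩ := Metric.nhds_basis_closedBall.mem_iff.1
    (c.open_target.mem_nhds (c.map_source hxc))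
  obtain ⟨s, hs, hss₀, hsR⟩ : ∃ s > 0, s ≤ s₀ ∧ s * ‖e‖ ≤ R / 2 := by
    refine ⟨min s₀ (R / 2 / (‖e‖ + 1)), by positivity, min_le_left _ _, ?_⟩
    calc min s₀ (R / 2 / (‖e‖ + 1)) * ‖e‖ ≤ R / 2 / (‖e‖ + 1) * (‖e‖ + 1) := by
          gcongr
          · exact min_le_right _ _
          · linarith
      _ = R / 2 := div_mul_cancel₀ _ (by positivity)
  set r := min r₀ (R / 2) with hr
  have hr0 : 0 < r := by positivity
  have hκs : 0 < κ * s := by positivity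
  set A := O ∩ Metric.ball (c x) r with hA
  have hAm : MeasurableSet A := hOo.measurableSet.inter measurableSet_ball
  have hAR : A ⊆ Metric.closedBall (c x) R := fun y hy => by
    have := Metric.mem_ball.1 hy.2
    exact Metric.mem_closedBall.2 (this.le.trans ((min_le_right _ _).trans (by linarith)))
  set O' := O ∩ Metric.ball (c x) R with hO'
  have hO'o : IsOpen O' := hOo.inter Metric.isOpen_ball
  have hO'R : O' ⊆ Metric.closedBall (c x) R :=
    inter_subset_right.trans Metric.ball_subset_closedBall
  set z : Model m := -(s • e) with hz
  have hzn : ‖z‖ ≤ R / 2 := by rwa [hz, norm_neg, norm_smul, Real.norm_of_nonneg hs.le]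
  -- The cone condition for the shorter shifts `t * s` keeps the segment in `O`; the sizes `r, ‖z‖ ≤
  -- R/2` keep it in the ball of radius `R`.
  have hseg : A ⊆ segDom O' z := by
    rintro y hy t ht
    have h1 : y + t • z = y - (t * s) • e := by rw [hz, smul_neg, smul_smul, sub_eq_add_neg]
    refine ⟨?_, ?_⟩
    · rcases ht.1.eq_or_lt with h0 | h0
      · rw [← h0, zero_smul, add_zero]
        exact hy.1
      · rw [h1]
        refine hcone y ⟨hy.1, Metric.ball_subset_ball (min_le_left _ _) hy.2⟩ (t * s)
          ⟨by positivity, ?_⟩ (Metric.mem_closedBall_self (by positivity))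
        exact (mul_le_of_le_one_left hs.le ht.2).trans hss₀
    · have h2 := Metric.mem_ball.1 hy.2
      have h3 : dist (y + t • z) y ≤ R / 2 := by
        rw [dist_eq_norm, add_sub_cancel_left, norm_smul, Real.norm_of_nonneg ht.1]
        exact (mul_le_of_le_one_left (norm_nonneg _) ht.2).trans hzn
      have h4 := dist_triangle (y + t • z) y (c x)
      rw [Metric.mem_ball]
      linarith [min_le_right r₀ (R / 2)]
  obtain ⟨b, hb⟩ := exists_lintegral_comparison g hc (isCompact_closedBall (c x) R) hRc
  obtain ⟨b', hb'⟩ := exists_lintegral_covec_le g hc (isCompact_closedBall (c x) R) hRc hp0.le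
  have hw : IsWeakDeriv O' (fun y => u (c.symm y)) (covec g c Y) :=
    (h.isWeakDeriv hΩ hc).mono hOo inter_subset_left
  have hshift := hw.lintegral_shift_le hO'o z hseg hp
  have hZ : ∫⁻ y in O', ‖covec g c Y y‖ₑ ^ p < ⊤ := by
    refine (hb' _ hO'R hO'o.measurableSet Y).trans_lt (ENNReal.mul_lt_top ENNReal.coe_lt_top ?_)
    refine (lintegral_mono_set ?_).trans_lt hY
    rintro _ ⟨y, hy, rfl⟩
    exact hy.1.2
  have hdiff : ∫⁻ y in A, ‖u (c.symm (y + z)) - u (c.symm y)‖ₑ ^ p < ⊤ :=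
    hshift.trans_lt (ENNReal.mul_lt_top
      (ENNReal.rpow_lt_top_of_nonneg hp0.le enorm_ne_top) hZ)
  -- All translated points lie here. The set is compact because having an open ball of fixed radius
  -- inside `O` is a closed condition on the centre.
  set K := {a : Model m | Metric.ball a (κ * s) ⊆ O} ∩ Metric.closedBall (c x) R with hK
  have hKcpt : IsCompact K := (isCompact_closedBall _ _).inter_left (isClosed_setOf_ball_subset _ _)
  have hKO : K ⊆ O := fun a ha => ha.1 (Metric.mem_ball_self hκs)
  have hAK : ∀ y ∈ A, y + z ∈ K := fun y hy => by
    refine ⟨?_, ?_⟩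
    · refine Metric.ball_subset_closedBall.trans ?_
      rw [hz, ← sub_eq_add_neg]
      exact hcone y ⟨hy.1, Metric.ball_subset_ball (min_le_left _ _) hy.2⟩ s ⟨hs, hss₀⟩
    · have := hseg hy 1 ⟨zero_le_one, le_rfl⟩
      rw [one_smul] at this
      exact hO'R this
  have hshifted : ∫⁻ y in A, ‖u (c.symm (y + z))‖ₑ ^ p < ⊤ := by
    have h1 : ∫⁻ y in A, ‖u (c.symm (y + z))‖ₑ ^ p ≤ ∫⁻ y in K, ‖u (c.symm y)‖ₑ ^ p := by
      rw [← lintegral_indicator hAm, ← lintegral_indicator hKcpt.measurableSet,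
        ← lintegral_add_right_eq_self (K.indicator fun y => ‖u (c.symm y)‖ₑ ^ p) z]
      refine lintegral_mono fun y => ?_
      by_cases hy : y ∈ A
      · rw [indicator_of_mem hy, indicator_of_mem (hAK y hy)]
      · rw [indicator_of_notMem hy]
        exact zero_le
    refine h1.trans_lt ?_
    refine ((hb K inter_subset_right hKcpt.measurableSet fun x => ‖u x‖ₑ ^ p).1).trans_lt
      (ENNReal.mul_lt_top ENNReal.coe_lt_top ?_)
    refine h.lintegral_lt_top_of_isCompact hΩ hp hY (isCompact_symm_image hKcpt
      (hKO.trans inter_subset_left)) ?_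
    rintro _ ⟨y, hy, rfl⟩
    exact (hKO hy).2
  have hAfin : ∫⁻ y in A, ‖u (c.symm y)‖ₑ ^ p < ⊤ := by
    have hm : AEMeasurable (fun y => ‖u (c.symm (y + z)) - u (c.symm y)‖ₑ ^ p)
        (volume.restrict A) := by
      have h1 : AEMeasurable (fun y => u (c.symm y)) (volume.restrict O') :=
        hw.locInt.aestronglyMeasurable.aemeasurable
      have h2 : AEMeasurable (fun y => u (c.symm y)) (volume.restrict A) :=
        h1.mono_measure (Measure.restrict_mono (fun y hy => by
          have := hseg hy 0 ⟨le_rfl, zero_le_one⟩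
          rwa [zero_smul, add_zero] at this) le_rfl)
      have h3 : AEMeasurable (fun y => u (c.symm (y + z))) (volume.restrict A) := by
        have hq : Measure.QuasiMeasurePreserving (fun y : Model m => y + z) (volume.restrict A)
            (volume.restrict O') := by
          have := ((measurePreserving_add_right (volume : Measure (Model m)) z).restrict_preimage
            hO'o.measurableSet).quasiMeasurePreserving
          refine this.mono_left (Measure.absolutelyContinuous_of_le
            (Measure.restrict_mono (fun y hy => ?_) le_rfl))
          have := hseg hy 1 ⟨zero_le_one, le_rfl⟩
          rwa [one_smul] at this
        exact h1.comp_quasiMeasurePreserving hq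
      exact ((h3.sub h2).enorm).pow_const p
    calc ∫⁻ y in A, ‖u (c.symm y)‖ₑ ^ p
        ≤ ∫⁻ y in A, 2 ^ (p - 1) * (‖u (c.symm (y + z)) - u (c.symm y)‖ₑ ^ p +
            ‖u (c.symm (y + z))‖ₑ ^ p) := by
          refine lintegral_mono fun y => ?_
          refine le_trans ?_ (ENNReal.rpow_add_le_mul_rpow_add_rpow _ _ hp)
          gcongr
          calc ‖u (c.symm y)‖ₑ = ‖-(u (c.symm (y + z)) - u (c.symm y)) + u (c.symm (y + z))‖ₑ := by
                congr 1; ring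
            _ ≤ _ := (enorm_add_le _ _).trans_eq (by rw [enorm_neg])
      _ = 2 ^ (p - 1) * ((∫⁻ y in A, ‖u (c.symm (y + z)) - u (c.symm y)‖ₑ ^ p) +
            ∫⁻ y in A, ‖u (c.symm (y + z))‖ₑ ^ p) := by
          rw [lintegral_const_mul' _ _ (by simp [ENNReal.rpow_eq_top_iff]), lintegral_add_left' hm]
      _ < ⊤ := ENNReal.mul_lt_top (lt_top_iff_ne_top.2 (by simp [ENNReal.rpow_eq_top_iff]))
          (ENNReal.add_lt_top.2 ⟨hdiff, hshifted⟩)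
  refine ⟨c.symm '' Metric.ball (c x) r, symm_image_mem_nhds c hxc (Metric.ball_mem_nhds _ hr0), ?_⟩
  have hsub : c.symm '' Metric.ball (c x) r ∩ Ω ⊆ c.symm '' A := by
    rintro _ ⟨⟨y, hy, rfl⟩, hyΩ⟩
    have hyt : y ∈ c.target := hRc (Metric.mem_closedBall.2
      ((Metric.mem_ball.1 hy).le.trans ((min_le_right _ _).trans (by linarith))))
    exact ⟨y, ⟨⟨hyt, hyΩ⟩, hy⟩, rfl⟩
  exact (lintegral_mono_set hsub).trans_lt (((hb A hAR hAm fun x => ‖u x‖ₑ ^ p).2).trans_lt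
    (ENNReal.mul_lt_top ENNReal.coe_lt_top hAfin))

theorem IsWeakGradient.lintegral_lt_top (hΩ : IsOpen Ω) (hcpt : IsCompact (closure Ω))
    (hbd : HasSmoothBoundary m Ω) (h : IsWeakGradient g Ω u Y)
    {p : ℝ} (hp : 1 ≤ p) (hY : ∫⁻ x in Ω, ENNReal.ofReal (nrm g x (Y x)) ^ p ∂(vol g) < ⊤) :
    ∫⁻ x in Ω, ‖u x‖ₑ ^ p ∂(vol g) < ⊤ := by
  have := lintegral_lt_top_of_nhds hcpt fun x hx =>
    h.exists_nhds_lintegral_inter_lt_top hΩ hbd hp hY hx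
  rwa [inter_eq_right.2 subset_closure] at this

end LocalIntegrability

/-! ### The local Poincaré inequality on a connected domain. -/

section PoincareManifold

variable {m : ℕ} {M : Type*} [TopologicalSpace M] [ChartedSpace (Model m) M]
  [IsManifold (𝓡 m) ∞ M] {g : RMetric m M} [MeasurableSpace M] [BorelSpace M]
  {Ω : Set M} {u v : M → ℝ} {Y : VField m M}

/-- The `L¹` norm on `U` of every Sobolev function is controlled by its `L¹` norm on `N` and the one
of its gradient on a compact subset of `Ω`. -/
def Controlled (g : RMetric m M) (Ω N U : Set M) : Prop :=
  ∃ (C : NNReal) (K : Set M), IsCompact K ∧ K ⊆ Ω ∧ ∀ (u : M → ℝ) (Y : VField m M),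
    IsWeakGradient g Ω u Y → ∫⁻ x in U, ‖u x‖ₑ ∂(vol g) ≤
      C * ((∫⁻ x in N, ‖u x‖ₑ ∂(vol g)) + ∫⁻ x in K, ENNReal.ofReal (nrm g x (Y x)) ∂(vol g))

theorem Controlled.mono {N U U' : Set M} (h : Controlled g Ω N U) (hU : U' ⊆ U) :
    Controlled g Ω N U' := by
  obtain ⟨C, K, hK, hKΩ, h⟩ := h
  exact ⟨C, K, hK, hKΩ, fun u Y hY => (lintegral_mono_set hU).trans (h u Y hY)⟩

theorem controlled_self (N : Set M) : Controlled g Ω N N :=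
  ⟨1, ∅, isCompact_empty, empty_subset _, fun u Y _ => by simp⟩

theorem Controlled.union {N U U' : Set M} (h : Controlled g Ω N U) (h' : Controlled g Ω N U') :
    Controlled g Ω N (U ∪ U') := by
  obtain ⟨C, K, hK, hKΩ, h⟩ := h
  obtain ⟨C', K', hK', hKΩ', h'⟩ := h'
  refine ⟨C + C', K ∪ K', hK.union hK', union_subset hKΩ hKΩ', fun u Y hY => ?_⟩
  refine (lintegral_union_le _ _ _).trans ?_
  rw [ENNReal.coe_add, add_mul]
  exact add_le_add
    ((h u Y hY).trans (by gcongr; exact subset_union_left))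
    ((h' u Y hY).trans (by gcongr; exact subset_union_right))

theorem Controlled.trans {N U U' : Set M} (h : Controlled g Ω N U) (h' : Controlled g Ω U U') :
    Controlled g Ω N U' := by
  obtain ⟨C, K, hK, hKΩ, h⟩ := h
  obtain ⟨C', K', hK', hKΩ', h'⟩ := h'
  refine ⟨C' * (C + 1), K ∪ K', hK.union hK', union_subset hKΩ hKΩ', fun u Y hY => ?_⟩
  refine (h' u Y hY).trans ?_
  rw [ENNReal.coe_mul, mul_assoc]
  gcongr
  rw [ENNReal.coe_add, ENNReal.coe_one, add_mul, one_mul]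
  refine add_le_add ((h u Y hY).trans (by gcongr; exact subset_union_left)) ?_
  exact (lintegral_mono_set subset_union_right).trans le_add_self

variable [T2Space M]

/-- The part of the coordinate ball in `U` is open and nonempty, hence of positive measure, and
`poincare_subset` applies. -/
theorem controlled_ball (hΩ : IsOpen Ω) {c : OpenPartialHomeomorph M (Model m)}
    (hc : c ∈ atlas (Model m) M) {y₀ : Model m} {r : ℝ}
    (hrΩ : Metric.closedBall y₀ r ⊆ chartDom c Ω) {U : Set M} (hU : IsOpen U)
    (hUB : (U ∩ c.symm '' Metric.ball y₀ r).Nonempty) :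
    Controlled g Ω U (c.symm '' Metric.ball y₀ r) := by
  set B := Metric.ball y₀ r with hB
  have hKc : Metric.closedBall y₀ r ⊆ c.target := hrΩ.trans inter_subset_left
  have hBK : B ⊆ Metric.closedBall y₀ r := Metric.ball_subset_closedBall
  set N := B ∩ c.symm ⁻¹' U with hN
  have hNo : IsOpen N := by
    have : N = B ∩ (c.target ∩ c.symm ⁻¹' U) := by
      rw [← inter_assoc, inter_eq_left.2 (hBK.trans hKc)]
    rw [this]
    exact Metric.isOpen_ball.inter (isOpen_inter_preimage_symm c hU)
  have hNne : N.Nonempty := by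
    obtain ⟨_, hxU, y, hy, rfl⟩ := hUB
    exact ⟨y, hy, hxU⟩
  have hNB : N ⊆ B := inter_subset_left
  have hN0 : volume N ≠ 0 := (hNo.measure_pos volume hNne).ne'
  have hNt : volume N ≠ ⊤ := ((measure_mono hNB).trans_lt measure_ball_lt_top).ne
  obtain ⟨b, hb⟩ := exists_lintegral_comparison g hc (isCompact_closedBall y₀ r) hKc
  obtain ⟨b', hb'⟩ := exists_lintegral_covec_le g hc (isCompact_closedBall y₀ r) hKc zero_le_one
  simp only [ENNReal.rpow_one] at hb'
  set D := ENNReal.ofReal (2 * r) * volume (Metric.ball (0 : Model m) (2 * r)) with hD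
  have hDt : D ≠ ⊤ := ENNReal.mul_ne_top ENNReal.ofReal_ne_top measure_ball_lt_top.ne
  have hBt : volume B ≠ ⊤ := measure_ball_lt_top.ne
  have hKΩ : c.symm '' Metric.closedBall y₀ r ⊆ Ω := by
    rintro _ ⟨y, hy, rfl⟩
    exact (hrΩ hy).2
  obtain ⟨C, hC⟩ : ∃ C : NNReal, (C : ℝ≥0∞) =
      b * ((volume N)⁻¹ * (volume B * b + D * b')) := by
    refine ⟨ENNReal.toNNReal _, ENNReal.coe_toNNReal ?_⟩
    exact ENNReal.mul_ne_top ENNReal.coe_ne_top (ENNReal.mul_ne_top (ENNReal.inv_ne_top.2 hN0)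
      (ENNReal.add_ne_top.2 ⟨ENNReal.mul_ne_top hBt ENNReal.coe_ne_top,
        ENNReal.mul_ne_top hDt ENNReal.coe_ne_top⟩))
  refine ⟨C, c.symm '' Metric.closedBall y₀ r, isCompact_symm_image (isCompact_closedBall _ _) hKc,
    hKΩ, fun u Y hY => ?_⟩
  have hP := (hY.isWeakDeriv hΩ hc).poincare_subset (isOpen_chartDom c hΩ) (hBK.trans hrΩ) hNB
  set I := ∫⁻ x in U, ‖u x‖ₑ ∂(vol g)
  set J := ∫⁻ x in c.symm '' Metric.closedBall y₀ r, ENNReal.ofReal (nrm g x (Y x)) ∂(vol g)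
  have h1 : ∫⁻ y in N, ‖u (c.symm y)‖ₑ ≤ b * I :=
    (hb N (hNB.trans hBK) hNo.measurableSet fun x => ‖u x‖ₑ).1.trans (mul_le_mul' le_rfl (lintegral_mono_set (by
      rintro _ ⟨y, hy, rfl⟩
      exact hy.2)))
  have h2 : ∫⁻ y in B, ‖covec g c Y y‖ₑ ≤ b' * J :=
    (hb' B hBK measurableSet_ball Y).trans
      (mul_le_mul' le_rfl (lintegral_mono_set (image_mono hBK)))
  have h3 : ∫⁻ y in B, ‖u (c.symm y)‖ₑ ≤ (volume N)⁻¹ * (volume B * (b * I) + D * (b' * J)) := by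
    rw [mul_comm (volume N)⁻¹, ← div_eq_mul_inv, ENNReal.le_div_iff_mul_le (.inl hN0) (.inl hNt),
      mul_comm]
    exact hP.trans (by gcongr)
  refine (hb B hBK measurableSet_ball fun x => ‖u x‖ₑ).2.trans ?_
  rw [hC, mul_assoc, mul_assoc]
  gcongr
  refine h3.trans ?_
  gcongr
  rw [add_mul]
  refine add_le_add ?_ ?_
  · rw [← mul_assoc]
    gcongr
    exact le_self_add
  · rw [← mul_assoc]
    gcongr
    exact le_add_self

/-- The points with a controlled neighbourhood form an open set. The other points of `Ω` do as well,
since a small ball that meets a controlled open set is controlled. Connectedness leaves only the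
first set, and a compact set is a finite union of controlled pieces. -/
theorem controlled_of_isCompact (hΩ : IsOpen Ω) (hconn : IsPreconnected Ω) {N : Set M}
    (hN : IsOpen N) (hNΩ : (N ∩ Ω).Nonempty) {K : Set M} (hK : IsCompact K) (hKΩ : K ⊆ Ω) :
    Controlled g Ω N K := by
  set S : Set M := {x | ∃ U, IsOpen U ∧ x ∈ U ∧ Controlled g Ω N U} with hS
  set T : Set M := {x | x ∈ Ω ∧ x ∉ S} with hT
  have hSo : IsOpen S := isOpen_iff_forall_mem_open.2 fun x ⟨U, hU, hxU, h⟩ =>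
    ⟨U, fun z hz => ⟨U, hU, hz, h⟩, hU, hxU⟩
  have hball : ∀ x ∈ Ω, ∃ B, IsOpen B ∧ x ∈ B ∧ B ⊆ Ω ∧ ∀ U : Set M, IsOpen U → (U ∩ B).Nonempty →
      Controlled g Ω U B := by
    intro x hx
    set c := chartAt (Model m) x with hcdef
    have hc : c ∈ atlas (Model m) M := chart_mem_atlas _ _
    have hxc : x ∈ c.source := mem_chart_source _ _
    obtain ⟨r, hr, hrΩ⟩ := exists_ball_subset_chartDom c hΩ hx hxc
    have hBK : Metric.ball (c x) r ⊆ Metric.closedBall (c x) r := Metric.ball_subset_closedBall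
    refine ⟨c.symm '' Metric.ball (c x) r, ?_, ⟨c x, Metric.mem_ball_self hr, c.left_inv hxc⟩, ?_,
      fun U hU hne => controlled_ball hΩ hc hrΩ hU hne⟩
    · exact c.symm.isOpen_image_of_subset_source Metric.isOpen_ball
        ((hBK.trans hrΩ).trans inter_subset_left)
    · rintro _ ⟨y, hy, rfl⟩
      exact (hrΩ (hBK hy)).2
  have hTo : IsOpen T := by
    refine isOpen_iff_forall_mem_open.2 fun x hx => ?_
    obtain ⟨B, hBo, hxB, hBΩ, hB⟩ := hball x hx.1
    refine ⟨B, fun z hz => ⟨hBΩ hz, fun hzS => hx.2 ?_⟩, hBo, hxB⟩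
    obtain ⟨U, hU, hzU, hUc⟩ := hzS
    exact ⟨B, hBo, hxB, hUc.trans (hB U hU ⟨z, hzU, hz⟩)⟩
  have hΩS : Ω ⊆ S := by
    refine hconn.subset_left_of_subset_union hSo hTo ?_ (fun x hx => ?_) ?_
    · exact Set.disjoint_left.2 fun x hx hx' => hx'.2 hx
    · by_cases h : x ∈ S
      · exact .inl h
      · exact .inr ⟨hx, h⟩
    · obtain ⟨x, hxN, hxΩ⟩ := hNΩ
      exact ⟨x, hxΩ, N, hN, hxN, controlled_self N⟩
  refine hK.induction_on (p := Controlled g Ω N) ((controlled_self N).mono (empty_subset _))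
    (fun s t hst ht => ht.mono hst) (fun s t hs ht => hs.union ht) fun x hx => ?_
  obtain ⟨U, hU, hxU, h⟩ := hΩS (hKΩ hx)
  exact ⟨U, mem_nhdsWithin_of_mem_nhds (hU.mem_nhds hxU), h⟩

/-- The difference of `u y` and the average is the average of `u y - u x` over `x`, so the double
integral of `poincare_ball` bounds it. -/
theorem lintegral_sub_average_le {O : Set (Model m)} {u : Model m → ℝ}
    {Z : Model m → Model m →L[ℝ] ℝ} (h : IsWeakDeriv O u Z) (hO : IsOpen O) {y₀ : Model m} {r : ℝ}
    (hr : 0 < r) (hB : Metric.closedBall y₀ r ⊆ O) :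
    ∫⁻ y in Metric.ball y₀ r, ‖u y - ⨍ x in Metric.ball y₀ r, u x‖ₑ ≤
      (volume (Metric.ball y₀ r))⁻¹ * (ENNReal.ofReal (2 * r) *
        volume (Metric.ball (0 : Model m) (2 * r)) * ∫⁻ x in Metric.ball y₀ r, ‖Z x‖ₑ) := by
  set B := Metric.ball y₀ r with hBdef
  have hBO : B ⊆ O := Metric.ball_subset_closedBall.trans hB
  have hui : IntegrableOn u B := (h.locInt.integrableOn_compact_subset hB
    (isCompact_closedBall _ _)).mono_set Metric.ball_subset_closedBall
  have hB0 : volume B ≠ 0 := (Metric.measure_ball_pos volume y₀ hr).ne'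
  have hBt : volume B ≠ ⊤ := measure_ball_lt_top.ne
  have hP := h.poincare_ball hO hBO le_rfl
  simp only [ENNReal.rpow_one] at hP
  have hpt : ∀ y, ‖u y - ⨍ x in B, u x‖ₑ ≤ (volume B)⁻¹ * ∫⁻ x in B, ‖u x - u y‖ₑ := fun y => by
    have h1 : u y - ⨍ x in B, u x = -(volume.real B)⁻¹ * ∫ x in B, (u x - u y) := by
      rw [integral_sub hui (integrableOn_const hBt), setIntegral_const, setAverage_eq, smul_eq_mul,
        smul_eq_mul]
      have : volume.real B ≠ 0 := (ENNReal.toReal_pos hB0 hBt).ne'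
      field_simp
      ring
    rw [h1, enorm_mul, enorm_neg]
    have h2 : ‖(volume.real B)⁻¹‖ₑ = (volume B)⁻¹ := by
      rw [Real.enorm_eq_ofReal (by positivity), measureReal_def, ENNReal.ofReal_inv_of_pos
        (ENNReal.toReal_pos hB0 hBt), ENNReal.ofReal_toReal hBt]
    rw [h2]
    gcongr
    exact enorm_integral_le_lintegral_enorm _
  calc ∫⁻ y in B, ‖u y - ⨍ x in B, u x‖ₑ ≤ ∫⁻ y in B, (volume B)⁻¹ * ∫⁻ x in B, ‖u x - u y‖ₑ :=
        lintegral_mono hpt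
    _ = (volume B)⁻¹ * ∫⁻ y in B, ∫⁻ x in B, ‖u x - u y‖ₑ :=
        lintegral_const_mul' _ _ (ENNReal.inv_ne_top.2 hB0)
    _ ≤ _ := by gcongr

/-- The local Poincaré inequality on a connected open set. -/
theorem exists_local_poincare [SecondCountableTopology M] (g : RMetric m M) (hΩ : IsOpen Ω)
    (hconn : IsConnected Ω) :
    ∃ A : (M → ℝ) → ℝ, (∀ u v, LocallyIntegrableOn u Ω (vol g) → LocallyIntegrableOn v Ω (vol g) →
      A (u - v) = A u - A v) ∧
      ∀ K, IsCompact K → K ⊆ Ω → ∃ (C : NNReal) (K' : Set M), IsCompact K' ∧ K' ⊆ Ω ∧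
        ∀ u (Y : VField m M), IsWeakGradient g Ω u Y → ∫⁻ x in K, ‖u x - A u‖ₑ ∂(vol g) ≤
          C * ∫⁻ x in K', ENNReal.ofReal (nrm g x (Y x)) ∂(vol g) := by
  obtain ⟨x₀, hx₀⟩ := hconn.nonempty
  set c := chartAt (Model m) x₀ with hcdef
  have hc : c ∈ atlas (Model m) M := chart_mem_atlas _ _
  have hxc : x₀ ∈ c.source := mem_chart_source _ _
  obtain ⟨r, hr, hrΩ⟩ := exists_ball_subset_chartDom c hΩ hx₀ hxc
  set B := Metric.ball (c x₀) r with hB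
  have hBK : B ⊆ Metric.closedBall (c x₀) r := Metric.ball_subset_closedBall
  have hKc : Metric.closedBall (c x₀) r ⊆ c.target := hrΩ.trans inter_subset_left
  have hint : ∀ u, LocallyIntegrableOn u Ω (vol g) → IntegrableOn (fun y => u (c.symm y)) B :=
    fun u hu => ((locallyIntegrableOn_comp_symm hΩ hc hu).integrableOn_compact_subset hrΩ
      (isCompact_closedBall _ _)).mono_set hBK
  have hN : IsOpen (c.symm '' B) := c.symm.isOpen_image_of_subset_source Metric.isOpen_ball
    ((hBK.trans hrΩ).trans inter_subset_left)
  have hNΩ : c.symm '' Metric.closedBall (c x₀) r ⊆ Ω := by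
    rintro _ ⟨y, hy, rfl⟩
    exact (hrΩ hy).2
  have hx₀N : x₀ ∈ c.symm '' B := ⟨c x₀, Metric.mem_ball_self hr, c.left_inv hxc⟩
  -- The constant is the Lebesgue average in one fixed coordinate ball, so it depends linearly on
  -- `u` and is the same for every `K`.
  refine ⟨fun u => ⨍ y in B, u (c.symm y), fun u v hu hv => ?_, fun K hK hKΩ => ?_⟩
  · simp only [setAverage_eq]
    rw [← smul_sub, ← integral_sub (hint u hu) (hint v hv)]
    rfl
  obtain ⟨C, K', hK', hK'Ω, hC⟩ := controlled_of_isCompact (g := g) hΩ hconn.isPreconnected hN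
    ⟨x₀, hx₀N, hx₀⟩ hK hKΩ
  obtain ⟨b, hb⟩ := exists_lintegral_comparison g hc (isCompact_closedBall (c x₀) r) hKc
  obtain ⟨b', hb'⟩ := exists_lintegral_covec_le g hc (isCompact_closedBall (c x₀) r) hKc zero_le_one
  simp only [ENNReal.rpow_one] at hb'
  set D := (volume B)⁻¹ * (ENNReal.ofReal (2 * r) * volume (Metric.ball (0 : Model m) (2 * r)))
    with hD
  have hDt : D ≠ ⊤ := ENNReal.mul_ne_top
    (ENNReal.inv_ne_top.2 (Metric.measure_ball_pos volume _ hr).ne')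
    (ENNReal.mul_ne_top ENNReal.ofReal_ne_top measure_ball_lt_top.ne)
  refine ⟨C * (b * (D.toNNReal * b') + 1), c.symm '' Metric.closedBall (c x₀) r ∪ K',
    (isCompact_symm_image (isCompact_closedBall _ _) hKc).union hK', union_subset hNΩ hK'Ω,
    fun u Y hY => ?_⟩
  set a := ⨍ y in B, u (c.symm y) with ha
  -- Subtracting `a` does not change the gradient, so control from the ball extends the estimate of
  -- `u - a` to all of `K`.
  have hsub : IsWeakGradient g Ω (u - fun _ => a) Y := by
    have := hY.sub hΩ (isWeakGradient_const hΩ a)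
    rwa [sub_zero] at this
  have h1 := lintegral_sub_average_le (hY.isWeakDeriv hΩ hc) (isOpen_chartDom c hΩ) hr hrΩ
  set J := ∫⁻ x in c.symm '' Metric.closedBall (c x₀) r ∪ K', ENNReal.ofReal (nrm g x (Y x)) ∂(vol g)
  have h2 : ∫⁻ y in B, ‖covec g c Y y‖ₑ ≤ b' * J :=
    (hb' B hBK measurableSet_ball Y).trans (mul_le_mul' le_rfl
      (lintegral_mono_set ((image_mono hBK).trans subset_union_left)))
  have h3 : ∫⁻ x in c.symm '' B, ‖u x - a‖ₑ ∂(vol g) ≤ b * (D * (b' * J)) := by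
    refine (hb B hBK measurableSet_ball fun x => ‖u x - a‖ₑ).2.trans ?_
    gcongr
    refine h1.trans ?_
    rw [hD, mul_assoc (volume B)⁻¹]
    gcongr
  refine (hC _ _ hsub).trans ?_
  rw [ENNReal.coe_mul, mul_assoc]
  gcongr
  rw [ENNReal.coe_add, ENNReal.coe_one, add_mul, one_mul, ENNReal.coe_mul, ENNReal.coe_mul,
    ENNReal.coe_toNNReal hDt, mul_assoc, mul_assoc]
  exact add_le_add h3 (lintegral_mono_set subset_union_right)

end PoincareManifold

/-! ### Density of `C¹` functions on `M` in the `L¹` norm of gradients. -/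

section Density

variable {m : ℕ} {M : Type*} [TopologicalSpace M] [ChartedSpace (Model m) M]
  [IsManifold (𝓡 m) ∞ M] {g : RMetric m M}

theorem coeff_sub (c : OpenPartialHomeomorph M (Model m)) (X Y : VField m M) (y : Model m) :
    coeff c (X - Y) y = coeff c X y - coeff c Y y :=
  map_sub (mfderiv (𝓡 m) (𝓡 m) c (c.symm y) : Model m →L[ℝ] Model m) (X (c.symm y)) (Y (c.symm y))

theorem covec_sub (c : OpenPartialHomeomorph M (Model m)) (X Y : VField m M) (y : Model m) :
    covec g c (X - Y) y = covec g c X y - covec g c Y y := by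
  rw [covec, covec, covec, coeff_sub, map_sub]

theorem gradient_eq_of_eventuallyEq {v w : M → ℝ} {x : M} (h : v =ᶠ[𝓝 x] w) :
    gradient g v x = gradient g w x :=
  congrArg (fun L : Model m →L[ℝ] ℝ => ((metricAt g x).inverse L : Model m))
    (h.mfderiv_eq : (mfderiv (𝓡 m) 𝓘(ℝ, ℝ) v x : Model m →L[ℝ] ℝ) = _)

theorem gradient_const (a : ℝ) (x : M) : gradient g (fun _ => a) x = 0 := by
  have h : (mfderiv (𝓡 m) 𝓘(ℝ, ℝ) (fun _ : M => a) x : Model m →L[ℝ] ℝ) = 0 := mfderiv_const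
  exact (congrArg (fun L : Model m →L[ℝ] ℝ => ((metricAt g x).inverse L : Model m)) h).trans
    (map_zero _)

theorem gradient_add {v w : M → ℝ} {x : M} (hv : MDifferentiableAt (𝓡 m) 𝓘(ℝ, ℝ) v x)
    (hw : MDifferentiableAt (𝓡 m) 𝓘(ℝ, ℝ) w x) :
    gradient g (v + w) x = gradient g v x + gradient g w x := by
  let L : Model m →L[ℝ] ℝ := mfderiv (𝓡 m) 𝓘(ℝ, ℝ) v x
  let L' : Model m →L[ℝ] ℝ := mfderiv (𝓡 m) 𝓘(ℝ, ℝ) w x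
  have h : (mfderiv (𝓡 m) 𝓘(ℝ, ℝ) (v + w) x : Model m →L[ℝ] ℝ) = L + L' := mfderiv_add hv hw
  exact (congrArg (fun L : Model m →L[ℝ] ℝ => ((metricAt g x).inverse L : Model m)) h).trans
    (map_add _ _ _)

theorem gradient_sum {ι : Type*} (S : Finset ι) {χ : ι → M → ℝ} {x : M}
    (h : ∀ i ∈ S, MDifferentiableAt (𝓡 m) 𝓘(ℝ, ℝ) (χ i) x) :
    gradient g (fun x => ∑ i ∈ S, χ i x) x = ∑ i ∈ S, gradient g (χ i) x := by
  classical
  have key : MDifferentiableAt (𝓡 m) 𝓘(ℝ, ℝ) (fun x => ∑ i ∈ S, χ i x) x ∧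
      gradient g (fun x => ∑ i ∈ S, χ i x) x = ∑ i ∈ S, gradient g (χ i) x := by
    induction S using Finset.induction_on with
    | empty => exact ⟨by simpa using mdifferentiableAt_const, by simpa using gradient_const 0 x⟩
    | insert a S ha ih =>
      obtain ⟨h1, h2⟩ := ih fun i hi => h i (Finset.mem_insert_of_mem hi)
      have h3 := h a (Finset.mem_insert_self a S)
      have e : (fun x => ∑ i ∈ insert a S, χ i x) = χ a + fun x => ∑ i ∈ S, χ i x :=
        funext fun x => Finset.sum_insert ha
      rw [e, gradient_add h3 h1, h2, Finset.sum_insert ha]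
      exact ⟨h3.add h1, rfl⟩
  exact key.2

theorem contMDiff_indicator_comp [T2Space M] {c : OpenPartialHomeomorph M (Model m)}
    (hc : c ∈ atlas (Model m) M) {w : Model m → ℝ} (hw : ContDiff ℝ 1 w)
    {K : Set (Model m)} (hK : IsCompact K) (hKc : K ⊆ c.target) (h0 : ∀ y, y ∉ K → w y = 0) :
    ContMDiff (𝓡 m) 𝓘(ℝ, ℝ) 1 (c.source.indicator fun x => w (c x)) := by
  intro x
  by_cases hx : x ∈ c.source
  · have hcs : ContMDiffOn (𝓡 m) (𝓡 m) 1 c c.source :=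
      (contMDiffOn_of_mem_maximalAtlas (n := ∞) (IsManifold.subset_maximalAtlas hc)).of_le
        (by exact_mod_cast le_top)
    have h1 : ContMDiffOn (𝓡 m) 𝓘(ℝ, ℝ) 1 (fun x => w (c x)) c.source :=
      hw.contMDiff.comp_contMDiffOn hcs
    refine (h1.contMDiffAt (c.open_source.mem_nhds hx)).congr_of_eventuallyEq ?_
    filter_upwards [c.open_source.mem_nhds hx] with z hz
    rw [indicator_of_mem hz]
  · have hKi : IsClosed (c.symm '' K) :=
      (hK.image_of_continuousOn (c.continuousOn_symm.mono hKc)).isClosed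
    have hxK : x ∉ c.symm '' K := by
      rintro ⟨y, hy, rfl⟩
      exact hx (c.map_target (hKc hy))
    refine (contMDiffAt_const (c := (0 : ℝ))).congr_of_eventuallyEq ?_
    filter_upwards [hKi.isOpen_compl.mem_nhds hxK] with z hz
    by_cases hzs : z ∈ c.source
    · rw [indicator_of_mem hzs]
      exact h0 _ fun h => hz ⟨c z, h, c.left_inv hzs⟩
    · rw [indicator_of_notMem hzs]

variable [MeasurableSpace M] [BorelSpace M] [T2Space M] {Ω : Set M} {u : M → ℝ} {Y : VField m M}

/-- The field `χ Y + u grad χ` is the weak gradient of `χ u`. In the chart it becomes the weak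
derivative of a compactly cut off function, to which `exists_contDiff_approx` applies; the
approximation extends by zero to `M`. -/
theorem IsWeakGradient.exists_contMDiff_approx_of_chart (hΩ : IsOpen Ω) (h : IsWeakGradient g Ω u Y)
    (hu : IntegrableOn u Ω (vol g)) (hY : ∫⁻ x in Ω, ENNReal.ofReal (nrm g x (Y x)) ∂(vol g) < ⊤)
    {c : OpenPartialHomeomorph M (Model m)} (hc : c ∈ atlas (Model m) M) {y₀ e : Model m}
    {κ s₀ r : ℝ} (hcone : HasConeAt (chartDom c Ω) y₀ e κ s₀ r)
    (hrc : Metric.closedBall y₀ r ⊆ c.target) {χ : M → ℝ} (hχ : ContMDiff (𝓡 m) 𝓘(ℝ, ℝ) 1 χ)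
    (hχU : tsupport χ ⊆ c.symm '' Metric.ball y₀ r) {η : ℝ≥0∞} (hη : η ≠ 0) :
    ∃ v : M → ℝ, ContMDiff (𝓡 m) 𝓘(ℝ, ℝ) 1 v ∧ ∫⁻ x in Ω, ENNReal.ofReal (nrm g x
      (((fun x => χ x • Y x) + (fun x => u x • gradient g χ x) - gradient g v : VField m M) x))
        ∂(vol g) ≤ η := by
  set O := chartDom c Ω with hO
  have hOo : IsOpen O := isOpen_chartDom c hΩ
  set B := Metric.ball y₀ r with hB
  have hBK : B ⊆ Metric.closedBall y₀ r := Metric.ball_subset_closedBall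
  have hBc : B ⊆ c.target := hBK.trans hrc
  have hUs : c.symm '' B ⊆ c.source := symm_image_subset_source hBc
  have htc : IsCompact (tsupport χ) :=
    (isCompact_symm_image (isCompact_closedBall y₀ r) hrc).of_isClosed_subset (isClosed_tsupport _)
      (hχU.trans (image_mono hBK))
  set K := c '' tsupport χ with hK
  have hKcpt : IsCompact K := htc.image_of_continuousOn (c.continuousOn.mono (hχU.trans hUs))
  have hKB : K ⊆ B := by
    rintro _ ⟨x, hx, rfl⟩
    obtain ⟨y, hy, rfl⟩ := hχU hx
    rwa [c.right_inv (hBc hy)]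
  have hχ0 : ∀ y ∈ c.target, y ∉ K → χ (c.symm y) = 0 := fun y hy hyK =>
    image_eq_zero_of_notMem_tsupport fun h => hyK ⟨_, h, c.right_inv hy⟩
  set χ' : Model m → ℝ := c.target.indicator fun y => χ (c.symm y) with hχ'
  have hcd : chartDom c (univ : Set M) = c.target := by simp [chartDom]
  have hχs : ContDiffOn ℝ 1 (fun y => χ (c.symm y)) c.target := by
    have := contDiffOn_comp_symm (Ω := univ) hc hχ.contMDiffOn
    rwa [hcd] at this
  have hχ's : ContDiff ℝ 1 χ' := contDiff_indicator_of_eq_zero_off_compact c.open_target hχs hKcpt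
    (hKB.trans hBc) hχ0
  have hχ'0 : ∀ y, y ∉ K → χ' y = 0 := fun y hy => by
    by_cases hyt : y ∈ c.target
    · rw [hχ', indicator_of_mem hyt, hχ0 y hyt hy]
    · rw [hχ', indicator_of_notMem hyt]
  have hdχ'0 : ∀ y, y ∉ K → fderiv ℝ χ' y = 0 := fun y hy => by
    have : χ' =ᶠ[𝓝 y] fun _ => 0 := by
      filter_upwards [hKcpt.isClosed.isOpen_compl.mem_nhds hy] with z hz using hχ'0 z hz
    rw [this.fderiv_eq, fderiv_const_apply]
  have hw := h.isWeakDeriv hΩ hc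
  have hOB : MeasurableSet (O ∩ B) := hOo.measurableSet.inter measurableSet_ball
  have hOBK : O ∩ B ⊆ Metric.closedBall y₀ r := inter_subset_right.trans hBK
  have hOBΩ : c.symm '' (O ∩ B) ⊆ Ω := by
    rintro _ ⟨y, hy, rfl⟩
    exact hy.1.2
  obtain ⟨b, hb⟩ := exists_lintegral_comparison g hc (isCompact_closedBall y₀ r) hrc
  obtain ⟨b₁, hb₁⟩ := exists_lintegral_covec_le g hc (isCompact_closedBall y₀ r) hrc zero_le_one
  obtain ⟨b₂, hb₂⟩ := exists_lintegral_nrm_le g hc (isCompact_closedBall y₀ r) hrc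
  simp only [ENNReal.rpow_one] at hb₁
  have hui : IntegrableOn (fun y => u (c.symm y)) (O ∩ B) := by
    refine ⟨hw.locInt.aestronglyMeasurable.mono_measure
      (Measure.restrict_mono inter_subset_left le_rfl), ?_⟩
    refine ((hb _ hOBK hOB fun x => ‖u x‖ₑ).1).trans_lt (ENNReal.mul_lt_top ENNReal.coe_lt_top ?_)
    exact (lintegral_mono_set hOBΩ).trans_lt hu.2
  have hZi : IntegrableOn (covec g c Y) (O ∩ B) := by
    refine ⟨hw.locInt_deriv.aestronglyMeasurable.mono_measure
      (Measure.restrict_mono inter_subset_left le_rfl), ?_⟩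
    refine (hb₁ _ hOBK hOB Y).trans_lt (ENNReal.mul_lt_top ENNReal.coe_lt_top ?_)
    exact (lintegral_mono_set hOBΩ).trans_lt hY
  have hcK := isCompact_closedBall y₀ r
  have hχ'c := hχ's.continuous.continuousOn (s := Metric.closedBall y₀ r)
  have hdχ'c := (hχ's.continuous_fderiv one_ne_zero).continuousOn (s := Metric.closedBall y₀ r)
  have hu1 : IntegrableOn (fun y => χ' y * u (c.symm y)) O :=
    (hui.continuousOn_mul_of_subset hχ'c hcK hOB hOBK).of_forall_sdiff_eq_zero hOo.measurableSet
      fun y hy => by rw [hχ'0 y fun hyK => hy.2 ⟨hy.1, hKB hyK⟩, zero_mul]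
  have hZ1 : IntegrableOn (fun y => χ' y • covec g c Y y + u (c.symm y) • fderiv ℝ χ' y) O :=
    ((hZi.continuousOn_smul_of_subset hχ'c hcK hOB hOBK).add
      (hui.smul_continuousOn_of_subset hdχ'c hOB hcK hOBK)).of_forall_sdiff_eq_zero
      hOo.measurableSet fun y hy => by
        have hyK : y ∉ K := fun hyK => hy.2 ⟨hy.1, hKB hyK⟩
        simp only [Pi.add_apply]
        rw [hχ'0 y hyK, hdχ'0 y hyK, zero_smul, smul_zero, add_zero]
  obtain ⟨η', hη', hη'b⟩ : ∃ η' : ℝ≥0∞, η' ≠ 0 ∧ b₂ * η' ≤ η := by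
    obtain ⟨τ, hτ, hτ'⟩ := ENNReal.exists_nnreal_pos_mul_lt (ENNReal.coe_ne_top (r := b₂)) hη
    exact ⟨τ, by simpa using hτ.ne', by rw [mul_comm]; exact hτ'.le⟩
  obtain ⟨w, hws, hwc, hwB, hwη⟩ := (hw.contDiff_smul hOo hχ's).exists_contDiff_approx hOo hu1 hZ1
    hKcpt Metric.isOpen_ball hKB
    (fun y _ hyK => by rw [hχ'0 y hyK, zero_mul])
    (fun y _ hyK => by rw [hχ'0 y hyK, hdχ'0 y hyK, zero_smul, smul_zero, add_zero])
    hcone.1 hcone.2.1 hcone.2.2.2 hη'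
  set v : M → ℝ := c.source.indicator fun x => w (c x) with hv
  have hvs : ContMDiff (𝓡 m) 𝓘(ℝ, ℝ) 1 v := contMDiff_indicator_comp hc hws hwc.isCompact
    (hwB.trans hBc) fun y hy => image_eq_zero_of_notMem_tsupport hy
  refine ⟨v, hvs, ?_⟩
  set G : VField m M := (fun x => χ x • Y x) + (fun x => u x • gradient g χ x) - gradient g v with hG
  -- All three terms are supported in the coordinate ball, so the global integral reduces to `O ∩
  -- B`.
  have hG0 : ∀ x, x ∉ c.symm '' B → G x = 0 := fun x hx => by
    have hxχ : x ∉ tsupport χ := fun h => hx (hχU h)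
    have e1 : χ x = 0 := image_eq_zero_of_notMem_tsupport hxχ
    have e2 : gradient g χ x = 0 := by
      have : χ =ᶠ[𝓝 x] fun _ => 0 := notMem_tsupport_iff_eventuallyEq.1 hxχ
      rw [gradient_eq_of_eventuallyEq this, gradient_const]
    have hxw : x ∉ c.symm '' tsupport w := fun h => hx (image_mono hwB h)
    have hcl : IsClosed (c.symm '' tsupport w) :=
      (isCompact_symm_image hwc.isCompact (hwB.trans hBc)).isClosed
    have e3 : gradient g v x = 0 := by
      have : v =ᶠ[𝓝 x] fun _ => 0 := by
        filter_upwards [hcl.isOpen_compl.mem_nhds hxw] with z hz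
        by_cases hzs : z ∈ c.source
        · rw [hv, indicator_of_mem hzs]
          exact image_eq_zero_of_notMem_tsupport fun h => hz ⟨c z, h, c.left_inv hzs⟩
        · rw [hv, indicator_of_notMem hzs]
      rw [gradient_eq_of_eventuallyEq this, gradient_const]
    change χ x • Y x + u x • gradient g χ x - gradient g v x = 0
    rw [e1, e2, e3, zero_smul, smul_zero, add_zero, sub_zero]
  have hcov : ∀ y ∈ O ∩ B, covec g c G y =
      (χ' y • covec g c Y y + u (c.symm y) • fderiv ℝ χ' y) - fderiv ℝ w y := fun y hy => by
    have hyt : y ∈ c.target := hy.1.1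
    have e1 : (fun y => χ (c.symm y)) =ᶠ[𝓝 y] χ' := by
      filter_upwards [c.open_target.mem_nhds hyt] with z hz
      rw [hχ', indicator_of_mem hz]
    have e2 : (fun y => v (c.symm y)) =ᶠ[𝓝 y] w := by
      filter_upwards [c.open_target.mem_nhds hyt] with z hz
      rw [hv, indicator_of_mem (c.map_target hz), c.right_inv hz]
    rw [hG, covec_sub, covec_add, covec_smul, covec_smul,
      covec_gradient g hc hyt (hχ.mdifferentiableAt one_ne_zero),
      covec_gradient g hc hyt (hvs.mdifferentiableAt one_ne_zero), e1.fderiv_eq, e2.fderiv_eq,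
      e1.eq_of_nhds]
  have hsplit : ∫⁻ x in Ω, ENNReal.ofReal (nrm g x (G x)) ∂(vol g) ≤
      ∫⁻ x in c.symm '' (O ∩ B), ENNReal.ofReal (nrm g x (G x)) ∂(vol g) := by
    have hm := measurableSet_symm_image c (hOBK.trans hrc) hOB
    rw [← lintegral_indicator hm, ← lintegral_indicator hΩ.measurableSet]
    refine lintegral_mono fun x => ?_
    by_cases hxΩ : x ∈ Ω
    · by_cases hxB : x ∈ c.symm '' B
      · obtain ⟨y, hy, rfl⟩ := hxB
        rw [indicator_of_mem hxΩ, 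
          indicator_of_mem (show c.symm y ∈ c.symm '' (O ∩ B) from ⟨y, ⟨⟨hBc hy, hxΩ⟩, hy⟩, rfl⟩)]
      · rw [indicator_of_mem hxΩ, (congrArg (nrm g x) (hG0 x hxB)).trans (nrm_zero g x)]
        simp
    · rw [indicator_of_notMem hxΩ]
      exact zero_le
  refine hsplit.trans ((hb₂ _ hOBK hOB G).trans (le_trans ?_ hη'b))
  refine mul_le_mul' le_rfl (le_trans ?_ hwη)
  calc ∫⁻ y in O ∩ B, ‖covec g c G y‖ₑ
      = ∫⁻ y in O ∩ B, ‖fderiv ℝ w y - (χ' y • covec g c Y y + u (c.symm y) • fderiv ℝ χ' y)‖ₑ := by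
        refine setLIntegral_congr_fun hOB fun y hy => ?_
        simp only [hcov y hy]
        exact enorm_sub_rev _ _
    _ ≤ _ := lintegral_mono_set inter_subset_left

/-- A finite partition of unity on the compact closure of `Ω`, subordinate to coordinate balls with
the cone condition, glues the local approximations. -/
theorem IsWeakGradient.exists_contMDiff_approx [SecondCountableTopology M] (hΩ : IsOpen Ω)
    (hcpt : IsCompact (closure Ω)) (hbd : HasSmoothBoundary m Ω) (h : IsWeakGradient g Ω u Y)
    (hu : IntegrableOn u Ω (vol g)) (hY : ∫⁻ x in Ω, ENNReal.ofReal (nrm g x (Y x)) ∂(vol g) < ⊤)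
    {η : ℝ≥0∞} (hη : η ≠ 0) :
    ∃ v : M → ℝ, ContMDiff (𝓡 m) 𝓘(ℝ, ℝ) 1 v ∧
      ∫⁻ x in Ω, ENNReal.ofReal (nrm g x ((Y - gradient g v) x)) ∂(vol g) ≤ η := by
  have : LocallyCompactSpace M := ChartedSpace.locallyCompactSpace (Model m) M
  have hloc : ∀ q : closure Ω, ∃ c ∈ atlas (Model m) M, ∃ (y₀ e : Model m) (κ s₀ r : ℝ),
      HasConeAt (chartDom c Ω) y₀ e κ s₀ r ∧ Metric.closedBall y₀ r ⊆ c.target ∧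
        (q : M) ∈ c.symm '' Metric.ball y₀ r := by
    rintro ⟨q, hq⟩
    have hqc : q ∈ (chartAt (Model m) q).source := mem_chart_source _ _
    obtain ⟨e, κ, s₀, r₀, hcone⟩ := hasConeAt_chartDom hΩ hbd (chart_mem_atlas (Model m) q)
      ((chartAt (Model m) q).map_source hqc) (by rwa [(chartAt (Model m) q).left_inv hqc])
    obtain ⟨R, hR, hRc⟩ := Metric.nhds_basis_closedBall.mem_iff.1
      ((chartAt (Model m) q).open_target.mem_nhds ((chartAt (Model m) q).map_source hqc))
    have hr0 : 0 < min r₀ R := lt_min hcone.2.2.1 hR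
    exact ⟨_, chart_mem_atlas (Model m) q, _, e, κ, s₀, min r₀ R,
      hcone.mono hcone.2.1 le_rfl hr0 (min_le_left _ _),
      (Metric.closedBall_subset_closedBall (min_le_right _ _)).trans hRc,
      _, Metric.mem_ball_self hr0, (chartAt (Model m) q).left_inv hqc⟩
  choose c hc y₀ e κ s₀ r hcone hrc hq using hloc
  set U : closure Ω → Set M := fun q => (c q).symm '' Metric.ball (y₀ q) (r q) with hU
  have hUo : ∀ q, IsOpen (U q) := fun q =>
    (c q).symm.isOpen_image_of_subset_source Metric.isOpen_ball
      (Metric.ball_subset_closedBall.trans (hrc q))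
  obtain ⟨t, ht⟩ := hcpt.elim_finite_subcover U hUo fun x hx => mem_iUnion.2 ⟨⟨x, hx⟩, hq ⟨x, hx⟩⟩
  obtain ⟨f, hf⟩ := SmoothPartitionOfUnity.exists_isSubordinate (𝓡 m) (isClosed_closure (s := Ω))
    (fun i : t => U i) (fun i => hUo i) fun x hx => by
      obtain ⟨i, hi, hxi⟩ := mem_iUnion₂.1 (ht hx)
      exact mem_iUnion.2 ⟨⟨i, hi⟩, hxi⟩
  have hfs : ∀ i, ContMDiff (𝓡 m) 𝓘(ℝ, ℝ) 1 (f i) := fun i =>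
    (f i).contMDiff.of_le (by exact_mod_cast le_top)
  have hη' : η / (Fintype.card t + 1 : ℕ) ≠ 0 :=
    (ENNReal.div_pos hη (ENNReal.natCast_ne_top _)).ne'
  choose v hvs hv using fun i : t => h.exists_contMDiff_approx_of_chart hΩ hu hY (hc i) (hcone i)
    (hrc i) (hfs i) (hf i) hη'
  set G : t → VField m M := fun i =>
    (fun x => f i x • Y x) + (fun x => u x • gradient g (f i) x) - gradient g (v i) with hG
  -- The functions `f i` add up to `1` near every point of the open set `Ω`, so their gradients
  -- cancel and the local fields add up to `Y`.
  have hsum : ∀ x ∈ Ω, (Y - gradient g fun x => ∑ i, v i x) x = ∑ i, G i x := fun x hx => by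
    have e1 : ∀ z ∈ Ω, ∑ i, f i z = 1 := fun z hz => by
      rw [← finsum_eq_sum_of_fintype]
      exact f.sum_eq_one (subset_closure hz)
    have e2 : ∑ i, gradient g (f i) x = 0 := by
      rw [← gradient_sum Finset.univ fun i _ => (hfs i).mdifferentiableAt one_ne_zero]
      have : (fun x => ∑ i, f i x) =ᶠ[𝓝 x] fun _ => 1 := by
        filter_upwards [hΩ.mem_nhds hx] with z hz using e1 z hz
      rw [gradient_eq_of_eventuallyEq this, gradient_const]
    have e3 : gradient g (fun x => ∑ i, v i x) x = ∑ i, gradient g (v i) x :=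
      gradient_sum Finset.univ fun i _ => (hvs i).mdifferentiableAt one_ne_zero
    have e4 : ∑ i, G i x = ∑ i, (f i x • Y x + u x • gradient g (f i) x - gradient g (v i) x) := rfl
    rw [e4, Finset.sum_sub_distrib, Finset.sum_add_distrib, ← Finset.sum_smul, ← Finset.smul_sum,
      e1 x hx, e2, smul_zero, add_zero, one_smul, ← e3]
    rfl
  have hGm : ∀ i, AEMeasurable (fun x => ENNReal.ofReal (nrm g x (G i x))) ((vol g).restrict Ω) :=
    fun i => by
      refine (IsMeasField.aemeasurable_nrm hΩ ?_).ennreal_ofReal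
      refine (((h.meas.smul (hfs i).continuous.measurable.aemeasurable).add
        (IsMeasField.smul hu.aemeasurable ?_)).sub ?_)
      · exact (isWeakGradient_gradient hΩ (hfs i).contMDiffOn).meas
      · exact (isWeakGradient_gradient hΩ (hvs i).contMDiffOn).meas
  refine ⟨fun x => ∑ i, v i x, ?_, ?_⟩
  · exact contMDiff_finsetSum fun i _ => hvs i
  calc ∫⁻ x in Ω, ENNReal.ofReal (nrm g x ((Y - gradient g fun x => ∑ i, v i x) x)) ∂(vol g)
      ≤ ∫⁻ x in Ω, ∑ i, ENNReal.ofReal (nrm g x (G i x)) ∂(vol g) := by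
        refine setLIntegral_mono' hΩ.measurableSet fun x hx => ?_
        refine le_of_le_of_eq (ENNReal.ofReal_le_ofReal ?_)
          (ENNReal.ofReal_sum_of_nonneg fun i _ => nrm_nonneg g x (G i x))
        exact (congrArg (nrm g x) (hsum x hx)).trans_le (nrm_sum_le g x _ _)
    _ = ∑ i, ∫⁻ x in Ω, ENNReal.ofReal (nrm g x (G i x)) ∂(vol g) :=
        lintegral_finsetSum' _ fun i _ => hGm i
    _ ≤ ∑ _i : t, η / (Fintype.card t + 1 : ℕ) := Finset.sum_le_sum fun i _ => hv i
    _ ≤ (Fintype.card t + 1 : ℕ) * (η / (Fintype.card t + 1 : ℕ)) := by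
        rw [Finset.sum_const, nsmul_eq_mul, Finset.card_univ]
        gcongr
        exact Nat.le_succ _
    _ ≤ η := ENNReal.mul_div_le

end Density

/-! ### Limits of weak gradients. -/

section Limits

variable {m : ℕ} {M : Type*} [TopologicalSpace M] [ChartedSpace (Model m) M]
  [IsManifold (𝓡 m) ∞ M] {g : RMetric m M}

/-- At a single point all norms are comparable. The constant may depend on `x`, as it is used for
pointwise convergence only. -/
theorem exists_norm_le_nrm (g : RMetric m M) (x : M) : ∃ a : ℝ, ∀ v : Model m, ‖v‖ ≤ a * nrm g x v := by
  obtain ⟨e, he⟩ := exists_equiv_of_pos (B := metricAt g x) fun v hv => g.pos x v hv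
  have h1 : ∀ v : Model m, nrm g x v ≤ √‖metricAt g x‖ * ‖v‖ := fun v => by
    refine abs_le_of_sq_le_sq' ?_ (by positivity) |>.2
    have h2 := (le_abs_self _).trans ((metricAt g x).le_opNorm₂ v v)
    have h3 : 0 ≤ ‖metricAt g x‖ := ContinuousLinearMap.opNorm_nonneg _
    generalize ‖metricAt g x‖ = S at h2 h3
    rw [nrm_sq, mul_pow, Real.sq_sqrt h3, pow_two ‖v‖, ← mul_assoc]
    exact h2
  refine ⟨‖(e.symm : (Model m →L[ℝ] ℝ) →L[ℝ] Model m)‖ * √‖metricAt g x‖, fun v => ?_⟩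
  have h2 : ‖metricAt g x v‖ ≤ √‖metricAt g x‖ * nrm g x v := by
    refine ContinuousLinearMap.opNorm_le_bound _ (mul_nonneg (by positivity) (nrm_nonneg g x v))
      fun w => ?_
    calc |metricAt g x v w| ≤ nrm g x v * nrm g x w := abs_metricAt_le g x v w
      _ ≤ nrm g x v * (√‖metricAt g x‖ * ‖w‖) :=
        mul_le_mul_of_nonneg_left (h1 w) (nrm_nonneg g x v)
      _ = _ := by ring
  calc ‖v‖ = ‖e.symm (metricAt g x v)‖ := by rw [← he]; simp
    _ ≤ ‖(e.symm : (Model m →L[ℝ] ℝ) →L[ℝ] Model m)‖ * ‖metricAt g x v‖ :=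
        (e.symm : (Model m →L[ℝ] ℝ) →L[ℝ] Model m).le_opNorm _
    _ ≤ _ := by rw [mul_assoc]; gcongr

theorem continuous_nrm (g : RMetric m M) (x : M) : Continuous (nrm g x) := by
  have : Continuous fun v : Model m => √(metricAt g x v v) :=
    ((metricAt g x).continuous.clm_apply continuous_id).sqrt
  exact this

theorem exists_tendsto_of_summable_nrm {x : M} {v : ℕ → Model m}
    (h : Summable fun k => nrm g x (v k - v (k + 1))) : ∃ L, Filter.Tendsto v .atTop (𝓝 L) := by
  obtain ⟨a, ha⟩ := exists_norm_le_nrm g x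
  refine cauchySeq_tendsto_of_complete (cauchySeq_of_summable_dist ?_)
  exact Summable.of_nonneg_of_le (fun k => dist_nonneg)
    (fun k => by rw [dist_eq_norm]; exact ha _) (h.mul_left a)

theorem lintegral_le_of_tendsto_ae {α : Type*} [MeasurableSpace α] {μ : Measure α}
    {F : ℕ → α → ℝ≥0∞} {f : α → ℝ≥0∞} {b : ℝ≥0∞} (hF : ∀ n, AEMeasurable (F n) μ)
    (hlim : ∀ᵐ x ∂μ, Filter.Tendsto (fun n => F n x) .atTop (𝓝 (f x)))
    (hb : ∀ᶠ n in .atTop, ∫⁻ x, F n x ∂μ ≤ b) : ∫⁻ x, f x ∂μ ≤ b := by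
  calc ∫⁻ x, f x ∂μ = ∫⁻ x, Filter.liminf (fun n => F n x) .atTop ∂μ :=
        lintegral_congr_ae (hlim.mono fun x hx => hx.liminf_eq.symm)
    _ ≤ Filter.liminf (fun n => ∫⁻ x, F n x ∂μ) .atTop := lintegral_liminf_le' hF
    _ ≤ b := Filter.liminf_le_of_frequently_le' hb.frequently

theorem exists_compact_exhaustion [LocallyCompactSpace M] [SecondCountableTopology M] {Ω : Set M}
    (hΩ : IsOpen Ω) : ∃ K : ℕ → Set M, (∀ n, IsCompact (K n)) ∧ Monotone K ∧ (⋃ n, K n) = Ω := by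
  have : LocallyCompactSpace Ω := hΩ.locallyCompactSpace
  refine ⟨fun n => Subtype.val '' compactCovering Ω n,
    fun n => (isCompact_compactCovering Ω n).image continuous_subtype_val,
    fun a b hab => image_mono (compactCovering_subset Ω hab), ?_⟩
  rw [← image_iUnion, iUnion_compactCovering, image_univ, Subtype.range_coe]

/-- One subsequence serves all compact sets: its `k`-th step is at most `2⁻ᵏ` on the `k`-th set of
an exhaustion. On the fixed set `K j` the steps from `j` on then have a convergent sum in `L¹`,
hence almost everywhere. -/
theorem exists_summable_subseq [LocallyCompactSpace M] [SecondCountableTopology M]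
    [MeasurableSpace M] [BorelSpace M] [T2Space M] {μ : Measure M} {Ω : Set M} (hΩ : IsOpen Ω)
    {d : ℕ → ℕ → M → ℝ} (hd0 : ∀ a b x, 0 ≤ d a b x)
    (hd : ∀ a b, AEMeasurable (d a b) (μ.restrict Ω))
    (hC : ∀ K, IsCompact K → K ⊆ Ω → ∀ ε : ℝ≥0∞, ε ≠ 0 → ∃ N, ∀ a ≥ N, ∀ b ≥ N,
      ∫⁻ x in K, ENNReal.ofReal (d a b x) ∂μ ≤ ε) :
    ∃ φ : ℕ → ℕ, StrictMono φ ∧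
      ∀ᵐ x ∂(μ.restrict Ω), Summable fun k => d (φ k) (φ (k + 1)) x := by
  obtain ⟨K, hK, hKm, hKΩ⟩ := exists_compact_exhaustion hΩ
  have hKsub : ∀ n, K n ⊆ Ω := fun n => hKΩ ▸ subset_iUnion K n
  have hε : ∀ k : ℕ, ((2 : ℝ≥0∞)⁻¹) ^ k ≠ 0 := fun k => pow_ne_zero _ (by simp)
  obtain ⟨φ, hφ, hφK⟩ := Filter.extraction_forall_of_eventually (P := fun k n => ∀ a ≥ n, ∀ b ≥ n,
    ∫⁻ x in K k, ENNReal.ofReal (d a b x) ∂μ ≤ ((2 : ℝ≥0∞)⁻¹) ^ k) fun k => by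
      obtain ⟨N, hN⟩ := hC (K k) (hK k) (hKsub k) _ (hε k)
      filter_upwards [Filter.eventually_ge_atTop N] with n hn a ha b hb
      exact hN a (le_trans hn ha) b (le_trans hn hb)
  refine ⟨φ, hφ, ?_⟩
  rw [← hKΩ, ae_restrict_iUnion_iff]
  intro j
  have hm : ∀ k, AEMeasurable (fun x => ENNReal.ofReal (d (φ (k + j)) (φ (k + j + 1)) x))
      (μ.restrict (K j)) := fun k =>
    ((hd _ _).mono_measure (Measure.restrict_mono (hKsub j) le_rfl)).ennreal_ofReal
  have hfin : ∫⁻ x in K j, ∑' k, ENNReal.ofReal (d (φ (k + j)) (φ (k + j + 1)) x) ∂μ ≠ ⊤ := by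
    rw [lintegral_tsum hm]
    refine ne_top_of_le_ne_top (b := ∑' k : ℕ, ((2 : ℝ≥0∞)⁻¹) ^ k) ?_ (ENNReal.tsum_le_tsum fun k => ?_)
    · rw [ENNReal.tsum_geometric]
      simp
    · refine (lintegral_mono_set (hKm (Nat.le_add_left j k))).trans ?_
      refine (hφK (k + j) _ le_rfl _ (hφ.monotone (Nat.le_succ _))).trans ?_
      rw [pow_add]
      exact mul_le_of_le_one_right zero_le (pow_le_one₀ zero_le (by simp))
  filter_upwards [ae_lt_top' (AEMeasurable.tsum hm) hfin] with x hx
  rw [← summable_nat_add_iff j]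
  refine (ENNReal.summable_toReal hx.ne).congr fun k => ?_
  rw [ENNReal.toReal_ofReal (hd0 _ _ _), add_right_comm]

variable [MeasurableSpace M] [BorelSpace M] [T2Space M] [SecondCountableTopology M] {Ω : Set M}

theorem aestronglyMeasurable_nrm (hΩ : IsOpen Ω) {Y : VField m M} (hY : IsMeasField g Ω Y) :
    AEStronglyMeasurable (fun x => nrm g x (Y x)) ((vol g).restrict Ω) :=
  (hY.aemeasurable_nrm hΩ).aestronglyMeasurable

/-- Weak gradients are stable under local `L¹` convergence. -/
theorem isWeakGradient_of_tendsto (hΩ : IsOpen Ω) {u : ℕ → M → ℝ} {Y : ℕ → VField m M}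
    (h : ∀ n, IsWeakGradient g Ω (u n) (Y n)) {v : M → ℝ} {Z : VField m M}
    (hv : LocallyIntegrableOn v Ω (vol g)) (hZ : IsMeasField g Ω Z)
    (hZi : LocallyIntegrableOn (fun x => nrm g x (Z x)) Ω (vol g))
    (huv : ∀ K, IsCompact K → K ⊆ Ω →
      Filter.Tendsto (fun n => ∫⁻ x in K, ‖u n x - v x‖ₑ ∂(vol g)) .atTop (𝓝 0))
    (hYZ : ∀ K, IsCompact K → K ⊆ Ω → Filter.Tendsto
      (fun n => ∫⁻ x in K, ENNReal.ofReal (nrm g x ((Y n - Z) x)) ∂(vol g)) .atTop (𝓝 0)) :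
    IsWeakGradient g Ω v Z where
  locInt := hv
  meas := hZ
  locInt_norm := hZi
  integral_eq X hX hXK := by
    obtain ⟨K, hK, hKΩ, h0⟩ := hXK
    obtain ⟨S, hS⟩ := hK.bddAbove_image (continuous_nrm_of_isCField (g := g) hX).continuousOn
    obtain ⟨T, hT⟩ := hK.bddAbove_image (continuous_divergence g hX).norm.continuousOn
    have hdiv0 : ∀ x, x ∉ K → divergence g X x = 0 := fun x hx =>
      divergence_eq_zero g (by
        filter_upwards [hK.isClosed.isOpen_compl.mem_nhds hx] with z hz using h0 z hz)
    have hKm := hK.measurableSet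
    have bound : ∀ (F : M → ℝ) (f : M → ℝ≥0∞) (b : ℝ), (∀ x, x ∉ K → F x = 0) →
        (∀ x ∈ K, ‖F x‖ₑ ≤ ENNReal.ofReal b * f x) →
        ∫⁻ x in Ω, ‖F x‖ₑ ∂(vol g) ≤ ENNReal.ofReal b * ∫⁻ x in K, f x ∂(vol g) := by
      intro F f b hF0 hFb
      rw [← lintegral_const_mul' _ _ ENNReal.ofReal_ne_top, ← lintegral_indicator hKm]
      refine (setLIntegral_le_lintegral _ _).trans (lintegral_mono fun x => ?_)
      by_cases hx : x ∈ K
      · rw [indicator_of_mem hx]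
        exact hFb x hx
      · rw [indicator_of_notMem hx, hF0 x hx, enorm_zero]
    have lim0 : ∀ (b : ℝ) {f : ℕ → ℝ≥0∞}, Filter.Tendsto f .atTop (𝓝 0) →
        Filter.Tendsto (fun n => ENNReal.ofReal b * f n) .atTop (𝓝 0) := fun b f hf => by
      simpa using ENNReal.Tendsto.const_mul hf (.inr ENNReal.ofReal_ne_top)
    have t1 : Filter.Tendsto (fun n => ∫ x in Ω, metricAt g x (X x) (Y n x) ∂(vol g)) .atTop
        (𝓝 (∫ x in Ω, metricAt g x (X x) (Z x) ∂(vol g))) := by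
      refine tendsto_integral_of_L1 _ (integrableOn_inner hΩ hK hKΩ hX h0 hZ hZi).aestronglyMeasurable
        (.of_forall fun n => integrableOn_inner hΩ hK hKΩ hX h0 (h n).meas (h n).locInt_norm) ?_
      refine tendsto_of_tendsto_of_tendsto_of_le_of_le tendsto_const_nhds (lim0 S (hYZ K hK hKΩ))
        (fun n => zero_le) fun n => bound _ _ _ (fun x hx => ?_) fun x hx => ?_
      · have e : (X x : Model m) = 0 := h0 x hx
        have e' : ∀ w : Model m, metricAt g x (X x) w = 0 := fun w =>
          (congrArg (fun v : Model m => metricAt g x v w) e).trans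
            (congrArg (fun L : Model m →L[ℝ] ℝ => L w) (map_zero (metricAt g x)))
        exact (congrArg₂ (· - ·) (e' _) (e' _)).trans (sub_zero _)
      · have e : metricAt g x (X x) (Y n x) - metricAt g x (X x) (Z x) =
            metricAt g x (X x) ((Y n - Z) x) := (map_sub (metricAt g x (X x)) (Y n x) (Z x)).symm
        rw [e, ← ofReal_norm, ← ENNReal.ofReal_mul ((nrm_nonneg g x (X x)).trans
          (hS (mem_image_of_mem _ hx)))]
        refine ENNReal.ofReal_le_ofReal ((abs_metricAt_le g x _ _).trans ?_)
        exact mul_le_mul_of_nonneg_right (hS (mem_image_of_mem _ hx)) (nrm_nonneg g x _)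
    have t2 : Filter.Tendsto (fun n => ∫ x in Ω, u n x * divergence g X x ∂(vol g)) .atTop
        (𝓝 (∫ x in Ω, v x * divergence g X x ∂(vol g))) := by
      refine tendsto_integral_of_L1 _
        (integrableOn_mul_divergence g hK hKΩ hΩ hv hX h0).aestronglyMeasurable
        (.of_forall fun n => integrableOn_mul_divergence g hK hKΩ hΩ (h n).locInt hX h0) ?_
      refine tendsto_of_tendsto_of_tendsto_of_le_of_le tendsto_const_nhds (lim0 T (huv K hK hKΩ))
        (fun n => zero_le) fun n => bound _ _ _ (fun x hx => ?_) fun x hx => ?_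
      · rw [hdiv0 x hx, mul_zero, mul_zero, sub_zero]
      · rw [← sub_mul, enorm_mul, mul_comm]
        gcongr
        rw [← ofReal_norm]
        exact ENNReal.ofReal_le_ofReal (hT (mem_image_of_mem _ hx))
    have t3 := t1.congr fun n => (h n).integral_metricAt_eq hK hKΩ hX h0
    exact tendsto_nhds_unique t3 t2.neg

/-- Sobolev functions whose gradients are a local `L¹` Cauchy sequence converge, up to constants and
a subsequence. -/
theorem exists_isWeakGradient_limit (hΩ : IsOpen Ω) (hconn : IsConnected Ω) {u : ℕ → M → ℝ}
    {Y : ℕ → VField m M} (h : ∀ n, IsWeakGradient g Ω (u n) (Y n))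
    (hC : ∀ K, IsCompact K → K ⊆ Ω → ∀ ε : ℝ≥0∞, ε ≠ 0 → ∃ N, ∀ a ≥ N, ∀ b ≥ N,
      ∫⁻ x in K, ENNReal.ofReal (nrm g x ((Y a - Y b) x)) ∂(vol g) ≤ ε) :
    ∃ (v : M → ℝ) (Z : VField m M) (φ : ℕ → ℕ), StrictMono φ ∧ IsWeakGradient g Ω v Z ∧
      ∀ᵐ x ∂((vol g).restrict Ω),
        Filter.Tendsto (fun k => (Y (φ k) x : Model m)) .atTop (𝓝 (Z x : Model m)) := by
  classical
  have : LocallyCompactSpace M := ChartedSpace.locallyCompactSpace (Model m) M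
  obtain ⟨A, hA, hP⟩ := exists_local_poincare g hΩ hconn
  -- After this normalization, the Poincaré inequality makes the functions locally `L¹` Cauchy
  -- because their gradients are; linearity of `A` lets it be applied to differences.
  set w : ℕ → M → ℝ := fun n => u n - fun _ => A (u n) with hw
  have hwY : ∀ n, IsWeakGradient g Ω (w n) (Y n) := fun n => by
    have := (h n).sub hΩ (isWeakGradient_const hΩ (A (u n)))
    rwa [sub_zero] at this
  have hCw : ∀ K, IsCompact K → K ⊆ Ω → ∀ ε : ℝ≥0∞, ε ≠ 0 → ∃ N, ∀ a ≥ N, ∀ b ≥ N,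
      ∫⁻ x in K, ‖w a x - w b x‖ₑ ∂(vol g) ≤ ε := by
    intro K hK hKΩ ε hε
    obtain ⟨C, K', hK', hK'Ω, hCK⟩ := hP K hK hKΩ
    obtain ⟨τ, hτ, hτ'⟩ := ENNReal.exists_nnreal_pos_mul_lt (ENNReal.coe_ne_top (r := C)) hε
    obtain ⟨N, hN⟩ := hC K' hK' hK'Ω τ (by simpa using hτ.ne')
    refine ⟨N, fun a ha b hb => ?_⟩
    have e : ∀ x, w a x - w b x = (u a - u b) x - A (u a - u b) := fun x => by
      rw [hA _ _ (h a).locInt (h b).locInt]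
      simp only [hw, Pi.sub_apply]
      ring
    simp only [e]
    refine (hCK _ _ ((h a).sub hΩ (h b))).trans ((mul_le_mul' le_rfl (hN a ha b hb)).trans ?_)
    rw [mul_comm]
    exact hτ'.le
  have hYm : ∀ a b, AEMeasurable (fun x => nrm g x ((Y a - Y b) x)) ((vol g).restrict Ω) := fun a b =>
    ((h a).meas.sub (h b).meas).aemeasurable_nrm hΩ
  have hwm : ∀ n, AEMeasurable (w n) ((vol g).restrict Ω) := fun n =>
    (hwY n).locInt.aestronglyMeasurable.aemeasurable
  obtain ⟨φ, hφ, hsum⟩ := exists_summable_subseq (μ := vol g) hΩ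
    -- Adding the two distances gives a common subsequence for functions and gradients.
    (d := fun a b x => nrm g x ((Y a - Y b) x) + |w a x - w b x|)
    (fun a b x => add_nonneg (nrm_nonneg g x _) (abs_nonneg _))
    (fun a b => (hYm a b).add ((hwm a).sub (hwm b)).abs) fun K hK hKΩ ε hε => by
      have hε2 : ε / 2 ≠ 0 := (ENNReal.half_pos hε).ne'
      obtain ⟨N, hN⟩ := hC K hK hKΩ _ hε2
      obtain ⟨N', hN'⟩ := hCw K hK hKΩ _ hε2
      refine ⟨max N N', fun a ha b hb => ?_⟩
      have e : ∀ x, ENNReal.ofReal (nrm g x ((Y a - Y b) x) + |w a x - w b x|) =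
          ENNReal.ofReal (nrm g x ((Y a - Y b) x)) + ‖w a x - w b x‖ₑ := fun x =>
        (ENNReal.ofReal_add (nrm_nonneg g x _) (abs_nonneg _)).trans
          (congrArg _ (ofReal_norm (w a x - w b x)))
      simp only [e]
      rw [lintegral_add_left' ((hYm a b).mono_measure
        (Measure.restrict_mono hKΩ le_rfl)).ennreal_ofReal, ← ENNReal.add_halves ε]
      exact add_le_add (hN a ((le_max_left _ _).trans ha) b ((le_max_left _ _).trans hb))
        (hN' a ((le_max_right _ _).trans ha) b ((le_max_right _ _).trans hb))
  set Z : VField m M := fun x => if H : ∃ L : Model m,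
    Filter.Tendsto (fun k => (Y (φ k) x : Model m)) .atTop (𝓝 L) then H.choose else (0 : Model m)
    with hZ
  set v : M → ℝ := fun x => if H : ∃ L : ℝ,
    Filter.Tendsto (fun k => w (φ k) x) .atTop (𝓝 L) then H.choose else 0 with hv
  have hYZ : ∀ᵐ x ∂((vol g).restrict Ω),
      Filter.Tendsto (fun k => (Y (φ k) x : Model m)) .atTop (𝓝 (Z x : Model m)) := by
    filter_upwards [hsum] with x hx
    have H : ∃ L : Model m, Filter.Tendsto (fun k => (Y (φ k) x : Model m)) .atTop (𝓝 L) :=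
      exists_tendsto_of_summable_nrm (g := g) (x := x) (hx.of_nonneg_of_le
        (fun k => nrm_nonneg g x _) fun k => le_add_of_nonneg_right (abs_nonneg _))
    have e : (Z x : Model m) = H.choose := dif_pos H
    rw [e]
    exact H.choose_spec
  have hwv : ∀ᵐ x ∂((vol g).restrict Ω), Filter.Tendsto (fun k => w (φ k) x) .atTop (𝓝 (v x)) := by
    filter_upwards [hsum] with x hx
    have H : ∃ L : ℝ, Filter.Tendsto (fun k => w (φ k) x) .atTop (𝓝 L) :=
      cauchySeq_tendsto_of_complete (cauchySeq_of_summable_dist (hx.of_nonneg_of_le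
        (fun k => dist_nonneg) fun k => le_add_of_nonneg_left (nrm_nonneg g x _)))
    have e : v x = H.choose := dif_pos H
    rw [e]
    exact H.choose_spec
  have hZm : IsMeasField g Ω Z := fun c hc => by
    refine aemeasurable_of_tendsto_metrizable_ae .atTop (fun k => (h (φ k)).meas c hc) ?_
    filter_upwards [ae_mono (Measure.restrict_mono inter_subset_left le_rfl) hYZ] with x hx
    exact ((mfderiv (𝓡 m) (𝓡 m) c x : Model m →L[ℝ] Model m).continuous.tendsto _).comp hx
  have hvm : AEMeasurable v ((vol g).restrict Ω) :=
    aemeasurable_of_tendsto_metrizable_ae .atTop (fun k => hwm (φ k)) hwv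
  -- Fatou's lemma in the second index turns the Cauchy estimates into convergence to the pointwise
  -- limits.
  have hL1 : ∀ K, IsCompact K → K ⊆ Ω → ∀ ε : ℝ≥0∞, ε ≠ 0 → ∀ᶠ k in .atTop,
      ∫⁻ x in K, ENNReal.ofReal (nrm g x ((Y (φ k) - Z) x)) ∂(vol g) ≤ ε ∧
      ∫⁻ x in K, ‖w (φ k) x - v x‖ₑ ∂(vol g) ≤ ε := by
    intro K hK hKΩ ε hε
    obtain ⟨N, hN⟩ := hC K hK hKΩ ε hε
    obtain ⟨N', hN'⟩ := hCw K hK hKΩ ε hε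
    have hr : (vol g).restrict K ≤ (vol g).restrict Ω := Measure.restrict_mono hKΩ le_rfl
    have hge : ∀ n, ∀ᶠ k in .atTop, n ≤ φ k := fun n => hφ.tendsto_atTop.eventually_ge_atTop n
    filter_upwards [hge N, hge N'] with k hk hk'
    constructor
    · refine lintegral_le_of_tendsto_ae
        (F := fun l x => ENNReal.ofReal (nrm g x ((Y (φ k) - Y (φ l)) x)))
        (fun l => ((hYm _ _).mono_measure hr).ennreal_ofReal) ?_
        ((hge N).mono fun l hl => hN _ hk _ hl)
      filter_upwards [ae_mono hr hYZ] with x hx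
      refine ENNReal.tendsto_ofReal (((continuous_nrm g x).tendsto _).comp ?_)
      exact (tendsto_const_nhds (x := (Y (φ k) x : Model m))).sub hx
    · refine lintegral_le_of_tendsto_ae (F := fun l x => ‖w (φ k) x - w (φ l) x‖ₑ)
        (fun l => (((hwm _).sub (hwm _)).mono_measure hr).enorm) ?_
        ((hge N').mono fun l hl => hN' _ hk' _ hl)
      filter_upwards [ae_mono hr hwv] with x hx
      exact (tendsto_const_nhds.sub hx).enorm
  have hZi : LocallyIntegrableOn (fun x => nrm g x (Z x)) Ω (vol g) := by
    refine (locallyIntegrableOn_iff_compact hΩ).2 fun K hKΩ hK => ?_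
    obtain ⟨k, hk, -⟩ := (hL1 K hK hKΩ 1 one_ne_zero).exists
    have hr : (vol g).restrict K ≤ (vol g).restrict Ω := Measure.restrict_mono hKΩ le_rfl
    have i1 : IntegrableOn (fun x => nrm g x (Y (φ k) x)) K (vol g) :=
      (locallyIntegrableOn_iff_compact hΩ).1 (h (φ k)).locInt_norm K hKΩ hK
    have i2 : IntegrableOn (fun x => nrm g x ((Y (φ k) - Z) x)) K (vol g) := by
      refine ⟨((((h (φ k)).meas.sub hZm).aemeasurable_nrm hΩ).mono_measure
        hr).aestronglyMeasurable, ?_⟩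
      refine lt_of_le_of_lt (lintegral_mono fun x => ?_) (hk.trans_lt ENNReal.one_lt_top)
      exact (Real.enorm_eq_ofReal (nrm_nonneg g x _)).le
    refine (i1.add i2).mono' (((hZm.aemeasurable_nrm hΩ).mono_measure hr).aestronglyMeasurable)
      (.of_forall fun x => ?_)
    have e : (Z x : Model m) = (Y (φ k) x : Model m) - ((Y (φ k) - Z) x : Model m) :=
      (sub_sub_cancel (Y (φ k) x : Model m) (Z x)).symm
    refine (Real.norm_of_nonneg (nrm_nonneg g x (Z x))).trans_le ?_
    exact (congrArg (nrm g x) e).trans_le (nrm_sub_le g x _ _)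
  have hvi : LocallyIntegrableOn v Ω (vol g) := by
    refine (locallyIntegrableOn_iff_compact hΩ).2 fun K hKΩ hK => ?_
    obtain ⟨k, -, hk⟩ := (hL1 K hK hKΩ 1 one_ne_zero).exists
    have hr : (vol g).restrict K ≤ (vol g).restrict Ω := Measure.restrict_mono hKΩ le_rfl
    have i1 : IntegrableOn (w (φ k)) K (vol g) :=
      (locallyIntegrableOn_iff_compact hΩ).1 (hwY (φ k)).locInt K hKΩ hK
    have i2 : IntegrableOn (fun x => w (φ k) x - v x) K (vol g) :=
      ⟨(((hwm (φ k)).sub hvm).mono_measure hr).aestronglyMeasurable,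
        hk.trans_lt ENNReal.one_lt_top⟩
    exact (i1.sub i2).congr (.of_forall fun x => sub_sub_cancel _ _)
  refine ⟨v, Z, φ, hφ, ?_, hYZ⟩
  refine isWeakGradient_of_tendsto hΩ (fun k => hwY (φ k)) hvi hZm hZi (fun K hK hKΩ => ?_)
    fun K hK hKΩ => ?_
  · refine ENNReal.tendsto_nhds_zero.2 fun ε hε => ?_
    exact (hL1 K hK hKΩ ε hε.ne').mono fun k hk => hk.2
  · refine ENNReal.tendsto_nhds_zero.2 fun ε hε => ?_
    exact (hL1 K hK hKΩ ε hε.ne').mono fun k hk => hk.1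

end Limits

/-! ### Convexity, growth and Lipschitz continuity of the integrand. -/

section Integrand

/-- The quantitative midpoint convexity of `v ↦ √(1 + k²‖v‖²)`, in terms of inner products. -/
theorem sqrt_midpoint_defect {k p q s : ℝ} (hp : 0 ≤ p) (hq : 0 ≤ q) (hs : s ^ 2 ≤ p * q) :
    2 * √(1 + k ^ 2 * ((p + 2 * s + q) / 4)) ≤ √(1 + k ^ 2 * p) + √(1 + k ^ 2 * q) ∧
    k ^ 2 * (p - 2 * s + q) ≤ 2 * (√(1 + k ^ 2 * p) * √(1 + k ^ 2 * q)) *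
      (√(1 + k ^ 2 * p) + √(1 + k ^ 2 * q)) *
      (√(1 + k ^ 2 * p) + √(1 + k ^ 2 * q) - 2 * √(1 + k ^ 2 * ((p + 2 * s + q) / 4))) := by
  have hpq : 0 ≤ p + 2 * s + q ∧ 0 ≤ p - 2 * s + q := by
    have h : |2 * s| ≤ p + q := abs_le_of_sq_le_sq (by nlinarith [sq_nonneg (p - q)]) (by linarith)
    have := abs_le.1 h
    constructor <;> linarith
  have hd : 0 ≤ k ^ 2 * (p - 2 * s + q) := mul_nonneg (sq_nonneg k) hpq.2
  have ha2 : √(1 + k ^ 2 * p) ^ 2 = 1 + k ^ 2 * p := Real.sq_sqrt (by positivity)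
  have hb2 : √(1 + k ^ 2 * q) ^ 2 = 1 + k ^ 2 * q := Real.sq_sqrt (by positivity)
  have hc2 : √(1 + k ^ 2 * ((p + 2 * s + q) / 4)) ^ 2 = 1 + k ^ 2 * ((p + 2 * s + q) / 4) :=
    Real.sq_sqrt (by have := mul_nonneg (sq_nonneg k) hpq.1; linarith)
  have ha : 0 < √(1 + k ^ 2 * p) := Real.sqrt_pos.2 (by positivity)
  have hb : 0 < √(1 + k ^ 2 * q) := Real.sqrt_pos.2 (by positivity)
  have hc : 0 ≤ √(1 + k ^ 2 * ((p + 2 * s + q) / 4)) := Real.sqrt_nonneg _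
  generalize √(1 + k ^ 2 * p) = a at *
  generalize √(1 + k ^ 2 * q) = b at *
  generalize √(1 + k ^ 2 * ((p + 2 * s + q) / 4)) = c at *
  have ht : 0 < a * b := mul_pos ha hb
  -- With `p`, `q` the squared norms and `s` the inner product, the right side exceeds the left by
  -- `k⁴(pq - s²)`, which is nonnegative by Cauchy–Schwarz.
  have htr : k ^ 2 * (p - 2 * s + q) ≤ (a * b) ^ 2 - (1 + k ^ 2 * s) ^ 2 := by
    have h1 : (a * b) ^ 2 = (1 + k ^ 2 * p) * (1 + k ^ 2 * q) := by rw [mul_pow, ha2, hb2]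
    have h2 : 0 ≤ (k ^ 2) ^ 2 * (p * q - s ^ 2) := mul_nonneg (sq_nonneg _) (by linarith)
    rw [h1]
    nlinarith
  have hrt : |1 + k ^ 2 * s| ≤ a * b := abs_le_of_sq_le_sq (by linarith) ht.le
  have hrt' := abs_le.1 hrt
  have h3 : k ^ 2 * (p - 2 * s + q) ≤ (a * b - (1 + k ^ 2 * s)) * (2 * (a * b)) := by
    have : (a * b) ^ 2 - (1 + k ^ 2 * s) ^ 2 = (a * b - (1 + k ^ 2 * s)) * (a * b + (1 + k ^ 2 * s)) := by
      ring
    rw [this] at htr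
    exact htr.trans (mul_le_mul_of_nonneg_left (by linarith) (by linarith))
  have h4 : (a + b) ^ 2 - (2 * c) ^ 2 = 2 * (a * b - (1 + k ^ 2 * s)) := by
    have : (a + b) ^ 2 - (2 * c) ^ 2 = a ^ 2 + b ^ 2 + 2 * (a * b) - 4 * c ^ 2 := by ring
    rw [this, ha2, hb2, hc2]
    ring
  have h5 : 2 * c ≤ a + b := abs_le_of_sq_le_sq' (by linarith) (by linarith) |>.2
  refine ⟨h5, h3.trans ?_⟩
  -- Factor `(a+b)² - (2c)²`, which equals `2(ab - (1 + k²s))`, and replace `a + b + 2c` by the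
  -- larger `2(a+b)`, using the midpoint convexity just obtained.
  have h6 : a * b - (1 + k ^ 2 * s) ≤ (a + b - 2 * c) * (a + b) := by
    have : (a + b) ^ 2 - (2 * c) ^ 2 = (a + b - 2 * c) * (a + b + 2 * c) := by ring
    rw [this] at h4
    have h7 : (a + b - 2 * c) * (a + b + 2 * c) ≤ (a + b - 2 * c) * (2 * (a + b)) :=
      mul_le_mul_of_nonneg_left (by linarith) (by linarith)
    linarith
  calc (a * b - (1 + k ^ 2 * s)) * (2 * (a * b)) ≤ (a + b - 2 * c) * (a + b) * (2 * (a * b)) :=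
        mul_le_mul_of_nonneg_right h6 (by positivity)
    _ = _ := by ring

variable {m : ℕ} {M : Type*} [TopologicalSpace M] [ChartedSpace (Model m) M]
  [IsManifold (𝓡 m) ∞ M] {g : RMetric m M}

/-- The function `√(1 + a²‖v‖²)` on the tangent space at `x`. -/
def capNorm (g : RMetric m M) (a : ℝ) (x : M) (v : Model m) : ℝ := √(1 + a ^ 2 * nrm g x v ^ 2)

theorem one_le_capNorm (a : ℝ) (x : M) (v : Model m) : 1 ≤ capNorm g a x v := by
  rw [capNorm, Real.one_le_sqrt]
  have : 0 ≤ a ^ 2 * nrm g x v ^ 2 := by positivity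
  linarith

theorem le_capNorm {a : ℝ} (x : M) (v : Model m) : a * nrm g x v ≤ capNorm g a x v := by
  refine Real.le_sqrt_of_sq_le ?_
  rw [mul_pow]
  linarith

theorem capNorm_le {a : ℝ} (ha : 0 ≤ a) (x : M) (v : Model m) :
    capNorm g a x v ≤ 1 + a * nrm g x v := by
  have := mul_nonneg ha (nrm_nonneg g x v)
  refine Real.sqrt_le_iff.2 ⟨by linarith, ?_⟩
  rw [add_sq, one_pow, mul_pow]
  linarith

theorem capNorm_sub_le {a : ℝ} (ha : 0 ≤ a) (x : M) (v w : Model m) :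
    capNorm g a x v - capNorm g a x w ≤ a * nrm g x (v - w) := by
  have h1 : nrm g x v ≤ nrm g x w + nrm g x (v - w) := by
    have := nrm_add_le g x w (v - w)
    rwa [add_sub_cancel] at this
  have h2 := nrm_nonneg g x (v - w)
  have h3 := nrm_nonneg g x v
  have h4 := nrm_nonneg g x w
  have h5 := one_le_capNorm (g := g) a x w
  have h6 := le_capNorm (g := g) (a := a) x w
  have h7 : capNorm g a x w ^ 2 = 1 + a ^ 2 * nrm g x w ^ 2 := Real.sq_sqrt (by positivity)
  have h8 : 0 ≤ a * nrm g x (v - w) := mul_nonneg ha h2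
  rw [sub_le_iff_le_add']
  refine Real.sqrt_le_iff.2 ⟨by linarith, ?_⟩
  calc 1 + a ^ 2 * nrm g x v ^ 2 ≤ 1 + a ^ 2 * (nrm g x w + nrm g x (v - w)) ^ 2 := by gcongr
    _ = (1 + a ^ 2 * nrm g x w ^ 2) + 2 * (a * nrm g x w) * (a * nrm g x (v - w)) +
        (a * nrm g x (v - w)) ^ 2 := by ring
    _ ≤ capNorm g a x w ^ 2 + 2 * capNorm g a x w * (a * nrm g x (v - w)) +
        (a * nrm g x (v - w)) ^ 2 := by rw [h7]; gcongr
    _ = _ := by ring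

theorem capNorm_midpoint (a : ℝ) (x : M) (v w : Model m) :
    2 * capNorm g a x ((1 / 2 : ℝ) • (v + w)) ≤ capNorm g a x v + capNorm g a x w ∧
    a ^ 2 * nrm g x (v - w) ^ 2 ≤ 2 * (capNorm g a x v * capNorm g a x w) *
      (capNorm g a x v + capNorm g a x w) *
      (capNorm g a x v + capNorm g a x w - 2 * capNorm g a x ((1 / 2 : ℝ) • (v + w))) := by
  have hs : metricAt g x v w ^ 2 ≤ nrm g x v ^ 2 * nrm g x w ^ 2 := by
    rw [← mul_pow]
    exact sq_le_sq' (neg_le_of_abs_le (abs_metricAt_le g x v w))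
      ((le_abs_self _).trans (abs_metricAt_le g x v w))
  have e : nrm g x ((1 / 2 : ℝ) • (v + w)) ^ 2 =
      (nrm g x v ^ 2 + 2 * metricAt g x v w + nrm g x w ^ 2) / 4 := by
    rw [nrm_smul, mul_pow, nrm_add_sq, abs_of_pos (by norm_num)]
    ring
  have h := sqrt_midpoint_defect (k := a) (sq_nonneg (nrm g x v)) (sq_nonneg (nrm g x w)) hs
  rw [nrm_sub_sq]
  simp only [capNorm, e]
  exact h

theorem continuous_capNorm (a : ℝ) (x : M) : Continuous (capNorm g a x) :=
  (continuous_const.add (continuous_const.mul ((continuous_nrm g x).pow 2))).sqrt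

/-- The vector `W + grad h` at `x`. -/
def shiftPlus (g : RMetric m M) (W : VField m M) (h : M → ℝ) (x : M) : Model m :=
  (W x : Model m) + (gradient g h x : Model m)

/-- The vector `W - grad h` at `x`. -/
def shiftMinus (g : RMetric m M) (W : VField m M) (h : M → ℝ) (x : M) : Model m :=
  (W x : Model m) - (gradient g h x : Model m)

/-- The integrand of the area functional, as a function on the model space. -/
def areaInt (g : RMetric m M) (k : M → ℝ) (W : VField m M) (h : M → ℝ) (x : M) (X : Model m) : ℝ :=
  capNorm g (k x) x (shiftPlus g W h x + X) +
    capNorm g (k x) x (shiftMinus g W h x + X)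

variable {k : M → ℝ} {W : VField m M} {h : M → ℝ}

theorem areaInt_nonneg (x : M) (X : Model m) : 0 ≤ areaInt g k W h x X :=
  add_nonneg (Real.sqrt_nonneg _) (Real.sqrt_nonneg _)

theorem areaInt_le {x : M} (hk : 0 ≤ k x) (X : Model m) : areaInt g k W h x X ≤
    2 + 2 * k x * (nrm g x (W x) + nrm g x (gradient g h x) + nrm g x X) := by
  have h1 := capNorm_le (g := g) hk x (shiftPlus g W h x + X : Model m)
  have h2 := capNorm_le (g := g) hk x (shiftMinus g W h x + X : Model m)
  have h3 : nrm g x (shiftPlus g W h x + X : Model m) ≤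
      nrm g x (W x) + nrm g x (gradient g h x) + nrm g x X := by
    have hs := nrm_add_le g x (shiftPlus g W h x) X
    have h' := nrm_add_le g x (W x) (gradient g h x)
    exact hs.trans (add_le_add h' le_rfl)
  have h4 : nrm g x (shiftMinus g W h x + X : Model m) ≤
      nrm g x (W x) + nrm g x (gradient g h x) + nrm g x X := by
    have hs := nrm_add_le g x (shiftMinus g W h x) X
    have h' := nrm_sub_le g x (W x) (gradient g h x)
    exact hs.trans (add_le_add h' le_rfl)
  have h5 := mul_le_mul_of_nonneg_left h3 hk
  have h6 := mul_le_mul_of_nonneg_left h4 hk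
  unfold areaInt
  linarith

/-- The two arguments add up to `2(W + X)`, so `grad h` cancels. Coercivity therefore does not
involve `grad h`, which is integrable on `Ω` but need not be bounded. -/
theorem le_areaInt {x : M} (hk : 0 ≤ k x) (X : Model m) :
    2 * k x * (nrm g x X - nrm g x (W x)) ≤ areaInt g k W h x X := by
  have key : ∀ w z : Model m, 2 * (nrm g x X - nrm g x w) ≤
      nrm g x (w + z + X) + nrm g x (w - z + X) := fun w z => by
    have h3 := nrm_add_le g x (w + z + X) (w - z + X)
    have e : (w + z + X) + (w - z + X) = (2 : ℝ) • (w + X) := by module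
    rw [e, nrm_smul, abs_of_pos two_pos] at h3
    have h5 := nrm_sub_le g x (w + X) w
    rw [add_sub_cancel_left] at h5
    linarith
  have h1 := le_capNorm (g := g) (a := k x) x (shiftPlus g W h x + X)
  have h2 := le_capNorm (g := g) (a := k x) x (shiftMinus g W h x + X)
  have h3 : 2 * (nrm g x X - nrm g x (W x)) ≤
    nrm g x (shiftPlus g W h x + X) + nrm g x (shiftMinus g W h x + X) := key _ _
  have h6 := mul_le_mul_of_nonneg_left h3 hk
  unfold areaInt
  linarith

theorem areaInt_sub_le {x : M} (hk : 0 ≤ k x) (X Y : Model m) :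
    areaInt g k W h x X - areaInt g k W h x Y ≤ 2 * k x * nrm g x (X - Y) := by
  have h1 := capNorm_sub_le (g := g) hk x (shiftPlus g W h x + X : Model m)
    (shiftPlus g W h x + Y : Model m)
  have h2 := capNorm_sub_le (g := g) hk x (shiftMinus g W h x + X : Model m)
    (shiftMinus g W h x + Y : Model m)
  rw [add_sub_add_left_eq_sub] at h1 h2
  unfold areaInt
  linarith

/-- The first summand alone gives the bound: the second has nonnegative defect and positive values,
so including it only enlarges the right side. -/
theorem areaInt_midpoint (x : M) (X Y : Model m) :
    2 * areaInt g k W h x ((1 / 2 : ℝ) • (X + Y)) ≤ areaInt g k W h x X + areaInt g k W h x Y ∧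
    k x ^ 2 * nrm g x (X - Y) ^ 2 ≤ 2 * (areaInt g k W h x X * areaInt g k W h x Y) *
      (areaInt g k W h x X + areaInt g k W h x Y) *
      (areaInt g k W h x X + areaInt g k W h x Y -
        2 * areaInt g k W h x ((1 / 2 : ℝ) • (X + Y))) := by
  have key : ∀ P : Model m, (1 / 2 : ℝ) • ((P + X) + (P + Y)) = P + (1 / 2 : ℝ) • (X + Y) := fun P => by
    module
  have h1 := capNorm_midpoint (g := g) (k x) x (shiftPlus g W h x + X : Model m)
    (shiftPlus g W h x + Y : Model m)
  have h2 := capNorm_midpoint (g := g) (k x) x (shiftMinus g W h x + X : Model m)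
    (shiftMinus g W h x + Y : Model m)
  rw [key, add_sub_add_left_eq_sub] at h1 h2
  have p1 := one_le_capNorm (g := g) (k x) x (shiftPlus g W h x + X : Model m)
  have p2 := one_le_capNorm (g := g) (k x) x (shiftMinus g W h x + X : Model m)
  have p3 := one_le_capNorm (g := g) (k x) x (shiftPlus g W h x + Y : Model m)
  have p4 := one_le_capNorm (g := g) (k x) x (shiftMinus g W h x + Y : Model m)
  unfold areaInt
  generalize capNorm g (k x) x (shiftPlus g W h x + X : Model m) = a at *
  generalize capNorm g (k x) x (shiftMinus g W h x + X : Model m) = a' at *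
  generalize capNorm g (k x) x (shiftPlus g W h x + Y : Model m) = b at *
  generalize capNorm g (k x) x (shiftMinus g W h x + Y : Model m) = b' at *
  generalize capNorm g (k x) x
    (shiftPlus g W h x + (1 / 2 : ℝ) • (X + Y) : Model m) = c at *
  generalize capNorm g (k x) x
    (shiftMinus g W h x + (1 / 2 : ℝ) • (X + Y) : Model m) = c' at *
  refine ⟨by linarith [h1.1, h2.1], h1.2.trans ?_⟩
  have q1 : 0 ≤ a + b - 2 * c := by linarith [h1.1]
  have q2 : a + b - 2 * c ≤ a + a' + (b + b') - 2 * (c + c') := by linarith [h2.1]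
  gcongr <;> linarith

theorem continuous_areaInt (x : M) : Continuous (areaInt g k W h x) :=
  ((continuous_capNorm _ x).comp (continuous_const.add continuous_id)).add
    ((continuous_capNorm _ x).comp (continuous_const.add continuous_id))

end Integrand

/-! ### The area integrand along a vector field. -/

section AreaData

variable {m : ℕ} {M : Type*} [TopologicalSpace M] [ChartedSpace (Model m) M]
  [IsManifold (𝓡 m) ∞ M] [MeasurableSpace M]

/-- The hypotheses on the data of the area functional. -/
structure AreaData (g : RMetric m M) (Ω : Set M) (k : M → ℝ) (W : VField m M) (h : M → ℝ) :
    Prop where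
  isOpen : IsOpen Ω
  isConnected : IsConnected Ω
  isCompact : IsCompact (closure Ω)
  smooth : HasSmoothBoundary m Ω
  cont : Continuous k
  pos : ∀ x, 0 < k x
  field : IsCField 1 W
  fn : ContMDiffOn (𝓡 m) 𝓘(ℝ, ℝ) 1 h Ω
  integrable : Integrable (fun x => nrm g x (gradient g h x)) ((vol g).restrict Ω)

/-- The pointwise norm of a vector field. -/
def fnrm (g : RMetric m M) (X : VField m M) (x : M) : ℝ := nrm g x (X x)

/-- The integrand of the area functional along a vector field. -/
def fArea (g : RMetric m M) (k : M → ℝ) (W : VField m M) (h : M → ℝ) (X : VField m M) (x : M) : ℝ :=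
  areaInt g k W h x (X x)

variable [T2Space M] [SecondCountableTopology M] [BorelSpace M] {g : RMetric m M}
  {Ω : Set M} {k : M → ℝ} {W : VField m M} {h : M → ℝ} {X Y : VField m M}

theorem fnrm_nonneg (X : VField m M) (x : M) : 0 ≤ fnrm g X x := nrm_nonneg g x (X x)

theorem fArea_nonneg (X : VField m M) (x : M) : 0 ≤ fArea g k W h X x := areaInt_nonneg x (X x)

theorem fnrm_add_le (X Y : VField m M) (x : M) : fnrm g (X + Y) x ≤ fnrm g X x + fnrm g Y x :=
  nrm_add_le g x (X x) (Y x)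

theorem fnrm_sub_le (X Y : VField m M) (x : M) : fnrm g (X - Y) x ≤ fnrm g X x + fnrm g Y x :=
  nrm_sub_le g x (X x) (Y x)

theorem fnrm_smul (a : ℝ) (X : VField m M) (x : M) : fnrm g (a • X) x = |a| * fnrm g X x :=
  nrm_smul g x a (X x)

theorem fnrm_parallelogram (X Y : VField m M) (x : M) :
    2 * fnrm g ((1 / 2 : ℝ) • (X + Y)) x ^ 2 + 2⁻¹ * fnrm g (X - Y) x ^ 2 =
      fnrm g X x ^ 2 + fnrm g Y x ^ 2 := by
  have h1 : fnrm g (X + Y) x ^ 2 = fnrm g X x ^ 2 + 2 * metricAt g x (X x) (Y x) + fnrm g Y x ^ 2 :=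
    nrm_add_sq g x (X x) (Y x)
  have h2 : fnrm g (X - Y) x ^ 2 = fnrm g X x ^ 2 - 2 * metricAt g x (X x) (Y x) + fnrm g Y x ^ 2 :=
    nrm_sub_sq g x (X x) (Y x)
  rw [fnrm_smul, mul_pow, h1, h2, abs_of_pos (by norm_num)]
  ring

theorem fArea_le {x : M} (hk : 0 ≤ k x) (X : VField m M) : fArea g k W h X x ≤
    2 + 2 * k x * (fnrm g W x + fnrm g (gradient g h) x + fnrm g X x) :=
  areaInt_le hk (X x)

theorem le_fArea {x : M} (hk : 0 ≤ k x) (X : VField m M) :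
    2 * k x * (fnrm g X x - fnrm g W x) ≤ fArea g k W h X x := le_areaInt hk (X x)

theorem fArea_sub_le {x : M} (hk : 0 ≤ k x) (X Y : VField m M) :
    fArea g k W h X x - fArea g k W h Y x ≤ 2 * k x * fnrm g (X - Y) x :=
  areaInt_sub_le hk (X x) (Y x)

theorem fArea_midpoint (X Y : VField m M) (x : M) :
    2 * fArea g k W h ((1 / 2 : ℝ) • (X + Y)) x ≤ fArea g k W h X x + fArea g k W h Y x ∧
    k x ^ 2 * fnrm g (X - Y) x ^ 2 ≤ 2 * (fArea g k W h X x * fArea g k W h Y x) *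
      (fArea g k W h X x + fArea g k W h Y x) *
      (fArea g k W h X x + fArea g k W h Y x - 2 * fArea g k W h ((1 / 2 : ℝ) • (X + Y)) x) :=
  areaInt_midpoint x (X x) (Y x)

theorem isFiniteMeasure_restrict_of_isCompact (g : RMetric m M) (hΩ : IsCompact (closure Ω)) :
    IsFiniteMeasure ((vol g).restrict Ω) := by
  have : LocallyCompactSpace M := ChartedSpace.locallyCompactSpace (Model m) M
  exact ⟨by rw [Measure.restrict_apply_univ]
            exact (measure_mono subset_closure).trans_lt hΩ.measure_lt_top⟩

namespace AreaData

theorem exists_bounds (D : AreaData g Ω k W h) : ∃ κ₀ κ₁ w : ℝ, 0 < κ₀ ∧ 0 < κ₁ ∧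
    ∀ x ∈ Ω, κ₀ ≤ k x ∧ k x ≤ κ₁ ∧ fnrm g W x ≤ w := by
  have hne : (closure Ω).Nonempty := D.isConnected.nonempty.closure
  obtain ⟨a, -, ha⟩ := D.isCompact.exists_isMinOn hne D.cont.continuousOn
  obtain ⟨b, -, hb⟩ := D.isCompact.exists_isMaxOn hne D.cont.continuousOn
  obtain ⟨c, -, hc⟩ := D.isCompact.exists_isMaxOn hne
    (continuous_nrm_of_isCField (g := g) D.field).continuousOn
  exact ⟨k a, k b, nrm g c (W c), D.pos a, D.pos b, fun x hx =>
    ⟨ha (subset_closure hx), hb (subset_closure hx), hc (subset_closure hx)⟩⟩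

theorem exists_gradient_bound (D : AreaData g Ω k W h) {K : Set M} (hK : IsCompact K)
    (hKΩ : K ⊆ Ω) : ∃ b : ℝ, ∀ x ∈ K, fnrm g (gradient g h) x ≤ b := by
  have hc : ContinuousOn (fnrm g (gradient g h)) K :=
    (continuousOn_nrm D.isOpen fun c hc => continuousOn_coeff_gradient D.isOpen D.fn hc).mono hKΩ
  obtain ⟨b, hb⟩ := hK.bddAbove_image hc
  exact ⟨b, fun x hx => hb (mem_image_of_mem _ hx)⟩

theorem aemeasurable_capNorm (D : AreaData g Ω k W h) (hX : IsMeasField g Ω X) :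
    AEMeasurable (fun x => capNorm g (k x) x (X x)) ((vol g).restrict Ω) :=
  (((D.cont.measurable.pow_const 2).aemeasurable.mul
    ((hX.aemeasurable_nrm D.isOpen).pow_const 2)).const_add 1).sqrt

theorem isMeasField_gradient (D : AreaData g Ω k W h) : IsMeasField g Ω (gradient g h) :=
  isMeasField_of_continuousOn D.isOpen fun _ hc => continuousOn_coeff_gradient D.isOpen D.fn hc

theorem aemeasurable_areaInt (D : AreaData g Ω k W h) (hX : IsMeasField g Ω X) :
    AEMeasurable (fArea g k W h X) ((vol g).restrict Ω) :=
  (D.aemeasurable_capNorm (((isMeasField_of_isCField D.isOpen D.field).add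
      D.isMeasField_gradient).add hX)).add
    (D.aemeasurable_capNorm (((isMeasField_of_isCField D.isOpen D.field).sub
      D.isMeasField_gradient).add hX))

theorem integrable_areaInt (D : AreaData g Ω k W h) (hX : IsMeasField g Ω X)
    (hXi : Integrable (fnrm g X) ((vol g).restrict Ω)) :
    Integrable (fArea g k W h X) ((vol g).restrict Ω) := by
  obtain ⟨κ₀, κ₁, w, -, h1, hb⟩ := D.exists_bounds
  have := isFiniteMeasure_restrict_of_isCompact g D.isCompact
  have hi : Integrable (fun x => 2 + 2 * κ₁ * (w + fnrm g (gradient g h) x + fnrm g X x))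
      ((vol g).restrict Ω) :=
    (integrable_const _).add ((((integrable_const w).add D.integrable).add hXi).const_mul _)
  refine hi.mono' (D.aemeasurable_areaInt hX).aestronglyMeasurable ?_
  filter_upwards [ae_restrict_mem D.isOpen.measurableSet] with x hx
  obtain ⟨-, hk, hw⟩ := hb x hx
  rw [Real.norm_of_nonneg (fArea_nonneg _ x)]
  refine (fArea_le (D.pos x).le _).trans ?_
  have n1 := fnrm_nonneg (g := g) (gradient g h) x
  have n2 := fnrm_nonneg (g := g) X x
  have n3 := fnrm_nonneg (g := g) W x
  gcongr

/-- By `le_fArea`, with `k` bounded below and `W` bounded on the compact closure, finite area forces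
an integrable field. -/
theorem integrable_nrm (D : AreaData g Ω k W h) (hX : IsMeasField g Ω X)
    (hXi : ∫⁻ x in Ω, ENNReal.ofReal (fArea g k W h X x) ∂(vol g) < ⊤) :
    Integrable (fnrm g X) ((vol g).restrict Ω) := by
  obtain ⟨κ₀, κ₁, w, h0, -, hb⟩ := D.exists_bounds
  have := isFiniteMeasure_restrict_of_isCompact g D.isCompact
  have hF : Integrable (fArea g k W h X) ((vol g).restrict Ω) := by
    refine ⟨(D.aemeasurable_areaInt hX).aestronglyMeasurable, ?_⟩
    rwa [hasFiniteIntegral_iff_ofReal (.of_forall fun x => fArea_nonneg _ x)]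
  have hi : Integrable (fun x => w + (2 * κ₀)⁻¹ * fArea g k W h X x)
      ((vol g).restrict Ω) := (integrable_const _).add (hF.const_mul _)
  refine hi.mono' (aestronglyMeasurable_nrm D.isOpen hX) ?_
  filter_upwards [ae_restrict_mem D.isOpen.measurableSet] with x hx
  obtain ⟨hk, -, hw⟩ := hb x hx
  rw [Real.norm_of_nonneg (fnrm_nonneg _ x)]
  have h2 := le_fArea (g := g) (W := W) (h := h) (D.pos x).le X
  have h3 := fArea_nonneg (g := g) (k := k) (W := W) (h := h) X x
  rcases le_total (fnrm g X x) w with hs | hs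
  · have : 0 ≤ (2 * κ₀)⁻¹ * fArea g k W h X x := by positivity
    linarith
  rw [← sub_le_iff_le_add', inv_mul_eq_div, le_div_iff₀ (by positivity)]
  refine le_trans ?_ h2
  calc (fnrm g X x - w) * (2 * κ₀) ≤ (fnrm g X x - w) * (2 * k x) := by
        gcongr
    _ ≤ (fnrm g X x - fnrm g W x) * (2 * k x) := by
        have := (D.pos x).le
        gcongr
    _ = _ := by ring

end AreaData

end AreaData

/-! ### The variational problems as problems for gradient fields. -/

section Potential

variable {m : ℕ} {M : Type*} [TopologicalSpace M] [ChartedSpace (Model m) M]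
  [IsManifold (𝓡 m) ∞ M] [MeasurableSpace M]

/-- The area functional on vector fields. -/
def areaOf (g : RMetric m M) (Ω : Set M) (k : M → ℝ) (W : VField m M) (h : M → ℝ)
    (Y : VField m M) : ℝ := ∫ x in Ω, fArea g k W h Y x ∂(vol g)

/-- The Dirichlet energy of a vector field. -/
def energyOf (g : RMetric m M) (Ω : Set M) (Y : VField m M) : ℝ :=
  ∫ x in Ω, fnrm g Y x ^ 2 ∂(vol g)

/-- `Y` is a weak gradient on `Ω` of class `L^p`. -/
def HasPotential (g : RMetric m M) (Ω : Set M) (p : ℝ≥0∞) (Y : VField m M) : Prop :=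
  (∃ u, IsWeakGradient g Ω u Y) ∧ MemLp (fnrm g Y) p ((vol g).restrict Ω)

variable [T2Space M] [SecondCountableTopology M] [BorelSpace M] {g : RMetric m M}
  {Ω : Set M} {k : M → ℝ} {W : VField m M} {h : M → ℝ} {X Y : VField m M} {u v : M → ℝ}
  {p : ℝ≥0∞}

theorem HasPotential.isMeasField (h : HasPotential g Ω p Y) : IsMeasField g Ω Y :=
  let ⟨⟨_, hu⟩, _⟩ := h
  hu.meas

theorem aestronglyMeasurable_fnrm (hΩ : IsOpen Ω) (hY : IsMeasField g Ω Y) :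
    AEStronglyMeasurable (fnrm g Y) ((vol g).restrict Ω) := aestronglyMeasurable_nrm hΩ hY

theorem IsWeakGradient.memLp_congr (hΩ : IsOpen Ω) (hX : IsWeakGradient g Ω u X)
    (hY : IsWeakGradient g Ω u Y) (h : MemLp (fnrm g X) p ((vol g).restrict Ω)) :
    MemLp (fnrm g Y) p ((vol g).restrict Ω) :=
  (memLp_congr_ae ((hX.ae_eq hΩ hY).mono fun x hx => congrArg (nrm g x) hx)).1 h

theorem HasPotential.sub (hΩ : IsOpen Ω) (hX : HasPotential g Ω p X) (hY : HasPotential g Ω p Y) :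
    HasPotential g Ω p (X - Y) := by
  obtain ⟨⟨u, hu⟩, hX⟩ := hX
  obtain ⟨⟨v, hv⟩, hY⟩ := hY
  refine ⟨⟨_, hu.sub hΩ hv⟩, (hX.add hY).mono' (aestronglyMeasurable_fnrm hΩ (hu.sub hΩ hv).meas)
    (.of_forall fun x => ?_)⟩
  rw [Real.norm_of_nonneg (fnrm_nonneg _ x)]
  exact fnrm_sub_le X Y x

theorem HasPotential.midpoint (hΩ : IsOpen Ω) (hX : HasPotential g Ω p X)
    (hY : HasPotential g Ω p Y) : HasPotential g Ω p ((1 / 2 : ℝ) • (X + Y)) := by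
  obtain ⟨⟨u, hu⟩, hX⟩ := hX
  obtain ⟨⟨v, hv⟩, hY⟩ := hY
  have hw := (hu.add hΩ hv).const_smul (1 / 2)
  refine ⟨⟨_, hw⟩, (hX.add hY).mono' (aestronglyMeasurable_fnrm hΩ hw.meas)
    (.of_forall fun x => ?_)⟩
  rw [Real.norm_of_nonneg (fnrm_nonneg _ x), fnrm_smul, abs_of_pos (by norm_num)]
  have h1 := fnrm_add_le (g := g) X Y x
  have h2 := fnrm_nonneg (g := g) (X + Y) x
  simp only [Pi.add_apply]
  linarith

theorem HasPotential.weakGrad (hu : IsWeakGradient g Ω u Y) :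
    IsWeakGradient g Ω u (weakGrad g Ω u) := by
  rw [SymArea.weakGrad, dif_pos ⟨Y, hu⟩]
  exact Exists.choose_spec (⟨Y, hu⟩ : ∃ Y, IsWeakGradient g Ω u Y)

namespace AreaData

theorem mono (D : AreaData g Ω k W h) (hY : HasPotential g Ω 2 Y) : HasPotential g Ω 1 Y := by
  have := isFiniteMeasure_restrict_of_isCompact g D.isCompact
  exact ⟨hY.1, hY.2.mono_exponent one_le_two⟩

theorem integrable_of_hasPotential (D : AreaData g Ω k W h) (hY : HasPotential g Ω 1 Y) :
    Integrable (fArea g k W h Y) ((vol g).restrict Ω) :=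
  D.integrable_areaInt hY.isMeasField (memLp_one_iff_integrable.1 hY.2)

theorem area_eq (D : AreaData g Ω k W h) (hu : IsWeakGradient g Ω u Y) :
    area g Ω k W h u = areaOf g Ω k W h Y :=
  integral_congr_ae (((HasPotential.weakGrad hu).ae_eq D.isOpen hu).mono fun x hx =>
    congrArg (areaInt g k W h x) hx)

theorem areaEps_eq (D : AreaData g Ω k W h) (hu : IsWeakGradient g Ω u Y)
    (hY : MemLp (fnrm g Y) 2 ((vol g).restrict Ω)) (ε : ℝ) :
    areaEps g Ω k W h ε u = areaOf g Ω k W h Y + ε * energyOf g Ω Y := by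
  have h1 : areaEps g Ω k W h ε u =
      ∫ x in Ω, (fArea g k W h Y x + ε * fnrm g Y x ^ 2) ∂(vol g) :=
    integral_congr_ae (((HasPotential.weakGrad hu).ae_eq D.isOpen hu).mono fun x hx =>
      congrArg (fun v : Model m => areaInt g k W h x v + ε * nrm g x v ^ 2) hx)
  rw [h1, integral_add (D.integrable_of_hasPotential (D.mono ⟨⟨u, hu⟩, hY⟩))
    (hY.integrable_sq.const_mul ε), integral_const_mul]
  rfl

/-- A weak gradient requires `u` to be locally integrable only. The smooth boundary makes `u` an
`L^p` function on `Ω`, so that it has a mean value to subtract. -/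
theorem exists_meanZero (D : AreaData g Ω k W h) (hp : 1 ≤ p) (hp' : p ≠ ⊤)
    (hu : IsWeakGradient g Ω u Y) (hY : MemLp (fnrm g Y) p ((vol g).restrict Ω)) :
    ∃ a : ℝ, (fun x => u x - a) ∈ MeanZeroSobolev g Ω p ∧
      IsWeakGradient g Ω (fun x => u x - a) Y := by
  have hfin := isFiniteMeasure_restrict_of_isCompact g D.isCompact
  have hp0 : p ≠ 0 := (zero_lt_one.trans_le hp).ne'
  have hup : MemLp u p ((vol g).restrict Ω) := by
    have hm : AEStronglyMeasurable u ((vol g).restrict Ω) := by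
      have : LocallyCompactSpace M := ChartedSpace.locallyCompactSpace (Model m) M
      exact hu.locInt.aestronglyMeasurable
    refine ⟨hm, ?_⟩
    rw [eLpNorm_lt_top_iff_lintegral_rpow_enorm_lt_top hp0 hp']
    refine hu.lintegral_lt_top D.isOpen D.isCompact D.smooth
      (by rw [← ENNReal.toReal_one]; exact ENNReal.toReal_mono hp' hp) ?_
    have h1 := (eLpNorm_lt_top_iff_lintegral_rpow_enorm_lt_top hp0 hp').1 hY.2
    refine lt_of_le_of_lt (lintegral_mono fun x => ?_) h1
    have : ENNReal.ofReal (fnrm g Y x) = ‖fnrm g Y x‖ₑ :=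
      (Real.enorm_of_nonneg (fnrm_nonneg Y x)).symm
    exact (congrArg (· ^ p.toReal) this).le
  obtain ⟨a, ha⟩ : ∃ a : ℝ, ∫ x in Ω, (u x - a) ∂(vol g) = 0 := by
    have hi : Integrable u ((vol g).restrict Ω) := memLp_one_iff_integrable.1 (hup.mono_exponent hp)
    -- Were the measure zero, every integral would vanish and `a = 0` would serve.
    by_cases h0 : ((vol g).restrict Ω).real univ = 0
    · refine ⟨0, ?_⟩
      have : (vol g).restrict Ω = 0 := by
        rwa [measureReal_eq_zero_iff, Measure.measure_univ_eq_zero] at h0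
      rw [this, integral_zero_measure]
    · refine ⟨(((vol g).restrict Ω).real univ)⁻¹ * ∫ x in Ω, u x ∂(vol g), ?_⟩
      rw [integral_sub hi (integrable_const _), integral_const, smul_eq_mul, ← mul_assoc,
        mul_inv_cancel₀ h0, one_mul, sub_self]
  have hg : IsWeakGradient g Ω (fun x => u x - a) Y := by
    have := hu.sub D.isOpen (isWeakGradient_const D.isOpen a)
    rwa [sub_zero] at this
  exact ⟨a, ⟨⟨hup.sub (memLp_const a), Y, hg, hY⟩, ha⟩, hg⟩

/-- The functionals depend on the gradient only, and every gradient field in `L^p` has a potential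
of mean zero. So competitors may be taken to be gradient fields, which are closed under differences
and midpoints. -/
theorem isMinimizer_iff (D : AreaData g Ω k W h) (hp : 1 ≤ p) (hp' : p ≠ ⊤)
    {A : (M → ℝ) → ℝ} {F : VField m M → ℝ} (hAF : ∀ u Y, IsWeakGradient g Ω u Y →
      MemLp (fnrm g Y) p ((vol g).restrict Ω) → A u = F Y)
    (hu : u ∈ MeanZeroSobolev g Ω p) (hY : IsWeakGradient g Ω u Y) :
    IsMinimizer A (MeanZeroSobolev g Ω p) u ↔ ∀ Z, HasPotential g Ω p Z → F Y ≤ F Z := by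
  have key : ∀ {v Z}, v ∈ MeanZeroSobolev g Ω p → IsWeakGradient g Ω v Z →
      MemLp (fnrm g Z) p ((vol g).restrict Ω) := by
    rintro v Z ⟨⟨-, X, hX, hXp⟩, -⟩ hZ
    exact hX.memLp_congr D.isOpen hZ hXp
  constructor
  · rintro ⟨-, hmin⟩ Z ⟨⟨v, hv⟩, hZ⟩
    obtain ⟨a, ha, hg⟩ := D.exists_meanZero hp hp' hv hZ
    rw [← hAF u Y hY (key hu hY), ← hAF _ Z hg hZ]
    exact hmin _ ha
  · intro H
    refine ⟨hu, fun v hv => ?_⟩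
    obtain ⟨⟨-, X, hX, hXp⟩, -⟩ := id hv
    rw [hAF u Y hY (key hu hY), hAF v X hX (key hv hX)]
    exact H X ⟨⟨v, hX⟩, key hv hX⟩

theorem isMinimizer_area_iff (D : AreaData g Ω k W h)
    (hu : u ∈ MeanZeroSobolev g Ω 1) (hY : IsWeakGradient g Ω u Y) :
    IsMinimizer (area g Ω k W h) (MeanZeroSobolev g Ω 1) u ↔
      ∀ Z, HasPotential g Ω 1 Z → areaOf g Ω k W h Y ≤ areaOf g Ω k W h Z :=
  D.isMinimizer_iff le_rfl ENNReal.one_ne_top (fun _ _ hv _ => D.area_eq hv) hu hY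

theorem isMinimizer_areaEps_iff (D : AreaData g Ω k W h) (ε : ℝ)
    (hu : u ∈ MeanZeroSobolev g Ω 2) (hY : IsWeakGradient g Ω u Y) :
    IsMinimizer (areaEps g Ω k W h ε) (MeanZeroSobolev g Ω 2) u ↔
      ∀ Z, HasPotential g Ω 2 Z → areaOf g Ω k W h Y + ε * energyOf g Ω Y ≤
        areaOf g Ω k W h Z + ε * energyOf g Ω Z :=
  D.isMinimizer_iff (F := fun Z => areaOf g Ω k W h Z + ε * energyOf g Ω Z) one_le_two
    ENNReal.ofNat_ne_top (fun _ _ hv hZ => D.areaEps_eq hv hZ ε) hu hY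

/-- The midpoint convexity defect of the area integrand. -/
theorem integral_defect (D : AreaData g Ω k W h) (hX : HasPotential g Ω 1 X)
    (hY : HasPotential g Ω 1 Y) :
    Integrable (fun x => fArea g k W h X x + fArea g k W h Y x -
      2 * fArea g k W h ((1 / 2 : ℝ) • (X + Y)) x) ((vol g).restrict Ω) ∧
    ∫ x in Ω, (fArea g k W h X x + fArea g k W h Y x -
      2 * fArea g k W h ((1 / 2 : ℝ) • (X + Y)) x) ∂(vol g) = areaOf g Ω k W h X +
        areaOf g Ω k W h Y - 2 * areaOf g Ω k W h ((1 / 2 : ℝ) • (X + Y)) := by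
  have h1 := D.integrable_of_hasPotential hX
  have h2 := D.integrable_of_hasPotential hY
  have h3 := (D.integrable_of_hasPotential (hX.midpoint D.isOpen hY)).const_mul 2
  refine ⟨(h1.add h2).sub h3, ?_⟩
  have e := integral_sub (h1.add h2) h3
  simp only [Pi.add_apply] at e
  rw [e, integral_add h1 h2, integral_const_mul]
  rfl

theorem areaOf_midpoint_le (D : AreaData g Ω k W h) (hX : HasPotential g Ω 1 X)
    (hY : HasPotential g Ω 1 Y) : 2 * areaOf g Ω k W h ((1 / 2 : ℝ) • (X + Y)) ≤
      areaOf g Ω k W h X + areaOf g Ω k W h Y := by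
  have h1 := (D.integral_defect hX hY).2
  have h2 : 0 ≤ ∫ x in Ω, (fArea g k W h X x + fArea g k W h Y x -
      2 * fArea g k W h ((1 / 2 : ℝ) • (X + Y)) x) ∂(vol g) :=
    integral_nonneg fun x => sub_nonneg.2 (fArea_midpoint X Y x).1
  linarith

theorem areaOf_nonneg (Y : VField m M) : 0 ≤ areaOf g Ω k W h Y :=
  integral_nonneg fun x => fArea_nonneg Y x

theorem energyOf_nonneg (Y : VField m M) : 0 ≤ energyOf g Ω Y :=
  integral_nonneg fun x => sq_nonneg (fnrm g Y x)

theorem energyOf_parallelogram (hΩ : IsOpen Ω) (hX : HasPotential g Ω 2 X)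
    (hY : HasPotential g Ω 2 Y) :
    2 * energyOf g Ω ((1 / 2 : ℝ) • (X + Y)) + 2⁻¹ * energyOf g Ω (X - Y) =
      energyOf g Ω X + energyOf g Ω Y := by
  unfold energyOf
  rw [← integral_const_mul, ← integral_const_mul,
    ← integral_add ((hX.midpoint hΩ hY).2.integrable_sq.const_mul 2)
      ((hX.sub hΩ hY).2.integrable_sq.const_mul _),
    ← integral_add hX.2.integrable_sq hY.2.integrable_sq]
  exact integral_congr_ae (.of_forall fun x => fnrm_parallelogram X Y x)

end AreaData

end Potential

/-! ### Minimizers of the approximating functionals. -/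

section Existence

/-- Fatou's lemma for nonnegative functions; integrability of the limit is a consequence of the
bound. -/
theorem integral_le_of_tendsto_ae {α : Type*} [MeasurableSpace α] {μ : Measure α}
    {F : ℕ → α → ℝ} {f : α → ℝ} {b : ℝ} (hF0 : ∀ n x, 0 ≤ F n x) (hf0 : ∀ x, 0 ≤ f x)
    (hF : ∀ n, Integrable (F n) μ)
    (hlim : ∀ᵐ x ∂μ, Filter.Tendsto (fun n => F n x) .atTop (𝓝 (f x)))
    (hb : ∀ᶠ n in .atTop, ∫ x, F n x ∂μ ≤ b) : Integrable f μ ∧ ∫ x, f x ∂μ ≤ b := by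
  have hb0 : 0 ≤ b := by
    obtain ⟨n, hn⟩ := hb.exists
    exact (integral_nonneg (hF0 n)).trans hn
  have h1 : ∫⁻ x, ENNReal.ofReal (f x) ∂μ ≤ ENNReal.ofReal b := by
    refine lintegral_le_of_tendsto_ae (fun n => (hF n).aemeasurable.ennreal_ofReal)
      (hlim.mono fun x hx => (ENNReal.continuous_ofReal.tendsto _).comp hx)
      (hb.mono fun n hn => ?_)
    rw [← ofReal_integral_eq_lintegral_ofReal (hF n) (.of_forall (hF0 n))]
    exact ENNReal.ofReal_le_ofReal hn
  have hm : AEStronglyMeasurable f μ :=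
    aestronglyMeasurable_of_tendsto_ae _ (fun n => (hF n).aestronglyMeasurable) hlim
  have hi : Integrable f μ := ⟨hm, by
    rw [hasFiniteIntegral_iff_ofReal (.of_forall hf0)]
    exact h1.trans_lt ENNReal.ofReal_lt_top⟩
  rw [← ofReal_integral_eq_lintegral_ofReal hi (.of_forall hf0)] at h1
  exact ⟨hi, (ENNReal.ofReal_le_ofReal_iff hb0).1 h1⟩

/-- On sets of finite measure, smallness in `L²` gives smallness in `L¹`. -/
theorem exists_lintegral_le_of_sq {α : Type*} [MeasurableSpace α] {μ : Measure α}
    [IsFiniteMeasure μ] {ε : ℝ≥0∞} (hε : ε ≠ 0) : ∃ η : ℝ, 0 < η ∧ ∀ f : α → ℝ, (∀ x, 0 ≤ f x) →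
      ∫⁻ x, ENNReal.ofReal (f x ^ 2) ∂μ ≤ ENNReal.ofReal η →
        ∫⁻ x, ENNReal.ofReal (f x) ∂μ ≤ ε := by
  rcases eq_or_ne ε ⊤ with rfl | hε'
  · exact ⟨1, one_pos, fun _ _ _ => le_top⟩
  have he : 0 < ε.toReal := ENNReal.toReal_pos hε hε'
  set e := ε.toReal
  set v := μ.real univ
  have hv : 0 ≤ v := measureReal_nonneg
  set δ := e / (2 * (v + 1)) with hδ
  have hδ0 : 0 < δ := by positivity
  refine ⟨δ * (e / 2), by positivity, fun f hf h => ?_⟩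
  -- From `f ≤ δ + δ⁻¹ f²`; the choice of `δ` and of the bound `δ * (e / 2)` makes each term
  -- contribute at most `e / 2`.
  have h1 : ∀ x, ENNReal.ofReal (f x) ≤
      ENNReal.ofReal δ + ENNReal.ofReal δ⁻¹ * ENNReal.ofReal (f x ^ 2) := fun x => by
    rw [← ENNReal.ofReal_mul (by positivity), ← ENNReal.ofReal_add hδ0.le (by positivity)]
    refine ENNReal.ofReal_le_ofReal ?_
    rw [inv_mul_eq_div, ← sub_le_iff_le_add', le_div_iff₀ hδ0]
    nlinarith [sq_nonneg (f x - δ), hf x]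
  calc ∫⁻ x, ENNReal.ofReal (f x) ∂μ
      ≤ ∫⁻ x, (ENNReal.ofReal δ + ENNReal.ofReal δ⁻¹ * ENNReal.ofReal (f x ^ 2)) ∂μ :=
        lintegral_mono h1
    _ = ENNReal.ofReal δ * μ univ + ENNReal.ofReal δ⁻¹ * ∫⁻ x, ENNReal.ofReal (f x ^ 2) ∂μ := by
        rw [lintegral_add_left measurable_const, lintegral_const,
          lintegral_const_mul' _ _ ENNReal.ofReal_ne_top]
    _ ≤ ENNReal.ofReal δ * ENNReal.ofReal v + ENNReal.ofReal δ⁻¹ * ENNReal.ofReal (δ * (e / 2)) := by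
        gcongr
        exact (ENNReal.ofReal_toReal (measure_ne_top μ univ)).ge
    _ = ENNReal.ofReal (δ * v + δ⁻¹ * (δ * (e / 2))) := by
        rw [← ENNReal.ofReal_mul hδ0.le, ← ENNReal.ofReal_mul (by positivity),
          ← ENNReal.ofReal_add (by positivity) (by positivity)]
    _ ≤ ENNReal.ofReal e := by
        refine ENNReal.ofReal_le_ofReal ?_
        rw [inv_mul_cancel_left₀ hδ0.ne']
        have : δ * v ≤ e / 2 := by
          rw [hδ, div_mul_eq_mul_div, div_le_iff₀ (by positivity)]
          nlinarith
        linarith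
    _ = ε := ENNReal.ofReal_toReal hε'

variable {m : ℕ} {M : Type*} [TopologicalSpace M] [ChartedSpace (Model m) M]
  [IsManifold (𝓡 m) ∞ M] [MeasurableSpace M]
  [T2Space M] [SecondCountableTopology M] [BorelSpace M] {g : RMetric m M}
  {Ω : Set M} {k : M → ℝ} {W : VField m M} {h : M → ℝ} {X Z : VField m M} {Y : ℕ → VField m M}
  {u v : M → ℝ}

theorem exists_limit_of_sq (hΩ : IsOpen Ω) (hconn : IsConnected Ω)
    (hY : ∀ n, ∃ u, IsWeakGradient g Ω u (Y n))
    (hC : ∀ K, IsCompact K → K ⊆ Ω → ∀ η : ℝ, 0 < η → ∃ N, ∀ a ≥ N, ∀ b ≥ N,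
      ∫⁻ x in K, ENNReal.ofReal (fnrm g (Y a - Y b) x ^ 2) ∂(vol g) ≤ ENNReal.ofReal η) :
    ∃ (v : M → ℝ) (Z : VField m M) (φ : ℕ → ℕ), StrictMono φ ∧ IsWeakGradient g Ω v Z ∧
      ∀ᵐ x ∂((vol g).restrict Ω),
        Filter.Tendsto (fun k => (Y (φ k) x : Model m)) .atTop (𝓝 (Z x : Model m)) := by
  choose u hu using hY
  have : LocallyCompactSpace M := ChartedSpace.locallyCompactSpace (Model m) M
  refine exists_isWeakGradient_limit hΩ hconn hu fun K hK hKΩ ε hε => ?_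
  have : IsFiniteMeasure ((vol g).restrict K) :=
    ⟨by rw [Measure.restrict_apply_univ]; exact hK.measure_lt_top⟩
  obtain ⟨η, hη, H⟩ := exists_lintegral_le_of_sq (μ := (vol g).restrict K) hε
  obtain ⟨N, hN⟩ := hC K hK hKΩ η hη
  exact ⟨N, fun a ha b hb => H _ (fnrm_nonneg _) (hN a ha b hb)⟩

theorem tendsto_fnrm {x : M} (hx : Filter.Tendsto (fun k => (Y k x : Model m)) .atTop
    (𝓝 (Z x : Model m))) : Filter.Tendsto (fun k => fnrm g (Y k) x) .atTop (𝓝 (fnrm g Z x)) :=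
  ((continuous_nrm g x).tendsto (Z x)).comp hx

theorem tendsto_fArea {x : M} (hx : Filter.Tendsto (fun k => (Y k x : Model m)) .atTop
    (𝓝 (Z x : Model m))) :
    Filter.Tendsto (fun n => fArea g k W h (Y n) x) .atTop (𝓝 (fArea g k W h Z x)) :=
  ((continuous_areaInt x).tendsto (Z x)).comp hx

theorem hasPotential_zero (hΩ : IsOpen Ω) (p : ℝ≥0∞) : HasPotential g Ω p (0 : VField m M) := by
  refine ⟨⟨_, isWeakGradient_const hΩ 0⟩, ?_⟩
  have : fnrm g (0 : VField m M) = 0 := funext fun x => nrm_zero g x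
  rw [this]
  exact MemLp.zero

namespace AreaData

/-- The direct method without weak compactness: the strictly convex Dirichlet term makes a
minimizing sequence of gradients Cauchy in `L²`, and Fatou's lemma gives lower semicontinuity along
an almost everywhere convergent subsequence. -/
theorem exists_isMinimizer_areaEps (D : AreaData g Ω k W h) {ε : ℝ} (hε : 0 < ε) :
    ∃ u, IsMinimizer (areaEps g Ω k W h ε) (MeanZeroSobolev g Ω 2) u := by
  set F : VField m M → ℝ := fun Y => areaOf g Ω k W h Y + ε * energyOf g Ω Y with hF
  have hF0 : ∀ Y, 0 ≤ F Y := fun Y =>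
    add_nonneg (areaOf_nonneg Y) (mul_nonneg hε.le (energyOf_nonneg Y))
  set S := F '' {Y | HasPotential g Ω 2 Y}
  have hS : BddBelow S := ⟨0, by rintro _ ⟨Y, -, rfl⟩; exact hF0 Y⟩
  have hSne : S.Nonempty := ⟨_, 0, hasPotential_zero D.isOpen 2, rfl⟩
  have hI : ∀ Y, HasPotential g Ω 2 Y → sInf S ≤ F Y := fun Y hY => csInf_le hS ⟨Y, hY, rfl⟩
  have hseq : ∀ n : ℕ, ∃ Y, HasPotential g Ω 2 Y ∧ F Y < sInf S + 1 / ((n : ℝ) + 1) := fun n => by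
    obtain ⟨_, ⟨Y, hY, rfl⟩, h2⟩ := exists_lt_of_csInf_lt hSne
      (lt_add_of_pos_right (sInf S) (Nat.one_div_pos_of_nat (α := ℝ) (n := n)))
    exact ⟨Y, hY, h2⟩
  choose Y hY hYF using hseq
  -- The midpoint is a competitor with value at least `sInf S`. The parallelogram law then bounds
  -- `ε/2` times the energy of the difference by the excess of the two values, convexity of the area
  -- only helping.
  have hd : ∀ a b, energyOf g Ω (Y a - Y b) ≤ 2 / ε * (F (Y a) + F (Y b) - 2 * sInf S) := by
    intro a b
    have h1 := energyOf_parallelogram D.isOpen (hY a) (hY b)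
    have h2 := D.areaOf_midpoint_le (D.mono (hY a)) (D.mono (hY b))
    have h3 := hI _ ((hY a).midpoint D.isOpen (hY b))
    rw [div_mul_eq_mul_div, le_div_iff₀ hε]
    simp only [hF] at h3 ⊢
    have h4 := congrArg (ε * ·) h1
    linarith
  have ht : Filter.Tendsto (fun n : ℕ => sInf S + 1 / ((n : ℝ) + 1)) .atTop (𝓝 (sInf S)) := by
    simpa using tendsto_one_div_add_atTop_nhds_zero_nat.const_add (sInf S)
  obtain ⟨v, Z, φ, hφ, hvZ, hlim⟩ := exists_limit_of_sq (g := g) D.isOpen D.isConnected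
    (fun n => (hY n).1) fun K hK hKΩ η hη => by
      have h1 : 0 < ε * η / 4 := by positivity
      obtain ⟨N, hN⟩ := (ht.eventually_lt_const (lt_add_of_pos_right (sInf S) h1)).exists_forall_of_atTop
      refine ⟨N, fun a ha b hb => ?_⟩
      have hi := ((hY a).sub D.isOpen (hY b)).2.integrable_sq
      refine (lintegral_mono_set hKΩ).trans ?_
      rw [← ofReal_integral_eq_lintegral_ofReal hi (.of_forall fun x => sq_nonneg _)]
      refine ENNReal.ofReal_le_ofReal ((hd a b).trans ?_)
      have h2 := (hYF a).trans (hN a ha)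
      have h3 := (hYF b).trans (hN b hb)
      rw [div_mul_eq_mul_div, div_le_iff₀ hε]
      nlinarith
  have hint : ∀ n, Integrable (fun x => fArea g k W h (Y n) x + ε * fnrm g (Y n) x ^ 2)
      ((vol g).restrict Ω) := fun n =>
    (D.integrable_of_hasPotential (D.mono (hY n))).add ((hY n).2.integrable_sq.const_mul ε)
  have hval : ∀ n, ∫ x in Ω, (fArea g k W h (Y n) x + ε * fnrm g (Y n) x ^ 2) ∂(vol g) =
      F (Y n) := fun n => by
    rw [integral_add (D.integrable_of_hasPotential (D.mono (hY n)))
      ((hY n).2.integrable_sq.const_mul ε), integral_const_mul]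
    rfl
  have hn0 : ∀ (V : VField m M) x, 0 ≤ fArea g k W h V x + ε * fnrm g V x ^ 2 := fun V x =>
    add_nonneg (fArea_nonneg V x) (mul_nonneg hε.le (sq_nonneg _))
  have hlimit : ∀ b > sInf S, Integrable (fun x => fArea g k W h Z x + ε * fnrm g Z x ^ 2)
      ((vol g).restrict Ω) ∧
      ∫ x in Ω, (fArea g k W h Z x + ε * fnrm g Z x ^ 2) ∂(vol g) ≤ b := fun b hb => by
    refine integral_le_of_tendsto_ae (fun n => hn0 (Y (φ n))) (hn0 Z) (fun n => hint (φ n)) ?_ ?_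
    · exact hlim.mono fun x hx => (tendsto_fArea hx).add (((tendsto_fnrm hx).pow 2).const_mul ε)
    · refine (hφ.tendsto_atTop.eventually (ht.eventually_lt_const hb)).mono fun n hn => ?_
      rw [hval]
      exact ((hYF _).trans hn).le
  have hZi := (hlimit _ (lt_add_one _)).1
  have hZ2 : MemLp (fnrm g Z) 2 ((vol g).restrict Ω) := by
    have hm := aestronglyMeasurable_fnrm D.isOpen hvZ.meas
    rw [memLp_two_iff_integrable_sq hm]
    refine (hZi.const_mul ε⁻¹).mono' (hm.pow 2) (.of_forall fun x => ?_)
    rw [Real.norm_of_nonneg (sq_nonneg _), inv_mul_eq_div, le_div_iff₀ hε]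
    have := fArea_nonneg (g := g) (k := k) (W := W) (h := h) Z x
    linarith
  have hFZ : F Z ≤ sInf S := le_of_forall_gt_imp_ge_of_dense fun b hb => by
    have := (hlimit b hb).2
    rwa [integral_add (D.integrable_of_hasPotential (D.mono ⟨⟨v, hvZ⟩, hZ2⟩))
      (hZ2.integrable_sq.const_mul ε), integral_const_mul] at this
  obtain ⟨a, ha, hg⟩ := D.exists_meanZero one_le_two ENNReal.ofNat_ne_top hvZ hZ2
  exact ⟨_, (D.isMinimizer_areaEps_iff ε ha hg).2 fun V hV => hFZ.trans (hI V hV)⟩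

end AreaData

end Existence

/-! ### The limit `ε → 0`. -/

section Limit

variable {m : ℕ} {M : Type*} [TopologicalSpace M] [ChartedSpace (Model m) M]
  [IsManifold (𝓡 m) ∞ M] [MeasurableSpace M]
  [T2Space M] [SecondCountableTopology M] [BorelSpace M] {g : RMetric m M}
  {Ω : Set M} {k : M → ℝ} {W : VField m M} {h : M → ℝ} {X Y Z : VField m M} {u v : M → ℝ}

theorem fnrm_sub_comm (X Y : VField m M) (x : M) : fnrm g (X - Y) x = fnrm g (Y - X) x := by
  have := nrm_neg g x ((Y - X : VField m M) x)
  have e : (-((Y - X : VField m M) x) : Model m) = (X - Y : VField m M) x := neg_sub (Y x) (X x)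
  exact (congrArg (nrm g x) e).symm.trans this

namespace AreaData

/-- The integrand is `2k`-Lipschitz in the gradient, so `L¹` approximation of gradients approximates
the area; and the gradient of a function `C¹` on `M` is bounded on the compact closure of `Ω`, hence
in `L²`. This is why minimizing over `W^{1,2}` gives the infimum over `W^{1,1}`. -/
theorem exists_areaOf_approx (D : AreaData g Ω k W h) (hY : HasPotential g Ω 1 Y) {δ : ℝ}
    (hδ : 0 < δ) : ∃ V, HasPotential g Ω 2 V ∧
      areaOf g Ω k W h V ≤ areaOf g Ω k W h Y + δ := by
  obtain ⟨κ₀, κ₁, w, -, hκ, hb⟩ := D.exists_bounds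
  have hfin := isFiniteMeasure_restrict_of_isCompact g D.isCompact
  obtain ⟨⟨u, hu⟩, hY1⟩ := id hY
  obtain ⟨a, ha, hg⟩ := D.exists_meanZero le_rfl ENNReal.one_ne_top hu hY1
  have hYi : Integrable (fnrm g Y) ((vol g).restrict Ω) := memLp_one_iff_integrable.1 hY1
  have hYl : ∫⁻ x in Ω, ENNReal.ofReal (nrm g x (Y x)) ∂(vol g) < ⊤ :=
    (hasFiniteIntegral_iff_ofReal (.of_forall (fnrm_nonneg Y))).1 hYi.2
  have hη : 0 < δ / (2 * κ₁) := by positivity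
  obtain ⟨v, hv, hvη⟩ := hg.exists_contMDiff_approx D.isOpen D.isCompact D.smooth
    (memLp_one_iff_integrable.1 ha.1.1) hYl (ENNReal.ofReal_pos.2 hη).ne'
  have hvc : Continuous (fnrm g (gradient g v)) :=
    continuousOn_univ.1 (continuousOn_nrm isOpen_univ fun c hc =>
      continuousOn_coeff_gradient isOpen_univ hv.contMDiffOn hc)
  obtain ⟨B, hB⟩ := D.isCompact.bddAbove_image hvc.continuousOn
  have hV : HasPotential g Ω 2 (gradient g v) := by
    refine ⟨⟨v, isWeakGradient_gradient D.isOpen hv.contMDiffOn⟩,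
      MemLp.of_bound hvc.aestronglyMeasurable B ?_⟩
    filter_upwards [ae_restrict_mem D.isOpen.measurableSet] with x hx
    rw [Real.norm_of_nonneg (fnrm_nonneg _ x)]
    exact hB (mem_image_of_mem _ (subset_closure hx))
  refine ⟨_, hV, ?_⟩
  have hd : HasPotential g Ω 1 (Y - gradient g v) := hY.sub D.isOpen (D.mono hV)
  have hdi : Integrable (fnrm g (Y - gradient g v)) ((vol g).restrict Ω) :=
    memLp_one_iff_integrable.1 hd.2
  have h1 : ∫ x in Ω, fnrm g (Y - gradient g v) x ∂(vol g) ≤ δ / (2 * κ₁) := by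
    refine (ENNReal.ofReal_le_ofReal_iff hη.le).1 ?_
    rw [ofReal_integral_eq_lintegral_ofReal hdi (.of_forall (fnrm_nonneg _))]
    exact hvη
  have hi := D.integrable_of_hasPotential hY
  have h2 : areaOf g Ω k W h (gradient g v) ≤
      ∫ x in Ω, (fArea g k W h Y x + 2 * κ₁ * fnrm g (Y - gradient g v) x) ∂(vol g) := by
    refine integral_mono_ae (D.integrable_of_hasPotential (D.mono hV)) (hi.add (hdi.const_mul _)) ?_
    filter_upwards [ae_restrict_mem D.isOpen.measurableSet] with x hx
    have h3 := fArea_sub_le (g := g) (W := W) (h := h) (D.pos x).le (gradient g v) Y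
    rw [fnrm_sub_comm] at h3
    have h4 : 2 * k x * fnrm g (Y - gradient g v) x ≤ 2 * κ₁ * fnrm g (Y - gradient g v) x := by
      have := fnrm_nonneg (g := g) (Y - gradient g v) x
      have := (hb x hx).2.1
      gcongr
    linarith
  rw [integral_add hi (hdi.const_mul _), integral_const_mul] at h2
  have h5 : 2 * κ₁ * ∫ x in Ω, fnrm g (Y - gradient g v) x ∂(vol g) ≤ δ := by
    rw [mul_comm, ← le_div_iff₀ (by positivity)]
    exact h1
  exact h2.trans (add_le_add le_rfl h5)

theorem exists_fArea_le (D : AreaData g Ω k W h) {K : Set M} (hK : IsCompact K) (hKΩ : K ⊆ Ω)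
    (C : ℝ) : ∃ B : ℝ, 0 < B ∧ ∀ x ∈ K, ∀ Y : VField m M, fnrm g Y x ≤ C → fArea g k W h Y x ≤ B := by
  obtain ⟨κ₀, κ₁, w, -, hκ, hb⟩ := D.exists_bounds
  obtain ⟨b, hgb⟩ := D.exists_gradient_bound hK hKΩ
  refine ⟨max 1 (2 + 2 * κ₁ * (w + b + C)), lt_max_of_lt_left one_pos, fun x hx Y hY =>
    le_max_of_le_right ((fArea_le (D.pos x).le Y).trans ?_)⟩
  have n1 := fnrm_nonneg (g := g) (gradient g h) x
  have n2 := fnrm_nonneg (g := g) Y x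
  have n3 := fnrm_nonneg (g := g) W x
  have h1 := hgb x hx
  obtain ⟨-, h2, h3⟩ := hb x (hKΩ hx)
  change fnrm g W x ≤ w at h3
  gcongr

/-- Integrate `fArea_midpoint`: on `K` its factor is at most `2B²(2B) = 4B³`, and as the defect is
nonnegative its integral may be extended to `Ω`. -/
theorem lintegral_sq_le (D : AreaData g Ω k W h) (hX : HasPotential g Ω 1 X)
    (hY : HasPotential g Ω 1 Y) {K : Set M} (hK : IsCompact K) (hKΩ : K ⊆ Ω) {κ B : ℝ} (hκ : 0 < κ)
    (hκk : ∀ x ∈ K, κ ≤ k x) (hB : 0 < B)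
    (hXB : ∀ᵐ x ∂((vol g).restrict K), fArea g k W h X x ≤ B)
    (hYB : ∀ᵐ x ∂((vol g).restrict K), fArea g k W h Y x ≤ B) :
    ∫⁻ x in K, ENNReal.ofReal (fnrm g (X - Y) x ^ 2) ∂(vol g) ≤ ENNReal.ofReal
      (4 * B ^ 3 / κ ^ 2 * (areaOf g Ω k W h X + areaOf g Ω k W h Y -
        2 * areaOf g Ω k W h ((1 / 2 : ℝ) • (X + Y)))) := by
  obtain ⟨hi, he⟩ := D.integral_defect hX hY
  set d : M → ℝ := fun x => fArea g k W h X x + fArea g k W h Y x -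
      2 * fArea g k W h ((1 / 2 : ℝ) • (X + Y)) x with hd
  have hd0 : ∀ x, 0 ≤ d x := fun x => sub_nonneg.2 (fArea_midpoint X Y x).1
  have hc : 0 ≤ 4 * B ^ 3 / κ ^ 2 := by positivity
  rw [← he, ← integral_const_mul, ofReal_integral_eq_lintegral_ofReal (hi.const_mul _)
    (.of_forall fun x => mul_nonneg hc (hd0 x))]
  refine le_trans (lintegral_mono_ae ?_) (lintegral_mono_set hKΩ)
  filter_upwards [hXB, hYB, ae_restrict_mem hK.measurableSet] with x h1 h2 hx
  refine ENNReal.ofReal_le_ofReal ?_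
  have h3 : k x ^ 2 * fnrm g (X - Y) x ^ 2 ≤ 2 * (fArea g k W h X x * fArea g k W h Y x) *
      (fArea g k W h X x + fArea g k W h Y x) * d x := (fArea_midpoint X Y x).2
  have h4 := fArea_nonneg (g := g) (k := k) (W := W) (h := h) X x
  have h5 := fArea_nonneg (g := g) (k := k) (W := W) (h := h) Y x
  rw [div_mul_eq_mul_div, le_div_iff₀ (by positivity)]
  have h6 := hd0 x
  calc fnrm g (X - Y) x ^ 2 * κ ^ 2 ≤ fnrm g (X - Y) x ^ 2 * k x ^ 2 := by
        have := hκk x hx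
        gcongr
    _ = k x ^ 2 * fnrm g (X - Y) x ^ 2 := mul_comm _ _
    _ ≤ _ := h3
    _ ≤ 2 * (B * B) * (B + B) * d x := by gcongr
    _ = 4 * B ^ 3 * d x := by ring

/-- Minimizers of `A_ε` for `ε → 0` form a minimizing sequence of `A` over `W^{1,2}`. Under the
local gradient bounds, vanishing midpoint defect means `L²` convergence on compact sets; Fatou and
the density of bounded gradients identify the limit as a minimizer in the larger class. -/
theorem exists_minimal_field (D : AreaData g Ω k W h)
    (bounds : ∀ U : Set M, IsOpen U → CompactlyIn U Ω → ∃ C : ℝ, ∀ ε : ℝ, 0 < ε → ε ≤ 1 →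
      ∀ u : M → ℝ, IsMinimizer (areaEps g Ω k W h ε) (MeanZeroSobolev g Ω 2) u →
        ∀ᵐ x ∂((vol g).restrict U), fnrm g (weakGrad g Ω u) x ≤ C) :
    ∃ (v : M → ℝ) (Z : VField m M), IsWeakGradient g Ω v Z ∧ HasPotential g Ω 1 Z ∧
      (∀ V, HasPotential g Ω 1 V → areaOf g Ω k W h Z ≤ areaOf g Ω k W h V) ∧
      ∀ U : Set M, IsOpen U → CompactlyIn U Ω →
        ∃ C : ℝ, ∀ᵐ x ∂((vol g).restrict U), fnrm g Z x ≤ C := by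
  have : LocallyCompactSpace M := ChartedSpace.locallyCompactSpace (Model m) M
  obtain ⟨κ₀, κ₁, w, hκ, -, hb⟩ := D.exists_bounds
  have hε : ∀ n : ℕ, (0 : ℝ) < 1 / ((n : ℝ) + 1) := fun n => Nat.one_div_pos_of_nat
  have hε1 : ∀ n : ℕ, 1 / ((n : ℝ) + 1) ≤ 1 := fun n => by
    rw [div_le_one (by positivity)]
    linarith [n.cast_nonneg (α := ℝ)]
  choose u hu using fun n : ℕ => D.exists_isMinimizer_areaEps (hε n)
  set Y : ℕ → VField m M := fun n => weakGrad g Ω (u n) with hYdef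
  have hg : ∀ n, IsWeakGradient g Ω (u n) (Y n) := fun n => by
    obtain ⟨⟨-, X, hX, -⟩, -⟩ := (hu n).1
    exact HasPotential.weakGrad hX
  have hY : ∀ n, HasPotential g Ω 2 (Y n) := fun n => by
    obtain ⟨⟨-, X, hX, hX2⟩, -⟩ := (hu n).1
    exact ⟨⟨_, hg n⟩, hX.memLp_congr D.isOpen (hg n) hX2⟩
  have hmin := fun n => (D.isMinimizer_areaEps_iff _ (hu n).1 (hg n)).1 (hu n)
  -- The infimum over `W^{1,2}` is the right one for the defect argument, since the approximating
  -- fields and their midpoints belong to this class.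
  set S := areaOf g Ω k W h '' {V | HasPotential g Ω 2 V}
  have hS : BddBelow S := ⟨0, by rintro _ ⟨V, -, rfl⟩; exact areaOf_nonneg V⟩
  have hSne : S.Nonempty := ⟨_, 0, hasPotential_zero D.isOpen 2, rfl⟩
  have hI : ∀ V, HasPotential g Ω 2 V → sInf S ≤ areaOf g Ω k W h V := fun V hV =>
    csInf_le hS ⟨V, hV, rfl⟩
  -- Compare with a fixed nearly optimal `V`: the area of the `n`-th minimizer is at most that of
  -- `V` plus `ε` times the energy of `V`, and the last term tends to zero.
  have hlt : ∀ b > sInf S, ∀ᶠ n in .atTop, areaOf g Ω k W h (Y n) < b := fun b hb => by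
    obtain ⟨_, ⟨V, hV, rfl⟩, hVb⟩ := exists_lt_of_csInf_lt hSne hb
    have ht : Filter.Tendsto
        (fun n : ℕ => areaOf g Ω k W h V + 1 / ((n : ℝ) + 1) * energyOf g Ω V) .atTop
        (𝓝 (areaOf g Ω k W h V)) := by
      simpa using ((tendsto_one_div_add_atTop_nhds_zero_nat (𝕜 := ℝ)).mul_const
        (energyOf g Ω V)).const_add (areaOf g Ω k W h V)
    refine (ht.eventually_lt_const hVb).mono fun n hn => ?_
    have h1 := hmin n V hV
    have h2 := mul_nonneg (hε n).le (energyOf_nonneg (g := g) (Ω := Ω) (Y n))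
    linarith
  have hbd : ∀ U : Set M, IsOpen U → CompactlyIn U Ω → ∃ C : ℝ, ∀ n,
      ∀ᵐ x ∂((vol g).restrict U), fnrm g (Y n) x ≤ C := fun U hU hUΩ => by
    obtain ⟨C, hC⟩ := bounds U hU hUΩ
    exact ⟨C, fun n => hC _ (hε n) (hε1 n) _ (hu n)⟩
  obtain ⟨v, Z, φ, hφ, hvZ, hlim⟩ := exists_limit_of_sq (g := g) D.isOpen D.isConnected
    (fun n => (hY n).1) fun K hK hKΩ η hη => by
      obtain ⟨U, hU, hKU, hUΩ, hUc⟩ := exists_open_between_and_isCompact_closure hK D.isOpen hKΩ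
      obtain ⟨C, hC⟩ := hbd U hU ⟨hUc, hUΩ⟩
      obtain ⟨B, hB, hCB⟩ := D.exists_fArea_le hK hKΩ C
      have hYB : ∀ n, ∀ᵐ x ∂((vol g).restrict K), fArea g k W h (Y n) x ≤ B := fun n => by
        filter_upwards [ae_restrict_of_ae_restrict_of_subset hKU (hC n),
          ae_restrict_mem hK.measurableSet] with x h1 hx using hCB x hx _ h1
      have hc : 0 < 4 * B ^ 3 / κ₀ ^ 2 := by positivity
      -- Two areas, each within this amount of the infimum, make the right side of `lintegral_sq_le`
      -- at most `η`.
      have h1 : 0 < η / (4 * B ^ 3 / κ₀ ^ 2) / 2 := by positivity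
      obtain ⟨N, hN⟩ := (hlt _ (lt_add_of_pos_right (sInf S) h1)).exists_forall_of_atTop
      refine ⟨N, fun a ha b hb' => (D.lintegral_sq_le (D.mono (hY a)) (D.mono (hY b)) hK hKΩ hκ
        (fun x hx => (hb x (hKΩ hx)).1) hB (hYB a) (hYB b)).trans (ENNReal.ofReal_le_ofReal ?_)⟩
      rw [mul_comm, ← le_div_iff₀ hc]
      have h2 := hN a ha
      have h3 := hN b hb'
      have h4 := hI _ ((hY a).midpoint D.isOpen (hY b))
      linarith
  have hlimit : ∀ b > sInf S, Integrable (fArea g k W h Z) ((vol g).restrict Ω) ∧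
      ∫ x in Ω, fArea g k W h Z x ∂(vol g) ≤ b := fun b hb =>
    integral_le_of_tendsto_ae (fun n => fArea_nonneg (Y (φ n))) (fArea_nonneg Z)
      (fun n => D.integrable_of_hasPotential (D.mono (hY (φ n))))
      (hlim.mono fun x hx => tendsto_fArea hx)
      ((hφ.tendsto_atTop.eventually (hlt b hb)).mono fun n hn => hn.le)
  have hZ : HasPotential g Ω 1 Z := ⟨⟨v, hvZ⟩, memLp_one_iff_integrable.2
    (D.integrable_nrm hvZ.meas ((hasFiniteIntegral_iff_ofReal (.of_forall (fArea_nonneg Z))).1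
      (hlimit _ (lt_add_one _)).1.2))⟩
  refine ⟨v, Z, hvZ, hZ, fun V hV => ?_, fun U hU hUΩ => ?_⟩
  · have h1 : areaOf g Ω k W h Z ≤ sInf S :=
      le_of_forall_gt_imp_ge_of_dense fun b hb => (hlimit b hb).2
    refine h1.trans (le_of_forall_pos_le_add fun δ hδ => ?_)
    obtain ⟨V', hV', hle⟩ := D.exists_areaOf_approx hV hδ
    exact (hI V' hV').trans hle
  · obtain ⟨C, hC⟩ := hbd U hU hUΩ
    refine ⟨C, ?_⟩
    -- One constant bounds the whole sequence, outside a countable union of null sets, so it bounds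
    -- the pointwise limit.
    filter_upwards [ae_all_iff.2 hC,
      ae_restrict_of_ae_restrict_of_subset (subset_closure.trans hUΩ.2) hlim] with x h1 h2
    exact le_of_tendsto' (tendsto_fnrm h2) fun n => h1 (φ n)

end AreaData

end Limit

/-! ### Lipschitz representatives, uniqueness and the conclusion. -/

section Representative

variable {m : ℕ} {M : Type*} [TopologicalSpace M] [ChartedSpace (Model m) M]
  [IsManifold (𝓡 m) ∞ M] [MeasurableSpace M]
  [T2Space M] [SecondCountableTopology M] [BorelSpace M] {g : RMetric m M}
  {Ω : Set M} {k : M → ℝ} {W : VField m M} {h : M → ℝ} {Y Z : VField m M} {u v : M → ℝ}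

instance isOpenPosMeasure_vol : (vol g).IsOpenPosMeasure := by
  refine ⟨fun U hU ⟨x, hx⟩ h0 => ?_⟩
  have hc : chartAt (Model m) x ∈ atlas (Model m) M := chart_mem_atlas _ x
  have hxc : x ∈ (chartAt (Model m) x).source := mem_chart_source _ x
  have h1 : ∀ᵐ x ∂((vol g).restrict (U ∩ (chartAt (Model m) x).source)), False := by
    rw [Filter.eventually_false_iff_eq_bot, ae_eq_bot, Measure.restrict_eq_zero]
    exact measure_mono_null inter_subset_left h0
  have hU' := hU.inter (chartAt (Model m) x).open_source
  rw [ae_vol_iff g hc hU'.measurableSet inter_subset_right (fun _ => False),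
    Filter.eventually_false_iff_eq_bot, ae_eq_bot, Measure.restrict_eq_zero] at h1
  have h2 : IsOpen ((chartAt (Model m) x).target ∩
      (chartAt (Model m) x).symm ⁻¹' (U ∩ (chartAt (Model m) x).source)) :=
    (chartAt (Model m) x).isOpen_inter_preimage_symm hU'
  refine h2.measure_ne_zero volume ⟨chartAt (Model m) x x, (chartAt (Model m) x).map_source hxc, ?_⟩ h1
  rw [mem_preimage, (chartAt (Model m) x).left_inv hxc]
  exact ⟨hx, hxc⟩

/-- A compact coordinate ball is contained in some `U` compactly inside `Ω`. The bound on `U`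
becomes a bound on the covector in the chart, and `exists_lipschitz` applies. -/
theorem IsWeakGradient.exists_lipschitz_nhds (hΩ : IsOpen Ω) (hv : IsWeakGradient g Ω v Z)
    (hb : ∀ U : Set M, IsOpen U → CompactlyIn U Ω →
      ∃ C : ℝ, ∀ᵐ x ∂((vol g).restrict U), fnrm g Z x ≤ C)
    {c : OpenPartialHomeomorph M (Model m)} (hc : c ∈ atlas (Model m) M) {x : M} (hx : x ∈ Ω)
    (hxc : x ∈ c.source) :
    ∃ N : Set M, IsOpen N ∧ x ∈ N ∧ N ⊆ c.source ∧ ∃ (C : NNReal) (w : Model m → ℝ),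
      LipschitzWith C w ∧ ∀ᵐ z ∂((vol g).restrict N), v z = w (c z) := by
  have : LocallyCompactSpace M := ChartedSpace.locallyCompactSpace (Model m) M
  obtain ⟨r, hr, hrΩ⟩ := exists_ball_subset_chartDom c hΩ hx hxc
  have hK : IsCompact (Metric.closedBall (c x) r) := isCompact_closedBall _ _
  have hKc : Metric.closedBall (c x) r ⊆ c.target := hrΩ.trans inter_subset_left
  have hBc : Metric.ball (c x) r ⊆ c.target := Metric.ball_subset_closedBall.trans hKc
  obtain ⟨U, hU, hKU, hUΩ, hUc⟩ := exists_open_between_and_isCompact_closure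
    (isCompact_symm_image hK hKc) hΩ (image_subset_iff.2 fun y hy => (hrΩ hy).2)
  obtain ⟨C, hC⟩ := hb U hU ⟨hUc, hUΩ⟩
  obtain ⟨b, hb0, hbK⟩ := exists_covec_le (g := g) hc hK hKc
  set N : Set M := c.symm '' Metric.ball (c x) r with hN
  have hNU : N ⊆ U := (image_mono Metric.ball_subset_closedBall).trans hKU
  have hNo : IsOpen N := c.symm.isOpen_image_of_subset_source Metric.isOpen_ball hBc
  have hNc : N ⊆ c.source := symm_image_subset_source hBc
  have hNB : c.target ∩ c.symm ⁻¹' N = Metric.ball (c x) r := target_inter_preimage_image c hBc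
  have h1 : ∀ᵐ y ∂(volume.restrict (Metric.ball (c x) r)), fnrm g Z (c.symm y) ≤ C := by
    rw [← hNB]
    refine (ae_vol_iff g hc hNo.measurableSet hNc (fun z => fnrm g Z z ≤ C)).1 ?_
    exact ae_restrict_of_ae_restrict_of_subset hNU hC
  have h2 : ∀ᵐ y ∂(volume.restrict (Metric.ball (c x) r)),
      ‖covec g c Z y‖ ≤ (Real.toNNReal (b * C) : ℝ) := by
    filter_upwards [h1, ae_restrict_mem Metric.isOpen_ball.measurableSet] with y hy hyB
    exact ((hbK y (Metric.ball_subset_closedBall hyB) Z).trans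
      (mul_le_mul_of_nonneg_left hy hb0.le)).trans (Real.le_coe_toNNReal _)
  obtain ⟨w, hw, hvw⟩ := (hv.isWeakDeriv hΩ hc).exists_lipschitz (isOpen_chartDom c hΩ) hrΩ h2
  refine ⟨N, hNo, ⟨c x, Metric.mem_ball_self hr, c.left_inv hxc⟩, hNc, _, w, hw, ?_⟩
  rw [ae_vol_iff g hc hNo.measurableSet hNc, hNB]
  filter_upwards [hvw, ae_restrict_mem Metric.isOpen_ball.measurableSet] with y hy hyB
  rw [hy, c.right_inv (hBc hyB)]

/-- Local Lipschitz representatives are continuous and agree almost everywhere on overlaps; open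
sets have positive volume, so they agree everywhere there and glue to one function. -/
theorem IsWeakGradient.exists_isLocLipschitz (hΩ : IsOpen Ω) (hv : IsWeakGradient g Ω v Z)
    (hb : ∀ U : Set M, IsOpen U → CompactlyIn U Ω →
      ∃ C : ℝ, ∀ᵐ x ∂((vol g).restrict U), fnrm g Z x ≤ C) :
    ∃ u : M → ℝ, IsLocLipschitz m Ω u ∧ ∀ᵐ x ∂((vol g).restrict Ω), v x = u x := by
  classical
  choose N hNo hxN hNc C w hw hvw using fun x : Ω =>
    hv.exists_lipschitz_nhds hΩ hb (chart_mem_atlas _ x.1) x.2 (mem_chart_source _ x.1)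
  set u : M → ℝ := fun x => if hx : x ∈ Ω then w ⟨x, hx⟩ (chartAt (Model m) x x) else 0 with hu
  -- The glued function coincides with every local Lipschitz representative, in whatever chart this
  -- is given, and so inherits the Lipschitz property in all charts.
  have key : ∀ {c : OpenPartialHomeomorph M (Model m)} {N' : Set M} {C' : NNReal} {w' : Model m → ℝ},
      IsOpen N' → N' ⊆ c.source → LipschitzWith C' w' →
      (∀ᵐ z ∂((vol g).restrict N'), v z = w' (c z)) → ∀ z ∈ N', z ∈ Ω → u z = w' (c z) := by
    intro c N' C' w' hN'o hN'c hw' hvw' z hz hzΩ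
    have h1 : (fun y => w ⟨z, hzΩ⟩ (chartAt (Model m) z y)) =ᵐ[(vol g).restrict (N ⟨z, hzΩ⟩ ∩ N')]
        fun y => w' (c y) := by
      filter_upwards [ae_restrict_of_ae_restrict_of_subset inter_subset_left (hvw ⟨z, hzΩ⟩),
        ae_restrict_of_ae_restrict_of_subset inter_subset_right hvw'] with y h1 h2
      exact h1.symm.trans h2
    have h2 := Measure.eqOn_open_of_ae_eq h1 ((hNo _).inter hN'o)
      ((hw _).continuous.comp_continuousOn
        ((chartAt (Model m) z).continuousOn.mono (inter_subset_left.trans (hNc ⟨z, hzΩ⟩))))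
      (hw'.continuous.comp_continuousOn (c.continuousOn.mono (inter_subset_right.trans hN'c)))
    have h3 : u z = w ⟨z, hzΩ⟩ (chartAt (Model m) z z) := dif_pos hzΩ
    exact h3.trans (h2 ⟨hxN ⟨z, hzΩ⟩, hz⟩)
  refine ⟨u, fun c hc y hy => ?_, ?_⟩
  · obtain ⟨N', hN'o, hyN', hN'c, C', w', hw', hvw'⟩ :=
      hv.exists_lipschitz_nhds hΩ hb hc hy.2 (c.map_target hy.1)
    refine ⟨C', (c.target ∩ c.symm ⁻¹' Ω) ∩ (c.target ∩ c.symm ⁻¹' N'), ?_, ?_⟩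
    · exact Filter.inter_mem self_mem_nhdsWithin (mem_nhdsWithin_of_mem_nhds
        ((c.isOpen_inter_preimage_symm hN'o).mem_nhds ⟨hy.1, hyN'⟩))
    · intro a ha b hb'
      simp only
      rw [key hN'o hN'c hw' hvw' _ ha.2.2 ha.1.2, key hN'o hN'c hw' hvw' _ hb'.2.2 hb'.1.2,
        c.right_inv ha.1.1, c.right_inv hb'.1.1]
      exact hw' a b
  · rw [ae_restrict_iff' hΩ.measurableSet, ae_iff]
    refine measure_null_of_locally_null _ fun x hx => ?_
    have hxΩ : x ∈ Ω := by
      by_contra hc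
      exact hx fun h => absurd h hc
    refine ⟨N ⟨x, hxΩ⟩ ∩ {z | ¬(z ∈ Ω → v z = u z)}, Filter.inter_mem
      (mem_nhdsWithin_of_mem_nhds ((hNo _).mem_nhds (hxN ⟨x, hxΩ⟩))) self_mem_nhdsWithin, ?_⟩
    have h1 := hvw ⟨x, hxΩ⟩
    rw [ae_restrict_iff' (hNo _).measurableSet, ae_iff] at h1
    refine measure_mono_null ?_ h1
    rintro z ⟨hz, hz'⟩ hzN
    exact hz' fun hzΩ =>
      (hzN hz).trans (key (hNo _) (hNc _) (hw _) (hvw _) z hz hzΩ).symm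

/-- With zero gradient the local Poincaré inequality gives `v = A v` almost everywhere on each set
of a compact exhaustion, the constant being the same for all of them. -/
theorem IsWeakGradient.exists_ae_eq_const (hΩ : IsOpen Ω) (hconn : IsConnected Ω)
    (hv : IsWeakGradient g Ω v Z) (hZ : ∀ᵐ x ∂((vol g).restrict Ω), fnrm g Z x = 0) :
    ∃ a : ℝ, ∀ᵐ x ∂((vol g).restrict Ω), v x = a := by
  have : LocallyCompactSpace M := ChartedSpace.locallyCompactSpace (Model m) M
  obtain ⟨A, -, hA⟩ := exists_local_poincare g hΩ hconn
  obtain ⟨K, hK, -, hKΩ⟩ := exists_compact_exhaustion hΩ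
  refine ⟨A v, ?_⟩
  rw [← hKΩ, ae_restrict_iUnion_iff]
  intro n
  have hn : K n ⊆ Ω := hKΩ ▸ subset_iUnion K n
  obtain ⟨C, K', hK', hK'Ω, H⟩ := hA (K n) (hK n) hn
  have h0 : ∫⁻ x in K', ENNReal.ofReal (fnrm g Z x) ∂(vol g) = 0 := by
    refine (lintegral_congr_ae ((ae_restrict_of_ae_restrict_of_subset hK'Ω hZ).mono
      fun x hx => ?_)).trans lintegral_zero
    simp only [hx, ENNReal.ofReal_zero]
  have h1 : ∫⁻ x in K n, ‖v x - A v‖ₑ ∂(vol g) = 0 := by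
    refine le_antisymm ((H v Z hv).trans (le_of_eq ?_)) zero_le
    exact (congrArg (fun t => (C : ℝ≥0∞) * t) h0).trans (mul_zero _)
  have hm : AEMeasurable (fun x => ‖v x - A v‖ₑ) ((vol g).restrict (K n)) :=
    ((hv.locInt.aestronglyMeasurable.mono_set hn).aemeasurable.sub_const _).enorm
  filter_upwards [(lintegral_eq_zero_iff' hm).1 h1] with x hx
  exact sub_eq_zero.1 (enorm_eq_zero.1 hx)

namespace AreaData

/-- The midpoint has no smaller area, so the nonnegative defect has integral zero and vanishes
almost everywhere. Then `fArea_midpoint` gives equality of the fields, with no bound on them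
required. -/
theorem fnrm_sub_ae_eq_zero (D : AreaData g Ω k W h) (hY : HasPotential g Ω 1 Y)
    (hZ : HasPotential g Ω 1 Z)
    (hYm : ∀ V, HasPotential g Ω 1 V → areaOf g Ω k W h Y ≤ areaOf g Ω k W h V)
    (hZm : ∀ V, HasPotential g Ω 1 V → areaOf g Ω k W h Z ≤ areaOf g Ω k W h V) :
    ∀ᵐ x ∂((vol g).restrict Ω), fnrm g (Y - Z) x = 0 := by
  obtain ⟨hi, he⟩ := D.integral_defect hY hZ
  have h0 : 0 ≤ fun x => fArea g k W h Y x + fArea g k W h Z x -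
      2 * fArea g k W h ((1 / 2 : ℝ) • (Y + Z)) x := fun x => sub_nonneg.2 (fArea_midpoint Y Z x).1
  have h1 := hYm _ (hY.midpoint D.isOpen hZ)
  have h2 := hZm _ (hY.midpoint D.isOpen hZ)
  have h3 := le_antisymm (he.le.trans (by linarith)) (integral_nonneg h0)
  filter_upwards [(integral_eq_zero_iff_of_nonneg h0 hi).1 h3] with x hx
  have h4 := (fArea_midpoint (g := g) (k := k) (W := W) (h := h) Y Z x).2
  simp only [Pi.zero_apply] at hx
  rw [hx, mul_zero] at h4
  have h5 : k x ^ 2 * fnrm g (Y - Z) x ^ 2 = 0 := le_antisymm h4 (by positivity)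
  have h6 := (mul_eq_zero.1 h5).resolve_left (pow_ne_zero 2 (D.pos x).ne')
  exact pow_eq_zero_iff two_ne_zero |>.1 h6

theorem ae_eq_of_isMinimizer (D : AreaData g Ω k W h)
    (hu : IsMinimizer (area g Ω k W h) (MeanZeroSobolev g Ω 1) u)
    (hv : IsMinimizer (area g Ω k W h) (MeanZeroSobolev g Ω 1) v) :
    v =ᵐ[(vol g).restrict Ω] u := by
  obtain ⟨⟨hu1, Y, hY, hY1⟩, hu0⟩ := id hu.1
  obtain ⟨⟨hv1, Z, hZ, hZ1⟩, hv0⟩ := id hv.1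
  have h1 := D.fnrm_sub_ae_eq_zero ⟨⟨v, hZ⟩, hZ1⟩ ⟨⟨u, hY⟩, hY1⟩
    ((D.isMinimizer_area_iff hv.1 hZ).1 hv) ((D.isMinimizer_area_iff hu.1 hY).1 hu)
  obtain ⟨a, ha⟩ := (hZ.sub D.isOpen hY).exists_ae_eq_const D.isOpen D.isConnected h1
  have hfin := isFiniteMeasure_restrict_of_isCompact g D.isCompact
  have h2 : ∫ x in Ω, (v x - u x) ∂(vol g) = 0 := by
    rw [integral_sub (memLp_one_iff_integrable.1 hv1) (memLp_one_iff_integrable.1 hu1), hu0, hv0,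
      sub_zero]
  have h3 : ∫ x in Ω, (v x - u x) ∂(vol g) = ∫ _ in Ω, a ∂(vol g) := integral_congr_ae ha
  rw [h2, integral_const, smul_eq_mul, eq_comm, mul_eq_zero, measureReal_eq_zero_iff,
    Measure.restrict_apply_univ] at h3
  -- `Ω` is open and nonempty, hence of positive volume, and a constant of mean zero is zero.
  have h4 : a = 0 := h3.resolve_left (D.isOpen.measure_ne_zero (vol g) D.isConnected.nonempty)
  filter_upwards [ha] with x hx
  exact sub_eq_zero.1 (hx.trans h4)

theorem exists_minimizer (D : AreaData g Ω k W h)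
    (bounds : ∀ U : Set M, IsOpen U → CompactlyIn U Ω → ∃ C : ℝ, ∀ ε : ℝ, 0 < ε → ε ≤ 1 →
      ∀ u : M → ℝ, IsMinimizer (areaEps g Ω k W h ε) (MeanZeroSobolev g Ω 2) u →
        ∀ᵐ x ∂((vol g).restrict U), fnrm g (weakGrad g Ω u) x ≤ C) :
    ∃ u : M → ℝ, IsLocLipschitz m Ω u ∧
      IsMinimizer (area g Ω k W h) (MeanZeroSobolev g Ω 1) u := by
  obtain ⟨v₀, Z, hv₀, hZ, hmin, hb⟩ := D.exists_minimal_field bounds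
  obtain ⟨a, ⟨⟨hv1, -⟩, hv0⟩, hv⟩ := D.exists_meanZero le_rfl ENNReal.one_ne_top hv₀ hZ.2
  obtain ⟨u, hu, hvu⟩ := hv.exists_isLocLipschitz D.isOpen hb
  have hg := hv.congr hvu
  -- Passing to the Lipschitz representative keeps the weak gradient, the integrability and the
  -- mean, hence also minimality.
  have hmz : u ∈ MeanZeroSobolev g Ω 1 :=
    ⟨⟨(memLp_congr_ae hvu).1 hv1, Z, hg, hZ.2⟩, (integral_congr_ae hvu).symm.trans hv0⟩
  exact ⟨u, hu, (D.isMinimizer_area_iff hmz hg).2 hmin⟩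

end AreaData

end Representative

end SymArea

end

theorem mainTheorem5 {m : ℕ} {M : Type*} [TopologicalSpace M] [ChartedSpace (SymArea.Model m) M]
    [IsManifold (𝓡 m) ∞ M] [T2Space M] [SecondCountableTopology M]
    [MeasurableSpace M] [BorelSpace M]
    (g : SymArea.RMetric m M)
    (Ω : Set M) (hΩ_open : IsOpen Ω) (hΩ_conn : IsConnected Ω) (hΩ_cpt : IsCompact (closure Ω))
    (hΩ_bdry : SymArea.HasSmoothBoundary m Ω)
    (k : M → ℝ) (hk : ContMDiff (𝓡 m) 𝓘(ℝ, ℝ) ∞ k) (hk_pos : ∀ x, 0 < k x)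
    (W : SymArea.VField m M) (hW : SymArea.IsCField ∞ W)
    (h : M → ℝ) (hh : ContMDiffOn (𝓡 m) 𝓘(ℝ, ℝ) ∞ h Ω)
    (hh_int : IntegrableOn (fun x => SymArea.tnorm g x (SymArea.gradient g h x)) Ω
      (SymArea.vol g))
    (bounds : ∀ U : Set M, IsOpen U → SymArea.CompactlyIn U Ω →
      ∃ C : ℝ, ∀ ε : ℝ, 0 < ε → ε ≤ 1 → ∀ u : M → ℝ,
        SymArea.IsMinimizer (SymArea.areaEps g Ω k W h ε) (SymArea.MeanZeroSobolev g Ω 2) u →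
          (∀ᵐ x ∂((SymArea.vol g).restrict U), |u x| ≤ C) ∧
          (∀ᵐ x ∂((SymArea.vol g).restrict U),
            SymArea.tnorm g x (SymArea.weakGrad g Ω u x) ≤ C)) :
    ∃ u₀ : M → ℝ,
      SymArea.IsLocLipschitz m Ω u₀ ∧
      SymArea.IsMinimizer (SymArea.area g Ω k W h) (SymArea.MeanZeroSobolev g Ω 1) u₀ ∧
      ∀ v : M → ℝ,
        SymArea.IsMinimizer (SymArea.area g Ω k W h) (SymArea.MeanZeroSobolev g Ω 1) v →
          v =ᵐ[(SymArea.vol g).restrict Ω] u₀ := by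
  have D : SymArea.AreaData g Ω k W h :=
    ⟨hΩ_open, hΩ_conn, hΩ_cpt, hΩ_bdry, hk.continuous, hk_pos,
      hW.of_le (by exact_mod_cast le_top), hh.of_le (by exact_mod_cast le_top), hh_int⟩
  obtain ⟨u, hu, hmin⟩ := D.exists_minimizer fun U hU hUΩ => by
    obtain ⟨C, hC⟩ := bounds U hU hUΩ
    exact ⟨C, fun ε hε hε1 v hv => (hC ε hε hε1 v hv).2⟩
  exact ⟨u, hu, hmin, fun v hv => D.ae_eq_of_isMinimizer hmin hv⟩
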